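/- \textbf{Theorem.} Let $\gamma,\delta$ be strict partitions with $|\gamma|+|\delta|=n$ (the empty partition is allowed). The maps $\psi_i$ ($i=0$ or $1<i<n$) defined below map $\mathrm{SST}(\gamma\otimes\delta)$ into itself, and they form a queer dual equivalence for $\mathrm{SST}(\gamma\otimes\delta)$ with its descent map $\mathrm{Des}$. Moreover, the product of Schur $P$-functions is Schur $P$-positive: there are nonnegative integers $f^{\varepsilon}$, indexed by strict partitions $\varepsilon$ and all but finitely many of them zero, with $P_\gamma P_\delta=\sum_{\varepsilon} f^{\varepsilon}P_{\varepsilon}$. \medskip \textbf{Descents and generating functions.} For a permutation $w$ of $[n]=\{1,\dots,n\}$ in one-line notation, $\mathrm{Des}(w)$ is the set of $i\in[n-1]$ such that $i$ is to the right of $i+1$ in $w$. For $D\subseteq[n-1]$ let $F_{n,D}=\sum x_{i_1}\cdots x_{i_n}$ over all $i_1\le\dots\le i_n$ with $i_j<i_{j+1}$ for $j\in D$. For a partition $\lambda$ of $n$, $s_\lambda=\sum_T F_{n,\mathrm{Des}(\mathrm{row}(T))}$ over the standard Young tableaux $T$ of shape $\lambda$; rows are indexed from the bottom, and $\mathrm{row}(T)$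 reads the rows left to right, from the top row to the bottom row. \textbf{Signed standard tableaux.} The shifted diagram of a strict partition $\gamma$ has $\gamma_i$ cells in row $i$ (rows indexed from the bottom), in columns $i,\dots,i+\gamma_i-1$; the cells with equal row and column index form the main diagonal. A signed standard tableau of shape $\gamma$ is a bijective filling of this diagram with the letters $1,\dots,|\gamma|$, each either marked or unmarked, such that absolute values increase along rows and up columns and no entry on the main diagonal is marked. The hook reading word $\mathrm{hook}(S)$ lists absolute values: for $i$ from largest to smallest, first the marked entries of column $i$ from bottom to top, then the unmarked entries of row $i$ from left to right. Put $P_\gamma=\sum_S F_{|\gamma|,\mathrm{Des}(\mathrm{hook}(S))}$ over the signed standard tableaux $S$ of shape $\gamma$. $\mathrm{SST}(\gamma\otimes\delta)$ is the set of pairs $S\otimes T$ of fillings of the shifted diagrams of $\gamma$ and of $\delta$ with letters, marked or unmarked, such that each of $1,\dots,n$ is used exactly once in $S$ and $T$ together, absolute values increase along the rows and up the columns of each of $S$ and $T$, and no entry on either main diagonal is marked. Its reading word is the concatenation $\mathrm{hook}(S\otimes T)=\mathrm{hook}(S)\,\mathrm{hook}(T)$, and $\mathrm{Des}(S\otimes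 T)=\mathrm{Des}(\mathrm{hook}(S\otimes T))$. \textbf{The maps.} Let $1<i<n$, and let $S$ be one of the two fillings, containing $i-1,i,i+1$. Let $a\le b\le c$ be the diagonals of these three letters (row minus column for an unmarked letter, column minus row for a marked one). Then $d_i(S)$ is given by: (1) if $i$ lies on diagonal $b$, then $d_i(S)=S$; (2) else if $a=b$ (resp. $b=c$), toggle the mark on the letter on diagonal $c$ (resp. $a$); (3) else if $\big||a|-|c|\big|=1$, toggle the marks on the letters on diagonals $a$ and $c$; (4) else swap the absolute values of the letters on diagonals $a$ and $c$, keeping the marks in their cells. The map $d_0$ toggles the mark on the letter $2$. For $1<i<n$: (1) if $i$ lies between $i-1$ and $i+1$ in $\mathrm{hook}(S\otimes T)$, then $\psi_i(S\otimes T)=S\otimes T$; (2) else if $i-1,i,i+1$ are all in $S$, then $\psi_i(S\otimes T)=d_i(S)\otimes T$; (3) else if all three are in $T$, then $\psi_i(S\otimes T)=S\otimes d_i(T)$; (4) else swap the absolute values of those two of the three letters that are furthest apart in $\mathrm{hook}(S\otimes T)$, keeping the marks in their cells. For $i=0$: $\psi_0(S\otimes T)=d_0(S)\otimes T$ if $1,2$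 are both in $S$; $\psi_0(S\otimes T)=S\otimes d_0(T)$ if both are in $T$; otherwise swap $1$ and $2$. If $n<2$, then $\psi_0$ is the identity. \textbf{Queer dual equivalence.} Let $\mathcal A$ be a finite set with a map $\mathrm{Des}$ to subsets of $[n-1]$. A \emph{dual equivalence} for $(\mathcal A,\mathrm{Des})$ is a family of involutions $\varphi_i$ of $\mathcal A$, $1<i<n$, such that (a) for all $1<h\le i<n$ with $i-h\le3$ and all $T\in\mathcal A$ there is a partition $\lambda$ of $m=i-h+3$ with $\sum_{U}F_{m,D(U)}=s_\lambda$, where $U$ runs over the class of $T$ under the equivalence relation generated by $\varphi_h,\dots,\varphi_i$, and $D(U)=\{x-h+2: x\in\mathrm{Des}(U),\ h-1\le x\le i\}$; (b) $\varphi_i\varphi_j=\varphi_j\varphi_i$ whenever $|i-j|\ge3$. A \emph{queer dual equivalence} is a dual equivalence $\{\psi_i\}_{1<i<n}$ together with an involution $\psi_0$ of $\mathcal A$ such that, writing $[S]_{\le k}$ for the class of $S$ under the equivalence relation generated by the $\psi_h$ with $h\le k$, $h\ne1$: (i) for $i\in\{1,2,3\}$ with $i<n$ and all $S\in\mathcal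 A$ there is a strict partition $\varepsilon$ of $i+1$ with $\sum_{U\in[S]_{\le i}}F_{i+1,\mathrm{Des}(U)\cap[i]}=P_\varepsilon$; (ii) $\psi_0\psi_i=\psi_i\psi_0$ for all $3<i<n$; (iii) for $0\le k<n$ and $S,T\in\mathcal A$ with $T\in[S]_{\le k}$ there is a sequence of indices $i_1,\dots,i_j\in\{0,1,\dots,k\}\setminus\{1\}$, at most two of which are equal to $k$, such that $T=\psi_{i_j}\cdots\psi_{i_1}(S)$. -/

import Mathlib

namespace QueerDual

/-! ### Fundamental quasisymmetric functions -/

/-- The descent set of a word `w` in the letters `1, …, n`: all `i ∈ {1, …, n - 1}` such that `i` occurs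
to the right of `i + 1` in `w`. -/
def wordDes (n : ℕ) (w : List ℕ) : Finset ℕ :=
  (Finset.Ico 1 n).filter fun i => w.idxOf (i + 1) < w.idxOf i

/-- The fundamental quasisymmetric function `F_{n,D}` in infinitely many variables: the sum of
`x_{f 1} ⋯ x_{f n}` over weakly increasing `f` with `f j < f (j + 1)` for `j ∈ D`
(positions of `f` are counted from `0` in the code, so `j = k + 1` below). -/
noncomputable def fundamental (n : ℕ) (D : Finset ℕ) : MvPowerSeries ℕ ℤ :=
  fun m => (Nat.card {f : Fin n → ℕ //
    Monotone f ∧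
    (∀ (k : ℕ) (hk : k + 1 < n), k + 1 ∈ D → f ⟨k, by omega⟩ < f ⟨k + 1, hk⟩) ∧
    ∑ j, Finsupp.single (f j) 1 = m} : ℤ)

/-! ### Schur functions -/

/-- Standard Young tableaux of shape `μ`: bijective fillings of the cells `(row, column)` with
`1, …, |μ|`, increasing along rows and along columns. -/
def standardYoungTableaux (μ : YoungDiagram) : Finset (μ.cells → ℕ) :=
  (Fintype.piFinset fun _ : μ.cells => Finset.Icc 1 μ.card).filter fun T =>
    (Function.Injective T ∧ Finset.univ.image T = Finset.Icc 1 μ.card) ∧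
    (∀ c d : μ.cells, c.1.1 = d.1.1 → c.1.2 < d.1.2 → T c < T d) ∧
    (∀ c d : μ.cells, c.1.2 = d.1.2 → c.1.1 < d.1.1 → T c < T d)

/-- The row reading word: rows read left to right, starting with the row of largest index. -/
def rowWord {μ : YoungDiagram} (T : μ.cells → ℕ) : List ℕ :=
  (List.range μ.card).reverse.flatMap fun i => (List.range μ.card).filterMap fun j =>
    if h : (i, j) ∈ μ.cells then some (T ⟨(i, j), h⟩) else none

/-- The Schur function, through its expansion over standard Young tableaux. -/
noncomputable def schur (μ : YoungDiagram) : MvPowerSeries ℕ ℤ :=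
  ∑ T ∈ standardYoungTableaux μ, fundamental μ.card (wordDes μ.card (rowWord T))

/-! ### Strict partitions and signed fillings of shifted diagrams -/

/-- Strict partitions: finite strictly decreasing sequences of positive integers. -/
structure StrictPartition where
  parts : List ℕ
  strict : parts.Pairwise (· > ·)
  pos : ∀ p ∈ parts, 0 < p

/-- The sum of the parts. -/
def StrictPartition.size (γ : StrictPartition) : ℕ := γ.parts.sum

/-- The cells `(row, column)`, counted from `0`, of the shifted diagram: row `i` is moved `i`
columns to the right. -/
def StrictPartition.cells (γ : StrictPartition) : Finset (ℕ × ℕ) :=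
  (Finset.range γ.parts.length).biUnion fun i =>
    (Finset.Ico i (i + γ.parts.getD i 0)).image fun j => (i, j)

/-- A filling of the shifted diagram of `γ` with signed letters: `(S c).1` is the absolute value of
the entry of the cell `c`, and `(S c).2` tells whether this entry is marked. -/
abbrev SignedFilling (γ : StrictPartition) : Type := γ.cells → ℕ × Bool

variable {γ δ : StrictPartition}

/-- Absolute values increase along the rows and columns, and no entry on the main diagonal is
marked. -/
def SignedFilling.IsMonotone (S : SignedFilling γ) : Prop :=
  (∀ c d : γ.cells, c.1.1 = d.1.1 → c.1.2 ≤ d.1.2 → (S c).1 ≤ (S d).1) ∧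
  (∀ c d : γ.cells, c.1.2 = d.1.2 → c.1.1 ≤ d.1.1 → (S c).1 ≤ (S d).1) ∧
  (∀ c : γ.cells, c.1.1 = c.1.2 → (S c).2 = false)

instance (S : SignedFilling γ) : Decidable S.IsMonotone := by
  unfold SignedFilling.IsMonotone; infer_instance

/-- Signed standard tableaux of shape `γ`: bijective fillings with a signed permutation of
`1, …, |γ|` that are monotone in the above sense. -/
def signedStandardTableaux (γ : StrictPartition) : Finset (SignedFilling γ) :=
  (Fintype.piFinset fun _ : γ.cells => Finset.Icc 1 γ.size ×ˢ Finset.univ).filter fun S =>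
    (Function.Injective (fun c => (S c).1) ∧
      Finset.univ.image (fun c => (S c).1) = Finset.Icc 1 γ.size) ∧
    S.IsMonotone

/-- The entry in row `r` and column `c`, if there is such a cell. -/
def SignedFilling.entry? (S : SignedFilling γ) (r c : ℕ) : Option (ℕ × Bool) :=
  if h : (r, c) ∈ γ.cells then some (S ⟨(r, c), h⟩) else none

/-- The hook reading word (of absolute values): for `i` from largest to smallest, the marked entries
of column `i` from bottom (row `0`) to top, then the unmarked entries of row `i` from left to right. -/
def SignedFilling.hook (S : SignedFilling γ) : List ℕ :=
  (List.range γ.size).reverse.flatMap fun i =>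
    ((List.range γ.size).filterMap fun r =>
      (S.entry? r i).bind fun e => if e.2 = true then some e.1 else none) ++
    ((List.range γ.size).filterMap fun c =>
      (S.entry? i c).bind fun e => if e.2 = false then some e.1 else none)

/-- The Schur `P`-function, through its expansion over signed standard tableaux. -/
noncomputable def schurP (γ : StrictPartition) : MvPowerSeries ℕ ℤ :=
  ∑ S ∈ signedStandardTableaux γ, fundamental γ.size (wordDes γ.size S.hook)

/-! ### Elementary involutions on fillings of one shifted diagram -/

/-- The letter `k` is the absolute value of some entry. -/
def SignedFilling.Occurs (S : SignedFilling γ) (k : ℕ) : Prop := ∃ c, (S c).1 = k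

instance (S : SignedFilling γ) (k : ℕ) : Decidable (S.Occurs k) := by
  unfold SignedFilling.Occurs; infer_instance

/-- Toggle the mark on the letter `k`. -/
def SignedFilling.toggle (k : ℕ) (S : SignedFilling γ) : SignedFilling γ :=
  fun c => if (S c).1 = k then ((S c).1, !(S c).2) else S c

/-- Exchange the absolute values `k` and `l`, keeping the marks in their cells. -/
def SignedFilling.swap (k l : ℕ) (S : SignedFilling γ) : SignedFilling γ :=
  fun c => (Equiv.swap k l (S c).1, (S c).2)

/-- The diagonal of the letter `k`: row minus column if it is unmarked, column minus row if it is
marked (a sum with one term if `k` occurs in exactly one cell). -/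
def SignedFilling.diag (S : SignedFilling γ) (k : ℕ) : ℤ :=
  ∑ c : γ.cells with (S c).1 = k,
    if (S c).2 = true then (c.1.2 : ℤ) - c.1.1 else (c.1.1 : ℤ) - c.1.2

section Three
variable {α : Type*} [LinearOrder α]

/-- The least of the values of `f` at `i - 1`, `i`, `i + 1`. -/
def lo (f : ℕ → α) (i : ℕ) : α := min (f (i - 1)) (min (f i) (f (i + 1)))

/-- The greatest of the values of `f` at `i - 1`, `i`, `i + 1`. -/
def hi (f : ℕ → α) (i : ℕ) : α := max (f (i - 1)) (max (f i) (f (i + 1)))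

/-- The median of the values of `f` at `i - 1`, `i`, `i + 1`. -/
def mid (f : ℕ → α) (i : ℕ) : α :=
  max (min (f (i - 1)) (f i)) (min (max (f (i - 1)) (f i)) (f (i + 1)))

/-- The letter among `i - 1`, `i`, `i + 1` at which `f` takes the value `x`. -/
def letterAt (f : ℕ → α) (i : ℕ) (x : α) : ℕ :=
  if f (i - 1) = x then i - 1 else if f i = x then i else i + 1

end Three

/-- The elementary dual equivalence `d_i`, where `a ≤ b ≤ c` are the diagonals of the letters
`i - 1`, `i`, `i + 1`. -/
def SignedFilling.d (i : ℕ) (S : SignedFilling γ) : SignedFilling γ :=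
  let a := lo S.diag i
  let b := mid S.diag i
  let c := hi S.diag i
  if S.diag i = b then S
  else if a = b then S.toggle (letterAt S.diag i c)
  else if b = c then S.toggle (letterAt S.diag i a)
  else if |(|a| - |c|)| = 1 then
    (S.toggle (letterAt S.diag i a)).toggle (letterAt S.diag i c)
  else S.swap (letterAt S.diag i a) (letterAt S.diag i c)

/-- The elementary queer involution: toggle the mark on the letter `2`. -/
def SignedFilling.d0 (S : SignedFilling γ) : SignedFilling γ := S.toggle 2

/-! ### Concatenated shapes -/

/-- Signed standard tableaux `S ⊗ T` of concatenated shape `γ ⊗ δ`: pairs of monotone fillings of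
the two diagrams which together use each of `1, …, |γ| + |δ|` exactly once. -/
def tensorTableaux (γ δ : StrictPartition) : Finset (SignedFilling γ × SignedFilling δ) :=
  ((Fintype.piFinset fun _ : γ.cells => Finset.Icc 1 (γ.size + δ.size) ×ˢ Finset.univ) ×ˢ
    (Fintype.piFinset fun _ : δ.cells => Finset.Icc 1 (γ.size + δ.size) ×ˢ Finset.univ)).filter
  fun X =>
    (Function.Injective (fun c => (Sum.elim X.1 X.2 c).1) ∧
      Finset.univ.image (fun c => (Sum.elim X.1 X.2 c).1) = Finset.Icc 1 (γ.size + δ.size)) ∧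
    X.1.IsMonotone ∧ X.2.IsMonotone

/-- The concatenation of the hook reading words. -/
def tensorHook (X : SignedFilling γ × SignedFilling δ) : List ℕ := X.1.hook ++ X.2.hook

/-- The descent set of a tableau of concatenated shape. -/
def tensorDes (X : SignedFilling γ × SignedFilling δ) : Finset ℕ :=
  wordDes (γ.size + δ.size) (tensorHook X)

/-- The position of the letter `k` in the hook reading word. -/
def tensorPos (X : SignedFilling γ × SignedFilling δ) (k : ℕ) : ℕ := (tensorHook X).idxOf k

/-- The dual equivalence involution on tableaux of concatenated shape, for `1 < i < n`. -/
def tensorDual (i : ℕ) (X : SignedFilling γ × SignedFilling δ) :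
    SignedFilling γ × SignedFilling δ :=
  let a := letterAt (tensorPos X) i (lo (tensorPos X) i)
  let c := letterAt (tensorPos X) i (hi (tensorPos X) i)
  if tensorPos X i = mid (tensorPos X) i then X
  else if X.1.Occurs (i - 1) ∧ X.1.Occurs i ∧ X.1.Occurs (i + 1) then (X.1.d i, X.2)
  else if X.2.Occurs (i - 1) ∧ X.2.Occurs i ∧ X.2.Occurs (i + 1) then (X.1, X.2.d i)
  else (X.1.swap a c, X.2.swap a c)

/-- The queer involution on tableaux of concatenated shape. If there are fewer than two letters,
then there is nothing to toggle or to swap, and it is the identity. -/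
def tensorQueer (X : SignedFilling γ × SignedFilling δ) : SignedFilling γ × SignedFilling δ :=
  if γ.size + δ.size < 2 then X
  else if X.1.Occurs 1 ∧ X.1.Occurs 2 then (X.1.d0, X.2)
  else if X.2.Occurs 1 ∧ X.2.Occurs 2 then (X.1, X.2.d0)
  else (X.1.swap 1 2, X.2.swap 1 2)

/-- The family `ψ_i` for `i = 0, 2, 3, …, n - 1`; at all other indices the value is irrelevant and
set to be the identity. -/
def tensorPsi (i : ℕ) (X : SignedFilling γ × SignedFilling δ) :
    SignedFilling γ × SignedFilling δ :=
  if i = 0 then tensorQueer X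
  else if 1 < i ∧ i < γ.size + δ.size then tensorDual i X
  else X

/-! ### Abstract dual equivalences and queer dual equivalences -/

section Abstract
variable {A : Type*} [Fintype A]

open Classical in
/-- The equivalence class of `T` generated by the maps `φ i` with `i ∈ I`. -/
noncomputable def eqvClass (φ : ℕ → A → A) (I : Set ℕ) (T : A) : Finset A :=
  Finset.univ.filter fun U => Relation.EqvGen (fun x y => ∃ i ∈ I, φ i x = y) T U

/-- `Des_{(a,b)}`: delete the letters less than `a` or at least `b`, then subtract `a - 1`. -/
def desRestrict (a b : ℕ) (D : Finset ℕ) : Finset ℕ :=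
  (D.filter fun x => a ≤ x ∧ x < b).image fun x => x + 1 - a

/-- `φ_i` (`1 < i < n`) is a dual equivalence for `(A, Des)`, where `Des` takes values in the subsets
of `{1, …, n - 1}`. -/
structure IsDualEquivalence (n : ℕ) (Des : A → Finset ℕ) (φ : ℕ → A → A) : Prop where
  des_subset : ∀ T, Des T ⊆ Finset.Ico 1 n
  involutive : ∀ i, 1 < i → i < n → Function.Involutive (φ i)
  schur_local : ∀ h i, 1 < h → h ≤ i → i ≤ h + 3 → i < n → ∀ T : A,
    ∃ μ : YoungDiagram, μ.card = i - h + 3 ∧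
      ∑ U ∈ eqvClass φ (Set.Icc h i) T,
        fundamental (i - h + 3) (desRestrict (h - 1) (i + 1) (Des U)) = schur μ
  comm : ∀ i j, 1 < i → i < n → 1 < j → j < n → i + 3 ≤ j ∨ j + 3 ≤ i → ∀ T : A,
    φ j (φ i T) = φ i (φ j T)

/-- The class `[S]_{≤ k}` generated by `ψ_h` for `h ≤ k`, `h ≠ 1`. -/
noncomputable def classLE (ψ : ℕ → A → A) (k : ℕ) (S : A) : Finset A :=
  eqvClass ψ {h | h ≤ k ∧ h ≠ 1} S

/-- `ψ_i` (`1 < i < n`) together with `ψ_0` is a queer dual equivalence for `(A, Des)`. -/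
structure IsQueerDualEquivalence (n : ℕ) (Des : A → Finset ℕ) (ψ : ℕ → A → A) : Prop where
  dual : IsDualEquivalence n Des ψ
  involutive_zero : Function.Involutive (ψ 0)
  schurP_local : ∀ i, 1 ≤ i → i ≤ 3 → i < n → ∀ S : A,
    ∃ ε : StrictPartition, ε.size = i + 1 ∧
      ∑ U ∈ classLE ψ i S, fundamental (i + 1) (Des U ∩ Finset.Icc 1 i) = schurP ε
  comm_zero : ∀ i, 3 < i → i < n → ∀ S : A, ψ 0 (ψ i S) = ψ i (ψ 0 S)
  two_edge : ∀ k, k < n → ∀ S T : A, T ∈ classLE ψ k S →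
    ∃ l : List ℕ, (∀ j ∈ l, j ≤ k ∧ j ≠ 1) ∧ l.count k ≤ 2 ∧
      T = l.foldl (fun U j => ψ j U) S

end Abstract

end QueerDual

/-! A strict partition is encoded by its symmetric site function (Maya diagram): adding a cell moves
an occupied site, together with its mirror image, one step to the right. A signed standard tableau
is then a chain: the sequence of signed diagonals `z 1, z 2, …` of its letters, each addable when
its turn comes. The absolute value gives the diagonal of the cell, the sign tells whether the letter
is marked. Consecutive letters are read in the order of decreasing diagonals (`idxOf_lt_iff`), so
`i` is a descent exactly when `z i < z (i + 1)`, and the involutions `d_i` and `d_0` become the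
local rules `tri` and `exch` on three or two consecutive diagonals.

The tool is an insertion built from a local growth rule, a signed form of shifted insertion. A carry
is a cell to be added before all letters. It passes through a chain: a letter off the diagonal of
the carry stays; a letter on it is bumped to the next addable diagonal to its right in the signed
order, and its new diagonal becomes the carry. A pass preserves descents (`IsShape.step_lt`,
`IsShape.step_gt`), commutes with every elementary dual equivalence (`IsShape.pass3_tri`, the heart
of the proof), and over the empty shape also commutes with the queer involution (`Word.pairComm`).
It is injective once the final shape is known (`IsShape.passF_inj`) and can be run backwards
(`IsShape.exists_unpass`).

A permutation is itself a chain, whose letters lie on isolated far diagonals `-Y`. There `tri` is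
the classical dual equivalence, which swaps two letters, and `exch` on the first two letters swaps
`1` and `2`. Passing the far parts one after the other pulls all letters in; `rsk` is the resulting
chain and `recs` the recording data. Hence `rsk` intertwines the classical involutions with the
signed ones and keeps the recording data fixed. Every chain over the empty shape is the insertion of
a word (`exists_rsk_eq`).

Consequently a tableau `S ⊗ T` has a word `f` whose subword on the letters of `S` inserts to `S` and
whose subword on the letters of `T`, using farther diagonals, inserts to `T` (`exists_rep`). On
words, each `ψ_i` is the elementary involution, whether the letters lie in one filling or in both
(`Rep.dual`, `Rep.queer`). The involutivity and the commutations are then visible.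

For the class sums, the whole word `f`, or a window of consecutive letters, is inserted at once into
a single chain. The involutions act on this chain and fix the recording data. Chains with the same
final shape are connected, with at most two uses of the last involution (`ChainIn.reach`); this
gives the condition on paths. So a class corresponds to all chains with a given end, with the same
descents (`Window.sum_class`). Over the empty shape these are the signed standard tableaux of a
strict partition, and the sum is a Schur `P`-function. Over a large staircase no letter reaches the
main diagonal, the chains are standard Young tableaux, and the sum is a Schur function.

Finally, standardizing pairs of weakly increasing sequences shows that `P_γ P_δ` is the generating
function of all tableaux `S ⊗ T` (`schurP_mul_schurP`); splitting it into classes of all the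
involutions gives Schur `P`-positivity. -/

namespace QueerDual

/-! ### Sites, hops and bumps -/

/-- Exchange the sites `z`, `z + 1` and the mirror sites `-z`, `1 - z`. -/
def hop (z : ℤ) (m : ℤ → Bool) : ℤ → Bool := fun s =>
  m (if s = z then z + 1 else if s = z + 1 then z else if s = -z then 1 - z
    else if s = 1 - z then -z else s)

/-- The shape `m` has room for one more cell on the diagonal `z`. -/
def Addable (m : ℤ → Bool) (z : ℤ) : Prop := m z = true ∧ m (z + 1) = false

/-- Site functions of strict partitions: site `s ≥ 1` is occupied when `s` is a part. -/
structure IsShape (m : ℤ → Bool) : Prop where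
  sym : ∀ s, m (1 - s) = !m s
  bdd : ∃ B, ∀ s, B ≤ s → m s = false

/-- The target `z'` of a bump from `z`: the site after `z'` is the first one free. -/
def Clean (m : ℤ → Bool) (z z' : ℤ) : Prop :=
  z < z' ∧ (∀ s, z + 2 ≤ s → s ≤ z' → m s = true) ∧ (z < 0 → z' ≤ 0) ∧
    (z ≠ -1 → m (z' + 1) = false)

/-- The last site before the first free one to the right of `z`. -/
noncomputable def nextFree (m : ℤ → Bool) (z : ℤ) : ℤ :=
  open Classical in if h : ∃ t : ℕ, m (z + 1 + t) = false then z + Nat.find h else z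

/-- The diagonal to which a letter on the diagonal `z` is bumped. -/
noncomputable def bmp (m : ℤ → Bool) (z : ℤ) : ℤ := nextFree (hop z m) z

variable {m : ℤ → Bool} {x y z a b c s : ℤ}

theorem hop_eq (h1 : s ≠ z) (h2 : s ≠ z + 1) (h3 : s ≠ -z) (h4 : s ≠ 1 - z) :
    hop z m s = m s := by
  unfold hop; grind

theorem hop_self : hop z m z = m (z + 1) := by
  unfold hop; grind

theorem hop_succ : hop z m (z + 1) = m z := by
  unfold hop; grind

theorem hop_at_neg : hop z m (-z) = m (1 - z) := by
  unfold hop; grind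

theorem hop_at_sub : hop z m (1 - z) = m (-z) := by
  unfold hop; grind

theorem hop_neg (z : ℤ) (m : ℤ → Bool) : hop (-z) m = hop z m := by
  funext s; unfold hop; congr 1; grind

theorem hop_hop (z : ℤ) (m : ℤ → Bool) : hop z (hop z m) = m := by
  funext s; unfold hop; congr 1; grind

theorem hop_abs (z : ℤ) (m : ℤ → Bool) : hop |z| m = hop z m := by
  rcases abs_choice z with h | h <;> rw [h]; exact hop_neg z m

theorem hop_eq_of_abs (h : |y| = |z|) (m : ℤ → Bool) : hop y m = hop z m := by
  rw [← hop_abs y, h, hop_abs]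

/-- A hop touches the sites `z`, `z + 1` and their mirrors `1 - z`, `-z`. For two diagonals whose
absolute values differ by more than one these sets are disjoint, and for equal absolute values the
hops coincide. -/
theorem hop_comm (m : ℤ → Bool) (h : |(|y| - |z|)| ≠ 1) : hop y (hop z m) = hop z (hop y m) := by
  by_cases hyz : |y| = |z|
  · rw [hop_eq_of_abs hyz, hop_eq_of_abs hyz]
  funext s
  by_cases e1 : s = y
  · rw [e1, hop_self, hop_eq, hop_eq, hop_self] <;> grind
  by_cases e2 : s = y + 1
  · rw [e2, hop_succ, hop_eq, hop_eq, hop_succ] <;> grind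
  by_cases e3 : s = -y
  · rw [e3, hop_at_neg, hop_eq, hop_eq, hop_at_neg] <;> grind
  by_cases e4 : s = 1 - y
  · rw [e4, hop_at_sub, hop_eq, hop_eq, hop_at_sub] <;> grind
  rw [hop_eq e1 e2 e3 e4]
  by_cases f1 : s = z
  · rw [f1, hop_self, hop_self, hop_eq] <;> grind
  by_cases f2 : s = z + 1
  · rw [f2, hop_succ, hop_succ, hop_eq] <;> grind
  by_cases f3 : s = -z
  · rw [f3, hop_at_neg, hop_at_neg, hop_eq] <;> grind
  by_cases f4 : s = 1 - z
  · rw [f4, hop_at_sub, hop_at_sub, hop_eq] <;> grind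
  rw [hop_eq f1 f2 f3 f4, hop_eq f1 f2 f3 f4, hop_eq e1 e2 e3 e4]

theorem IsShape.shape_hop (hm : IsShape m) (z : ℤ) : IsShape (hop z m) := by
  refine ⟨fun s => ?_, ?_⟩
  · have h1 := hm.sym z
    have h2 := hm.sym (-z)
    have h3 := hm.sym s
    rw [sub_neg_eq_add, add_comm] at h2
    by_cases e1 : s = z
    · rw [e1, hop_at_sub, hop_self, h2, Bool.not_not]
    by_cases e2 : s = z + 1
    · rw [e2, show 1 - (z + 1) = -z by ring, hop_at_neg, hop_succ, h1]
    by_cases e3 : s = -z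
    · rw [e3, show 1 - -z = z + 1 by ring, hop_at_neg, hop_succ, h1, Bool.not_not]
    by_cases e4 : s = 1 - z
    · rw [e4, show 1 - (1 - z) = z by ring, hop_at_sub, hop_self, h2]
    rw [hop_eq e1 e2 e3 e4, hop_eq, h3] <;> omega
  · obtain ⟨B, hB⟩ := hm.bdd
    refine ⟨max B (|z| + 2), fun s hs => ?_⟩
    rw [hop_eq] <;> grind

theorem IsShape.addable_neg (hm : IsShape m) : Addable m (-z) ↔ Addable m z := by
  have h1 := hm.sym z
  have h2 := hm.sym (-z)
  unfold Addable; grind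

theorem IsShape.addable_of_abs (hm : IsShape m) (h : |y| = |z|) : Addable m y ↔ Addable m z := by
  rcases abs_eq_abs.1 h with rfl | rfl
  · rfl
  · exact hm.addable_neg

theorem IsShape.addable_abs (hm : IsShape m) : Addable m |z| ↔ Addable m z :=
  hm.addable_of_abs (abs_abs z)

theorem Addable.not_succ (h : Addable m z) : ¬ Addable m (z + 1) := by
  unfold Addable at *; grind

/-- Addability on a diagonal requires the next site to be free, addability on the following diagonal
requires it to be occupied; mirror symmetry reduces to nonnegative diagonals. -/
theorem IsShape.not_near (hm : IsShape m) (hy : Addable m y) (hz : Addable m z) :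
    |(|y| - |z|)| ≠ 1 := by
  rw [← hm.addable_abs] at hy hz
  intro h
  rcases abs_eq (zero_le_one) |>.1 h with h | h
  · exact hz.not_succ (by rwa [show |z| + 1 = |y| by omega])
  · exact hy.not_succ (by rwa [show |y| + 1 = |z| by omega])

theorem IsShape.addable_hop (hm : IsShape m) (hy : Addable m y) (hz : Addable m z)
    (hyz : |y| ≠ |z|) : Addable (hop y m) z := by
  have := hm.not_near hy hz
  unfold Addable at *
  rw [hop_eq, hop_eq] <;> grind

/-- Cells added one after the other on non-adjacent diagonals can be added in the other order. This
is what makes the swap in `exch` legitimate. -/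
theorem IsShape.addable_of_hop (hm : IsShape m) (hy : Addable m y) (hz : Addable (hop y m) z)
    (hyz : |(|y| - |z|)| ≠ 1) : |y| ≠ |z| ∧ Addable m z := by
  have h1 := hm.sym y
  have h2 := hm.sym (-y)
  have hne : |y| ≠ |z| := by
    intro h
    have := (hm.shape_hop y).addable_of_abs h |>.2 hz
    unfold Addable at *
    rw [hop_self] at this; grind
  refine ⟨hne, ?_⟩
  unfold Addable at *
  rw [hop_eq, hop_eq] at hz <;> grind

theorem IsShape.not_addable_hop (hm : IsShape m) (hy : Addable m y) (h : |z| = |y|) :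
    ¬ Addable (hop y m) z := by
  rw [(hm.shape_hop y).addable_of_abs h]
  unfold Addable at *
  rw [hop_self]; grind

/-- Boundedness supplies a free site to the right, so the default value in `nextFree` is never used:
the target is the end of the occupied block that starts at `z + 1` after the hop. -/
theorem IsShape.bmp_spec (hm : IsShape m) (ha : Addable m z) :
    z < bmp m z ∧ (∀ s, z < s → s ≤ bmp m z → hop z m s = true) ∧
      hop z m (bmp m z + 1) = false := by
  classical
  have h : ∃ t : ℕ, hop z m (z + 1 + t) = false := by
    obtain ⟨B, hB⟩ := (hm.shape_hop z).bdd
    exact ⟨(B - z - 1).toNat, hB _ (by omega)⟩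
  unfold bmp nextFree
  rw [dif_pos h]
  have h1 := Nat.find_spec h
  have h2 := fun t => Nat.find_min (H := h) (m := t)
  generalize Nat.find h = n at *
  refine ⟨?_, fun s hs hs' => ?_, ?_⟩
  · rcases n with _ | n
    · simp only [Nat.cast_zero, add_zero, hop_succ, ha.1] at h1; cases h1
    · push_cast; omega
  · have := h2 (s - z - 1).toNat (by omega)
    rwa [show z + 1 + ((s - z - 1).toNat : ℤ) = s by omega, Bool.not_eq_false] at this
  · rw [← h1]; congr 1; ring

/-- The block cannot contain both `0` and `1`, which are mirror images, so a bump from the negative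
side ends at `0` at the latest. The exception `z = -1` arises because the target is then `0`, and
the site after it is moved by the mirror part of the hop itself. -/
theorem IsShape.bmp_clean (hm : IsShape m) (ha : Addable m z) : Clean m z (bmp m z) := by
  obtain ⟨h1, h2, h3⟩ := hm.bmp_spec ha
  have hs := hm.sym
  generalize bmp m z = z' at *
  have h0 : z < 0 → z' ≤ 0 := by
    intro h0
    by_contra hc
    have a1 := h2 1 (by omega) (by omega)
    have a2 := h2 0 (by omega) (by omega)
    have := hs 1
    unfold hop at a1 a2 h3; unfold Addable at ha; grind
  refine ⟨h1, fun s h4 h5 => ?_, h0, ?_⟩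
  · have := h2 s (by omega) h5
    unfold hop at this; grind
  · intro; unfold hop at h3; grind

theorem Clean.unique (h : Clean m z a) (h' : Clean m z b) : a = b := by
  obtain ⟨h1, h2, h4, h3⟩ := h
  obtain ⟨k1, k2, k4, k3⟩ := h'
  by_contra hne
  rcases lt_or_gt_of_ne hne with h | h
  · have := k2 (a + 1) (by omega) (by omega); grind
  · have := h2 (b + 1) (by omega) (by omega); grind

theorem IsShape.bmp_eq (hm : IsShape m) (ha : Addable m z) (h : Clean m z c) : bmp m z = c :=
  (hm.bmp_clean ha).unique h

theorem IsShape.addable_bmp (hm : IsShape m) (ha : Addable m z) :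
    Addable (hop z m) (bmp m z) := by
  obtain ⟨h1, h2, h3⟩ := hm.bmp_spec ha
  exact ⟨h2 _ h1 le_rfl, h3⟩

/-- A bump is not affected by a far cell. -/
theorem IsShape.bmp_hop (hm : IsShape m) (hy : Addable m y) (hz : Addable m z)
    (hyz : |y| ≠ |z|) (hc : |bmp m z| ≠ |y|) : bmp (hop y m) z = bmp m z := by
  refine (hm.shape_hop y).bmp_eq (hm.addable_hop hy hz hyz) ?_
  obtain ⟨q1, q2, q3, q4⟩ := hm.bmp_clean hz
  have h0 := hm.not_near hy hz
  have e1 := hm.sym y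
  have e2 := hm.sym (-y)
  generalize bmp m z = c at *
  unfold Addable at *
  refine ⟨q1, fun s hs hs' => ?_, q3, fun h1 => ?_⟩
  · have := q2 s hs hs'
    have i1 := q2 (1 - y)
    have i2 := q2 (1 + y)
    rw [hop_eq] <;> grind
  · have i1 := q2 (1 - y)
    have i2 := q2 (1 + y)
    have := q4 h1
    rw [hop_eq] <;> grind

/-- Adding the cell on `|y|` first frees the very site at which the bump would have ended, so the
bump stops one site earlier. -/
theorem IsShape.bmp_hop_of_eq (hm : IsShape m) (hy : Addable m y) (hz : Addable m z)
    (hyz : |y| ≠ |z|) (hc : |bmp m z| = |y|) : bmp (hop y m) z = bmp m z - 1 := by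
  refine (hm.shape_hop y).bmp_eq (hm.addable_hop hy hz hyz) ?_
  obtain ⟨q1, q2, q3, q4⟩ := hm.bmp_clean hz
  have h0 := hm.not_near hy hz
  have e1 := hm.sym y
  have e2 := hm.sym (-y)
  generalize bmp m z = c at *
  unfold Addable at *
  refine ⟨by grind, fun s hs hs' => ?_, by grind, fun h1 => ?_⟩
  · have := q2 s hs (by omega)
    have i1 := q2 (1 - y)
    have i2 := q2 (1 + y)
    rw [hop_eq] <;> grind
  · have i1 := q2 (1 - y)
    have i2 := q2 (1 + y)
    rw [show c - 1 + 1 = c by ring]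
    rcases abs_eq_abs.1 hc with rfl | rfl
    · rw [hop_self]; exact hy.2
    · rw [hop_at_neg]; grind

/-- The bump from `z` runs over the site `-y - 1`, which is occupied after the hop; hence its mirror
`y + 2` is free and the letter on `y` moves only one step. Together with `IsShape.bmp_hop_of_eq`
this produces a pair of opposite signs, the origin of the toggling case of `exch`. -/
theorem IsShape.bmp_of_mirror (hm : IsShape m) (hy : Addable m y) (hz : Addable m z)
    (hyz : |y| ≠ |z|) (hc : bmp m z = -y) : bmp (hop z m) y = y + 1 := by
  refine (hm.shape_hop z).bmp_eq (hm.addable_hop hz hy hyz.symm) ?_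
  obtain ⟨q1, q2, q3, q4⟩ := hm.bmp_clean hz
  have h0 := hm.not_near hy hz
  have e1 := hm.sym y
  have e2 := hm.sym (-y)
  rw [hc] at *
  have e3 := hm.sym (y + 2)
  have e4 := hm.sym z
  unfold Addable at *
  have i1 := q2 (-y - 1)
  refine ⟨by grind, fun s hs hs' => by omega, by grind, fun h1 => ?_⟩
  · rw [show y + 1 + 1 = y + 2 by ring]
    by_cases h : y + 2 = - z
    · rw [h, hop_at_neg]; grind
    · rw [hop_eq] <;> grind

end QueerDual

namespace QueerDual

/-! ### Passing a carry through a chain -/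

/-- The new diagonal of a letter on the diagonal `z` after a carry `x` passed. -/
noncomputable def stepOut (m : ℤ → Bool) (x z : ℤ) : ℤ := if |z| = x then bmp m z else z

/-- The carry after passing a letter on the diagonal `z`. -/
noncomputable def stepCarry (m : ℤ → Bool) (x z : ℤ) : ℤ := if |z| = x then |bmp m z| else x

variable {m : ℤ → Bool} {x y z a b c s : ℤ}

theorem stepOut_pos (h : |z| = x) : stepOut m x z = bmp m z := if_pos h
theorem stepOut_neg (h : |z| ≠ x) : stepOut m x z = z := if_neg h
theorem stepCarry_pos (h : |z| = x) : stepCarry m x z = |bmp m z| := if_pos h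
theorem stepCarry_neg (h : |z| ≠ x) : stepCarry m x z = x := if_neg h

theorem stepCarry_nonneg (h0 : 0 ≤ x) : 0 ≤ stepCarry m x z := by
  unfold stepCarry; split_ifs
  · exact abs_nonneg _
  · exact h0

theorem IsShape.addable_stepCarry (hm : IsShape m) (hx : Addable m x) (h0 : 0 ≤ x)
    (hz : Addable m z) : Addable (hop z m) (stepCarry m x z) := by
  by_cases h : |z| = x
  · rw [stepCarry_pos h, (hm.shape_hop z).addable_abs]
    exact hm.addable_bmp hz
  · rw [stepCarry_neg h]
    exact hm.addable_hop hz hx (by rwa [abs_of_nonneg h0])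

theorem IsShape.addable_stepOut (hm : IsShape m) (hx : Addable m x) (h0 : 0 ≤ x)
    (hz : Addable m z) : Addable (hop x m) (stepOut m x z) := by
  by_cases h : |z| = x
  · rw [stepOut_pos h, ← h, hop_abs]
    exact hm.addable_bmp hz
  · rw [stepOut_neg h]
    exact hm.addable_hop hx hz (by rw [abs_of_nonneg h0]; exact fun e => h e.symm)

/-- The elementary square of shapes closes: carry first or letter first, the same shape results. -/
theorem IsShape.hop_stepOut (hm : IsShape m) (hx : Addable m x) (hz : Addable m z) :
    hop (stepOut m x z) (hop x m) = hop (stepCarry m x z) (hop z m) := by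
  by_cases h : |z| = x
  · rw [stepOut_pos h, stepCarry_pos h, ← h, hop_abs, hop_abs]
  · rw [stepOut_neg h, stepCarry_neg h]
    exact hop_comm m (hm.not_near hz hx)

/-- The elementary exchange of two consecutive letters on diagonals `y` and `z`. -/
def exch (y z : ℤ) : ℤ × ℤ := if |(|y| - |z|)| = 1 then (-y, -z) else (z, y)

/-- Passing through `y`, `z` and through `exch y z` gives results related by `exch`. -/
def PairComm (m : ℤ → Bool) (x y z u v : ℤ) : Prop :=
  stepCarry (hop u m) (stepCarry m x u) v = stepCarry (hop y m) (stepCarry m x y) z ∧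
  ((|(|stepOut m x y| - |stepOut (hop y m) (stepCarry m x y) z|)| ≠ 1 ∧
      stepOut m x u = stepOut (hop y m) (stepCarry m x y) z ∧
      stepOut (hop u m) (stepCarry m x u) v = stepOut m x y) ∨
    (|stepOut m x y + stepOut (hop y m) (stepCarry m x y) z| = 1 ∧
      stepOut m x u = - stepOut m x y ∧
      stepOut (hop u m) (stepCarry m x u) v = - stepOut (hop y m) (stepCarry m x y) z))

theorem PairComm.symm (h : PairComm m x y z a b) : PairComm m x a b y z := by
  obtain ⟨h1, ⟨h2, h3, h4⟩ | ⟨h2, h3, h4⟩⟩ := h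
  · refine ⟨h1.symm, .inl ⟨?_, h4.symm, h3.symm⟩⟩
    rw [h3, h4, abs_sub_comm]; exact h2
  · refine ⟨h1.symm, .inr ⟨?_, by rw [h3, neg_neg], by rw [h4, neg_neg]⟩⟩
    rw [h3, h4, ← h2, ← abs_neg]; congr 1; ring

/-- The carry sits on `|z|`. If `z` is bumped off the diagonal of `y`, the two letters simply change
order. If it is bumped to `-y`, one order gives `(y, -y - 1)` and the other `(-y, y + 1)`, which are
related by toggling both. The excluded case, `z` bumped to `y` itself, is not an exchange of two
letters at all and needs a third letter (`IsShape.pass3_special`). -/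
theorem IsShape.pairComm_of_meet (hm : IsShape m) (hy : Addable m y) (hz : Addable m z)
    (hyz : |y| ≠ |z|) (hE : bmp m z = y → y = 0) : PairComm m |z| y z z y := by
  have hc1 := hm.bmp_clean hz
  have hn := hm.not_near hy hz
  unfold PairComm
  rw [stepOut_pos (z := z) rfl, stepCarry_pos (z := z) rfl, stepOut_neg hyz, stepCarry_neg hyz,
    stepOut_pos rfl, stepCarry_pos rfl]
  by_cases h : |bmp m z| = |y|
  · have h' : bmp m z = -y := by
      rcases abs_eq_abs.1 h with h | h
      · rw [h, hE h, neg_zero]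
      · exact h
    rw [stepOut_pos h.symm, stepCarry_pos h.symm, hm.bmp_hop_of_eq hy hz hyz h,
      hm.bmp_of_mirror hy hz hyz h', h']
    refine ⟨?_, .inr ⟨?_, rfl, by ring⟩⟩
    · rw [← abs_neg]; congr 1; ring
    · rw [show y + (-y - 1) = -1 by ring]; rfl
  · rw [stepOut_neg (Ne.symm h), stepCarry_neg (Ne.symm h), hm.bmp_hop hy hz hyz h]
    refine ⟨rfl, .inl ⟨?_, rfl, rfl⟩⟩
    obtain ⟨q1, q2, q3, q4⟩ := hc1
    have e1 := hm.sym y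
    have e2 := hm.sym (-y)
    unfold Addable at *
    generalize bmp m z = c at *
    have i1 := q2 (1 - y)
    have i2 := q2 (1 + y)
    grind

theorem IsShape.pairComm (hm : IsShape m) (hy : Addable m y) (hz : Addable m z)
    (hyz : |y| ≠ |z|) (h1 : |z| = x → bmp m z = y → y = 0)
    (h2 : |y| = x → bmp m y = z → z = 0) :
    PairComm m x y z z y := by
  by_cases e1 : |z| = x
  · rw [← e1]; exact hm.pairComm_of_meet hy hz hyz (h1 e1)
  by_cases e2 : |y| = x
  · rw [← e2]; exact (hm.pairComm_of_meet hz hy hyz.symm (h2 e2)).symm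
  unfold PairComm
  simp only [stepCarry_neg e1, stepCarry_neg e2, stepOut_neg e1, stepOut_neg e2]
  exact ⟨trivial, .inl ⟨hm.not_near hy hz, trivial, trivial⟩⟩

/-- Adjacent diagonals of opposite signs, the first on the negative side. -/
theorem IsShape.pairComm_adj_meet (hm : IsShape m) (hy : Addable m y) (hz : Addable (hop y m) z)
    (h0 : y < 0) (h0' : 0 < z) (hyz : |y + z| = 1) : PairComm m |y| y z (-y) (-z) := by
  have hy' := hm.addable_neg.2 hy
  have hc := hm.bmp_clean hy
  have hc' := hm.bmp_clean hy'
  have hcz := (hm.shape_hop y).bmp_clean hz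
  have hcz' := (hm.shape_hop y).bmp_clean ((hm.shape_hop y).addable_neg.2 hz)
  have s1 := hm.sym y
  have s2 := hm.sym z
  have s3 := hm.sym (-y)
  have s4 := hm.sym (-z)
  unfold PairComm
  rw [stepOut_pos rfl, stepCarry_pos rfl, stepOut_pos (abs_neg y), stepCarry_pos (abs_neg y),
    hop_neg]
  unfold Addable at *
  -- If `z = 1 - y`, only `y` moves in the first order, while in the other order `-y` moves to `z`
  -- and then pushes `-z` to the place where `y` went. If `z = -1 - y`, the two orders change roles.
  -- In both cases a toggled pair turns into a swapped pair.
  rcases abs_eq (zero_le_one) |>.1 hyz with h | h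
  · obtain rfl : z = 1 - y := by omega
    have k1 : m (1 - y + 1) = false := by
      have := hz.2
      rwa [hop_eq] at this <;> omega
    have k2 : bmp m (-y) = 1 - y := by
      refine hm.bmp_eq hy' ⟨by omega, fun s _ _ => by omega, by omega, fun _ => k1⟩
    have k3 : |1 - y| ≠ |bmp m y| := by
      have := hc.1; have := hc.2.2.1 h0; grind
    have k4 : bmp (hop y m) (-(1 - y)) = bmp m y := by
      refine hcz'.unique ?_
      obtain ⟨q1, q2, q3, q4⟩ := hc
      generalize bmp m y = c at *
      refine ⟨by omega, fun s hs hs' => ?_, by omega, fun _ => ?_⟩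
      · by_cases hs1 : s = y + 1
        · rw [hs1, hop_succ]; exact hy.1
        · rw [hop_eq] <;> grind
      · by_cases hy1 : y = -1
        · subst hy1
          obtain rfl : c = 0 := by omega
          have : (0 : ℤ) + 1 = -(-1) := rfl
          rw [this, hop_at_neg]; grind
        · have := q4 hy1
          rw [hop_eq] <;> grind
    rw [k2, stepOut_neg k3, stepCarry_neg k3, stepOut_pos (abs_neg _), stepCarry_pos (abs_neg _), k4]
    refine ⟨rfl, .inl ⟨?_, rfl, rfl⟩⟩
    have := hc.1; have := hc.2.2.1 h0; grind
  · obtain rfl : z = -1 - y := by omega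
    have k1 : m (-1 - y) = true := by
      have := hz.1
      rwa [hop_eq] at this <;> omega
    have s5 := hm.sym (-1 - y)
    have k2 : bmp m y = y + 1 := by
      refine hm.bmp_eq hy ⟨by omega, fun s _ _ => by omega, by omega, fun _ => ?_⟩
      grind
    have k3 : |-(-1 - y)| ≠ |bmp m (-y)| := by
      have := hc'.1; grind
    have k5 : |-1 - y| = |y + 1| := by rw [← abs_neg]; congr 1; ring
    have k4 : bmp (hop y m) (-1 - y) = bmp m (-y) := by
      refine hcz.unique ?_
      obtain ⟨q1, q2, q3, q4⟩ := hc'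
      generalize bmp m (-y) = c at *
      refine ⟨by omega, fun s hs hs' => ?_, by omega, fun _ => ?_⟩
      · by_cases hs1 : s = 1 - y
        · rw [hs1, hop_at_sub]; exact hy'.1
        · rw [hop_eq] <;> grind
      · have := q4 (by omega)
        rw [hop_eq] <;> grind
    rw [k2, stepOut_pos k5, stepCarry_pos k5, stepOut_neg k3, stepCarry_neg k3, k4]
    refine ⟨rfl, .inl ⟨?_, rfl, by ring⟩⟩
    have := hc'.1; grind

theorem IsShape.pairComm_adj (hm : IsShape m) (hy : Addable m y) (hz : Addable (hop y m) z)
    (hx : Addable m x) (h0 : 0 ≤ x)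
    (hyz : |(|y| - |z|)| = 1) (hs : y < 0 ∧ 0 < z ∨ z < 0 ∧ 0 < y) :
    PairComm m x y z (-y) (-z) := by
  by_cases e1 : |y| = x
  · rw [← e1]
    rcases hs with hs | hs
    · exact hm.pairComm_adj_meet hy hz hs.1 hs.2 (by grind)
    · have := hm.pairComm_adj_meet (y := -y) (z := -z) (hm.addable_neg.2 hy)
        (by rw [hop_neg]; exact (hm.shape_hop y).addable_neg.2 hz) (by omega) (by omega) (by grind)
      rw [neg_neg, neg_neg, abs_neg] at this
      exact this.symm
  -- A carry off `|y|` is also off the adjacent diagonal `|z|`, because adjacent diagonals are not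
  -- addable together. So nothing is bumped.
  · have e2 : |z| ≠ x := by
      rintro rfl
      have := hm.not_near hy hx
      rw [abs_abs] at this; exact this hyz
    have e1' : |-y| ≠ x := by rwa [abs_neg]
    have e2' : |-z| ≠ x := by rwa [abs_neg]
    unfold PairComm
    simp only [stepCarry_neg e1, stepCarry_neg e2, stepOut_neg e1, stepOut_neg e2,
      stepCarry_neg e1', stepCarry_neg e2', stepOut_neg e1', stepOut_neg e2']
    exact ⟨trivial, .inr ⟨by grind, trivial, trivial⟩⟩

end QueerDual

/-! ### A pass preserves descents -/

namespace QueerDual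
variable {m : ℤ → Bool} {x y z a b c s : ℤ}

theorem IsShape.ne_of_chain (hm : IsShape m) (hy : Addable m y) (hz : Addable (hop y m) z) :
    |y| = |z| → False := fun h => hm.not_addable_hop hy h.symm hz

/-- The site `z + 1` has to be free for `z` to be added, so a bump of `y` ends at `z` at the latest;
if it ends exactly at `z`, the carry pushes `z` further to the right. A bump of `z` alone only
widens the gap. -/
theorem IsShape.step_lt (hm : IsShape m) (hy : Addable m y) (hz : Addable (hop y m) z)
    (hx : Addable m x) (h0 : 0 ≤ x) (hyz : y < z) :
    stepOut m x y < stepOut (hop y m) (stepCarry m x y) z := by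
  have hne := hm.ne_of_chain hy hz
  have hc := hm.bmp_clean hy
  have hcz := (hm.shape_hop y).bmp_clean hz
  have s1 := hm.sym y
  have s2 := hm.sym z
  have s3 := hm.sym (-y)
  have s4 := hm.sym (-z)
  by_cases hadj : |(|y| - |z|)| = 1
  · have e2 : |z| = x → False := by
      rintro rfl
      have := hm.not_near hy hx
      rw [abs_abs] at this; exact this hadj
    by_cases e1 : |y| = x
    · rw [stepOut_pos e1, stepCarry_pos e1]
      unfold stepOut
      unfold Addable at *
      obtain ⟨q1, q2, q3, q4⟩ := hc
      obtain ⟨r1, r2, r3, r4⟩ := hcz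
      generalize bmp m y = c at *
      generalize bmp (hop y m) z = d at *
      have z2 := hz.2
      have z1 := hz.1
      have i1 := q2 (z + 1)
      unfold hop at z1 z2
      grind
    · rw [stepOut_neg e1, stepCarry_neg e1, stepOut_neg e2]; exact hyz
  · obtain ⟨-, hz'⟩ := hm.addable_of_hop hy hz hadj
    by_cases e1 : |y| = x
    · rw [stepOut_pos e1, stepCarry_pos e1]
      unfold stepOut
      unfold Addable at *
      obtain ⟨q1, q2, q3, q4⟩ := hc
      obtain ⟨r1, r2, r3, r4⟩ := hcz
      generalize bmp m y = c at *
      generalize bmp (hop y m) z = d at *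
      have i1 := q2 (z + 1)
      grind
    · rw [stepOut_neg e1, stepCarry_neg e1]
      unfold stepOut; split_ifs
      · have := hcz.1; omega
      · exact hyz

/-- Adding `y` vacates the site `y`, which normally stops a bump coming from `z < y`, while `y`
itself moves only to the right. -/
theorem IsShape.step_gt (hm : IsShape m) (hy : Addable m y) (hz : Addable (hop y m) z)
    (hx : Addable m x) (h0 : 0 ≤ x) (hyz : z < y) :
    stepOut (hop y m) (stepCarry m x y) z < stepOut m x y := by
  have hne := hm.ne_of_chain hy hz
  have hc := hm.bmp_clean hy
  have hcz := (hm.shape_hop y).bmp_clean hz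
  have s1 := hm.sym y
  have s2 := hm.sym z
  have s3 := hm.sym (-y)
  have s4 := hm.sym (-z)
  by_cases hadj : |(|y| - |z|)| = 1
  · have e2 : |z| = x → False := by
      rintro rfl
      have := hm.not_near hy hx
      rw [abs_abs] at this; exact this hadj
    by_cases e1 : |y| = x
    · rw [stepOut_pos e1, stepCarry_pos e1]
      unfold stepOut
      unfold Addable at *
      obtain ⟨q1, q2, q3, q4⟩ := hc
      obtain ⟨r1, r2, r3, r4⟩ := hcz
      generalize bmp m y = c at *
      generalize bmp (hop y m) z = d at *
      have z2 := hz.2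
      have z1 := hz.1
      have i1 := q2 (z + 1)
      -- A letter on the negative side is bumped at most to `0`, and `c > y ≥ 0`.
      by_cases hc' : |z| = |c| ∧ z < 0 ∧ 0 ≤ y
      · rw [if_pos hc'.1]; omega
      rw [not_and_or] at hc'
      unfold hop at z1 z2
      rcases lt_or_ge z 0 with hz0 | hz0 <;> rcases lt_or_ge y 0 with hy0 | hy0 <;> grind
    · rw [stepOut_neg e1, stepCarry_neg e1, stepOut_neg e2]; exact hyz
  · obtain ⟨-, hz'⟩ := hm.addable_of_hop hy hz hadj
    have y1 : hop y m (y + 1) = true := by rw [hop_succ]; exact hy.1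
    have y0 : hop y m y = false := by rw [hop_self]; exact hy.2
    by_cases e1 : |y| = x
    · rw [stepOut_pos e1, stepCarry_pos e1]
      unfold stepOut
      unfold Addable at *
      obtain ⟨q1, q2, q3, q4⟩ := hc
      obtain ⟨r1, r2, r3, r4⟩ := hcz
      generalize bmp m y = c at *
      generalize bmp (hop y m) z = d at *
      have i1 := q2 (z + 1)
      have i2 := r2 y
      grind
    · rw [stepOut_neg e1, stepCarry_neg e1]
      unfold stepOut; split_ifs
      · have i2 := hcz.2.1 y
        grind
      · exact hyz
end QueerDual

namespace QueerDual
variable {m : ℤ → Bool} {x y z a b c s : ℤ}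

/-! ### The elementary dual equivalence on three letters -/

/-- The elementary dual equivalence on the diagonals of three consecutive letters. -/
def tri (t : ℤ × ℤ × ℤ) : ℤ × ℤ × ℤ :=
  if (t.1 ≤ t.2.1 ∧ t.2.1 ≤ t.2.2) ∨ (t.2.2 ≤ t.2.1 ∧ t.2.1 ≤ t.1) then t
  else if t.1 = t.2.2 then (t.1, -t.2.1, t.2.2)
  else if (t.2.1 < t.1 ∧ t.1 < t.2.2) ∨ (t.2.2 < t.1 ∧ t.1 < t.2.1) then
    (t.1, (exch t.2.1 t.2.2).1, (exch t.2.1 t.2.2).2)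
  else ((exch t.1 t.2.1).1, (exch t.1 t.2.1).2, t.2.2)

/-- The three steps can be made one after the other. -/
def Chain3 (m : ℤ → Bool) (t : ℤ × ℤ × ℤ) : Prop :=
  Addable m t.1 ∧ Addable (hop t.1 m) t.2.1 ∧ Addable (hop t.2.1 (hop t.1 m)) t.2.2

def end3 (m : ℤ → Bool) (t : ℤ × ℤ × ℤ) : ℤ → Bool := hop t.2.2 (hop t.2.1 (hop t.1 m))

noncomputable def pass3 (m : ℤ → Bool) (x : ℤ) (t : ℤ × ℤ × ℤ) : ℤ × ℤ × ℤ :=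
  (stepOut m x t.1, stepOut (hop t.1 m) (stepCarry m x t.1) t.2.1,
    stepOut (hop t.2.1 (hop t.1 m)) (stepCarry (hop t.1 m) (stepCarry m x t.1) t.2.1) t.2.2)

noncomputable def carry3 (m : ℤ → Bool) (x : ℤ) (t : ℤ × ℤ × ℤ) : ℤ :=
  stepCarry (hop t.2.1 (hop t.1 m)) (stepCarry (hop t.1 m) (stepCarry m x t.1) t.2.1) t.2.2

theorem exch_exch (y z : ℤ) : exch (exch y z).1 (exch y z).2 = (y, z) := by
  unfold exch; split_ifs <;> simp_all [abs_sub_comm]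

theorem IsShape.chain_exch (hm : IsShape m) (hy : Addable m y) (hz : Addable (hop y m) z) :
    Addable m (exch y z).1 ∧ Addable (hop (exch y z).1 m) (exch y z).2 ∧
      hop (exch y z).2 (hop (exch y z).1 m) = hop z (hop y m) := by
  unfold exch
  split_ifs with h
  · simp only [hop_neg]
    exact ⟨hm.addable_neg.2 hy, (hm.shape_hop y).addable_neg.2 hz, trivial⟩
  · obtain ⟨h1, h2⟩ := hm.addable_of_hop hy hz h
    exact ⟨h2, hm.addable_hop h2 hy h1.symm, hop_comm m h⟩

/-- Between two cells of the same diagonal both neighbouring diagonals must receive a cell. With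
only one letter in between this is possible only on the main diagonal, which has a single neighbour.
-/
theorem IsShape.eq_zero_of_chain (hm : IsShape m) (hy : Addable m a) (hz : Addable (hop a m) b)
    (h3 : Addable (hop b (hop a m)) a) : a = 0 := by
  by_contra h0
  have s1 := hm.sym a
  have s2 := hm.sym (-a)
  have h1 := hop_self (z := a) (m := m)
  have h2 := hop_succ (z := a) (m := m)
  have h4 := hop_at_neg (z := a) (m := m)
  have h5 := hop_at_sub (z := a) (m := m)
  unfold Addable at *
  have h6 := h3.1
  have h7 := h3.2
  unfold hop at hz
  unfold hop at h6 h7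
  grind

/-- The two results of passing through a pair and through the exchanged pair. -/
def PairRel (y z u v : ℤ) : Prop :=
  (|(|y| - |z|)| ≠ 1 ∧ u = z ∧ v = y) ∨ (|y + z| = 1 ∧ u = -y ∧ v = -z)

/-- As long as `b` is the median of both triples, `tri` acts on the other two letters. Toggling may
be accompanied by a tie `b = z`, where `tri` takes its branch for equal outer diagonals; the
branches agree because the tie occurs only at `0`. -/
theorem tri_left (h : PairRel y z a c) (hb : b = z → b = 0)
    (hh : (y < b ∧ b < a ∧ y < z) ∨ (b < y ∧ a < b ∧ z < y)) :
    tri (b, y, z) = (b, a, c) := by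
  unfold tri exch
  simp only
  rcases h with ⟨h1, rfl, rfl⟩ | ⟨h1, rfl, rfl⟩
  · rw [if_neg (by omega), if_neg (by omega), if_pos (by omega), if_neg h1]
  · rw [if_neg (by omega)]
    by_cases e : b = z
    · rw [if_pos e, show z = 0 by rw [← e]; exact hb e]; rfl
    · rw [if_neg e, if_pos (by grind), if_pos (by grind)]

theorem tri_right (h : PairRel y z a c) (hb : y = b → b = 0)
    (hh : (b < z ∧ c < b ∧ y < z) ∨ (z < b ∧ b < c ∧ z < y)) :
    tri (y, z, b) = (a, c, b) := by
  unfold tri exch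
  simp only
  rcases h with ⟨h1, rfl, rfl⟩ | ⟨h1, rfl, rfl⟩
  · rw [if_neg (by omega), if_neg (by omega), if_neg (by omega), if_neg h1]
  · rw [if_neg (by omega)]
    by_cases e : y = b
    · rw [if_pos e, show y = 0 by rw [e]; exact hb e]; rfl
    · rw [if_neg e, if_neg (by grind), if_pos (by grind)]

theorem IsShape.chain3_pass3 (hm : IsShape m) (hx : Addable m x) (h0 : 0 ≤ x) {t : ℤ × ℤ × ℤ}
    (ht : Chain3 m t) : Chain3 (hop x m) (pass3 m x t) := by
  obtain ⟨h1, h2, h3⟩ := ht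
  have k1 := hm.addable_stepCarry hx h0 h1
  have k2 := (hm.shape_hop t.1).addable_stepCarry k1 (stepCarry_nonneg h0) h2
  have e1 := hm.hop_stepOut hx h1
  have e2 := (hm.shape_hop t.1).hop_stepOut k1 h2
  refine ⟨hm.addable_stepOut hx h0 h1, ?_, ?_⟩ <;> unfold pass3 <;> simp only
  · rw [e1]; exact (hm.shape_hop _).addable_stepOut k1 (stepCarry_nonneg h0) h2
  · rw [e1, e2]
    exact ((hm.shape_hop _).shape_hop _).addable_stepOut k2
      (stepCarry_nonneg (stepCarry_nonneg h0)) h3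

theorem PairComm.rel {y z u v : ℤ} (h : PairComm m x y z u v) :
    PairRel (stepOut m x y) (stepOut (hop y m) (stepCarry m x y) z)
      (stepOut m x u) (stepOut (hop u m) (stepCarry m x u) v) := h.2

/-- The site `b` has been vacated and stops the bump of `y`, unless `b = y + 1`; then `y` would be
adjacent to `b`, which contradicts its lying on the diagonal of the carry. So when the median letter
comes first, the bad case of `IsShape.pairComm_of_meet` does not arise. -/
theorem IsShape.bmp_ne_of_between (hm : IsShape m) (hx : Addable m x)
    (hb : Addable m b) (hy : Addable (hop b m) y) (h : |y| = stepCarry m x b)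
    (h1 : y < b) (h2 : b < c) : bmp (hop b m) y ≠ c := by
  rintro rfl
  obtain ⟨q1, q2, q3, q4⟩ := (hm.shape_hop b).bmp_clean hy
  obtain ⟨r1, r2, r3, r4⟩ := hm.bmp_clean hb
  have i1 := q2 b
  rw [hop_self, hb.2] at i1
  obtain rfl : b = y + 1 := by grind
  by_cases e : |y + 1| = x
  · rw [stepCarry_pos e] at h
    grind
  · rw [stepCarry_neg e] at h
    have := hm.not_near hx hb
    rw [← h, abs_abs] at this
    grind

/-- The median letter comes first. -/
theorem IsShape.pass3_left (hm : IsShape m) (hx : Addable m x) (h0 : 0 ≤ x)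
    (ht : Chain3 m (b, y, z)) (hb : y < b ∧ b < z ∨ z < b ∧ b < y) :
    pass3 m x (tri (b, y, z)) = tri (pass3 m x (b, y, z)) ∧
      carry3 m x (tri (b, y, z)) = carry3 m x (b, y, z) := by
  obtain ⟨h1, h2, h3⟩ := ht
  simp only at h1 h2 h3
  have hm1 := hm.shape_hop b
  have hx1 := hm.addable_stepCarry hx h0 h1
  have h01 : 0 ≤ stepCarry m x b := stepCarry_nonneg h0
  have htri : tri (b, y, z) = (b, (exch y z).1, (exch y z).2) := by
    unfold tri; simp only
    rw [if_neg (by omega), if_neg (by omega), if_pos (by omega)]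
  have hby := hm.ne_of_chain h1 h2
  obtain ⟨k1, k2, k3⟩ := hm1.chain_exch h2 h3
  -- Besides the commutation, the first letter of the exchanged pair has to lie on the other side of
  -- `b`: then `IsShape.step_lt` and `IsShape.step_gt` show that the image of `b` is again a median.
  have key : PairComm (hop b m) (stepCarry m x b) y z (exch y z).1 (exch y z).2 ∧
      (y < b → b < (exch y z).1) ∧ (b < y → (exch y z).1 < b) := by
    by_cases hadj : |(|y| - |z|)| = 1
    · rw [show exch y z = (-y, -z) from if_pos hadj]
      exact ⟨hm1.pairComm_adj h2 h3 hx1 h01 hadj (by grind), by grind, by grind⟩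
    · rw [show exch y z = (z, y) from if_neg hadj]
      obtain ⟨hne, hz⟩ := hm1.addable_of_hop h2 h3 hadj
      refine ⟨hm1.pairComm h2 hz hne (fun e h => absurd h ?_) (fun e h => absurd h ?_), by simp only; omega,
        by simp only; omega⟩
      · rcases hb with hb | hb
        · have := (hm1.bmp_clean hz).1; omega
        · exact hm.bmp_ne_of_between hx h1 hz e hb.1 hb.2
      · rcases hb with hb | hb
        · exact hm.bmp_ne_of_between hx h1 h2 e hb.1 hb.2
        · have := (hm1.bmp_clean h2).1; omega
  obtain ⟨hP, hl1, hl2⟩ := key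
  rw [htri]
  have hch := hm.chain3_pass3 hx h0 (t := (b, y, z)) ⟨h1, h2, h3⟩
  refine ⟨?_, hP.1⟩
  refine (tri_left hP.rel (fun e => ?_) ?_).symm
  · obtain ⟨c1, c2, c3⟩ := hch
    unfold pass3 at c1 c2 c3
    simp only at c1 c2 c3
    rw [← e] at c3
    exact (hm.shape_hop x).eq_zero_of_chain c1 c2 c3
  · rcases hb with hb | hb
    · exact .inl ⟨hm.step_gt h1 h2 hx h0 hb.1, hm.step_lt h1 k1 hx h0 (hl1 hb.1),
        hm1.step_lt h2 h3 hx1 h01 (by omega)⟩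
    · exact .inr ⟨hm.step_lt h1 h2 hx h0 hb.2, hm.step_gt h1 k1 hx h0 (hl2 hb.2),
        hm1.step_gt h2 h3 hx1 h01 (by omega)⟩

/-- The median letter comes last, and the bumped pair is not degenerate. -/
theorem IsShape.pass3_right (hm : IsShape m) (hx : Addable m x) (h0 : 0 ≤ x)
    (ht : Chain3 m (y, z, b)) (hb : y < b ∧ b < z ∨ z < b ∧ b < y)
    (hE1 : |z| = x → bmp m z ≠ y) (hE2 : |y| = x → bmp m y ≠ z) :
    pass3 m x (tri (y, z, b)) = tri (pass3 m x (y, z, b)) ∧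
      carry3 m x (tri (y, z, b)) = carry3 m x (y, z, b) := by
  obtain ⟨h1, h2, h3⟩ := ht
  simp only at h1 h2 h3
  have hx1 := hm.addable_stepCarry hx h0 h1
  have hm1 := hm.shape_hop y
  have h01 : 0 ≤ stepCarry m x y := stepCarry_nonneg h0
  have htri : tri (y, z, b) = ((exch y z).1, (exch y z).2, b) := by
    unfold tri; simp only
    rw [if_neg (by omega), if_neg (by omega), if_neg (by omega)]
  have hzb := hm1.ne_of_chain h2 h3
  obtain ⟨k1, k2, k3⟩ := hm.chain_exch h1 h2
  have key : PairComm m x y z (exch y z).1 (exch y z).2 ∧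
      (b < z → (exch y z).2 < b) ∧ (z < b → b < (exch y z).2) := by
    by_cases hadj : |(|y| - |z|)| = 1
    · rw [show exch y z = (-y, -z) from if_pos hadj]
      exact ⟨hm.pairComm_adj h1 h2 hx h0 hadj (by grind), by grind, by grind⟩
    · rw [show exch y z = (z, y) from if_neg hadj]
      obtain ⟨hne, hz⟩ := hm.addable_of_hop h1 h2 hadj
      exact ⟨hm.pairComm h1 hz hne (fun e h => absurd h (hE1 e)) (fun e h => absurd h (hE2 e)), by simp only; omega, by simp only; omega⟩
  obtain ⟨hP, hl1, hl2⟩ := key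
  rw [htri]
  have hch := hm.chain3_pass3 hx h0 (t := (y, z, b)) ⟨h1, h2, h3⟩
  have hk1 := hm.addable_stepCarry hx h0 k1
  have hk0 : 0 ≤ stepCarry m x (exch y z).1 := stepCarry_nonneg h0
  -- Shape and carry after the pair do not depend on its order, so the last letter has the same
  -- image in both triples.
  have e1 : pass3 m x ((exch y z).1, (exch y z).2, b) =
      (stepOut m x (exch y z).1, stepOut (hop (exch y z).1 m) (stepCarry m x (exch y z).1)
        (exch y z).2, (pass3 m x (y, z, b)).2.2) := by
    unfold pass3; simp only
    rw [hP.1, k3]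
  refine ⟨?_, ?_⟩
  swap
  · unfold carry3; simp only
    rw [hP.1, k3]
  rw [e1]
  refine (tri_right hP.rel (fun e => ?_) ?_).symm
  · obtain ⟨c1, c2, c3⟩ := hch
    unfold pass3 at c1 c2 c3 e
    simp only at c1 c2 c3 e
    rw [← e] at c3
    have := (hm.shape_hop x).eq_zero_of_chain c1 c2 c3
    unfold pass3
    simp only
    rw [← e, this]
  · have e2 : (pass3 m x (y, z, b)).2.2 =
        stepOut (hop (exch y z).2 (hop (exch y z).1 m)) (stepCarry (hop (exch y z).1 m)
          (stepCarry m x (exch y z).1) (exch y z).2) b := by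
      unfold pass3; simp only
      rw [hP.1, k3]
    have k4 : Addable (hop (exch y z).2 (hop (exch y z).1 m)) b := by rw [k3]; exact h3
    rcases hb with hb | hb
    · refine .inl ⟨hm1.step_gt h2 h3 hx1 h01 hb.2, ?_, hm.step_lt h1 h2 hx h0 (by omega)⟩
      rw [e2]
      exact (hm.shape_hop _).step_lt k2 k4 hk1 hk0 (hl1 hb.2)
    · refine .inr ⟨hm1.step_lt h2 h3 hx1 h01 hb.1, ?_, hm.step_gt h1 h2 hx h0 (by omega)⟩
      rw [e2]
      exact (hm.shape_hop _).step_gt k2 k4 hk1 hk0 (hl2 hb.1)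

end QueerDual

/-! ### Degenerate triples, and the commutation of a pass with the elementary dual equivalence -/

namespace QueerDual
variable {m : ℤ → Bool} {x y z a b c s : ℤ}

theorem tri_exch_right (h : (y < b ∧ b < z) ∨ (z < b ∧ b < y)) (hn : |(|y| - |z|)| ≠ 1) :
    tri (y, z, b) = (z, y, b) := by
  unfold tri exch; simp only
  rw [if_neg (by omega), if_neg (by omega), if_neg (by omega), if_neg hn]

theorem tri_exch_left (h : (y < b ∧ b < z) ∨ (z < b ∧ b < y)) (hn : |(|y| - |z|)| ≠ 1) :
    tri (b, y, z) = (b, z, y) := by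
  unfold tri exch; simp only
  rw [if_neg (by omega), if_neg (by omega), if_pos (by omega), if_neg hn]

theorem tri_eq (a b : ℤ) : tri (a, b, a) = if a = b then (a, b, a) else (a, -b, a) := by
  unfold tri; grind

theorem tri_eq_self (h : (a ≤ b ∧ b ≤ c) ∨ (c ≤ b ∧ b ≤ a)) : tri (a, b, c) = (a, b, c) := if_pos h

/-- The case in which one of the exchanged letters is bumped to the place of the other. -/
theorem IsShape.pass3_special (hm : IsShape m) (hy : Addable m y) (hz : Addable m z)
    (hyz : |y| ≠ |z|) (hb : Addable (hop z (hop y m)) b) (h1 : z < b) (h2 : b < y)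
    (hc : bmp m z = y) :
    pass3 m |z| (y, z, b) = tri (pass3 m |z| (z, y, b)) ∧
      pass3 m |z| (z, y, b) = tri (pass3 m |z| (y, z, b)) ∧
      carry3 m |z| (y, z, b) = carry3 m |z| (z, y, b) := by
  have hn := hm.not_near hy hz
  obtain ⟨q1, q2, q3, q4⟩ := hm.bmp_clean hz
  have hzy := hm.addable_hop hz hy hyz.symm
  have hyz' := hm.addable_hop hy hz hyz
  obtain ⟨r1, r2, r3, r4⟩ := (hm.shape_hop z).bmp_clean hzy
  have hcy : |bmp m z| = |y| := by rw [hc]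
  have e1 : bmp (hop y m) z = y - 1 := by rw [hm.bmp_hop_of_eq hy hz hyz hcy, hc]
  have hm2 := (hm.shape_hop y).shape_hop z
  obtain ⟨t1, t2, t3, t4⟩ := hm2.bmp_clean hb
  have s1 := hm.sym y
  have s2 := hm.sym (-y)
  have s3 := hm.sym z
  have s4 := hm.sym (-z)
  rw [hc] at q1 q2 q3 q4
  -- The bump from `z` to `y` ran over occupied sites only, so `y - 1` is the only place strictly
  -- between them at which the third letter can be added.
  have hb' : b = y - 1 := by
    by_contra hne
    have i1 := q2 (b + 1) (by omega) (by omega)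
    have i2 := q2 (1 - z)
    have hb2 := hb.2
    unfold Addable at *
    rw [hop_eq, hop_eq] at hb2 <;> grind
  subst hb'
  have hsy := (hm.shape_hop z).sym y
  -- The third letter, bumped in one order, lands where `y` lands in the other order. The exception
  -- is the main diagonal: `-1` stops at `0`, whereas `0` goes on to `1`.
  have e2 : bmp (hop z (hop y m)) (y - 1) = bmp (hop z m) y ∨
      (y = 0 ∧ bmp (hop z m) y = 1 ∧ bmp (hop z (hop y m)) (y - 1) = 0) := by
    have hcm := hop_comm m hn
    by_cases hy0 : y = 0
    · right
      subst hy0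
      have : bmp (hop z m) 0 = 1 := by
        refine (hm.shape_hop z).bmp_eq hzy ⟨by omega, fun s _ _ => by omega, by omega, fun _ => ?_⟩
        have k2 := hb.1
        rw [← hcm] at k2
        have k4 := (hm.shape_hop z).sym 2
        rw [hop_eq] at k2 <;> grind
      refine ⟨rfl, this, by omega⟩
    · left
      refine hm2.bmp_eq hb ?_
      rw [← hcm]
      generalize bmp (hop z m) y = e at *
      refine ⟨by omega, fun s hs hs' => ?_, by omega, fun _ => ?_⟩
      · by_cases hs1 : s = y + 1
        · rw [hs1, hop_succ]; exact hzy.1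
        · unfold Addable at *
          rw [hop_eq] <;> grind
      · by_cases hy1 : y = -1
        · subst hy1
          obtain rfl : e = 0 := by omega
          have := hzy.1
          rw [show (0 : ℤ) + 1 = -(-1) by rfl, hop_at_neg]; grind
        · have := r4 hy1
          unfold Addable at *
          rw [hop_eq] <;> grind
  have ezy : |y| ≠ |z| := hyz
  have P1 : pass3 m |z| (z, y, y - 1) = (y, bmp (hop z m) y,
      stepOut (hop y (hop z m)) |bmp (hop z m) y| (y - 1)) := by
    unfold pass3; simp only
    rw [stepOut_pos rfl, stepCarry_pos rfl, hc, stepOut_pos rfl, stepCarry_pos rfl]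
  have P2 : pass3 m |z| (y, z, y - 1) = (y, y - 1, bmp (hop z (hop y m)) (y - 1)) := by
    unfold pass3; simp only
    rw [stepOut_neg ezy, stepCarry_neg ezy, stepOut_pos rfl, stepCarry_pos rfl, e1, stepOut_pos rfl]
  have C1 : carry3 m |z| (z, y, y - 1) =
      stepCarry (hop y (hop z m)) |bmp (hop z m) y| (y - 1) := by
    unfold carry3; simp only
    rw [stepCarry_pos rfl, hc, stepCarry_pos rfl]
  have C2 : carry3 m |z| (y, z, y - 1) = |bmp (hop z (hop y m)) (y - 1)| := by
    unfold carry3; simp only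
    rw [stepCarry_neg ezy, stepCarry_pos rfl, e1, stepCarry_pos rfl]
  -- The triples differed in their first two letters; their images differ in the last two. So `tri`
  -- on the image exchanges another pair than before. For `y = 0` the images are `(0, 1, 0)` and
  -- `(0, -1, 0)`, related by the toggle of the middle letter.
  rw [P1, P2, C1, C2, hop_comm m hn]
  rcases e2 with e2 | ⟨rfl, e2, e3⟩
  · have hne : |y - 1| ≠ |bmp (hop z m) y| ∧ |(|y - 1| - |bmp (hop z m) y|)| ≠ 1 := by
      by_cases hy0 : y = 0
      · subst hy0
        have k2 := hb.1
        rw [← hop_comm m hn] at k2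
        have k4 := (hm.shape_hop z).sym 2
        rw [hop_eq] at k2 <;> grind
      · grind
    rw [e2, stepOut_neg hne.1, stepCarry_neg hne.1]
    have hn' := hne.2
    rw [abs_sub_comm] at hn'
    exact ⟨(tri_exch_left (by omega) hn').symm, (tri_exch_left (by omega) hne.2).symm, rfl⟩
  · rw [e2, e3, stepOut_pos (by norm_num), stepCarry_pos (by norm_num), e3]
    refine ⟨?_, ?_, rfl⟩ <;> rw [tri_eq] <;> rfl

/-- Two letters on the main diagonal with `±1` in between. A carry on `0` turns the toggle of the
middle letter into a swap of the last two letters: with `c` the bump of `1`, the images are `(1, c,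
0)` and `(1, 0, c)`. Any other carry bumps none of the three. -/
theorem IsShape.pass3_zero (hm : IsShape m) (hx : Addable m x) (h0 : 0 ≤ x) (hb0 : b = 1 ∨ b = -1)
    (ht : Chain3 m (0, b, 0)) :
    pass3 m x (0, -b, 0) = tri (pass3 m x (0, b, 0)) ∧
      carry3 m x (0, -b, 0) = carry3 m x (0, b, 0) := by
  obtain ⟨h1, h2, h3⟩ := ht
  simp only at h1 h2 h3
  suffices H : ∀ (h2 : Addable (hop 0 m) 1) (h3 : Addable (hop 1 (hop 0 m)) 0),
      pass3 m x (0, -1, 0) = tri (pass3 m x (0, 1, 0)) ∧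
      pass3 m x (0, 1, 0) = tri (pass3 m x (0, -1, 0)) ∧
      carry3 m x (0, -1, 0) = carry3 m x (0, 1, 0) by
    rcases hb0 with rfl | rfl
    · exact ⟨(H h2 h3).1, (H h2 h3).2.2⟩
    · have h2' : Addable (hop 0 m) 1 := (hm.shape_hop 0).addable_neg.1 h2
      have h3' : Addable (hop 1 (hop 0 m)) 0 := by rw [← hop_neg]; exact h3
      rw [neg_neg]
      exact ⟨(H h2' h3').2.1, (H h2' h3').2.2.symm⟩
  intro h2 h3
  have hm2 := (hm.shape_hop 0).shape_hop 1
  have c0 := hm.bmp_clean h1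
  have c1 := (hm.shape_hop 0).bmp_clean h2
  have c1' := (hm.shape_hop 0).bmp_clean ((hm.shape_hop 0).addable_neg.2 h2)
  have c2 := hm2.bmp_clean h3
  have b2 : m 2 = false := by
    have := h2.2
    rwa [hop_eq (by norm_num) (by norm_num) (by norm_num) (by norm_num)] at this
  have e0 : bmp m 0 = 1 :=
    hm.bmp_eq h1 ⟨by norm_num, fun s _ _ => by omega, by norm_num, fun _ => b2⟩
  have e1 : bmp (hop 0 m) (-1) = 0 := by
    have := c1'.1; have := c1'.2.2.1 (by norm_num); omega
  have e2 : bmp (hop 1 (hop 0 m)) 0 = bmp (hop 0 m) 1 := by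
    refine c2.unique ?_
    obtain ⟨r1, r2, r3, r4⟩ := c1
    generalize bmp (hop 0 m) 1 = c at *
    refine ⟨by omega, fun s hs hs' => ?_, by omega, fun _ => ?_⟩
    · by_cases hs1 : s = 1 + 1
      · rw [hs1, hop_succ]; exact h2.1
      · rw [hop_eq] <;> grind
    · rw [hop_eq] <;> grind
  have hn : (0 : ℤ) ≠ |bmp (hop 0 m) 1| := by have := c1.1; grind
  have hm1 : hop (-1) (hop 0 m) = hop 1 (hop 0 m) := hop_neg _ _
  unfold pass3 carry3
  simp only
  rw [hm1]
  by_cases hx0 : x = 0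
  · subst hx0
    have n1 : |(-1 : ℤ)| = 1 := rfl
    have n2 : |(0 : ℤ)| ≠ |bmp (hop 0 m) 1| := by rwa [abs_zero]
    simp only [stepOut_pos abs_zero, stepCarry_pos abs_zero, e0, abs_one, stepOut_pos n1,
      stepCarry_pos n1, stepOut_pos abs_one, stepCarry_pos abs_one, e1, abs_zero, e2,
      stepOut_neg n2, stepCarry_neg n2]
    have := c1.1
    have hn' : |(|(0 : ℤ)| - |bmp (hop 0 m) 1|)| ≠ 1 := by
      rw [abs_zero, zero_sub, abs_neg, abs_abs, abs_of_pos (by omega)]; omega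
    have hn'' : |(|bmp (hop 0 m) 1| - |(0 : ℤ)|)| ≠ 1 := by rwa [abs_sub_comm]
    exact ⟨(tri_exch_left (.inr ⟨zero_lt_one, c1.1⟩) hn'').symm,
      (tri_exch_left (.inl ⟨zero_lt_one, c1.1⟩) hn').symm, trivial⟩
  · have n0 : |(0 : ℤ)| ≠ x := by rw [abs_zero]; exact Ne.symm hx0
    have n1 : |(1 : ℤ)| ≠ x := by
      have := hm.not_near h1 hx
      rintro rfl
      simp at this
    have n1' : |(-1 : ℤ)| ≠ x := by rwa [abs_neg]
    simp only [stepOut_neg n0, stepCarry_neg n0, stepOut_neg n1, stepCarry_neg n1,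
      stepOut_neg n1', stepCarry_neg n1']
    refine ⟨?_, ?_, trivial⟩ <;> rw [tri_eq] <;> rfl

/-- Passing a carry commutes with the elementary dual equivalence. -/
theorem IsShape.pass3_tri (hm : IsShape m) (hx : Addable m x) (h0 : 0 ≤ x) {t : ℤ × ℤ × ℤ}
    (ht : Chain3 m t) :
    pass3 m x (tri t) = tri (pass3 m x t) ∧ carry3 m x (tri t) = carry3 m x t := by
  obtain ⟨a, b, c⟩ := t
  obtain ⟨h1, h2, h3⟩ := id ht
  simp only at h1 h2 h3
  have n1 := hm.ne_of_chain h1 h2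
  have n2 := (hm.shape_hop a).ne_of_chain h2 h3
  have hx1 := hm.addable_stepCarry hx h0 h1
  have h01 : 0 ≤ stepCarry m x a := stepCarry_nonneg h0
  by_cases hf : (a ≤ b ∧ b ≤ c) ∨ (c ≤ b ∧ b ≤ a)
  · rw [tri_eq_self hf]
    refine ⟨(tri_eq_self ?_).symm, rfl⟩
    rcases hf with hf | hf
    · exact .inl ⟨(hm.step_lt h1 h2 hx h0 (by grind)).le,
        ((hm.shape_hop a).step_lt h2 h3 hx1 h01 (by grind)).le⟩
    · exact .inr ⟨((hm.shape_hop a).step_gt h2 h3 hx1 h01 (by grind)).le,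
        (hm.step_gt h1 h2 hx h0 (by grind)).le⟩
  by_cases hac : a = c
  · subst hac
    obtain rfl := hm.eq_zero_of_chain h1 h2 h3
    rw [tri_eq, if_neg (by rintro rfl; exact hf (.inl ⟨le_rfl, le_rfl⟩))]
    refine hm.pass3_zero hx h0 ?_ ht
    by_contra hb
    have hn : |(|b| - |(0 : ℤ)|)| ≠ 1 := by
      rw [abs_zero, sub_zero, abs_abs]
      intro h
      exact hb ((abs_eq zero_le_one).1 h)
    have := ((hm.shape_hop 0).addable_of_hop h2 h3 hn).2
    exact hm.not_addable_hop h1 rfl this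
  by_cases hl : (b < a ∧ a < c) ∨ (c < a ∧ a < b)
  · exact hm.pass3_left hx h0 ht hl
  have hr : (a < c ∧ c < b) ∨ (b < c ∧ c < a) := by omega
  -- The only obstruction left is that one of the exchanged letters is bumped exactly to the place
  -- of the other.
  by_cases hE : (|b| = x → bmp m b ≠ a) ∧ (|a| = x → bmp m a ≠ b)
  · exact hm.pass3_right hx h0 ht hr hE.1 hE.2
  -- A bump does not cross the main diagonal from the negative side, and the median `c` lies
  -- strictly between `a` and `b`. So a bump from one to the other changes the absolute diagonal by
  -- at least two, and the pair is swapped, not toggled.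
  have hadj : |(|a| - |b|)| ≠ 1 := by
    intro hadj
    have h2' := fun e : |b| = x => hm.not_near h1 ((hm.addable_abs (z := b)).1 (e ▸ hx))
    apply hE
    refine ⟨fun e => absurd hadj (h2' e), fun e h => ?_⟩
    have := (hm.addable_bmp h1)
    obtain ⟨q1, q2, q3, q4⟩ := hm.bmp_clean h1
    rw [h] at q1 q3
    grind
  obtain ⟨hne, hb⟩ := hm.addable_of_hop h1 h2 hadj
  rw [tri_exch_right hr hadj]
  by_cases hE1 : |b| = x ∧ bmp m b = a
  · obtain ⟨rfl, he⟩ := hE1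
    have := (hm.bmp_clean hb).1
    have := hm.pass3_special h1 hb hne h3 (by omega) (by omega) he
    exact ⟨this.2.1, this.2.2.symm⟩
  · have hE2 : |a| = x ∧ bmp m a = b := by grind
    obtain ⟨rfl, he⟩ := hE2
    have := (hm.bmp_clean h1).1
    have := hm.pass3_special hb h1 hne.symm (by rw [hop_comm m hadj]; exact h3) (by omega)
      (by omega) he
    exact ⟨this.1, this.2.2⟩

end QueerDual

namespace QueerDual
variable {m : ℤ → Bool} {x y : ℤ} {z w : ℕ → ℤ} {n i j k : ℕ}

/-! ### Chains of letters -/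

/-- The shape after the letters `1, …, k`, where the letter `k` lies on the diagonal `z k`. -/
def shp (m : ℤ → Bool) (z : ℕ → ℤ) : ℕ → ℤ → Bool
  | 0 => m
  | k + 1 => hop (z (k + 1)) (shp m z k)

/-- The letters `1, …, n` can be added one after the other. -/
def IsChain (m : ℤ → Bool) (z : ℕ → ℤ) (n : ℕ) : Prop :=
  ∀ k < n, Addable (shp m z k) (z (k + 1))

noncomputable def carryAt (m : ℤ → Bool) (x : ℤ) (z : ℕ → ℤ) : ℕ → ℤ
  | 0 => x
  | k + 1 => stepCarry (shp m z k) (carryAt m x z k) (z (k + 1))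

/-- The letters after the carry passed. -/
noncomputable def passF (m : ℤ → Bool) (x : ℤ) (z : ℕ → ℤ) : ℕ → ℤ
  | 0 => z 0
  | k + 1 => stepOut (shp m z k) (carryAt m x z k) (z (k + 1))

theorem passF_succ : passF m x z (k + 1) =
    stepOut (shp m z k) (carryAt m x z k) (z (k + 1)) := rfl

def triple (z : ℕ → ℤ) (i : ℕ) : ℤ × ℤ × ℤ := (z (i - 1), z i, z (i + 1))

/-- The elementary dual equivalence on diagonals of letters. -/
def dE (i : ℕ) (z : ℕ → ℤ) : ℕ → ℤ := fun k =>
  if k = i - 1 then (tri (triple z i)).1 else if k = i then (tri (triple z i)).2.1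
  else if k = i + 1 then (tri (triple z i)).2.2 else z k

/-- The elementary queer involution on diagonals of letters. -/
def d0E (z : ℕ → ℤ) : ℕ → ℤ := fun k =>
  if k = 1 then (exch (z 1) (z 2)).1 else if k = 2 then (exch (z 1) (z 2)).2 else z k

theorem IsShape.shp (hm : IsShape m) (z : ℕ → ℤ) (k : ℕ) : IsShape (shp m z k) := by
  induction k with
  | zero => exact hm
  | succ k ih => exact ih.shape_hop _

theorem shp_congr (h : ∀ l, 1 ≤ l → l ≤ k → z l = w l) : shp m z k = shp m w k := by
  induction k with
  | zero => rfl
  | succ k ih =>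
    unfold shp
    rw [h (k + 1) (by omega) le_rfl, ih fun l h1 h2 => h l h1 (by omega)]

theorem shp_congr_of_le (hjk : j ≤ k) (hj : shp m z j = shp m w j)
    (h : ∀ l, j < l → l ≤ k → z l = w l) : shp m z k = shp m w k := by
  induction k, hjk using Nat.le_induction with
  | base => exact hj
  | succ k hk ih =>
    unfold shp
    rw [h (k + 1) (by omega) le_rfl, ih fun l h1 h2 => h l h1 (by omega)]

theorem carryAt_congr (h : ∀ l, 1 ≤ l → l ≤ k → z l = w l) :
    carryAt m x z k = carryAt m x w k := by
  induction k with
  | zero => rfl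
  | succ k ih =>
    unfold carryAt
    rw [h (k + 1) (by omega) le_rfl, ih fun l h1 h2 => h l h1 (by omega),
      shp_congr fun l h1 h2 => h l h1 (by omega)]

theorem carryAt_congr_of_le (hjk : j ≤ k) (hj : shp m z j = shp m w j)
    (hc : carryAt m x z j = carryAt m x w j)
    (h : ∀ l, j < l → l ≤ k → z l = w l) : carryAt m x z k = carryAt m x w k := by
  induction k, hjk using Nat.le_induction with
  | base => exact hc
  | succ k hk ih =>
    unfold carryAt
    rw [h (k + 1) (by omega) le_rfl, ih fun l h1 h2 => h l h1 (by omega),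
      shp_congr_of_le hk hj fun l h1 h2 => h l h1 (by omega)]

theorem IsChain.mono (h : IsChain m z n) (hk : k ≤ n) : IsChain m z k :=
  fun l hl => h l (by omega)

theorem IsChain.congr (h : IsChain m z n) (hzw : ∀ l, 1 ≤ l → l ≤ n → z l = w l) :
    IsChain m w n := by
  intro k hk
  rw [← shp_congr fun l h1 h2 => hzw l h1 (by omega), ← hzw (k + 1) (by omega) (by omega)]
  exact h k hk

theorem carryAt_nonneg (h0 : 0 ≤ x) (k : ℕ) : 0 ≤ carryAt m x z k := by
  induction k with
  | zero => exact h0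
  | succ k ih => exact stepCarry_nonneg ih

theorem IsShape.addable_carryAt (hm : IsShape m) (hx : Addable m x) (h0 : 0 ≤ x)
    (hz : IsChain m z n) (hk : k ≤ n) : Addable (QueerDual.shp m z k) (carryAt m x z k) := by
  induction k with
  | zero => exact hx
  | succ k ih =>
    exact (hm.shp z k).addable_stepCarry (ih (by omega)) (carryAt_nonneg h0 k) (hz k hk)

theorem IsShape.shp_passF (hm : IsShape m) (hx : Addable m x) (h0 : 0 ≤ x)
    (hz : IsChain m z n) (hk : k ≤ n) :
    QueerDual.shp (hop x m) (passF m x z) k = hop (carryAt m x z k) (QueerDual.shp m z k) := by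
  induction k with
  | zero => rfl
  | succ k ih =>
    have := (hm.shp z k).hop_stepOut (hm.addable_carryAt hx h0 hz (by omega : k ≤ n))
      (hz k hk)
    unfold QueerDual.shp
    rw [ih (by omega)]
    exact this

theorem IsShape.isChain_passF (hm : IsShape m) (hx : Addable m x) (h0 : 0 ≤ x)
    (hz : IsChain m z n) : IsChain (hop x m) (passF m x z) n := by
  intro k hk
  rw [hm.shp_passF hx h0 hz hk.le]
  exact (hm.shp z k).addable_stepOut (hm.addable_carryAt hx h0 hz hk.le) (carryAt_nonneg h0 k)
    (hz k hk)

/-- Consecutive letters never share a diagonal, so the preservation of both strict inequalities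
gives an equivalence: descents do not change. -/
theorem IsShape.passF_lt_iff (hm : IsShape m) (hx : Addable m x) (h0 : 0 ≤ x)
    (hz : IsChain m z n) (hi : 1 ≤ i) (hin : i < n) :
    passF m x z i < passF m x z (i + 1) ↔ z i < z (i + 1) := by
  obtain ⟨j, rfl⟩ : ∃ j, i = j + 1 := ⟨i - 1, by omega⟩
  have h1 := hz j (by omega)
  have h2 := hz (j + 1) hin
  have hs := hm.shp z j
  have hc := hm.addable_carryAt hx h0 hz (by omega : j ≤ n)
  have hn := carryAt_nonneg (m := m) (z := z) h0 j
  constructor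
  · intro h
    by_contra hlt
    rcases (not_lt.1 hlt).lt_or_eq with hlt | heq
    · have := hs.step_gt h1 h2 hc hn hlt
      exact lt_asymm this h
    · exact hs.ne_of_chain h1 h2 (by rw [heq])
  · exact fun h => hs.step_lt h1 h2 hc hn h

theorem dE_of_ne (h1 : k ≠ i - 1) (h2 : k ≠ i) (h3 : k ≠ i + 1) : dE i z k = z k := by
  unfold dE; rw [if_neg h1, if_neg h2, if_neg h3]

theorem dE_left : dE i z (i - 1) = (tri (triple z i)).1 := if_pos rfl

theorem dE_mid (hi : 1 < i) : dE i z i = (tri (triple z i)).2.1 := by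
  unfold dE; rw [if_neg (by omega), if_pos rfl]

theorem dE_right (hi : 1 < i) : dE i z (i + 1) = (tri (triple z i)).2.2 := by
  unfold dE; rw [if_neg (by omega), if_neg (by omega), if_pos rfl]

theorem triple_dE (hi : 1 < i) : triple (dE i z) i = tri (triple z i) := by
  unfold triple
  rw [dE_left, dE_mid hi, dE_right hi]
  rfl

theorem IsShape.chain3_tri (hm : IsShape m) {t : ℤ × ℤ × ℤ} (ht : Chain3 m t) :
    Chain3 m (tri t) ∧ end3 m (tri t) = end3 m t := by
  obtain ⟨a, b, c⟩ := t
  obtain ⟨h1, h2, h3⟩ := id ht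
  simp only at h1 h2 h3
  unfold tri
  split_ifs with e1 e2 e3
  · exact ⟨ht, rfl⟩
  · unfold Chain3 end3
    simp only [hop_neg]
    exact ⟨⟨h1, (hm.shape_hop a).addable_neg.2 h2, h3⟩, trivial⟩
  · obtain ⟨k1, k2, k3⟩ := (hm.shape_hop a).chain_exch h2 h3
    exact ⟨⟨h1, k1, k2⟩, k3⟩
  · obtain ⟨k1, k2, k3⟩ := hm.chain_exch h1 h2
    unfold Chain3 end3
    simp only [k3]
    exact ⟨⟨k1, k2, h3⟩, trivial⟩

/-- `exch` is an involution and the median letter keeps its position. The chain condition is needed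
for ties of the outer letters, before or after toggling a pair; they can occur only at `0`. -/
theorem IsShape.tri_tri (hm : IsShape m) {t : ℤ × ℤ × ℤ} (ht : Chain3 m t) : tri (tri t) = t := by
  have hc := (hm.chain3_tri ht).1
  obtain ⟨a, b, c⟩ := t
  obtain ⟨h1, h2, h3⟩ := id ht
  simp only at h1 h2 h3
  by_cases e1 : (a ≤ b ∧ b ≤ c) ∨ (c ≤ b ∧ b ≤ a)
  · rw [tri_eq_self e1, tri_eq_self e1]
  by_cases e2 : a = c
  · subst e2
    obtain rfl := hm.eq_zero_of_chain h1 h2 h3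
    rw [tri_eq, if_neg (by rintro rfl; exact e1 (.inl ⟨le_rfl, le_rfl⟩)), tri_eq, neg_neg,
      if_neg]
    intro h
    exact e1 (by omega)
  have n1 := hm.ne_of_chain h1 h2
  have n2 := (hm.shape_hop a).ne_of_chain h2 h3
  by_cases e3 : (b < a ∧ a < c) ∨ (c < a ∧ a < b)
  · have : tri (a, b, c) = (a, (exch b c).1, (exch b c).2) := by
      unfold tri; simp only; rw [if_neg e1, if_neg e2, if_pos e3]
    rw [this] at hc ⊢
    have hx := exch_exch b c
    by_cases hn : |(|b| - |c|)| = 1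
    · rw [show exch b c = (-b, -c) from if_pos hn] at *
      by_cases hac : a = -c
      · simp only [hac] at hc ⊢
        have := hm.eq_zero_of_chain hc.1 hc.2.1 hc.2.2
        rw [tri_eq, if_neg (by grind)]; grind
      · unfold tri
        simp only at *
        rw [if_neg (by grind), if_neg hac, if_pos (by grind), hx]
    · rw [show exch b c = (c, b) from if_neg hn] at *
      exact tri_exch_left (by omega) (by rwa [abs_sub_comm])
  · have : tri (a, b, c) = ((exch a b).1, (exch a b).2, c) := by
      unfold tri; simp only; rw [if_neg e1, if_neg e2, if_neg e3]
    rw [this] at hc ⊢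
    have hx := exch_exch a b
    by_cases hn : |(|a| - |b|)| = 1
    · rw [show exch a b = (-a, -b) from if_pos hn] at *
      by_cases hac : -a = c
      · simp only [← hac] at hc ⊢
        have := hm.eq_zero_of_chain hc.1 hc.2.1 hc.2.2
        rw [tri_eq, if_neg (by grind)]; grind
      · unfold tri
        simp only at *
        rw [if_neg (by grind), if_neg hac, if_neg (by grind), hx]
    · rw [show exch a b = (b, a) from if_neg hn] at *
      exact tri_exch_right (by omega) (by rwa [abs_sub_comm])

theorem IsChain.chain3 (hz : IsChain m z n) (hi : 1 < i) (hin : i < n) :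
    Chain3 (shp m z (i - 2)) (triple z i) := by
  obtain ⟨j, rfl⟩ : ∃ j, i = j + 2 := ⟨i - 2, by omega⟩
  exact ⟨hz j (by omega), hz (j + 1) (by omega), hz (j + 2) (by omega)⟩

theorem dE_dE (hm : IsShape m) (hz : IsChain m z n) (hi : 1 < i) (hin : i < n) :
    dE i (dE i z) = z := by
  funext k
  have h := (hm.shp z (i - 2)).tri_tri (hz.chain3 hi hin)
  have : tri (triple (dE i z) i) = triple z i := by rw [triple_dE hi, h]
  by_cases e1 : k = i - 1
  · rw [e1, dE_left, this]; rfl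
  by_cases e2 : k = i
  · rw [e2, dE_mid hi, this]; rfl
  by_cases e3 : k = i + 1
  · rw [e3, dE_right hi, this]; rfl
  rw [dE_of_ne e1 e2 e3, dE_of_ne e1 e2 e3]

theorem shp_dE_of_lt (hk : k < i - 1) : shp m (dE i z) k = shp m z k :=
  shp_congr fun l _ _ => dE_of_ne (by omega) (by omega) (by omega)

theorem shp_dE_of_gt (hm : IsShape m) (hz : IsChain m z n) (hi : 1 < i) (hin : i < n)
    (hk : i < k) : shp m (dE i z) k = shp m z k := by
  have h := ((hm.shp z (i - 2)).chain3_tri (hz.chain3 hi hin)).2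
  refine shp_congr_of_le (j := i + 1) hk ?_ fun l _ _ => dE_of_ne (by omega) (by omega) (by omega)
  have ht := triple_dE (z := z) hi
  obtain ⟨j, rfl⟩ : ∃ j, i = j + 2 := ⟨i - 2, by omega⟩
  have h0 : shp m (dE (j + 2) z) j = shp m z j := shp_dE_of_lt (by omega)
  have e1 : shp m (dE (j + 2) z) (j + 2 + 1) = end3 (shp m (dE (j + 2) z) j)
    (triple (dE (j + 2) z) (j + 2)) := rfl
  rw [e1, h0, ht]
  exact h

theorem IsShape.isChain_dE (hm : IsShape m) (hz : IsChain m z n) (hi : 1 < i) (hin : i < n) :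
    IsChain m (dE i z) n := by
  intro k hk
  have h := ((hm.shp z (i - 2)).chain3_tri (hz.chain3 hi hin)).1
  rcases lt_or_ge (k + 1) (i - 1) with h1 | h1
  · rw [shp_dE_of_lt (by omega), dE_of_ne (by omega) (by omega) (by omega)]
    exact hz k hk
  rcases lt_or_ge i k with h2 | h2
  · rw [shp_dE_of_gt hm hz hi hin h2, dE_of_ne (by omega) (by omega) (by omega)]
    exact hz k hk
  rw [← triple_dE hi] at h
  obtain ⟨j, rfl⟩ : ∃ j, i = j + 2 := ⟨i - 2, by omega⟩
  have h0 : QueerDual.shp m (dE (j + 2) z) j = QueerDual.shp m z j := shp_dE_of_lt (by omega)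
  rw [show j + 2 - 2 = j by omega, ← h0] at h
  obtain ⟨c1, c2, c3⟩ := h
  obtain rfl | rfl | rfl : k = j ∨ k = j + 1 ∨ k = j + 2 := by omega
  · exact c1
  · exact c2
  · exact c3

/-- Passing a carry commutes with the elementary dual equivalences. -/
theorem IsShape.passF_dE (hm : IsShape m) (hx : Addable m x) (h0 : 0 ≤ x) (hz : IsChain m z n)
    (hi : 1 < i) (hin : i < n) : passF m x (dE i z) = dE i (passF m x z) := by
  have h := (hm.shp z (i - 2)).pass3_tri (hm.addable_carryAt hx h0 hz (by omega : i - 2 ≤ n))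
    (carryAt_nonneg h0 _) (hz.chain3 hi hin)
  have hgt := fun k => shp_dE_of_gt (k := k) hm hz hi hin
  have ht := triple_dE (z := z) hi
  have ht' := triple_dE (z := passF m x z) hi
  obtain ⟨j, rfl⟩ : ∃ j, i = j + 2 := ⟨i - 2, by omega⟩
  rw [show j + 2 - 2 = j by omega] at h
  have hs0 : QueerDual.shp m (dE (j + 2) z) j = QueerDual.shp m z j := shp_dE_of_lt (by omega)
  have hc0 : carryAt m x (dE (j + 2) z) j = carryAt m x z j :=
    carryAt_congr fun l _ _ => dE_of_ne (by omega) (by omega) (by omega)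
  have hp : ∀ w : ℕ → ℤ, triple (passF m x w) (j + 2) =
      pass3 (QueerDual.shp m w j) (carryAt m x w j) (triple w (j + 2)) := fun w => rfl
  have hc : ∀ w : ℕ → ℤ, carryAt m x w (j + 3) =
      carry3 (QueerDual.shp m w j) (carryAt m x w j) (triple w (j + 2)) := fun w => rfl
  have key : triple (passF m x (dE (j + 2) z)) (j + 2) =
      triple (dE (j + 2) (passF m x z)) (j + 2) := by
    rw [hp, hs0, hc0, ht, h.1, ht', hp]
  have hc3 : carryAt m x (dE (j + 2) z) (j + 3) = carryAt m x z (j + 3) := by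
    rw [hc, hs0, hc0, ht, h.2, hc]
  funext k
  rcases Nat.eq_zero_or_pos k with rfl | hk
  · rw [dE_of_ne (by omega) (by omega) (by omega)]
    show dE (j + 2) z 0 = z 0
    exact dE_of_ne (by omega) (by omega) (by omega)
  obtain ⟨l, rfl⟩ : ∃ l, k = l + 1 := ⟨k - 1, by omega⟩
  rcases lt_or_ge l j with h1 | h1
  · rw [dE_of_ne (by omega) (by omega) (by omega)]
    rw [passF_succ, passF_succ, dE_of_ne (by omega) (by omega) (by omega), shp_dE_of_lt (by omega),
      carryAt_congr fun p _ _ => dE_of_ne (by omega) (by omega) (by omega)]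
  rcases lt_or_ge (j + 2) l with h2 | h2
  · rw [dE_of_ne (by omega) (by omega) (by omega)]
    rw [passF_succ, passF_succ, dE_of_ne (by omega) (by omega) (by omega), hgt l h2,
      carryAt_congr_of_le (j := j + 3) h2 (hgt _ (by omega)) hc3
        fun p _ _ => dE_of_ne (by omega) (by omega) (by omega)]
  unfold triple at key
  rw [Prod.mk.injEq, Prod.mk.injEq] at key
  obtain rfl | rfl | rfl : l = j ∨ l = j + 1 ∨ l = j + 2 := by omega
  · exact key.1
  · exact key.2.1
  · exact key.2.2

/-! ### The queer involution on chains, and undoing a pass -/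

theorem exch_of_pairRel {u v p q : ℤ} (h : PairRel p q u v) : exch p q = (u, v) := by
  unfold exch
  rcases h with ⟨h, rfl, rfl⟩ | ⟨h, rfl, rfl⟩
  · rw [if_neg h]
  · rw [if_pos (by grind)]

theorem d0E_one : d0E z 1 = (exch (z 1) (z 2)).1 := if_pos rfl

theorem d0E_two : d0E z 2 = (exch (z 1) (z 2)).2 := rfl

theorem d0E_of_ne (h1 : k ≠ 1) (h2 : k ≠ 2) : d0E z k = z k := by
  unfold d0E; rw [if_neg h1, if_neg h2]

theorem d0E_d0E : d0E (d0E z) = z := by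
  funext k
  have h : exch (d0E z 1) (d0E z 2) = (z 1, z 2) := by
    rw [d0E_one, d0E_two, exch_exch]
  by_cases h1 : k = 1
  · rw [h1, d0E_one, h]
  by_cases h2 : k = 2
  · rw [h2, d0E_two, h]
  rw [d0E_of_ne h1 h2, d0E_of_ne h1 h2]

theorem shp_d0E (hm : IsShape m) (hz : IsChain m z n) (hn : 2 ≤ n) (hk : 2 ≤ k) :
    shp m (d0E z) k = shp m z k := by
  refine shp_congr_of_le hk ?_ fun l _ _ => d0E_of_ne (by omega) (by omega)
  have h := (hm.chain_exch (hz 0 (by omega)) (hz 1 (by omega))).2.2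
  show hop (d0E z 2) (hop (d0E z 1) m) = hop (z 2) (hop (z 1) m)
  rw [d0E_one, d0E_two]
  exact h

theorem IsShape.isChain_d0E (hm : IsShape m) (hz : IsChain m z n) (hn : 2 ≤ n) :
    IsChain m (d0E z) n := by
  intro k hk
  obtain ⟨h1, h2, -⟩ := hm.chain_exch (hz 0 (by omega)) (hz 1 (by omega))
  rcases lt_or_ge k 2 with h | h
  · obtain rfl | rfl : k = 0 ∨ k = 1 := by omega
    · exact h1
    · exact h2
  · rw [shp_d0E hm hz hn h, d0E_of_ne (by omega) (by omega)]
    exact hz k hk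

/-- There is no third letter to repair the degenerate bump, so the commutation for the first two
letters is assumed here; it holds for words over the empty shape. -/
theorem IsShape.passF_d0E (hm : IsShape m) (hz : IsChain m z n) (hn : 2 ≤ n)
    (hp : PairComm m x (z 1) (z 2) (exch (z 1) (z 2)).1 (exch (z 1) (z 2)).2) :
    passF m x (d0E z) = d0E (passF m x z) := by
  have h := exch_of_pairRel hp.rel
  have h2 : carryAt m x (d0E z) 2 = carryAt m x z 2 := hp.1
  funext k
  obtain _ | _ | _ | k := k
  · rfl
  · rw [d0E_one, show exch (passF m x z (0 + 1)) (passF m x z 2) = _ from h]; rfl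
  · rw [d0E_two, show exch (passF m x z 1) (passF m x z (0 + 1 + 1)) = _ from h]; rfl
  · rw [d0E_of_ne (by omega) (by omega), passF_succ, passF_succ, d0E_of_ne (by omega) (by omega),
      shp_d0E hm hz hn (by omega), carryAt_congr_of_le (j := 2) (by omega) (shp_d0E hm hz hn le_rfl) h2
        fun l _ _ => d0E_of_ne (by omega) (by omega)]

/-- The step of a pass can be undone. -/
theorem IsShape.step_inj {m' : ℤ → Bool} {x' y y' : ℤ} (hm : IsShape m) (hm' : IsShape m')
    (hy : Addable m y) (hy' : Addable m' y') (hh : hop y m = hop y' m')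
    (ho : stepOut m x y = stepOut m' x' y') (hc : stepCarry m x y = stepCarry m' x' y') :
    y = y' ∧ x = x' := by
  have s1 := hm.bmp_spec hy
  have s2 := hm'.bmp_spec hy'
  have f1 : hop y m y = false := by rw [hop_self]; exact hy.2
  have f2 : hop y' m' y' = false := by rw [hop_self]; exact hy'.2
  by_cases h1 : |y| = x <;> by_cases h2 : |y'| = x'
  · rw [stepOut_pos h1, stepOut_pos h2] at ho
    rw [← ho, ← hh] at s2
    rw [← hh] at f2
    have : y = y' := by
      rcases lt_trichotomy y y' with h | h | h
      · rw [s1.2.1 y' h s2.1.le] at f2; cases f2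
      · exact h
      · rw [s2.2.1 y h s1.1.le] at f1; cases f1
    exact ⟨this, by rw [← h1, ← h2, this]⟩
  · rw [stepOut_pos h1, stepOut_neg h2] at ho
    rw [stepCarry_pos h1, stepCarry_neg h2] at hc
    rw [ho] at hc; exact absurd hc h2
  · rw [stepOut_neg h1, stepOut_pos h2] at ho
    rw [stepCarry_neg h1, stepCarry_pos h2] at hc
    rw [← ho] at hc; exact absurd hc.symm h1
  · rw [stepOut_neg h1, stepOut_neg h2] at ho
    rw [stepCarry_neg h1, stepCarry_neg h2] at hc
    exact ⟨ho, hc⟩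

theorem passF_inj_of_carry (hm : IsShape m) {x' : ℤ}
    (hz : IsChain m z n) (hw : IsChain m w n) (hs : shp m z n = shp m w n)
    (hc : carryAt m x z n = carryAt m x' w n)
    (hp : ∀ k, 1 ≤ k → k ≤ n → passF m x z k = passF m x' w k) :
    ∀ k, 1 ≤ k → k ≤ n → z k = w k := by
  induction n with
  | zero => intro k; omega
  | succ n ih =>
    obtain ⟨h1, h2⟩ := (hm.shp z n).step_inj (hm.shp w n) (hz n (by omega)) (hw n (by omega)) hs
      (hp (n + 1) (by omega) le_rfl) hc
    have h3 : shp m z n = shp m w n := by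
      have := congrArg (hop (z (n + 1))) hs
      unfold shp at this
      rwa [← h1, hop_hop, hop_hop] at this
    intro k hk1 hk2
    rcases hk2.lt_or_eq with hk | rfl
    · exact ih (hz.mono (by omega)) (hw.mono (by omega)) h3 h2 (fun l a b => hp l a (by omega)) k hk1
        (by omega)
    · exact h1

theorem eq_of_hop_eq {m : ℤ → Bool} {x y : ℤ} (hx : Addable m x) (hy : Addable m y) (hx0 : 0 ≤ x)
    (hy0 : 0 ≤ y) (h : hop x m = hop y m) : x = y := by
  have h1 := congrFun h (x + 1)
  rw [hop_succ, hx.1] at h1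
  have h2 := hx.2
  by_contra hne
  by_cases e : x + 1 = y
  · rw [e, hop_self, hy.2] at h1; cases h1
  rw [hop_eq, h2] at h1
  · cases h1
  all_goals omega

/-- A pass can be undone when the final shape is known. -/
theorem IsShape.passF_inj (hm : IsShape m) (hx : Addable m x) (h0 : 0 ≤ x)
    (hz : IsChain m z n) (hw : IsChain m w n)
    (hs : QueerDual.shp m z n = QueerDual.shp m w n)
    (hp : ∀ k, 1 ≤ k → k ≤ n → passF m x z k = passF m x w k) :
    ∀ k, 1 ≤ k → k ≤ n → z k = w k := by
  -- The last carry is not given, but it is the cell by which the final shape of the image exceeds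
  -- the common final shape.
  refine passF_inj_of_carry hm hz hw hs ?_ hp
  have h1 := hm.shp_passF hx h0 hz le_rfl
  have h2 := hm.shp_passF hx h0 hw le_rfl
  have a1 := hm.addable_carryAt hx h0 hz le_rfl
  have a2 := hm.addable_carryAt hx h0 hw le_rfl
  rw [shp_congr hp, h2, ← hs] at h1
  rw [← hs] at a2
  exact eq_of_hop_eq a1 a2 (carryAt_nonneg h0 _) (carryAt_nonneg h0 _) h1.symm

end QueerDual

namespace QueerDual
variable {m β : ℤ → Bool} {x y s B Y : ℤ} {z w : ℕ → ℤ} {n i j k : ℕ} {L : List ℤ}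

/-! ### Words as chains over far parts -/

/-- Insert the part `Y` into a shape. -/
def addPart (Y : ℤ) (m : ℤ → Bool) : ℤ → Bool := fun s =>
  if s = Y then true else if s = 1 - Y then false else m s

/-- The shape `β` with the additional parts in `L`. -/
def base (β : ℤ → Bool) (L : List ℤ) : ℤ → Bool := L.foldr addPart β

theorem addPart_of_ne (h1 : s ≠ Y) (h2 : s ≠ 1 - Y) : addPart Y m s = m s := by
  unfold addPart; rw [if_neg h1, if_neg h2]

theorem addPart_self : addPart Y m Y = true := if_pos rfl

theorem IsShape.shape_addPart (hm : IsShape m) (Y : ℤ) : IsShape (addPart Y m) := by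
  refine ⟨fun s => ?_, ?_⟩
  · have := hm.sym s
    unfold addPart
    grind
  · obtain ⟨B, hB⟩ := hm.bdd
    refine ⟨max B (|Y| + 2), fun s hs => ?_⟩
    rw [addPart_of_ne] <;> grind

/-- A far part occupies only the site `Y` and empties only its mirror. Hops that avoid these sites
do not see it, so it can be added to or dropped from a chain. -/
theorem hop_addPart (hY : 0 < Y) (h1 : |x| ≠ Y) (h2 : |x| ≠ Y - 1) :
    hop x (addPart Y m) = addPart Y (hop x m) := by
  have e1 : x ≠ Y := by grind
  have e2 : x ≠ Y - 1 := by grind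
  have e3 : x ≠ -Y := by grind
  have e4 : x ≠ 1 - Y := by grind
  clear h1 h2
  funext s
  unfold hop addPart
  dsimp only
  split_ifs <;> first | rfl | omega

theorem addable_addPart (hY : 0 < Y) (h1 : |x| ≠ Y) (h2 : |x| ≠ Y - 1) :
    Addable (addPart Y m) x ↔ Addable m x := by
  unfold Addable addPart
  grind

theorem hop_addPart_self (hm : IsShape m) (hY : 0 < Y) (h1 : m Y = false) (h2 : m (Y + 1) = false) :
    hop Y (addPart Y m) = addPart (Y + 1) m := by
  funext s
  have s1 := hm.sym Y
  have s2 := hm.sym (Y + 1)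
  unfold hop addPart
  grind

theorem shp_addPart (hY : 0 < Y) (h : ∀ l, 1 ≤ l → l ≤ k → |z l| ≠ Y ∧ |z l| ≠ Y - 1) :
    shp (addPart Y m) z k = addPart Y (shp m z k) := by
  induction k with
  | zero => rfl
  | succ k ih =>
    have := h (k + 1) (by omega) le_rfl
    unfold shp
    rw [ih fun l h1 h2 => h l h1 (by omega), hop_addPart hY this.1 this.2]

theorem isChain_addPart (hY : 0 < Y) (h : ∀ l, 1 ≤ l → l ≤ n → |z l| ≠ Y ∧ |z l| ≠ Y - 1) :
    IsChain (addPart Y m) z n ↔ IsChain m z n := by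
  refine forall₂_congr fun k hk => ?_
  have := h (k + 1) (by omega) hk
  rw [shp_addPart hY fun l h1 h2 => h l h1 (by omega), addable_addPart hY this.1 this.2]

theorem IsShape.shape_base (hm : IsShape β) (L : List ℤ) : IsShape (base β L) := by
  induction L with
  | nil => exact hm
  | cons Y L ih => exact ih.shape_addPart Y

theorem base_cons : base β (Y :: L) = addPart Y (base β L) := rfl

theorem base_of_not_mem (h1 : s ∉ L) (h2 : 1 - s ∉ L) : base β L s = β s := by
  induction L with
  | nil => rfl
  | cons Y L ih =>
    rw [List.mem_cons, not_or] at h1 h2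
    rw [base_cons, addPart_of_ne h1.1 (by omega), ih h1.2 h2.2]

/-- Words whose letters are bounded by `B` or lie on the diagonals `-Y` for the far parts `Y ∈ L`. -/
structure Word (β : ℤ → Bool) (B : ℤ) (L : List ℤ) (n : ℕ) (z : ℕ → ℤ) : Prop where
  shape : IsShape β
  nonneg : 0 ≤ B
  bnd : ∀ s, B < s → β s = false
  far : ∀ Y ∈ L, B + L.length + 1 < Y
  sep : L.Pairwise (· + 2 ≤ ·)
  chain : IsChain (base β L) z n
  letters : ∀ k, 1 ≤ k → k ≤ n → |z k| < B ∨ ∃ Y ∈ L, z k = -Y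

theorem Word.mono (h : Word β B L n z) (hk : k ≤ n) : Word β B L k z :=
  { h with
    chain := h.chain.mono hk
    letters := fun l h1 h2 => h.letters l h1 (by omega) }

theorem Word.congr (h : Word β B L n z) (hzw : ∀ k, 1 ≤ k → k ≤ n → z k = w k) :
    Word β B L n w :=
  { h with
    chain := h.chain.congr hzw
    letters := fun l h1 h2 => by rw [← hzw l h1 h2]; exact h.letters l h1 h2 }

theorem Word.shape_base (h : Word β B L n z) : IsShape (base β L) := h.shape.shape_base L

theorem Word.sep_head (h : Word β B (Y :: L) n z) : ∀ Y' ∈ L, Y + 2 ≤ Y' :=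
  (List.pairwise_cons.1 h.sep).1

theorem Word.lt_head (h : Word β B (Y :: L) n z) : B + L.length + 2 < Y := by
  have := h.far Y (by simp)
  rw [List.length_cons] at this; push_cast at this; omega

theorem Word.addable_head (h : Word β B (Y :: L) n z) : Addable (base β (Y :: L)) Y := by
  have h1 := h.lt_head
  have h2 := h.nonneg
  refine ⟨addPart_self, ?_⟩
  rw [base_of_not_mem, h.bnd _ (by omega)]
  · intro hc
    rcases List.mem_cons.1 hc with hc | hc
    · omega
    · have := h.sep_head _ hc; omega
  · intro hc
    have := h.far _ hc; omega

/-- No letter of a word meets the sites between the bound and the first far part. -/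
theorem Word.gap (h : Word β B L n z) (hk : k ≤ n) (h1 : B < s) (h2 : ∀ Y ∈ L, s < Y) :
    shp (base β L) z k s = false := by
  have h0 := h.nonneg
  induction k with
  | zero =>
    unfold shp
    rw [base_of_not_mem, h.bnd s h1]
    · intro hc
      have := h2 _ hc; omega
    · intro hc
      have := h.far _ hc; omega
  | succ k ih =>
    have hl : |z (k + 1)| < B ∨ s < |z (k + 1)| := by
      rcases h.letters (k + 1) (by omega) hk with hl | ⟨Y', hY', hl⟩
      · exact .inl hl
      · right
        rw [hl, abs_neg]
        exact lt_of_lt_of_le (h2 _ hY') (le_abs_self _)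
    unfold shp
    rw [hop_eq, ih (by omega)] <;> grind

theorem Word.gap_cons (h : Word β B (Y :: L) n z) (hk : k ≤ n) (h1 : B < s) (h2 : s < Y) :
    shp (base β (Y :: L)) z k s = false := by
  refine h.gap hk h1 fun Y' hY' => ?_
  rcases List.mem_cons.1 hY' with rfl | hY'
  · exact h2
  · have := h.sep_head _ hY'; omega

theorem Word.letters_cons (h : Word β B (Y :: L) n z) (hk : 1 ≤ k) (hkn : k ≤ n) :
    |z k| < B ∨ z k = -Y ∨ ∃ Y' ∈ L, z k = -Y' := by
  rcases h.letters k hk hkn with hl | ⟨Y', hY', hl⟩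
  · exact .inl hl
  · rcases List.mem_cons.1 hY' with rfl | hY'
    · exact .inr (.inl hl)
    · exact .inr (.inr ⟨Y', hY', hl⟩)

/-- A bump of the first far letter or of a bounded letter stays within the bound. -/
theorem Word.bmp_le (h : Word β B (Y :: L) n z) (hk : k < n)
    (hz : |z (k + 1)| < B ∨ z (k + 1) = -Y) :
    |bmp (shp (base β (Y :: L)) z k) (z (k + 1))| ≤ B := by
  have hY := h.lt_head
  have h0 := h.nonneg
  have hs := h.shape_base.shp z k
  obtain ⟨q1, q2, q3, q4⟩ := hs.bmp_clean (h.chain k hk)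
  generalize bmp (shp (base β (Y :: L)) z k) (z (k + 1)) = c at *
  have g := fun s => h.gap_cons (k := k) (s := s) hk.le
  rcases hz with hz | hz
  · rw [abs_lt] at hz
    rw [abs_le]
    refine ⟨by omega, ?_⟩
    by_contra hc
    have := q2 (B + 1) (by omega) (by omega)
    rw [g (B + 1) (by omega) (by omega)] at this; cases this
  · rw [hz] at q1 q2 q3 q4
    rw [abs_le]
    refine ⟨?_, by have := q3 (by omega); omega⟩
    by_contra hc
    have e1 := q4 (by omega)
    have e2 := hs.sym (-c)
    rw [g (-c) (by omega) (by omega), sub_neg_eq_add, add_comm, e1] at e2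
    cases e2

/-- The carry remains `Y` until it meets the letter on `-Y`, if there is one. That letter is pulled
into the bounded region, and the site `Y` is free ever after, so no later letter lies on `-Y`. -/
theorem Word.carry_cases (h : Word β B (Y :: L) n z) (hk : k ≤ n) :
    carryAt (base β (Y :: L)) Y z k = Y ∨
      carryAt (base β (Y :: L)) Y z k ≤ B ∧ shp (base β (Y :: L)) z k Y = false := by
  have hY := h.lt_head
  have h0 := h.nonneg
  induction k with
  | zero => exact .inl rfl
  | succ k ih =>
    have hl := h.letters_cons (k := k + 1) (by omega) hk
    have hb := h.bmp_le (k := k) hk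
    have hch := h.chain k hk
    unfold carryAt
    rcases ih (by omega) with ih | ⟨ih, ih'⟩
    · rw [ih]
      by_cases e : |z (k + 1)| = Y
      · right
        rw [stepCarry_pos e]
        have e' : z (k + 1) = -Y := by
          rcases hl with hl | hl | ⟨Y', hY', hl⟩
          · omega
          · exact hl
          · have := h.sep_head _ hY'; rw [hl, abs_neg, abs_of_nonneg (by omega)] at e; omega
        refine ⟨hb (.inr e'), ?_⟩
        have := h.shape_base.shp z k
        have e2 := this.addable_neg.1 (e' ▸ hch)
        unfold shp
        rw [e', hop_neg, hop_self, e2.2]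
      · left; rw [stepCarry_neg e]
    · right
      have e' : z (k + 1) ≠ -Y := by
        intro e'
        have := h.shape_base.shp z k
        have e2 := this.addable_neg.1 (e' ▸ hch)
        rw [e2.1] at ih'; cases ih'
      have hl' : |z (k + 1)| < B ∨ Y + 2 ≤ |z (k + 1)| := by
        rcases hl with hl | hl | ⟨Y', hY', hl⟩
        · exact .inl hl
        · exact absurd hl e'
        · have := h.sep_head _ hY'; rw [hl, abs_neg, abs_of_nonneg (by omega)]; exact .inr this
      refine ⟨?_, ?_⟩
      · by_cases e : |z (k + 1)| = carryAt (base β (Y :: L)) Y z k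
        · rw [stepCarry_pos e]
          exact hb (.inl (by omega))
        · rw [stepCarry_neg e]; exact ih
      · unfold shp
        rw [hop_eq, ih'] <;> grind

theorem Word.passF_cases (h : Word β B (Y :: L) n z) (hk : 1 ≤ k) (hkn : k ≤ n) :
    |passF (base β (Y :: L)) Y z k| ≤ B ∨ ∃ Y' ∈ L, passF (base β (Y :: L)) Y z k = -Y' := by
  obtain ⟨k, rfl⟩ : ∃ l, k = l + 1 := ⟨k - 1, by omega⟩
  have hY := h.lt_head
  have h0 := h.nonneg
  have hl := h.letters_cons (k := k + 1) (by omega) hkn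
  have hb := h.bmp_le (k := k) hkn
  have hch := h.chain k hkn
  have hs := h.shape_base.shp z k
  rw [passF_succ]
  rcases hl with hl | hl | ⟨Y', hY', hl⟩
  · left
    unfold stepOut
    split_ifs with e
    · exact hb (.inl hl)
    · exact hl.le
  · left
    rcases h.carry_cases (k := k) (by omega) with e | ⟨-, e⟩
    · rw [e, stepOut_pos (by rw [hl, abs_neg, abs_of_nonneg (by omega)])]
      exact hb (.inr hl)
    · have e2 := hs.addable_neg.1 (hl ▸ hch)
      rw [e2.1] at e; cases e
  · right
    have := h.sep_head _ hY'
    refine ⟨Y', hY', ?_⟩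
    rw [stepOut_neg, hl]
    rw [hl, abs_neg, abs_of_nonneg (by omega)]
    rcases h.carry_cases (k := k) (by omega) with e | ⟨e, -⟩ <;> omega

/-- Putting the carry in front turns the part `Y` into `Y + 1`, which no letter touches after the
pass. -/
theorem hop_base (hβ : IsShape β) (h0 : 0 ≤ B) (hB : ∀ s, B < s → β s = false) (hY : B < Y)
    (hL : ∀ Y' ∈ L, Y + 2 ≤ Y') : hop Y (base β (Y :: L)) = addPart (Y + 1) (base β L) := by
  refine hop_addPart_self (hβ.shape_base L) (by omega) ?_ ?_
  all_goals
    change base β L _ = false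
    rw [base_of_not_mem, hB _ (by omega)]
    all_goals
      intro hc
      have := hL _ hc
      omega

theorem Word.hop_base (h : Word β B (Y :: L) n z) :
    hop Y (base β (Y :: L)) = addPart (Y + 1) (base β L) := by
  have hY := h.lt_head
  exact QueerDual.hop_base h.shape h.nonneg h.bnd (by omega) h.sep_head

theorem Word.passF_far (h : Word β B (Y :: L) n z) (hk : 1 ≤ k) (hkn : k ≤ n) :
    |passF (base β (Y :: L)) Y z k| ≠ Y + 1 ∧ |passF (base β (Y :: L)) Y z k| ≠ Y + 1 - 1 := by
  have hY := h.lt_head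
  have h0 := h.nonneg
  rcases h.passF_cases hk hkn with e | ⟨Y', hY', e⟩
  · omega
  · have := h.sep_head _ hY'
    rw [e, abs_neg, abs_of_nonneg (by omega)]; omega

/-- One round of insertion: the far part `Y` is used up and dropped, and the bound grows by one.
This growth is why the far parts must exceed `B + L.length + 1`. -/
theorem Word.stage (h : Word β B (Y :: L) n z) :
    Word β (B + 1) L n (passF (base β (Y :: L)) Y z) := by
  have hY := h.lt_head
  have h0 := h.nonneg
  refine ⟨h.shape, by omega, fun s hs => h.bnd s (by omega), fun Y' hY' => ?_,
    (List.pairwise_cons.1 h.sep).2, ?_, fun k h1 h2 => ?_⟩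
  · have := h.sep_head _ hY'; omega
  · have := h.shape_base.isChain_passF h.addable_head (by omega) h.chain
    rwa [h.hop_base, isChain_addPart (by omega) fun l h1 h2 => h.passF_far h1 h2] at this
  · rcases h.passF_cases h1 h2 with e | e
    · left; omega
    · exact .inr e

/-! ### Insertion and recording -/

/-- The chain over `β` obtained from a word by inserting its far letters. -/
noncomputable def rsk (β : ℤ → Bool) : List ℤ → (ℕ → ℤ) → ℕ → ℤ
  | [], z => z
  | Y :: L, z => rsk β L (passF (base β (Y :: L)) Y z)

/-- The successive final shapes of an insertion. -/
noncomputable def recs (β : ℤ → Bool) (n : ℕ) : List ℤ → (ℕ → ℤ) → List (ℤ → Bool)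
  | [], z => [shp β z n]
  | Y :: L, z => shp (base β (Y :: L)) z n :: recs β n L (passF (base β (Y :: L)) Y z)

theorem passF_congr (h : ∀ k, 1 ≤ k → k ≤ n → z k = w k) (h1 : 1 ≤ k) (hk : k ≤ n) :
    passF m x z k = passF m x w k := by
  obtain ⟨k, rfl⟩ : ∃ l, k = l + 1 := ⟨k - 1, by omega⟩
  rw [passF_succ, passF_succ, h _ h1 hk, shp_congr fun l a b => h l a (by omega),
    carryAt_congr fun l a b => h l a (by omega)]

theorem rsk_congr (h : ∀ k, 1 ≤ k → k ≤ n → z k = w k) (h1 : 1 ≤ k) (hk : k ≤ n) :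
    rsk β L z k = rsk β L w k := by
  induction L generalizing z w with
  | nil => exact h k h1 hk
  | cons Y L ih => exact ih fun l a b => passF_congr h a b

theorem recs_congr (h : ∀ k, 1 ≤ k → k ≤ n → z k = w k) :
    recs β n L z = recs β n L w := by
  induction L generalizing z w with
  | nil => unfold recs; rw [shp_congr h]
  | cons Y L ih => unfold recs; rw [shp_congr h, ih fun l a b => passF_congr h a b]

theorem Word.rsk (h : Word β B L n z) : Word β (B + L.length) [] n (rsk β L z) := by
  induction L generalizing z B with
  | nil => simpa [QueerDual.rsk] using h
  | cons Y L ih =>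
    have := ih h.stage
    rwa [show B + 1 + (L.length : ℤ) = B + (Y :: L).length by
      rw [List.length_cons]; push_cast; ring] at this

theorem Word.rsk_lt_iff (h : Word β B L n z) (hi : 1 ≤ i) (hin : i < n) :
    QueerDual.rsk β L z i < QueerDual.rsk β L z (i + 1) ↔ z i < z (i + 1) := by
  induction L generalizing z B with
  | nil => rfl
  | cons Y L ih =>
    have hY := h.lt_head
    have h0 := h.nonneg
    exact (ih h.stage).trans
      (h.shape_base.passF_lt_iff h.addable_head (by omega) h.chain hi hin)

theorem Word.rsk_dE (h : Word β B L n z) (hi : 1 < i) (hin : i < n) :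
    QueerDual.rsk β L (dE i z) = dE i (QueerDual.rsk β L z) ∧
      recs β n L (dE i z) = recs β n L z := by
  induction L generalizing z B with
  | nil =>
    refine ⟨rfl, ?_⟩
    unfold recs
    rw [shp_dE_of_gt h.shape h.chain hi hin hin]
  | cons Y L ih =>
    have hY := h.lt_head
    have h0 := h.nonneg
    unfold recs QueerDual.rsk
    rw [h.shape_base.passF_dE h.addable_head (by omega) h.chain hi hin,
      shp_dE_of_gt h.shape_base h.chain hi hin hin]
    obtain ⟨e1, e2⟩ := ih h.stage
    exact ⟨e1, by rw [e2]⟩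

/-- The passes are undone from the last one backwards; each needs only the final shape recorded for
it. -/
theorem Word.rsk_inj (h : Word β B L n z) (h' : Word β B L n w)
    (hr : recs β n L z = recs β n L w)
    (he : ∀ k, 1 ≤ k → k ≤ n → QueerDual.rsk β L z k = QueerDual.rsk β L w k) :
    ∀ k, 1 ≤ k → k ≤ n → z k = w k := by
  induction L generalizing z w B with
  | nil => exact he
  | cons Y L ih =>
    have hY := h.lt_head
    have h0 := h.nonneg
    unfold recs at hr
    rw [List.cons.injEq] at hr
    exact h.shape_base.passF_inj h.addable_head (by omega) h.chain h'.chain hr.1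
      (ih h.stage h'.stage hr.2 he)

theorem Word.shp_rsk_eq (h : recs β n L z = recs β n L w) :
    shp β (QueerDual.rsk β L z) n = shp β (QueerDual.rsk β L w) n := by
  induction L generalizing z w with
  | nil => unfold recs at h; exact List.cons.inj h |>.1
  | cons Y L ih => unfold recs at h; exact ih (List.cons.inj h).2

end QueerDual

namespace QueerDual
variable {m M β : ℤ → Bool} {x y s B Y : ℤ} {z w : ℕ → ℤ} {n i j k l : ℕ} {L : List ℤ}

/-! ### Words over the empty shape -/

/-- The site function of the empty strict partition. -/
def emp : ℤ → Bool := fun s => decide (s ≤ 0)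

theorem isShape_emp : IsShape emp := by
  refine ⟨fun s => ?_, 1, fun s hs => ?_⟩
  · unfold emp
    by_cases h : s ≤ 0
    · rw [decide_eq_true h, decide_eq_false (by omega)]; rfl
    · rw [decide_eq_false h, decide_eq_true (by omega)]; rfl
  · unfold emp; rw [decide_eq_false (by omega)]

theorem emp_pos (h : 0 < s) : emp s = false := by unfold emp; rw [decide_eq_false (by omega)]

theorem emp_nonpos (h : s ≤ 0) : emp s = true := by unfold emp; rw [decide_eq_true h]

theorem Word.lt_abs_far (h : Word β B L n z) {Y : ℤ} (hY : Y ∈ L) : B + 1 < Y := by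
  have := h.far Y hY; omega

theorem Word.far_eq_or (h : Word β B L n z) {Y Y' : ℤ} (hY : Y ∈ L) (hY' : Y' ∈ L) :
    Y = Y' ∨ Y + 2 ≤ Y' ∨ Y' + 2 ≤ Y := by
  have := h.sep
  clear h
  induction L with
  | nil => cases hY
  | cons X L ih =>
    rw [List.pairwise_cons] at this
    rcases List.mem_cons.1 hY with rfl | h1 <;> rcases List.mem_cons.1 hY' with rfl | h2
    · exact .inl rfl
    · exact .inr (.inl (this.1 _ h2))
    · exact .inr (.inr (this.1 _ h1))
    · exact ih h1 h2 this.2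

/-- In a word over the empty shape, exchanging the first two letters commutes with the insertion. -/
theorem Word.pairComm (h : Word emp B (Y :: L) n z) (hn : 2 ≤ n) :
    PairComm (base emp (Y :: L)) Y (z 1) (z 2) (exch (z 1) (z 2)).1 (exch (z 1) (z 2)).2 := by
  have hY := h.lt_head
  have h0 := h.nonneg
  have hm := h.shape_base
  have h1 : Addable (base emp (Y :: L)) (z 1) := h.chain 0 (by omega)
  have h2 : Addable (hop (z 1) (base emp (Y :: L))) (z 2) := h.chain 1 (by omega)
  have l1 := h.letters 1 (by omega) (by omega)
  have l2 := h.letters 2 (by omega) (by omega)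
  have hb : ∀ s, s < Y → 1 - Y < s → base emp (Y :: L) s = emp s := by
    intro s hs hs'
    apply base_of_not_mem <;>
    · intro hc
      rcases List.mem_cons.1 hc with hc | hc
      · omega
      · have := h.sep_head _ hc; omega
  -- Near the origin the base shape is empty, so a first letter that is not far begins a new part
  -- `1`.
  have hz1 : |z 1| < B → z 1 = 0 := by
    intro hl
    rw [abs_lt] at hl
    have e1 := h1.1
    have e2 := h1.2
    rw [hb _ (by omega) (by omega)] at e1 e2
    unfold emp at e1 e2
    have := of_decide_eq_true e1
    have := of_decide_eq_false e2
    omega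
  by_cases hadj : |(|z 1| - |z 2|)| = 1
  · have hz0 : z 1 = 0 := by
      rcases l1 with l1 | ⟨Y', hY', l1⟩
      · exact hz1 l1
      · exfalso
        have f1 := h.lt_abs_far hY'
        have g1 : |z 1| = Y' := by rw [l1, abs_neg, abs_of_pos (by omega)]
        rw [g1] at hadj
        rcases l2 with l2 | ⟨Y2, hY2, l2⟩
        · grind
        · have := h.far_eq_or hY' hY2
          have := h.lt_abs_far hY2
          have g2 : |z 2| = Y2 := by rw [l2, abs_neg, abs_of_pos (by omega)]
          rw [g2] at hadj
          grind
    have hz2 : |z 2| = 1 := by rw [hz0] at hadj; simpa using hadj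
    have e1 : |z 1| ≠ Y := by rw [hz0, abs_zero]; omega
    have e2 : |z 2| ≠ Y := by omega
    rw [show exch (z 1) (z 2) = (-z 1, -z 2) from if_pos hadj]
    have e1' : |-z 1| ≠ Y := by rwa [abs_neg]
    have e2' : |-z 2| ≠ Y := by rwa [abs_neg]
    unfold PairComm
    simp only [stepCarry_neg e1, stepCarry_neg e2, stepOut_neg e1, stepOut_neg e2,
      stepCarry_neg e1', stepCarry_neg e2', stepOut_neg e1', stepOut_neg e2']
    exact ⟨trivial, .inr ⟨by rw [hz0, zero_add]; exact hz2, trivial, trivial⟩⟩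
  · rw [show exch (z 1) (z 2) = (z 2, z 1) from if_neg hadj]
    obtain ⟨hne, ha⟩ := hm.addable_of_hop h1 h2 hadj
    -- Over the empty shape the letter on `-Y` runs over all nonpositive sites and stops at `0`. The
    -- degenerate bump onto the other letter therefore forces that letter to be on `0`, which is
    -- permitted.
    have key : ∀ k, 1 ≤ k → k ≤ n → Addable (base emp (Y :: L)) (z k) → |z k| = Y →
        bmp (base emp (Y :: L)) (z k) = 0 := by
      intro k hk hkn hak hzk
      have : z k = -Y := by
        rcases h.letters k hk hkn with l1 | ⟨Y', hY', l1⟩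
        · omega
        · have f1 := h.lt_abs_far hY'
          rw [l1, abs_neg, abs_of_pos (by omega)] at hzk
          rw [l1, hzk]
      refine hm.bmp_eq hak ⟨by omega, fun s hs hs' => ?_, by omega, fun _ => ?_⟩
      · rw [hb _ (by omega) (by omega)]; exact emp_nonpos hs'
      · rw [hb _ (by omega) (by omega)]; rfl
    exact hm.pairComm h1 ha hne
      (fun e1 e2 => e2.symm.trans (key 2 (by omega) hn ha e1))
      (fun e1 e2 => e2.symm.trans (key 1 (by omega) (by omega) h1 e1))

theorem Word.rsk_d0E (h : Word emp B L n z) (hn : 2 ≤ n) :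
    QueerDual.rsk emp L (d0E z) = d0E (QueerDual.rsk emp L z) ∧
      recs emp n L (d0E z) = recs emp n L z := by
  induction L generalizing z B with
  | nil =>
    refine ⟨rfl, ?_⟩
    unfold recs
    rw [shp_d0E h.shape h.chain hn hn]
  | cons Y L ih =>
    unfold recs QueerDual.rsk
    rw [h.shape_base.passF_d0E h.chain hn (h.pairComm hn), shp_d0E h.shape_base h.chain hn hn]
    obtain ⟨e1, e2⟩ := ih h.stage
    exact ⟨e1, by rw [e2]⟩

/-! ### Removable cells -/

/-- A cell on the diagonal `x` can be removed. -/
def Rem (M : ℤ → Bool) (x : ℤ) : Prop := M x = false ∧ M (x + 1) = true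

theorem addable_hop_self : Addable (hop x M) x ↔ Rem M x := by
  unfold Addable Rem
  rw [hop_self, hop_succ, and_comm]

theorem Addable.rem_hop (h : Addable M x) : Rem (hop x M) x := by
  rw [← addable_hop_self, hop_hop]; exact h

theorem IsShape.rem_of_abs (hM : IsShape M) (h : |x| = |y|) : Rem M x ↔ Rem M y := by
  rw [← addable_hop_self, ← addable_hop_self, hop_eq_of_abs h,
    (hM.shape_hop y).addable_of_abs h]

theorem IsShape.rem_not_near (hM : IsShape M) (hx : Rem M x) (hy : Rem M y) :
    |(|x| - |y|)| ≠ 1 := by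
  rw [← hM.rem_of_abs (abs_abs _)] at hx hy
  unfold Rem at *
  intro h
  rcases abs_eq (zero_le_one) |>.1 h with h | h
  · rw [show |x| = |y| + 1 by omega, hy.2] at hx; cases hx.1
  · rw [show |y| = |x| + 1 by omega, hx.2] at hy; cases hy.1

theorem IsShape.rem_hop (hM : IsShape M) (hx : Rem M x) (hy : Rem M y) (h : |x| ≠ |y|) :
    Rem (hop y M) x := by
  have := hM.rem_not_near hx hy
  unfold Rem at *
  rw [hop_eq, hop_eq] <;> grind

theorem IsShape.addable_hop_of_rem (hM : IsShape M) (hx : Rem M x) (hy : Rem M y) (h : |x| ≠ |y|) :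
    Addable (hop x (hop y M)) y := by
  rw [hop_comm M (hM.rem_not_near hx hy), addable_hop_self]
  exact hM.rem_hop hy hx h.symm

/-- Below an occupied site there is a removable cell. -/
theorem IsShape.exists_rem (hM : IsShape M) (hs : 0 < s) (h : M s = true) :
    ∃ b, 0 ≤ b ∧ b < s ∧ Rem M b := by
  obtain ⟨t, rfl⟩ : ∃ t : ℕ, s = t + 1 := ⟨(s - 1).toNat, by omega⟩
  induction t with
  | zero =>
    refine ⟨0, le_rfl, by omega, ?_, h⟩
    have := hM.sym 0
    rw [sub_zero, show (1 : ℤ) = ((0 : ℕ) : ℤ) + 1 by norm_num, h] at this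
    simpa using this.symm
  | succ t ih =>
    by_cases ht : M ((t : ℤ) + 1) = true
    · obtain ⟨b, h1, h2, h3⟩ := ih (by omega) ht
      exact ⟨b, h1, by omega, h3⟩
    · exact ⟨(t : ℤ) + 1, by omega, by omega, Bool.eq_false_iff.2 ht, h⟩

/-- Between a free and an occupied site there is a removable cell. -/
theorem exists_rem_between (hxy : x < y) (h1 : M x = false) (h2 : M y = true) :
    ∃ b, x ≤ b ∧ b < y ∧ Rem M b := by
  obtain ⟨t, rfl⟩ : ∃ t : ℕ, y = x + 1 + t := ⟨(y - x - 1).toNat, by omega⟩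
  induction t with
  | zero => exact ⟨x, le_rfl, hxy, h1, by simpa using h2⟩
  | succ t ih =>
    by_cases ht : M (x + 1 + t) = true
    · obtain ⟨b, e1, e2, e3⟩ := ih (by omega) ht
      exact ⟨b, e1, by push_cast at *; omega, e3⟩
    · refine ⟨x + 1 + t, by omega, by push_cast; omega, Bool.eq_false_iff.2 ht, ?_⟩
      rw [← h2]; congr 1; push_cast; ring

/-! ### Undoing an insertion -/

/-- A pass of a carry can be undone, starting from a removable cell of the final shape. -/
theorem IsShape.exists_unpass {N : ℤ → Bool} (hN : IsShape N) (hB : 0 ≤ B) (hBY : B < Y)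
    (hfree : ∀ k ≤ n, QueerDual.shp N w k (-Y) = false)
    (hgap : ∀ k ≤ n, ∀ s, 1 - Y ≤ s → s ≤ -B → QueerDual.shp N w k s = true)
    (hl : ∀ k, 1 ≤ k → k ≤ n → |w k| < B ∨ w k < 0 ∧ |w k| ≠ Y ∧ B ≤ |w k|)
    (hw : IsChain N w n) (hx : Rem (QueerDual.shp N w n) x) (hx0 : 0 ≤ x) (hxB : x = Y ∨ x < B) :
    ∃ (z : ℕ → ℤ) (x₀ : ℤ), Rem N x₀ ∧ 0 ≤ x₀ ∧ (x₀ = Y ∨ x₀ < B) ∧ IsChain (hop x₀ N) z n ∧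
      (∀ k, 1 ≤ k → k ≤ n → passF (hop x₀ N) x₀ z k = w k) ∧ carryAt (hop x₀ N) x₀ z n = x ∧
      ∀ k, 1 ≤ k → k ≤ n → |w k| < B ∧ (|z k| < B ∨ z k = -Y) ∨ z k = w k := by
  induction n generalizing x with
  | zero =>
    exact ⟨fun _ => 0, x, hx, hx0, hxB, fun k hk => by omega, fun k h1 h2 => by omega, rfl,
      fun k h1 h2 => by omega⟩
  | succ n ih =>
    have hP := hN.shp w n
    have hu := hw n (by omega)
    have hlu := hl (n + 1) (by omega) le_rfl
    set u := w (n + 1) with hu'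
    have hPe : QueerDual.shp N w (n + 1) = hop u (QueerDual.shp N w n) := rfl
    set P := QueerDual.shp N w n with hP'
    -- One backward step: from the image `u` of the last letter and the outgoing carry `x`, recover
    -- the letter `v` and the incoming carry `x'`.
    obtain ⟨v, x', hv, hx'0, hx'B, hx', hout, hcar, hlv⟩ : ∃ v x' : ℤ, Addable (hop x' P) v ∧
        0 ≤ x' ∧ (x' = Y ∨ x' < B) ∧ Rem P x' ∧ stepOut (hop x' P) x' v = u ∧
        stepCarry (hop x' P) x' v = x ∧ (|u| < B ∧ (|v| < B ∨ v = -Y) ∨ v = u) := by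
      rw [hPe] at hx
      by_cases e : |u| = x
      · have hlt : |u| < B := by
          rcases hlu with h | h
          · exact h
          · omega
        have hlt' := abs_lt.1 hlt
        -- If `u` lies on the diagonal of the carry it was bumped, and it came from the nearest free
        -- site to its left. The site `-Y` is always free, so the search ends there at the latest.
        obtain ⟨v, hv1, hv2, hv3, hv4⟩ : ∃ v, -Y ≤ v ∧ v < u ∧ P v = false ∧
            ∀ s, v < s → s ≤ u → P s = true := by
          obtain ⟨v, ⟨g1, g2, g3⟩, g4⟩ := Int.exists_greatest_of_bdd
            (P := fun v => -Y ≤ v ∧ v ≤ u ∧ P v = false) ⟨u, fun v h => h.2.1⟩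
            ⟨-Y, le_rfl, by omega, hfree n (by omega)⟩
          refine ⟨v, g1, lt_of_le_of_ne g2 ?_, g3, fun s h1 h2 => ?_⟩
          · rintro rfl; rw [hu.1] at g3; cases g3
          · by_contra hc
            have := g4 s ⟨by omega, h2, Bool.eq_false_iff.2 hc⟩
            omega
        have hvr : Rem P v := ⟨hv3, hv4 _ (by omega) (by omega)⟩
        have hva : Addable (hop v P) v := addable_hop_self.2 hvr
        have hvB : v = -Y ∨ -B < v := by
          by_contra hc
          have := hgap n (by omega) v (by omega) (by omega)
          exact Bool.noConfusion (hv3.symm.trans this)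
        have hb : bmp (hop v P) v = u := by
          obtain ⟨q1, q2, q3⟩ := (hP.shape_hop v).bmp_spec hva
          rw [hop_hop] at q2 q3
          generalize bmp (hop v P) v = c at *
          rcases lt_trichotomy c u with h | h | h
          · rw [hv4 _ (by omega) (by omega)] at q3; cases q3
          · exact h
          · have := q2 (u + 1) (by omega) (by omega)
            rw [hu.2] at this; cases this
        refine ⟨v, |v|, ?_, abs_nonneg v, ?_, (hP.rem_of_abs (abs_abs v)).2 hvr, ?_, ?_, ?_⟩
        · rwa [hop_abs]
        · rcases hvB with rfl | h
          · left; rw [abs_neg, abs_of_nonneg (by omega)]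
          · right; rw [abs_lt]; omega
        · rw [stepOut_pos rfl, hop_abs, hb]
        · rw [stepCarry_pos rfl, hop_abs, hb, e]
        · left
          refine ⟨hlt, ?_⟩
          rcases hvB with h | h
          · exact .inr h
          · left; rw [abs_lt]; omega
      -- Otherwise the letter was not bumped; its cell and the carry are removable independently.
      · have hr := hu.rem_hop
        have hne : |u| ≠ |x| := by rwa [abs_of_nonneg hx0]
        have h1 := (hP.shape_hop u).addable_hop_of_rem hx hr hne.symm
        have h2 := (hP.shape_hop u).rem_hop hx hr hne.symm
        rw [hop_hop] at h1 h2
        exact ⟨u, x, h1, hx0, hxB, h2, stepOut_neg e, stepCarry_neg e, .inr rfl⟩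
    obtain ⟨z, x₀, hr, h0, hB0, hz, hp, hc, hlz⟩ := ih (fun k hk => hfree k (by omega))
      (fun k hk => hgap k (by omega)) (fun k h1 h2 => hl k h1 (by omega)) (hw.mono (by omega)) hx'
      hx'0 hx'B
    have hm := hN.shape_hop x₀
    have ha : Addable (hop x₀ N) x₀ := addable_hop_self.2 hr
    have hsh : QueerDual.shp (hop x₀ N) z n = hop x' P := by
      have := hm.shp_passF ha h0 hz le_rfl
      rw [shp_congr hp, hop_hop, hc, ← hP'] at this
      rw [this, hop_hop]
    let z' : ℕ → ℤ := fun k => if k = n + 1 then v else z k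
    have hz' : ∀ k, 1 ≤ k → k ≤ n → z k = z' k := fun k _ _ => (if_neg (by omega)).symm
    have hv' : z' (n + 1) = v := if_pos rfl
    refine ⟨z', x₀, hr, h0, hB0, fun k hk => ?_, fun k h1 h2 => ?_, ?_, fun k h1 h2 => ?_⟩
    · rcases Nat.lt_succ_iff_lt_or_eq.1 hk with hk | rfl
      · exact hz.congr hz' k hk
      · rw [← shp_congr hz', hv', hsh]; exact hv
    · rcases h2.lt_or_eq with hk | rfl
      · rw [← passF_congr hz' h1 (by omega)]; exact hp k h1 (by omega)
      · rw [passF_succ, ← shp_congr hz', ← carryAt_congr hz', hc, hv', hsh]; exact hout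
    · show stepCarry _ _ _ = _
      rw [← shp_congr hz', ← carryAt_congr hz', hc, hv', hsh]; exact hcar
    · rcases h2.lt_or_eq with hk | rfl
      · rw [← hz' k h1 (by omega)]; exact hlz k h1 (by omega)
      · rw [hv']; exact hlv

end QueerDual

/-! ### Every chain over the empty shape comes from a word -/

namespace QueerDual
variable {m M β : ℤ → Bool} {x y s B Y : ℤ} {z w : ℕ → ℤ} {n i j k l : ℕ} {L : List ℤ}

theorem Word.exists_site (h : Word β B L n z) (hk : ∃ k, 1 ≤ k ∧ k ≤ n ∧ |z k| < B) :
    ∃ s, 0 < s ∧ s ≤ B ∧ shp (base β L) z n s = true := by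
  obtain ⟨k, h1, h2, h3⟩ := hk
  induction n with
  | zero => omega
  | succ n ih =>
    have hch := h.chain n (by omega)
    have hs := h.shape_base.shp z n
    unfold shp
    rcases h.letters (n + 1) (by omega) le_rfl with hl | ⟨Y', hY', hl⟩
    · refine ⟨|z (n + 1)| + 1, by have := abs_nonneg (z (n + 1)); omega, hl, ?_⟩
      rw [← hop_abs, hop_succ]
      exact (hs.addable_abs.2 hch).1
    · have hf := h.lt_abs_far hY'
      have h0 := h.nonneg
      have hkn : k ≤ n := by
        by_contra hc
        obtain rfl : k = n + 1 := by omega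
        rw [hl, abs_neg, abs_of_pos (by omega)] at h3
        omega
      obtain ⟨s, e1, e2, e3⟩ := ih (h.mono (by omega)) hkn
      refine ⟨s, e1, e2, ?_⟩
      rw [hl, hop_neg, hop_eq (by omega) (by omega) (by omega) (by omega), e3]

theorem carryAt_eq_self (h : ∀ k, 1 ≤ k → k ≤ n → |z k| ≠ x) : carryAt m x z n = x := by
  induction n with
  | zero => rfl
  | succ n ih =>
    unfold carryAt
    rw [ih fun k h1 h2 => h k h1 (by omega), stepCarry_neg (h _ (by omega) le_rfl)]

/-- Backward form of `Word.stage`: one removable cell is pulled out of the bounded region and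
returned to the diagonal `-Y`. Counting bounded letters shows progress, since none is created and at
least one disappears. -/
theorem Word.exists_unstage (h : Word emp B L n w) (hY : B + L.length + 2 < Y)
    (hsep : ∀ Y' ∈ L, Y + 2 ≤ Y') (hk : ∃ k, 1 ≤ k ∧ k ≤ n ∧ |w k| < B) :
    ∃ z, Word emp B (Y :: L) n z ∧
      (∀ k, 1 ≤ k → k ≤ n → passF (base emp (Y :: L)) Y z k = w k) ∧
      (∀ k, 1 ≤ k → k ≤ n → |z k| < B → |w k| < B) ∧
      ∃ k, 1 ≤ k ∧ k ≤ n ∧ |w k| < B ∧ ¬ |z k| < B := by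
  have h0 := h.nonneg
  have hB := QueerDual.hop_base isShape_emp h0 h.bnd (by omega : B < Y) hsep
  set N := addPart (Y + 1) (base emp L) with hN
  have hNs : IsShape N := h.shape_base.shape_addPart _
  have hl : ∀ k, 1 ≤ k → k ≤ n → |w k| < B ∨ w k < 0 ∧ Y + 2 ≤ |w k| := by
    intro k h1 h2
    rcases h.letters k h1 h2 with hl | ⟨Y', hY', hl⟩
    · exact .inl hl
    · have := hsep _ hY'
      right
      rw [hl, abs_neg, abs_of_pos (by omega)]; omega
  have hav : ∀ k, 1 ≤ k → k ≤ n → |w k| ≠ Y + 1 ∧ |w k| ≠ Y + 1 - 1 := by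
    intro k h1 h2
    have := hl k h1 h2; omega
  have hsh : ∀ k ≤ n, shp N w k = addPart (Y + 1) (shp (base emp L) w k) := fun k hk =>
    shp_addPart (by omega) fun l h1 h2 => hav l h1 (by omega)
  obtain ⟨s, hs1, hs2, hs3⟩ := h.exists_site hk
  obtain ⟨b, hb1, hb2, hb3⟩ := (h.shape_base.shp w n).exists_rem hs1 hs3
  have hrem : Rem (shp N w n) b := by
    unfold Rem at *
    rw [hsh n le_rfl, addPart_of_ne (by omega) (by omega), addPart_of_ne (by omega) (by omega)]
    exact hb3
  obtain ⟨z, x₀, hr, hx0, hxB, hz, hp, hc, hlz⟩ := hNs.exists_unpass (Y := Y) h0 (by omega)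
    (fun k hk => by
      rw [hsh k hk]; unfold addPart
      rw [if_neg (by omega), if_pos (by omega)])
    (fun k hk s h1 h2 => by
      rw [hsh k hk, addPart_of_ne (by omega) (by omega)]
      have := h.gap (s := 1 - s) hk (by omega) fun Y' hY' => by have := hsep _ hY'; omega
      rw [(h.shape_base.shp w k).sym] at this
      simpa using this)
    (fun k h1 h2 => by have := hl k h1 h2; omega)
    ((isChain_addPart (by omega) hav).2 h.chain) hrem hb1 (.inr (by omega))
  -- Near the origin the starting shape is empty and has no removable cell, so the backward carry
  -- can only end in the part `Y + 1`.
  obtain rfl : x₀ = Y := by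
    rcases hxB with hx | hx
    · exact hx
    · exfalso
      have := hr.2
      rw [hN, addPart_of_ne (by omega) (by omega), base_of_not_mem, emp_pos (by omega)] at this
      · cases this
      all_goals
        intro hc
        have := hsep _ hc
        omega
  rw [← hB, hop_hop] at hz hp hc
  have hlw : ∀ k, 1 ≤ k → k ≤ n → |z k| < B ∨ ∃ Y' ∈ x₀ :: L, z k = -Y' := by
    intro k h1 h2
    rcases hlz k h1 h2 with ⟨-, e | e⟩ | e
    · exact .inl e
    · exact .inr ⟨x₀, by simp, e⟩
    · rw [e]
      rcases h.letters k h1 h2 with e | ⟨Y', hY', e⟩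
      · exact .inl e
      · exact .inr ⟨Y', by simp [hY'], e⟩
  refine ⟨z, ⟨isShape_emp, h0, h.bnd, ?_, List.pairwise_cons.2 ⟨hsep, h.sep⟩, hz, hlw⟩, hp, ?_, ?_⟩
  · intro Y' hY'
    rw [List.length_cons]; push_cast
    rcases List.mem_cons.1 hY' with rfl | hY'
    · omega
    · have := hsep _ hY'; omega
  · intro k h1 h2 h3
    rcases hlz k h1 h2 with ⟨e, -⟩ | e
    · exact e
    · rwa [← e]
  -- If no letter had become far, the carry `Y` would have met nothing and come out as `Y`, but it
  -- comes out as a bounded cell.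
  · by_contra hcon
    have : carryAt (base emp (x₀ :: L)) x₀ z n = x₀ := by
      refine carryAt_eq_self fun k h1 h2 e => hcon ⟨k, h1, h2, ?_⟩
      have e2 := hl k h1 h2
      rcases hlz k h1 h2 with ⟨e', -⟩ | e'
      · exact ⟨e', by omega⟩
      · rw [e'] at e; omega
    omega

/-- Different letters of a word use different far parts. -/
theorem Word.far_inj (h : Word β B L n z) (hY : Y ∈ L) (h1 : 1 ≤ k) (h2 : k < l) (h3 : l ≤ n)
    (hk : z k = -Y) (hl : z l = -Y) : False := by
  have hf := h.lt_abs_far hY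
  have h0 := h.nonneg
  have key : ∀ j, k ≤ j → j < l → shp (base β L) z j Y = false := by
    intro j hj
    induction j, hj using Nat.le_induction with
    | base =>
      intro _
      obtain ⟨k, rfl⟩ : ∃ t, k = t + 1 := ⟨k - 1, by omega⟩
      unfold shp
      have := (h.shape_base.shp z k).addable_neg.1 (hk ▸ h.chain k (by omega))
      rw [hk, hop_neg, hop_self]; exact this.2
    | succ j hj ih =>
      intro hjl
      have e := ih (by omega)
      have hch := h.chain j (by omega)
      unfold shp
      rcases h.letters (j + 1) (by omega) (by omega) with e' | ⟨Y', hY', e'⟩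
      · rw [hop_eq, e] <;> grind
      · have hf' := h.lt_abs_far hY'
        rw [e', hop_neg]
        rcases h.far_eq_or hY hY' with rfl | g
        · have := (h.shape_base.shp z j).addable_neg.1 (e' ▸ hch)
          rw [this.1] at e; cases e
        · rw [hop_eq, e] <;> omega
  obtain ⟨l, rfl⟩ : ∃ t, l = t + 1 := ⟨l - 1, by omega⟩
  have := (h.shape_base.shp z l).addable_neg.1 (hl ▸ h.chain l (by omega))
  have e := key l (by omega) (by omega)
  rw [this.1] at e; cases e

/-- After `k` cells no part exceeds `k`. -/
theorem emp_chain_bound (h : IsChain emp z n) (hk : k ≤ n) (hs : k < s) :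
    shp emp z k s = false := by
  induction k generalizing s with
  | zero => exact emp_pos (by simpa using hs)
  | succ k ih =>
    have hch := (isShape_emp.shp z k).addable_abs.2 (h k (by omega))
    have : |z (k + 1)| ≤ k := by
      by_contra hc
      have e := hch.1
      rw [ih (by omega) (by omega)] at e; cases e
    unfold shp
    push_cast at hs
    rw [hop_eq, ih (by omega) (by omega)] <;> grind

theorem emp_chain_lt (h : IsChain emp z n) (h1 : 1 ≤ k) (hk : k ≤ n) : |z k| < k := by
  obtain ⟨k, rfl⟩ : ∃ t, k = t + 1 := ⟨k - 1, by omega⟩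
  have hch := (isShape_emp.shp z k).addable_abs.2 (h k (by omega))
  by_contra hc
  have e := hch.1
  push_cast at hc
  rw [emp_chain_bound h (by omega) (by omega)] at e; cases e

/-- Every chain over the empty shape is the insertion of a word. -/
theorem exists_rsk_eq (h : IsChain emp w n) (hL : L.length ≤ n)
    (hfar : ∀ Y ∈ L, (n : ℤ) + L.length + 1 < Y) (hsep : L.Pairwise (· + 2 ≤ ·)) :
    ∃ z, Word emp n L n z ∧ (∀ k, 1 ≤ k → k ≤ n → rsk emp L z k = w k) ∧
      ((Finset.Icc 1 n).filter fun k => |z k| < n).card ≤ n - L.length := by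
  induction L with
  | nil =>
    refine ⟨w, ⟨isShape_emp, by omega, fun s hs => emp_pos (by omega), hfar, hsep, h,
      fun k h1 h2 => .inl ?_⟩, fun _ _ _ => rfl, ?_⟩
    · have := emp_chain_lt h h1 h2; omega
    · refine (Finset.card_filter_le _ _).trans ?_
      simp
  | cons Y L ih =>
    rw [List.length_cons] at hL hfar
    push_cast at hfar
    obtain ⟨z, hz, hr, hc⟩ := ih (by omega) (fun Y' hY' => by have := hfar Y' (by simp [hY']); omega)
      (List.pairwise_cons.1 hsep).2
    -- Pigeonhole: there are more letters than far parts in use, and different letters use different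
    -- far parts.
    have hnear : ∃ k, 1 ≤ k ∧ k ≤ n ∧ |z k| < n := by
      by_contra hcon
      have hall : ∀ k ∈ Finset.Icc 1 n, ∃ Y' ∈ L, z k = -Y' := by
        intro k hk
        rw [Finset.mem_Icc] at hk
        rcases hz.letters k hk.1 hk.2 with e | e
        · exact absurd ⟨k, hk.1, hk.2, e⟩ hcon
        · exact e
      have hle := Finset.card_le_card_of_injOn (s := Finset.Icc 1 n) (t := L.toFinset)
        (fun k => -z k) (fun k hk => by
          obtain ⟨Y', hY', e⟩ := hall k hk
          simp [e, hY']) (fun k hk l hl e => by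
          obtain ⟨Y', hY', e'⟩ := hall k hk
          have e2 : z l = -Y' := by simp only at e; omega
          simp only [Finset.coe_Icc, Set.mem_Icc] at hk hl
          rcases lt_trichotomy k l with g | g | g
          · exact (hz.far_inj hY' hk.1 g hl.2 e' e2).elim
          · exact g
          · exact (hz.far_inj hY' hl.1 g hk.2 e2 e').elim)
      have := L.toFinset_card_le
      simp at hle
      omega
    obtain ⟨v, hv, hp, h1, k, h2, h3, h4, h5⟩ := hz.exists_unstage (Y := Y)
      (by have := hfar Y (by simp); omega) (List.pairwise_cons.1 hsep).1 hnear
    refine ⟨v, hv, fun k hk1 hk2 => ?_, ?_⟩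
    · rw [← hr k hk1 hk2]
      exact rsk_congr hp hk1 hk2
    · rw [List.length_cons]
      have : ((Finset.Icc 1 n).filter fun k => |v k| < n) ⊂
          ((Finset.Icc 1 n).filter fun k => |z k| < n) := by
        rw [Finset.ssubset_iff_of_subset]
        · exact ⟨k, by simp [h2, h3, h4], by simp only [Finset.mem_filter]; tauto⟩
        · intro l hl
          simp only [Finset.mem_filter, Finset.mem_Icc] at hl ⊢
          exact ⟨hl.1, h1 l hl.1.1 hl.1.2 hl.2⟩
      have := Finset.card_lt_card this
      omega

theorem base_of_mem (hL : ∀ Y ∈ L, 0 < Y) (hs : s ∈ L) : base β L s = true := by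
  induction L with
  | nil => cases hs
  | cons Y L ih =>
    by_cases h : s = Y
    · rw [h]; exact addPart_self
    · rw [base_cons, addPart_of_ne h]
      · exact ih (fun Y' h => hL Y' (by simp [h])) ((List.mem_cons.1 hs).resolve_left h)
      · have := hL Y (by simp)
        have := hL s hs
        omega

/-- Different far parts in any order form a word. -/
theorem word_of_injOn (hβ : IsShape β) (h0 : 0 ≤ B) (hB : ∀ s, B < s → β s = false)
    (hfar : ∀ Y ∈ L, B + L.length + 1 < Y) (hsep : L.Pairwise (· + 2 ≤ ·))
    (hl : ∀ k, 1 ≤ k → k ≤ n → -z k ∈ L)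
    (hinj : ∀ k l, 1 ≤ k → k < l → l ≤ n → z k ≠ z l) : Word β B L n z := by
  have hw0 : Word β B L 0 z := ⟨hβ, h0, hB, hfar, hsep, fun k hk => by omega, fun k _ _ => by omega⟩
  refine { hw0 with
    chain := fun k hk => ?_
    letters := fun k h1 h2 => .inr ⟨_, hl k h1 h2, by ring⟩ }
  have key : ∀ j ≤ n, ∀ Y ∈ L, (∀ l, 1 ≤ l → l ≤ j → z l ≠ -Y) →
      Addable (shp (base β L) z j) Y := by
    intro j
    induction j with
    | zero =>
      intro _ Y hY _
      have hf := hw0.lt_abs_far hY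
      refine ⟨base_of_mem (fun Y' h => by have := hw0.lt_abs_far h; omega) hY, ?_⟩
      unfold shp
      rw [base_of_not_mem, hB _ (by omega)]
      · intro hc; have := hw0.far_eq_or hY hc; omega
      · intro hc; have := hw0.lt_abs_far hc; omega
    | succ j ih =>
      intro hj Y hY hne
      have e := ih (by omega) Y hY fun l h1 h2 => hne l h1 (by omega)
      have hj' := hl (j + 1) (by omega) hj
      have f1 := hw0.lt_abs_far hY
      have f2 := hw0.lt_abs_far hj'
      have f3 := hw0.far_eq_or hY hj'
      have := hne (j + 1) (by omega) le_rfl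
      change Addable (hop (z (j + 1)) (shp (base β L) z j)) Y
      unfold Addable at *
      rw [hop_eq, hop_eq] <;> first | exact e | omega
  have := (hβ.shape_base L).shp z k
  have e := this.addable_neg.2 (key k hk.le _ (hl (k + 1) (by omega) hk) fun l h1 h2 => by
    rw [neg_neg]; exact hinj l (k + 1) h1 (by omega) hk)
  rwa [neg_neg] at e

end QueerDual

namespace QueerDual
variable {m M β : ℤ → Bool} {x y s a b p q : ℤ} {z w u v : ℕ → ℤ} {n i j k l N c c' : ℕ}
  {A : ℤ → Prop} {Q : Prop}

/-! ### Connectivity of chains -/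

/-- The elementary involutions with indices `0` and `2, 3, …` -/
def opE (j : ℕ) (z : ℕ → ℤ) : ℕ → ℤ := if j = 0 then d0E z else dE j z

def pathE (l : List ℕ) (z : ℕ → ℤ) : ℕ → ℤ := l.foldl (fun z j => opE j z) z

/-- The word `w` arises from `z` by elementary involutions of the first `N` letters, using the last
one at most `c` times. -/
def Reach (Q : Prop) (c N : ℕ) (z w : ℕ → ℤ) : Prop :=
  ∃ l : List ℕ, (∀ j ∈ l, (2 ≤ j ∧ j < N) ∨ (Q ∧ j = 0 ∧ 2 ≤ N)) ∧ l.count (N - 1) ≤ c ∧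
    ∀ k, 1 ≤ k → k ≤ N → pathE l z k = w k

theorem dE_congr (hi : 1 < i) (hin : i < n) (h : ∀ k, 1 ≤ k → k ≤ n → z k = w k) (h1 : 1 ≤ k)
    (hk : k ≤ n) : dE i z k = dE i w k := by
  unfold dE triple
  rw [h (i - 1) (by omega) (by omega), h i (by omega) (by omega), h (i + 1) (by omega) (by omega),
    h k h1 hk]

theorem d0E_congr (hn : 2 ≤ n) (h : ∀ k, 1 ≤ k → k ≤ n → z k = w k) (h1 : 1 ≤ k)
    (hk : k ≤ n) : d0E z k = d0E w k := by
  unfold d0E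
  rw [h 1 (by omega) (by omega), h 2 (by omega) (by omega), h k h1 hk]

theorem opE_congr (hj : (2 ≤ j ∧ j < n) ∨ (j = 0 ∧ 2 ≤ n))
    (h : ∀ k, 1 ≤ k → k ≤ n → z k = w k) (h1 : 1 ≤ k) (hk : k ≤ n) : opE j z k = opE j w k := by
  unfold opE
  rcases hj with hj | hj
  · rw [if_neg (by omega), if_neg (by omega)]
    exact dE_congr hj.1 hj.2 h h1 hk
  · rw [if_pos hj.1, if_pos hj.1]
    exact d0E_congr hj.2 h h1 hk

theorem pathE_congr {l : List ℕ} (hl : ∀ j ∈ l, (2 ≤ j ∧ j < n) ∨ (Q ∧ j = 0 ∧ 2 ≤ n))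
    (h : ∀ k, 1 ≤ k → k ≤ n → z k = w k) (h1 : 1 ≤ k) (hk : k ≤ n) :
    pathE l z k = pathE l w k := by
  induction l generalizing z w with
  | nil => exact h k h1 hk
  | cons j l ih =>
    refine ih (fun i hi => hl i (by simp [hi])) fun k h1 hk => opE_congr ?_ h h1 hk
    rcases hl j (by simp) with h | h
    · exact .inl h
    · exact .inr h.2

theorem opE_of_lt (hj : (2 ≤ j ∧ j < n) ∨ (j = 0 ∧ 2 ≤ n)) (hk : n < k) : opE j z k = z k := by
  unfold opE
  rcases hj with hj | hj
  · rw [if_neg (by omega), dE_of_ne (by omega) (by omega) (by omega)]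
  · rw [if_pos hj.1, d0E_of_ne (by omega) (by omega)]

theorem pathE_of_lt {l : List ℕ} (hl : ∀ j ∈ l, (2 ≤ j ∧ j < n) ∨ (Q ∧ j = 0 ∧ 2 ≤ n))
    (hk : n < k) : pathE l z k = z k := by
  induction l generalizing z with
  | nil => rfl
  | cons j l ih =>
    refine (ih (z := opE j z) fun i hi => hl i (by simp [hi])).trans (opE_of_lt ?_ hk)
    rcases hl j (by simp) with h | h
    · exact .inl h
    · exact .inr h.2

theorem Reach.trans (h1 : Reach Q c N z w) (h2 : Reach Q c' N w v) : Reach Q (c + c') N z v := by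
  obtain ⟨l, a1, a2, a3⟩ := h1
  obtain ⟨l', b1, b2, b3⟩ := h2
  refine ⟨l ++ l', fun j hj => ?_, ?_, fun k hk hkN => ?_⟩
  · rcases List.mem_append.1 hj with h | h
    · exact a1 j h
    · exact b1 j h
  · rw [List.count_append]; omega
  · rw [← b3 k hk hkN, show pathE (l ++ l') z = pathE l' (pathE l z) by
      unfold pathE; rw [List.foldl_append]]
    exact pathE_congr b1 a3 hk hkN

theorem Reach.mono (h : Reach Q c N z w) (hc : c ≤ c') : Reach Q c' N z w := by
  obtain ⟨l, a1, a2, a3⟩ := h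
  exact ⟨l, a1, a2.trans hc, a3⟩

/-- The involution with index `n` moves the letter `n + 1`, so a path on the first `n` letters does
not use it; this makes the count zero. -/
theorem Reach.succ (h : Reach Q c n z w) (he : z (n + 1) = w (n + 1)) :
    Reach Q 0 (n + 1) z w := by
  obtain ⟨l, a1, a2, a3⟩ := h
  refine ⟨l, fun j hj => (a1 j hj).imp (fun h => ⟨h.1, by omega⟩)
    fun h => ⟨h.1, h.2.1, by omega⟩, ?_, fun k hk hkN => ?_⟩
  · rw [Nat.le_zero, List.count_eq_zero]
    intro hmem
    rcases a1 _ hmem with h | h <;> omega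
  · rcases hkN.lt_or_eq with h | rfl
    · exact a3 k hk (by omega)
    · rw [pathE_of_lt a1 (by omega), he]

theorem Reach.dE (hn : 2 ≤ n) : Reach Q 1 (n + 1) z (dE n z) := by
  refine ⟨[n], by simp; omega, by simp, fun k _ _ => ?_⟩
  show opE n z k = _
  unfold opE; rw [if_neg (by omega)]

/-- Append a letter to a chain of length `n`. -/
def ext (z : ℕ → ℤ) (n : ℕ) (v : ℤ) : ℕ → ℤ := fun k => if k = n + 1 then v else z k

theorem ext_last : ext z n a (n + 1) = a := if_pos rfl

theorem ext_of_le (h : k ≤ n) : ext z n a k = z k := if_neg (by omega)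

/-- Chains all of whose letters lie in `A`. -/
def ChainIn (A : ℤ → Prop) (β : ℤ → Bool) (z : ℕ → ℤ) (n : ℕ) : Prop :=
  IsChain β z n ∧ ∀ k, 1 ≤ k → k ≤ n → A (z k)

theorem shp_ext (h : k ≤ n) : shp β (ext z n a) k = shp β z k :=
  shp_congr fun l _ _ => ext_of_le (by omega)

theorem shp_ext_last : shp β (ext z n a) (n + 1) = hop a (shp β z n) := by
  show hop (ext z n a (n + 1)) (shp β (ext z n a) n) = _
  rw [ext_last, shp_ext le_rfl]

theorem ChainIn.ext (h : ChainIn A β z n) (ha : Addable (shp β z n) a) (hA : A a) :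
    ChainIn A β (ext z n a) (n + 1) := by
  refine ⟨fun k hk => ?_, fun k h1 h2 => ?_⟩
  · rw [shp_ext (by omega)]
    rcases Nat.lt_succ_iff_lt_or_eq.1 hk with hk | rfl
    · rw [ext_of_le (by omega)]; exact h.1 k hk
    · rw [ext_last]; exact ha
  · rcases h2.lt_or_eq with h2 | rfl
    · rw [ext_of_le (by omega)]; exact h.2 k h1 (by omega)
    · rw [ext_last]; exact hA

theorem ChainIn.mono (h : ChainIn A β z n) (hk : k ≤ n) : ChainIn A β z k :=
  ⟨h.1.mono hk, fun l h1 h2 => h.2 l h1 (by omega)⟩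

/-- Every removable cell can be the last one of a chain. -/
theorem ChainIn.exists_last (hβ : IsShape β) (hA : ∀ b, A b → ¬ Rem β b) (hz : ChainIn A β z n)
    (hb : Rem (shp β z n) b) (hAb : A b) :
    ∃ w k, n = k + 1 ∧ ChainIn A β w k ∧ hop b (shp β w k) = shp β z n ∧
      Addable (shp β w k) b := by
  induction n generalizing b with
  | zero => exact (hA b hAb hb).elim
  | succ n ih =>
    have hy := hz.1 n (by omega)
    by_cases e : |z (n + 1)| = |b|
    · exact ⟨z, n, rfl, hz.mono (by omega), hop_eq_of_abs e.symm _,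
        ((hβ.shp z n).addable_of_abs e).1 hy⟩
    · have hM := hβ.shp z (n + 1)
      have hyr : Rem (shp β z (n + 1)) (z (n + 1)) := hy.rem_hop
      have hr := hM.rem_hop hb hyr (Ne.symm e)
      rw [show hop (z (n + 1)) (shp β z (n + 1)) = shp β z n from hop_hop _ _] at hr
      obtain ⟨v, p, rfl, hv, hv2, hv3⟩ := ih (hz.mono (by omega)) hr hAb
      have hnear := hM.rem_not_near hb hyr
      rw [← hv2] at hy
      have h1 := (hβ.shp v p).addable_of_hop hv3 hy hnear
      refine ⟨QueerDual.ext v p (z (p + 1 + 1)), p + 1, rfl,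
        hv.ext h1.2 (hz.2 _ (by omega) le_rfl), ?_, ?_⟩
      · rw [shp_ext_last, hop_comm _ hnear, hv2]; rfl
      · rw [shp_ext_last]
        exact (hβ.shp v p).addable_hop h1.2 hv3 h1.1.symm

theorem tri_adj_left (h : (y < b ∧ b < x) ∨ (x < b ∧ b < y)) (hn : |(|y| - |x|)| = 1) :
    tri (b, y, x) = (b, -y, -x) := by
  unfold tri exch; simp only
  rw [if_neg (by omega), if_neg (by omega), if_pos (by omega), if_pos hn]

/-- Three letters at the end of a chain can be prescribed. -/
theorem ChainIn.exists_last_three (hβ : IsShape β) (hA : ∀ b, A b → ¬ Rem β b)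
    (hz : ChainIn A β z n) (hb : Rem (shp β z n) y) (hAy : A y)
    (hq : Rem (hop y (shp β z n)) q) (hAq : A q)
    (hp : Rem (hop q (hop y (shp β z n))) p) (hAp : A p) :
    ∃ w k, n = k + 3 ∧ ChainIn A β w (k + 3) ∧ shp β w (k + 3) = shp β z (k + 3) ∧
      w (k + 1) = p ∧ w (k + 2) = q ∧ w (k + 3) = y := by
  obtain ⟨v1, n1, rfl, c1, e1, a1⟩ := hz.exists_last hβ hA hb hAy
  have f1 : hop y (shp β z (n1 + 1)) = shp β v1 n1 := by rw [← e1, hop_hop]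
  rw [f1] at hq hp
  obtain ⟨v2, n2, rfl, c2, e2, a2⟩ := c1.exists_last hβ hA hq hAq
  have f2 : hop q (shp β v1 (n2 + 1)) = shp β v2 n2 := by rw [← e2, hop_hop]
  rw [f2] at hp
  obtain ⟨v3, n3, rfl, c3, e3, a3⟩ := c2.exists_last hβ hA hp hAp
  have d1 := c3.ext a3 hAp
  have g1 : shp β (QueerDual.ext v3 n3 p) (n3 + 1) = shp β v2 (n3 + 1) := by rw [shp_ext_last, e3]
  have d2 := d1.ext (g1 ▸ a2) hAq
  have g2 : shp β (QueerDual.ext (QueerDual.ext v3 n3 p) (n3 + 1) q) (n3 + 2) =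
      shp β v1 (n3 + 2) := by
    rw [shp_ext_last, g1, e2]
  have d3 := d2.ext (g2 ▸ a1) hAy
  refine ⟨_, n3, rfl, d3, ?_, ?_, ?_, ?_⟩
  · rw [shp_ext_last, g2, e1]
  · rw [ext_of_le (by omega), ext_of_le le_rfl, ext_last]
  · rw [ext_of_le le_rfl, ext_last]
  · exact ext_last

/-- Chains with the same final shape whose last letters lie on different diagonals. -/
theorem ChainIn.reach_of_ne (hβ : IsShape β) (hA : ∀ b, A b → ¬ Rem β b)
    (hconv : ∀ a b c, A a → A c → a < b → b < c → A b)
    (ih : ∀ z w, ChainIn A β z n → ChainIn A β w n → shp β z n = shp β w n → Reach Q 2 n z w)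
    (hz : ChainIn A β z (n + 1)) (hw : ChainIn A β w (n + 1))
    (hs : shp β z (n + 1) = shp β w (n + 1)) (hne : |z (n + 1)| ≠ |w (n + 1)|) :
    Reach Q 1 (n + 1) z w := by
  have hM := hβ.shp z (n + 1)
  have r1 : Rem (shp β z (n + 1)) (z (n + 1)) := (hz.1 n (by omega)).rem_hop
  have r2 : Rem (shp β z (n + 1)) (w (n + 1)) := by rw [hs]; exact (hw.1 n (by omega)).rem_hop
  have A1 := hz.2 (n + 1) (by omega) le_rfl
  have A2 := hw.2 (n + 1) (by omega) le_rfl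
  have hnear := hM.rem_not_near r1 r2
  set y := z (n + 1) with hy
  set y' := w (n + 1) with hy'
  have r3 := hM.rem_hop r2 r1 hne.symm
  have r3' := hM.rem_hop r1 r2 hne
  have a1 := hM.addable_hop_of_rem r1 r2 hne
  have a2 := hM.addable_hop_of_rem r2 r1 hne.symm
  have hcomm := hop_comm (shp β z (n + 1)) hnear
  rw [hcomm] at a1
  -- After both corners are removed, a site freed by one and a site filled by the other bound an
  -- interval that contains a further removable cell. Used as the third last letter it is the
  -- median, so a single application of the last involution swaps the two corners.
  obtain ⟨b, hb, hbr⟩ : ∃ b, ((y < b ∧ b < y') ∨ (y' < b ∧ b < y)) ∧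
      Rem (hop y' (hop y (shp β z (n + 1)))) b := by
    rcases lt_trichotomy y y' with h | h | h
    · obtain ⟨b, h1, h2, h3⟩ := exists_rem_between (x := y + 1) (y := y')
        (M := hop y' (hop y (shp β z (n + 1)))) (by grind) a2.2 a1.1
      exact ⟨b, .inl ⟨by omega, h2⟩, h3⟩
    · rw [h] at hne; exact absurd rfl hne
    · obtain ⟨b, h1, h2, h3⟩ := exists_rem_between (x := y' + 1) (y := y)
        (M := hop y' (hop y (shp β z (n + 1)))) (by grind) a1.2 a2.1
      exact ⟨b, .inr ⟨by omega, h2⟩, h3⟩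
  have hAb : A b := by
    rcases hb with h | h
    · exact hconv _ _ _ A1 A2 h.1 h.2
    · exact hconv _ _ _ A2 A1 h.1 h.2
  obtain ⟨u, p, hp, hu, hus, u1, u2, u3⟩ := hz.exists_last_three hβ hA r1 A1 r3 A2 hbr hAb
  obtain rfl : n = p + 2 := by omega
  have htri : triple u (p + 2) = (b, y', y) := by
    unfold triple; rw [u2, u3, show p + 2 - 1 = p + 1 by omega, u1]
  have hd : tri (b, y', y) = (b, y, y') := tri_exch_left (by omega) (by rwa [abs_sub_comm])
  have hv : ChainIn A β (dE (p + 2) u) (p + 3) := by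
    refine ⟨hβ.isChain_dE hu.1 (by omega) (by omega), fun k h1 h2 => ?_⟩
    unfold dE
    rw [htri, hd]
    split_ifs
    · exact hAb
    · exact A1
    · exact A2
    · exact hu.2 k h1 h2
  have hvs := shp_dE_of_gt hβ hu.1 (i := p + 2) (k := p + 3) (by omega) (by omega) (by omega)
  have hvl : dE (p + 2) u (p + 3) = y' := by
    rw [show p + 3 = p + 2 + 1 by omega, dE_right (by omega), htri, hd]
  have hcut : ∀ {z w : ℕ → ℤ}, ChainIn A β z (p + 3) → ChainIn A β w (p + 3) →
      shp β z (p + 3) = shp β w (p + 3) → z (p + 3) = w (p + 3) → Reach Q 0 (p + 3) z w := by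
    intro z w hz hw hs he
    refine (ih z w (hz.mono (by omega)) (hw.mono (by omega)) ?_).succ he
    have := congrArg (hop (z (p + 3))) hs
    rw [show shp β z (p + 3) = hop (z (p + 3)) (shp β z (p + 2)) from rfl,
      show shp β w (p + 3) = hop (w (p + 3)) (shp β w (p + 2)) from rfl, he, hop_hop, hop_hop] at this
    exact this
  have t1 := hcut hz hu hus.symm u3.symm
  have t2 : Reach Q 1 (p + 3) u (dE (p + 2) u) := Reach.dE (by omega)
  have t3 := hcut hv hw (by rw [hvs, hus, hs]) hvl
  exact (t1.trans t2).trans t3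

/-- Chains over the empty shape with the same final shape whose last letters are opposite, when no
other cell is removable. -/
theorem reach_of_neg (ih : ∀ z w, IsChain emp z n → IsChain emp w n → shp emp z n = shp emp w n →
      Reach True 2 n z w)
    (hz : IsChain emp z (n + 1)) (hw : IsChain emp w (n + 1))
    (hs : shp emp z (n + 1) = shp emp w (n + 1)) (hne : w (n + 1) = -z (n + 1))
    (h0 : z (n + 1) ≠ 0) (hr : ∀ c, Rem (shp emp z (n + 1)) c → |c| = |z (n + 1)|) :
    Reach True 1 (n + 1) z w := by
  have hM := isShape_emp.shp z (n + 1)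
  have r1 : Rem (shp emp z (n + 1)) (z (n + 1)) := (hz n (by omega)).rem_hop
  obtain ⟨x, hx, hxe⟩ : ∃ x, 1 ≤ x ∧ |z (n + 1)| = x := ⟨_, Int.one_le_abs h0, rfl⟩
  have r2 := (hM.rem_of_abs (abs_abs _)).2 r1
  rw [hxe] at r2 hr
  have hemp : ∀ b, True → ¬ Rem emp b := by
    rintro b - ⟨h1, h2⟩
    by_cases h : b ≤ 0
    · rw [emp_nonpos h] at h1; cases h1
    · rw [emp_pos (by omega)] at h2; cases h2
  have hlow : ∀ s, 1 ≤ s → s < x → shp emp z (n + 1) s = false := by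
    intro s h1 h2
    by_contra hc
    obtain ⟨b, b1, b2, b3⟩ := hM.exists_rem (by omega) (Bool.not_eq_false _ ▸ hc)
    have := hr b b3
    rw [abs_of_nonneg b1] at this; omega
  have hPe : hop (z (n + 1)) (shp emp z (n + 1)) = hop x (shp emp z (n + 1)) := by
    rw [← hxe, hop_abs]
  -- The aim is a chain ending in `p, ±q₀, z (n + 1)` with `p` the median and the last two diagonals
  -- adjacent; the last involution then toggles both of them.
  have key : ∀ q₀ p, Rem (hop x (shp emp z (n + 1))) q₀ →
      Rem (hop q₀ (hop x (shp emp z (n + 1)))) p → 0 ≤ p → p < x → p < q₀ →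
      |q₀ - x| = 1 → Reach True 1 (n + 1) z w := by
    intro q₀ p hq hp hp0 hpx hpq hqx
    -- The sign of the second last letter is free, and is chosen opposite to that of the last one.
    obtain ⟨q, hq1, hq2⟩ : ∃ q, |q| = q₀ ∧
        ((q < p ∧ p < z (n + 1)) ∨ (z (n + 1) < p ∧ p < q)) := by
      rcases lt_or_ge 0 (z (n + 1)) with h | h
      · rw [abs_of_pos h] at hxe
        exact ⟨-q₀, by rw [abs_neg, abs_of_pos (by omega)], .inl (by omega)⟩
      · rw [abs_of_nonpos h] at hxe
        exact ⟨q₀, abs_of_pos (by omega), .inr (by omega)⟩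
    have hPs := hM.shape_hop (z (n + 1))
    rw [← hPe] at hq hp
    rw [← hq1] at hq hp
    rw [hPs.rem_of_abs (abs_abs q)] at hq
    rw [hop_abs] at hp
    have hz' : ChainIn (fun _ => True) emp z (n + 1) := ⟨hz, fun _ _ _ => trivial⟩
    obtain ⟨u, k, hk, hu, hus, u1, u2, u3⟩ := hz'.exists_last_three isShape_emp hemp r1 trivial hq
      trivial hp trivial
    obtain rfl : n = k + 2 := by omega
    have htri : triple u (k + 2) = (p, q, z (k + 3)) := by
      unfold triple; rw [u2, u3, show k + 2 - 1 = k + 1 by omega, u1]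
    have hd : tri (p, q, z (k + 3)) = (p, -q, -z (k + 3)) :=
      tri_adj_left hq2 (by rw [hxe, hq1]; exact hqx)
    have hv := isShape_emp.isChain_dE hu.1 (i := k + 2) (by omega) (by omega)
    have hvs := shp_dE_of_gt isShape_emp hu.1 (i := k + 2) (k := k + 3) (by omega) (by omega)
      (by omega)
    have hvl : dE (k + 2) u (k + 3) = -z (k + 3) := by
      rw [show k + 3 = k + 2 + 1 by omega, dE_right (by omega), htri, hd]
    have hcut : ∀ {z w : ℕ → ℤ}, IsChain emp z (k + 3) → IsChain emp w (k + 3) →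
        shp emp z (k + 3) = shp emp w (k + 3) → z (k + 3) = w (k + 3) →
        Reach True 0 (k + 3) z w := by
      intro z w hz hw hs he
      refine (ih z w (hz.mono (by omega)) (hw.mono (by omega)) ?_).succ he
      have := congrArg (hop (z (k + 3))) hs
      rw [show shp emp z (k + 3) = hop (z (k + 3)) (shp emp z (k + 2)) from rfl,
        show shp emp w (k + 3) = hop (w (k + 3)) (shp emp w (k + 2)) from rfl, he, hop_hop,
        hop_hop] at this
      exact this
    have t1 := hcut hz hu.1 hus.symm u3.symm
    have t2 : Reach True 1 (k + 3) u (dE (k + 2) u) := Reach.dE (by omega)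
    have t3 := hcut hv hw (by rw [hvs, hus, hs]) (by rw [hvl, hne])
    exact (t1.trans t2).trans t3
  have hPs := hM.shape_hop x
  have hP1 : hop x (shp emp z (n + 1)) x = true := by rw [hop_self]; exact r2.2
  -- The smallest part is `x + 1`. For `x ≥ 2` three cells are taken from this part. For `x = 1` and
  -- a part `3`, the removed diagonals are `1`, `2`, `0`. Otherwise the shape is the single part
  -- `2`, and the involution with index `0` is needed.
  rcases hx.lt_or_eq with hx2 | rfl
  · have e1 : hop x (shp emp z (n + 1)) (x - 1) = false := by
      rw [hop_eq (by omega) (by omega) (by omega) (by omega)]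
      exact hlow _ (by omega) (by omega)
    have e2 : Rem (hop x (shp emp z (n + 1))) (x - 1) := ⟨e1, by rw [sub_add_cancel]; exact hP1⟩
    refine key (x - 1) (x - 2) e2 ⟨?_, ?_⟩ (by omega) (by omega) (by omega) (by norm_num)
    · rcases (show (2 : ℤ) ≤ x by omega).lt_or_eq with hx3 | rfl
      · rw [hop_eq (by omega) (by omega) (by omega) (by omega),
          hop_eq (by omega) (by omega) (by omega) (by omega)]
        exact hlow _ (by omega) (by omega)
      · have := (hPs.shape_hop 1).sym 1
        have e3 : hop 1 (hop 2 (shp emp z (n + 1))) 1 = true := by rw [hop_self]; exact hP1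
        rw [e3] at this
        exact this
    · rw [show x - 2 + 1 = x - 1 by ring, hop_self, sub_add_cancel]; exact hP1
  · by_cases h3 : shp emp z (n + 1) 3 = true
    · have e2 : Rem (hop 1 (shp emp z (n + 1))) 2 := by
        refine ⟨?_, ?_⟩
        · rw [show (2 : ℤ) = 1 + 1 by norm_num, hop_succ]; exact r2.1
        · rw [hop_eq (by norm_num) (by norm_num) (by norm_num) (by norm_num)]; exact h3
      have e3 : hop 2 (hop 1 (shp emp z (n + 1))) 1 = true := by
        rw [hop_eq (by norm_num) (by norm_num) (by norm_num) (by norm_num)]; exact hP1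
      have := (hPs.shape_hop 2).sym 1
      rw [e3] at this
      exact key 2 0 e2 ⟨this, e3⟩ le_rfl (by norm_num) (by norm_num) (by norm_num)
    · have hM2 : ∀ s, 0 < s → (shp emp z (n + 1) s = true ↔ s = 2) := by
        intro s hs'
        constructor
        · intro hst
          by_contra hs2
          rcases (show 1 ≤ s by omega).lt_or_eq with g | rfl
          · obtain ⟨b, b1, b2, b3⟩ := exists_rem_between (x := 3) (y := s) (by
              rcases (show 3 ≤ s by omega).lt_or_eq with g' | rfl
              · exact g'
              · exact absurd hst h3) (Bool.eq_false_iff.2 h3) hst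
            have := hr b b3
            rw [abs_of_nonneg (by omega)] at this; omega
          · rw [r2.1] at hst; cases hst
        · rintro rfl; exact r2.2
      have hPval : ∀ {v : ℕ → ℤ}, |v (n + 1)| = 1 → shp emp v (n + 1) = shp emp z (n + 1) →
          shp emp v n = hop 0 emp := by
        intro v hv hvs
        have e : shp emp v n = hop 1 (shp emp z (n + 1)) := by
          rw [← hvs, show shp emp v (n + 1) = hop (v (n + 1)) (shp emp v n) from rfl,
            ← hop_abs (v (n + 1)), hv, hop_hop]
        have hpos : ∀ s, 0 < s → shp emp v n s = hop 0 emp s := by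
          intro s hs'
          rw [e]
          by_cases g1 : s = 1
          · rw [g1, hP1]; rfl
          by_cases g2 : s = 2
          · have : hop 1 (shp emp z (n + 1)) 2 = false := by
              rw [show (2 : ℤ) = 1 + 1 by norm_num, hop_succ]; exact r2.1
            rw [g2, this]; rfl
          · rw [hop_eq (by omega) (by omega) (by omega) (by omega),
              hop_eq (by omega) (by omega) (by omega) (by omega), emp_pos hs']
            rw [Bool.eq_false_iff]
            exact fun hc => g2 ((hM2 s hs').1 hc)
        funext s
        by_cases hs' : 0 < s
        · exact hpos s hs'
        · have g1 := (isShape_emp.shp v n).sym (1 - s)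
          have g2 := (isShape_emp.shape_hop 0).sym (1 - s)
          rw [sub_sub_cancel] at g1 g2
          rw [g1, g2, hpos _ (by omega)]
      have hfirst : ∀ {v : ℕ → ℤ}, IsChain emp v (n + 1) → |v (n + 1)| = 1 →
          shp emp v (n + 1) = shp emp z (n + 1) → n = 1 ∧ v 1 = 0 := by
        intro v hv hv1 hvs
        have e := hPval hv1 hvs
        obtain _ | n := n
        · have := congrFun e 1
          change emp 1 = hop 0 emp 1 at this
          exact absurd this (by decide)
        · have r3 : Rem (shp emp v (n + 1)) (v (n + 1)) := (hv n (by omega)).rem_hop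
          have h4 : v (n + 1) = 0 := by
            rw [e] at r3
            have g1 := r3.1
            have g2 := r3.2
            unfold hop emp at g1 g2
            grind
          obtain _ | n := n
          · exact ⟨rfl, h4⟩
          · have e' : shp emp v (n + 1) = emp := by
              have e2 : hop (v (n + 1 + 1)) (shp emp v (n + 1)) = hop 0 emp := e
              have := congrArg (hop 0) e2
              rwa [h4, hop_hop, hop_hop] at this
            have r4 : Rem (shp emp v (n + 1)) (v (n + 1)) := (hv n (by omega)).rem_hop
            rw [e'] at r4
            exact (hemp _ trivial r4).elim
      obtain ⟨hn, hz1⟩ := hfirst hz hxe rfl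
      obtain ⟨-, hw1⟩ := hfirst hw (by rw [hne, abs_neg, hxe]) hs.symm
      subst hn
      refine ⟨[0], by simp, by simp, fun k h1 h2 => ?_⟩
      show d0E z k = w k
      have hex : exch (z 1) (z 2) = (-z 1, -z 2) := by
        unfold exch; rw [if_pos]; rw [hz1, show |z 2| = 1 from hxe]; rfl
      obtain rfl | rfl : k = 1 ∨ k = 2 := by omega
      · rw [d0E_one, hex, hz1, hw1]; rfl
      · rw [d0E_two, hex]; exact hne.symm

/-- Chains with the same final shape are connected. -/
theorem ChainIn.reach (hβ : IsShape β) (hA : ∀ b, A b → ¬ Rem β b)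
    (hconv : ∀ a b c, A a → A c → a < b → b < c → A b)
    (hQ : (Q = True ∧ β = emp ∧ ∀ a, A a) ∨ ∀ a b, A a → A b → |a| = |b| → a = b)
    (hz : ChainIn A β z n) (hw : ChainIn A β w n) (hs : shp β z n = shp β w n) :
    Reach Q 2 n z w := by
  induction n generalizing z w with
  | zero => exact ⟨[], by simp, by simp, fun k h1 h2 => by omega⟩
  | succ n ih =>
    by_cases hne : |z (n + 1)| = |w (n + 1)|
    swap
    · exact (hz.reach_of_ne hβ hA hconv (fun z w h1 h2 h3 => ih h1 h2 h3) hw hs hne).mono (by omega)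
    by_cases he : z (n + 1) = w (n + 1)
    · refine ((ih (hz.mono (by omega)) (hw.mono (by omega)) ?_).succ he).mono (by omega)
      have := congrArg (hop (z (n + 1))) hs
      rw [show shp β z (n + 1) = hop (z (n + 1)) (shp β z n) from rfl,
        show shp β w (n + 1) = hop (w (n + 1)) (shp β w n) from rfl, he, hop_hop, hop_hop] at this
      exact this
    rcases hQ with ⟨rfl, rfl, hall⟩ | hQ
    · have hin : ∀ {v : ℕ → ℤ} {k : ℕ}, IsChain emp v k → ChainIn A emp v k := fun h =>
        ⟨h, fun _ _ _ => hall _⟩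
      have hneg : w (n + 1) = -z (n + 1) := by
        rcases abs_eq_abs.1 hne with h | h
        · exact absurd h he
        · rw [h, neg_neg]
      by_cases hc : ∀ c, Rem (shp emp z (n + 1)) c → |c| = |z (n + 1)|
      · exact (reach_of_neg (fun z w h1 h2 h3 => ih (hin h1) (hin h2) h3) hz.1 hw.1 hs hneg
          (by intro h0; rw [h0, neg_zero] at hneg; exact he (h0.trans hneg.symm)) hc).mono (by omega)
      -- Two chains with opposite last letters are joined through a third one that ends in another
      -- corner; each half uses the last involution once. This is where the bound two comes from.
      · push Not at hc
        obtain ⟨c, hc1, hc2⟩ := hc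
        obtain ⟨v, k, hk, hv, hv2, hv3⟩ := hz.exists_last hβ hA hc1 (hall c)
        obtain rfl : n = k := by omega
        have hv' := hv.ext hv3 (hall c)
        have hs' : shp emp (QueerDual.ext v n c) (n + 1) = shp emp z (n + 1) := by
          rw [shp_ext_last, hv2]
        have ih' := fun z w h1 h2 h3 => ih (z := z) (w := w) h1 h2 h3
        exact (hz.reach_of_ne hβ hA hconv ih' hv' hs'.symm (by rw [ext_last]; exact hc2.symm)).trans
          (hv'.reach_of_ne hβ hA hconv ih' hw (hs'.trans hs)
            (by rw [ext_last, ← hne]; exact hc2))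
    · exact absurd (hQ _ _ (hz.2 _ (by omega) le_rfl) (hw.2 _ (by omega) le_rfl) hne) he

end QueerDual

namespace QueerDual
variable {m M β : ℤ → Bool} {x y s : ℤ} {z w : ℕ → ℤ} {n i j k l d e r : ℕ}

/-! ### Diagonal lengths -/

/-- The number of parts greater than `d`, which is the length of the diagonal `d`. -/
noncomputable def hgt (m : ℤ → Bool) (d : ℕ) : ℕ := {s : ℤ | (d : ℤ) < s ∧ m s = true}.ncard

theorem IsShape.finite_parts (hm : IsShape m) (d : ℤ) : {s : ℤ | d < s ∧ m s = true}.Finite := by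
  obtain ⟨B, hB⟩ := hm.bdd
  refine (Set.finite_Icc d B).subset fun s hs => ⟨hs.1.le, ?_⟩
  by_contra hc
  have := hB s (by omega)
  rw [hs.2] at this; cases this

theorem IsShape.hgt_succ (hm : IsShape m) (d : ℕ) :
    hgt m d = hgt m (d + 1) + if m (d + 1) = true then 1 else 0 := by
  unfold hgt
  split_ifs with h
  · rw [← Set.ncard_insert_of_notMem (a := (d : ℤ) + 1) (by simp) (hm.finite_parts _)]
    congr 1
    ext s
    simp only [Set.mem_ofPred_eq, Set.mem_insert_iff]
    push_cast
    constructor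
    · rintro ⟨h1, h2⟩
      by_cases e : s = d + 1
      · exact .inl e
      · exact .inr ⟨by omega, h2⟩
    · rintro (rfl | ⟨h1, h2⟩)
      · exact ⟨by omega, h⟩
      · exact ⟨by omega, h2⟩
  · rw [add_zero]
    congr 1
    ext s
    simp only [Set.mem_ofPred_eq]
    push_cast
    refine ⟨fun ⟨h1, h2⟩ => ⟨?_, h2⟩, fun ⟨h1, h2⟩ => ⟨by omega, h2⟩⟩
    by_contra hc
    obtain rfl : s = d + 1 := by omega
    exact h h2

theorem IsShape.hgt_le (hm : IsShape m) (d : ℕ) : hgt m (d + 1) ≤ hgt m d := by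
  rw [hm.hgt_succ d]; omega

theorem IsShape.le_hgt (hm : IsShape m) (d : ℕ) : hgt m d ≤ hgt m (d + 1) + 1 := by
  rw [hm.hgt_succ d]; split_ifs <;> omega

theorem IsShape.hgt_anti (hm : IsShape m) (h : d ≤ e) : hgt m e ≤ hgt m d := by
  induction e, h using Nat.le_induction with
  | base => exact le_rfl
  | succ e _ ih => exact (hm.hgt_le e).trans ih

theorem IsShape.hgt_le_add (hm : IsShape m) (h : d ≤ e) : hgt m d + d ≤ hgt m e + e := by
  induction e, h using Nat.le_induction with
  | base => exact le_rfl
  | succ e _ ih => have := hm.le_hgt e; omega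

theorem IsShape.exists_hgt_eq_zero (hm : IsShape m) : ∃ B : ℕ, ∀ d, B ≤ d → hgt m d = 0 := by
  obtain ⟨B, hB⟩ := hm.bdd
  refine ⟨B.toNat, fun d hd => ?_⟩
  unfold hgt
  rw [Set.ncard_eq_zero (hm.finite_parts _)]
  ext s
  simp only [Set.mem_ofPred_eq, Set.mem_empty_iff_false, iff_false]
  rintro ⟨h1, h2⟩
  rw [hB s (by omega)] at h2; cases h2

theorem IsShape.occupied_iff (hm : IsShape m) (d : ℕ) :
    m (d + 1) = true ↔ hgt m d = hgt m (d + 1) + 1 := by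
  rw [hm.hgt_succ d]; split_ifs with h <;> simp [h]

theorem IsShape.ext_of_hgt (hm : IsShape m) (hM : IsShape M) (h : ∀ d, hgt m d = hgt M d) :
    m = M := by
  have key : ∀ s, 0 < s → m s = M s := by
    intro s hs
    obtain ⟨d, rfl⟩ : ∃ d : ℕ, s = d + 1 := ⟨(s - 1).toNat, by omega⟩
    have h1 := hm.occupied_iff d
    have h2 := hM.occupied_iff d
    rw [h, h, ← h2] at h1
    exact Bool.eq_iff_iff.2 h1
  funext s
  by_cases hs : 0 < s
  · exact key s hs
  · have h1 := hm.sym (1 - s)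
    have h2 := hM.sym (1 - s)
    rw [sub_sub_cancel] at h1 h2
    rw [h1, h2, key _ (by omega)]

/-- Adding a cell lengthens its own diagonal by one and no other. The proof descends from large
diagonals, where both lengths vanish. -/
theorem IsShape.hgt_hop (hm : IsShape m) (hx : Addable m x) (d : ℕ) :
    hgt (hop x m) d = hgt m d + if x.natAbs = d then 1 else 0 := by
  have hx' := hm.addable_abs.2 hx
  rw [← hop_abs]
  rw [Int.abs_eq_natAbs] at hx' ⊢
  obtain ⟨a, ha⟩ : ∃ a : ℕ, x.natAbs = a := ⟨_, rfl⟩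
  rw [ha] at hx' ⊢
  have hM := hm.shape_hop a
  obtain ⟨B, hB⟩ := hm.exists_hgt_eq_zero
  obtain ⟨B', hB'⟩ := hM.exists_hgt_eq_zero
  obtain ⟨C, hC⟩ : ∃ C, C = max B (max B' (a + 1)) := ⟨_, rfl⟩
  rcases le_or_gt C d with h | h
  · rw [hB d (by omega), hB' d (by omega), if_neg (by omega)]
  · induction h.le using Nat.decreasingInduction with
    | self => rw [hB C (by omega), hB' C (by omega), if_neg (by omega)]
    | of_succ d hd ih =>
      have ih' : hgt (hop a m) (d + 1) = hgt m (d + 1) + if a = d + 1 then 1 else 0 := by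
        by_cases h' : d + 1 < C
        · exact ih h'
        · rw [hB (d + 1) (by omega), hB' (d + 1) (by omega), if_neg (by omega)]
      rw [hm.hgt_succ d, hM.hgt_succ d, ih']
      by_cases e1 : a = d + 1
      · have g1 : m ((d : ℤ) + 1) = true := by have := hx'.1; rwa [e1] at this
        have g2 : hop (a : ℤ) m ((d : ℤ) + 1) = false := by
          rw [show (d : ℤ) + 1 = a by omega, hop_self]; exact hx'.2
        rw [g1, g2, if_pos e1, if_neg (show ¬ a = d by omega)]; simp
      · by_cases e2 : a = d
        · have g1 : m ((d : ℤ) + 1) = false := by have := hx'.2; rwa [e2] at this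
          have g2 : hop (a : ℤ) m ((d : ℤ) + 1) = true := by
            rw [e2, hop_succ, ← e2]; exact hx'.1
          rw [g1, g2]; simp [e2]
        · rw [hop_eq (by omega) (by omega) (by omega) (by omega), if_neg e1, if_neg e2, add_zero, add_zero]

theorem hgt_emp (d : ℕ) : hgt emp d = 0 := by
  unfold hgt
  rw [Set.ncard_eq_zero (isShape_emp.finite_parts _)]
  ext s
  simp only [Set.mem_ofPred_eq, Set.mem_empty_iff_false, iff_false]
  rintro ⟨h1, h2⟩
  rw [emp_pos (by omega)] at h2; cases h2

theorem IsShape.hgt_shp_succ (hβ : IsShape β) (hz : IsChain β z n) (hk : k < n) (d : ℕ) :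
    hgt (QueerDual.shp β z (k + 1)) d =
      hgt (QueerDual.shp β z k) d + if (z (k + 1)).natAbs = d then 1 else 0 :=
  (hβ.shp z k).hgt_hop (hz k hk) d

theorem IsShape.hgt_shp_mono (hβ : IsShape β) (hz : IsChain β z n) (hkl : k ≤ l) (hl : l ≤ n)
    (d : ℕ) : hgt (QueerDual.shp β z k) d ≤ hgt (QueerDual.shp β z l) d := by
  induction l, hkl using Nat.le_induction with
  | base => exact le_rfl
  | succ l _ ih =>
    rw [hβ.hgt_shp_succ hz (by omega)]
    exact (ih (by omega)).trans (Nat.le_add_right _ _)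

/-! ### Cells of letters -/

/-- The row of the cell of the letter `k` in a chain. -/
noncomputable def rowOf (β : ℤ → Bool) (z : ℕ → ℤ) (k : ℕ) : ℕ :=
  hgt (shp β z (k - 1)) (z k).natAbs

noncomputable def cellOf (β : ℤ → Bool) (z : ℕ → ℤ) (k : ℕ) : ℕ × ℕ :=
  (rowOf β z k, rowOf β z k + (z k).natAbs)

/-- The cells of the shifted diagram of `M` which do not belong to the one of `β`. -/
def InSkew (β M : ℤ → Bool) (p : ℕ × ℕ) : Prop :=
  p.1 ≤ p.2 ∧ hgt β (p.2 - p.1) ≤ p.1 ∧ p.1 < hgt M (p.2 - p.1)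

/-- Cells of a diagonal are filled from the bottom and diagonal lengths never decrease, so the cell
of the letter `k` is present exactly from step `k` on. -/
theorem IsShape.rowOf_lt_iff (hβ : IsShape β) (hz : IsChain β z n) (h1 : 1 ≤ k) (hk : k ≤ n)
    (hl : l ≤ n) : rowOf β z k < hgt (QueerDual.shp β z l) (z k).natAbs ↔ k ≤ l := by
  obtain ⟨k, rfl⟩ : ∃ t, k = t + 1 := ⟨k - 1, by omega⟩
  have h := hβ.hgt_shp_succ hz hk (z (k + 1)).natAbs
  rw [if_pos rfl] at h
  constructor
  · intro h'
    by_contra hc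
    have := hβ.hgt_shp_mono hz (k := l) (l := k) (by omega) (by omega) (z (k + 1)).natAbs
    unfold rowOf at h'
    simp only [Nat.add_sub_cancel] at h'
    omega
  · intro h'
    have := hβ.hgt_shp_mono hz (k := k + 1) (l := l) h' hl (z (k + 1)).natAbs
    unfold rowOf
    simp only [Nat.add_sub_cancel]
    omega

/-- Letters increase to the north-east. -/
theorem IsShape.le_of_cellOf_le (hβ : IsShape β) (hz : IsChain β z n) (h1 : 1 ≤ k) (hk : k ≤ n)
    (h2 : 1 ≤ l) (hl : l ≤ n) (hr : (cellOf β z k).1 ≤ (cellOf β z l).1)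
    (hc : (cellOf β z k).2 ≤ (cellOf β z l).2) : k ≤ l := by
  rw [← hβ.rowOf_lt_iff hz h1 hk hl]
  have h3 := (hβ.rowOf_lt_iff hz h2 hl hl).2 le_rfl
  have hs := hβ.shp z l
  unfold cellOf at hr hc
  simp only at hr hc
  rcases le_total (z k).natAbs (z l).natAbs with h | h
  · have := hs.hgt_anti h; omega
  · have := hs.hgt_le_add h; omega

theorem IsShape.cellOf_inj (hβ : IsShape β) (hz : IsChain β z n) (h1 : 1 ≤ k) (hk : k ≤ n)
    (h2 : 1 ≤ l) (hl : l ≤ n) (h : cellOf β z k = cellOf β z l) : k = l :=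
  le_antisymm (hβ.le_of_cellOf_le hz h1 hk h2 hl (by rw [h]) (by rw [h]))
    (hβ.le_of_cellOf_le hz h2 hl h1 hk (by rw [h]) (by rw [h]))

theorem IsShape.inSkew_cellOf (hβ : IsShape β) (hz : IsChain β z n) (h1 : 1 ≤ k) (hk : k ≤ n) :
    InSkew β (QueerDual.shp β z n) (cellOf β z k) := by
  unfold InSkew cellOf
  simp only [Nat.add_sub_cancel_left]
  refine ⟨by omega, ?_, (hβ.rowOf_lt_iff hz h1 hk le_rfl).2 hk⟩
  exact hβ.hgt_shp_mono hz (k := 0) (l := k - 1) (by omega) (by omega) _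

theorem IsShape.exists_cellOf (hβ : IsShape β) (hz : IsChain β z n) {p : ℕ × ℕ}
    (hp : InSkew β (QueerDual.shp β z n) p) : ∃ k, 1 ≤ k ∧ k ≤ n ∧ cellOf β z k = p := by
  induction n with
  | zero =>
    obtain ⟨-, h1, h2⟩ := hp
    exact absurd h2 (by unfold QueerDual.shp; omega)
  | succ n ih =>
    obtain ⟨h0, h1, h2⟩ := hp
    rw [hβ.hgt_shp_succ hz (by omega)] at h2
    by_cases h : p.1 < hgt (QueerDual.shp β z n) (p.2 - p.1)
    · obtain ⟨k, e1, e2, e3⟩ := ih (hz.mono (by omega)) ⟨h0, h1, h⟩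
      exact ⟨k, e1, by omega, e3⟩
    · split_ifs at h2 with he
      · refine ⟨n + 1, by omega, le_rfl, ?_⟩
        unfold cellOf rowOf
        simp only [Nat.add_sub_cancel, he]
        exact Prod.ext (by simp only; omega) (by simp only; omega)
      · omega

/-- A labelling of cells which increases along the diagonals is the one determined by the chain of
its diagonals. -/
theorem IsShape.cellOf_eq (hβ : IsShape β) {cell : ℕ → ℕ × ℕ}
    (hz : IsChain β z n)
    (hd : ∀ k, 1 ≤ k → k ≤ n → (cell k).1 + (z k).natAbs = (cell k).2)
    (hlow : ∀ k, 1 ≤ k → k ≤ n → hgt β (z k).natAbs ≤ (cell k).1)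
    (hsurj : ∀ k, 1 ≤ k → k ≤ n → ∀ r, hgt β (z k).natAbs ≤ r → r < (cell k).1 →
      ∃ l, 1 ≤ l ∧ l < k ∧ cell l = (r, r + (z k).natAbs))
    (hinj : ∀ k l, 1 ≤ k → k < l → l ≤ n → cell k ≠ cell l) :
    ∀ k, 1 ≤ k → k ≤ n → cell k = cellOf β z k := by
  have key : ∀ k ≤ n, ∀ l, 1 ≤ l → l ≤ n →
      (l ≤ k ↔ (cell l).1 < hgt (QueerDual.shp β z k) (z l).natAbs) ∧
      (l = k → (cell l).1 = hgt (QueerDual.shp β z (k - 1)) (z l).natAbs) := by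
    intro k
    induction k with
    | zero =>
      intro _ l h1 h2
      have := hlow l h1 h2
      refine ⟨⟨fun h => by omega, fun h => ?_⟩, fun h => by omega⟩
      change (cell l).1 < hgt β _ at h
      omega
    | succ k ih =>
      intro hk
      have ih := ih (by omega)
      have hrow : (cell (k + 1)).1 = hgt (QueerDual.shp β z k) (z (k + 1)).natAbs := by
        have h1 := (ih (k + 1) (by omega) hk).1
        by_contra hne
        have h2 : hgt (QueerDual.shp β z k) (z (k + 1)).natAbs < (cell (k + 1)).1 := by
          have : ¬ k + 1 ≤ k := by omega
          rw [h1] at this; omega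
        have h3 : hgt β (z (k + 1)).natAbs ≤ hgt (QueerDual.shp β z k) (z (k + 1)).natAbs :=
          hβ.hgt_shp_mono hz (k := 0) (l := k) (by omega) (by omega) _
        obtain ⟨l, l1, l2, l3⟩ := hsurj (k + 1) (by omega) hk _ h3 h2
        have h4 := (ih l l1 (by omega)).1.1 (by omega)
        have h5 := hd l l1 (by omega)
        rw [l3] at h4 h5
        simp only at h4 h5
        rw [show (z l).natAbs = (z (k + 1)).natAbs by omega] at h4
        omega
      intro l h1 h2
      refine ⟨?_, fun h => by subst h; exact hrow⟩
      rw [hβ.hgt_shp_succ hz (by omega)]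
      by_cases hlk : l = k + 1
      · subst hlk
        rw [if_pos rfl]; omega
      · have h3 := (ih l h1 h2).1
        by_cases he : (z (k + 1)).natAbs = (z l).natAbs
        · rw [if_pos he]
          have h4 : (cell l).1 ≠ (cell (k + 1)).1 := by
            intro h4
            have e1 := hd l h1 h2
            have e2 := hd (k + 1) (by omega) hk
            have : cell l = cell (k + 1) := Prod.ext h4 (by omega)
            rcases Nat.lt_or_gt_of_ne hlk with g | g
            · exact hinj _ _ h1 g hk this
            · exact hinj _ _ (by omega) g h2 this.symm
          rw [hrow, he] at h4
          omega
        · rw [if_neg he]; omega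
  intro k h1 hk
  have h := (key k hk k h1 hk).2 rfl
  unfold cellOf rowOf
  exact Prod.ext h (by rw [← hd k h1 hk, h])

theorem InSkew.corner (hβ : IsShape β) (hM : IsShape M) {p q : ℕ × ℕ} (hp : InSkew β M p)
    (hq : InSkew β M q) (h1 : p.1 ≤ q.1) (h2 : p.2 ≤ q.2) : InSkew β M (p.1, q.2) := by
  obtain ⟨a1, a2, a3⟩ := hp
  obtain ⟨b1, b2, b3⟩ := hq
  unfold InSkew
  simp only
  have e1 := hβ.hgt_anti (d := p.2 - p.1) (e := q.2 - p.1) (by omega)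
  have e2 := hM.hgt_le_add (d := q.2 - q.1) (e := q.2 - p.1) (by omega)
  omega

/-- A labelling of the cells of a skew shape which increases along rows and columns gives a
chain. -/
theorem IsShape.isChain_of_cells (hβ : IsShape β) (hM : IsShape M) {cell : ℕ → ℕ × ℕ}
    (hd : ∀ k, 1 ≤ k → k ≤ n → (cell k).1 + (z k).natAbs = (cell k).2)
    (hin : ∀ k, 1 ≤ k → k ≤ n → InSkew β M (cell k))
    (hsurj : ∀ p, InSkew β M p → ∃ k, 1 ≤ k ∧ k ≤ n ∧ cell k = p)
    (hinj : ∀ k l, 1 ≤ k → k < l → l ≤ n → cell k ≠ cell l)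
    (hrow : ∀ k l, 1 ≤ k → k ≤ n → 1 ≤ l → l ≤ n → (cell k).1 = (cell l).1 →
      (cell k).2 ≤ (cell l).2 → k ≤ l)
    (hcol : ∀ k l, 1 ≤ k → k ≤ n → 1 ≤ l → l ≤ n → (cell k).2 = (cell l).2 →
      (cell k).1 ≤ (cell l).1 → k ≤ l)
    (hle : ∀ d, hgt β d ≤ hgt M d) :
    IsChain β z n ∧ QueerDual.shp β z n = M := by
  -- Rows and columns suffice because the south-east corner of two comparable cells again belongs to
  -- the skew shape.
  have hmono : ∀ k l, 1 ≤ k → k ≤ n → 1 ≤ l → l ≤ n → (cell k).1 ≤ (cell l).1 →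
      (cell k).2 ≤ (cell l).2 → k ≤ l := by
    intro k l h1 h2 h3 h4 h5 h6
    obtain ⟨j, j1, j2, j3⟩ := hsurj _ ((hin k h1 h2).corner hβ hM (hin l h3 h4) h5 h6)
    exact (hrow k j h1 h2 j1 j2 (by rw [j3]) (by rw [j3]; exact h6)).trans
      (hcol j l j1 j2 h3 h4 (by rw [j3]) (by rw [j3]; exact h5))
  have key : ∀ k ≤ n, IsChain β z k ∧ (∀ d, hgt (QueerDual.shp β z k) d ≤ hgt M d) ∧
      ∀ l, 1 ≤ l → l ≤ n → (l ≤ k ↔ (cell l).1 < hgt (QueerDual.shp β z k) (z l).natAbs) := by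
    intro k
    induction k with
    | zero =>
      refine fun _ => ⟨fun k hk => by omega, hle, fun l h1 h2 => ⟨fun h => by omega, fun h => ?_⟩⟩
      have h3 := (hin l h1 h2).2.1
      have h4 := hd l h1 h2
      rw [show (cell l).2 - (cell l).1 = (z l).natAbs by omega] at h3
      change (cell l).1 < hgt β _ at h
      omega
    | succ k ih =>
      intro hk
      obtain ⟨hch, hub, hlab⟩ := ih (by omega)
      have hs := hβ.shp z k
      have hlb : ∀ d, hgt β d ≤ hgt (QueerDual.shp β z k) d := fun d =>
        hβ.hgt_shp_mono hch (k := 0) (l := k) (by omega) le_rfl d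
      obtain ⟨e, he⟩ : ∃ e, (z (k + 1)).natAbs = e := ⟨_, rfl⟩
      obtain ⟨r, hr⟩ : ∃ r, (cell (k + 1)).1 = r := ⟨_, rfl⟩
      have hc2 : (cell (k + 1)).2 = r + e := by rw [← hd (k + 1) (by omega) hk, hr, he]
      have hcin := hin (k + 1) (by omega) hk
      have hrM : r < hgt M e := by
        have := hcin.2.2
        rwa [hc2, hr, Nat.add_sub_cancel_left] at this
      -- All cells south-west of the new cell carry smaller letters, so they are already present.
      -- Applied to the cell before it on the diagonal, the one below it and the one to its left,
      -- this gives the right row and the two sites required for addability.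
      have hpred : ∀ p, InSkew β M p → p.1 ≤ r → p.2 ≤ r + e → p ≠ (r, r + e) →
          p.1 < hgt (QueerDual.shp β z k) (p.2 - p.1) := by
        intro p hp h1 h2 h3
        obtain ⟨l, l1, l2, rfl⟩ := hsurj p hp
        have h4 := hmono l (k + 1) l1 l2 (by omega) hk (by omega) (by omega)
        have h5 : l ≠ k + 1 := by
          rintro rfl
          exact h3 (Prod.ext hr hc2)
        have h6 := (hlab l l1 l2).1 (by omega)
        have h7 := hd l l1 l2
        rwa [show (cell l).2 - (cell l).1 = (z l).natAbs by omega]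
      have hrk : hgt (QueerDual.shp β z k) e = r := by
        have h1 : hgt (QueerDual.shp β z k) e ≤ r := by
          have h2 := hlab (k + 1) (by omega) hk
          rw [hr, he] at h2
          omega
        rcases h1.lt_or_eq with h | h
        · have := hpred (hgt (QueerDual.shp β z k) e, hgt (QueerDual.shp β z k) e + e)
            ⟨by simp, by simpa using hlb e, by simp; omega⟩ h.le (by simp; omega)
            (fun h' => by rw [Prod.mk.injEq] at h'; omega)
          simp at this
        · exact h
      have h1 : QueerDual.shp β z k ((e : ℤ) + 1) = false := by
        by_contra hc
        have h2 := (hs.occupied_iff e).1 (by simpa using hc)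
        have h3 := hM.le_hgt e
        have h4 := hlb (e + 1)
        have := hpred (r - 1, r + e) ⟨by simp only; omega, ?_, ?_⟩ (by simp) le_rfl
          (fun h' => by rw [Prod.mk.injEq] at h'; omega)
        · simp only at this
          rw [show r + e - (r - 1) = e + 1 by omega] at this
          omega
        · simp only
          rw [show r + e - (r - 1) = e + 1 by omega]; omega
        · simp only
          rw [show r + e - (r - 1) = e + 1 by omega]; omega
      have h2 : QueerDual.shp β z k e = true := by
        obtain _ | e := e
        · have := hs.sym 1
          rw [show QueerDual.shp β z k 1 = false from h1] at this
          exact this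
        · by_contra hc
          have h2 : hgt (QueerDual.shp β z k) e = hgt (QueerDual.shp β z k) (e + 1) := by
            rw [hs.hgt_succ e, if_neg (by push_cast at hc; exact hc), add_zero]
          have h3 := hM.hgt_le e
          have h4 := hlb e
          have := hpred (r, r + e) ⟨by simp, by simp; omega, by simp; omega⟩ le_rfl (by simp only; omega)
            (fun h' => by rw [Prod.mk.injEq] at h'; omega)
          simp at this
          omega
      have hadd : Addable (QueerDual.shp β z k) (z (k + 1)) := by
        rw [← hs.addable_abs, Int.abs_eq_natAbs, he]
        exact ⟨h2, h1⟩
      have hch' : IsChain β z (k + 1) := by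
        intro l hl
        rcases Nat.lt_succ_iff_lt_or_eq.1 hl with hl | rfl
        · exact hch l hl
        · exact hadd
      refine ⟨hch', fun d => ?_, fun l l1 l2 => ?_⟩
      · rw [hβ.hgt_shp_succ hch' (by omega)]
        split_ifs with h
        · rw [← h, he, hrk]; exact hrM
        · exact hub d
      · rw [hβ.hgt_shp_succ hch' (by omega)]
        have h3 := hlab l l1 l2
        by_cases hlk : l = k + 1
        · subst hlk
          rw [if_pos rfl, he, hr, hrk]; omega
        · split_ifs with h
          · have h4 : (cell l).1 ≠ r := by
              intro h4
              have : cell l = cell (k + 1) :=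
                Prod.ext (h4.trans hr.symm) (by rw [hc2, ← hd l l1 l2, ← h, he, h4])
              rcases Nat.lt_or_gt_of_ne hlk with g | g
              · exact hinj _ _ l1 g hk this
              · exact hinj _ _ (by omega) g l2 this.symm
            rw [← h, he, hrk] at h3 ⊢
            omega
          · omega
  obtain ⟨h1, h2, h3⟩ := key n le_rfl
  refine ⟨h1, (hβ.shp z n).ext_of_hgt hM fun d => le_antisymm (h2 d) ?_⟩
  by_contra hc
  push Not at hc
  have h4 : hgt β d ≤ hgt (QueerDual.shp β z n) d :=
    hβ.hgt_shp_mono h1 (k := 0) (l := n) (by omega) le_rfl d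
  obtain ⟨k, k1, k2, k3⟩ := hsurj (hgt (QueerDual.shp β z n) d, hgt (QueerDual.shp β z n) d + d)
    ⟨by simp, by simpa using h4, by simpa using hc⟩
  have h5 := (h3 k k1 k2).1 k2
  have h6 := hd k k1 k2
  rw [k3] at h5 h6
  simp only at h5 h6
  rw [show (z k).natAbs = d by omega] at h5
  omega

end QueerDual

namespace QueerDual
variable {γ : StrictPartition} {S S' : SignedFilling γ} {e : ℕ → ℕ} {z : ℕ → ℤ} {n k l d r : ℕ}

/-! ### Shifted diagrams -/

theorem sum_range_getD (l : List ℕ) : ∑ i ∈ Finset.range l.length, l.getD i 0 = l.sum := by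
  induction l with
  | nil => rfl
  | cons a l ih =>
    rw [List.length_cons, Finset.sum_range_succ', List.sum_cons, ← ih, add_comm]
    rfl

theorem lt_countP_iff {l : List ℕ} (hl : l.Pairwise (· > ·)) :
    r < l.countP (fun p => decide (d < p)) ↔ d < l.getD r 0 := by
  induction l generalizing r with
  | nil => simp
  | cons a l ih =>
    rw [List.pairwise_cons] at hl
    have ih' := fun r => ih (r := r) hl.2
    rw [List.countP_cons]
    by_cases h : d < a
    · rw [if_pos (by simpa using h)]
      obtain _ | r := r
      · simpa using h
      · rw [Nat.add_lt_add_iff_right, ih']; rfl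
    · rw [if_neg (by simpa using h), add_zero]
      have h0 : ∀ r, ¬ r < l.countP (fun p => decide (d < p)) := by
        intro r
        rw [List.countP_eq_zero.2]
        · omega
        · intro p hp
          have := hl.1 p hp
          simp; omega
      obtain _ | r := r
      · simpa [h] using h0 0
      · have h1 := h0 r
        rw [ih'] at h1
        exact ⟨fun h2 => absurd h2 (h0 _), fun h2 => absurd h2 h1⟩

/-- The site function of a strict partition. -/
def maya (γ : StrictPartition) : ℤ → Bool := fun s =>
  if 0 < s then decide (s.toNat ∈ γ.parts) else !decide ((1 - s).toNat ∈ γ.parts)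

theorem isShape_maya (γ : StrictPartition) : IsShape (maya γ) := by
  refine ⟨fun s => ?_, γ.parts.sum + 1, fun s hs => ?_⟩
  · unfold maya
    by_cases h : 0 < s
    · rw [if_pos h, if_neg (by omega), sub_sub_cancel]
    · rw [if_neg h, if_pos (by omega), Bool.not_not]
  · unfold maya
    rw [if_pos (by omega), decide_eq_false]
    intro h
    have := List.le_sum_of_mem h
    omega

theorem hgt_maya (γ : StrictPartition) (d : ℕ) :
    hgt (maya γ) d = γ.parts.countP (fun p => decide (d < p)) := by
  have hnd : (γ.parts.filter fun p => decide (d < p)).Nodup :=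
    (γ.strict.imp (fun h => Nat.ne_of_gt h)).filter _
  have : {s : ℤ | (d : ℤ) < s ∧ maya γ s = true} =
      ((γ.parts.filter fun p => decide (d < p)).toFinset.image (Nat.cast : ℕ → ℤ) : Finset ℤ) := by
    ext s
    simp only [Set.mem_ofPred_eq, Finset.coe_image, Set.mem_image, Finset.mem_coe, List.mem_toFinset,
      List.mem_filter, decide_eq_true_eq, maya]
    constructor
    · rintro ⟨h1, h2⟩
      rw [if_pos (by omega), decide_eq_true_eq] at h2
      exact ⟨s.toNat, ⟨h2, by omega⟩, by omega⟩
    · rintro ⟨t, ⟨h1, h2⟩, rfl⟩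
      refine ⟨by omega, ?_⟩
      rw [if_pos (by omega), decide_eq_true_eq, Int.toNat_natCast]
      exact h1
  unfold hgt
  rw [this, Set.ncard_coe_finset, Finset.card_image_of_injective _ Nat.cast_injective,
    List.toFinset_card_of_nodup hnd, List.countP_eq_length_filter]

theorem mem_cells {p : ℕ × ℕ} :
    p ∈ γ.cells ↔ p.1 ≤ p.2 ∧ p.2 < p.1 + γ.parts.getD p.1 0 := by
  unfold StrictPartition.cells
  rw [Finset.mem_biUnion]
  constructor
  · rintro ⟨i, h1, h2⟩
    obtain ⟨j, h3, rfl⟩ := Finset.mem_image.1 h2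
    rw [Finset.mem_Ico] at h3
    exact h3
  · intro h
    refine ⟨p.1, ?_, Finset.mem_image.2 ⟨p.2, Finset.mem_Ico.2 h, rfl⟩⟩
    rw [Finset.mem_range]
    by_contra hc
    rw [List.getD_eq_default _ _ (by omega)] at h
    omega

/-- The row `r` meets the diagonal `d` exactly when the `r`-th part exceeds `d`, that is, when more
than `r` parts do. Fillings can thus be studied through diagonal lengths. -/
theorem mem_cells_iff {p : ℕ × ℕ} : p ∈ γ.cells ↔ InSkew emp (maya γ) p := by
  unfold InSkew
  rw [mem_cells, hgt_emp, hgt_maya, lt_countP_iff γ.strict]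
  omega

theorem card_cells (γ : StrictPartition) : γ.cells.card = γ.size := by
  unfold StrictPartition.cells StrictPartition.size
  rw [Finset.card_biUnion, ← sum_range_getD]
  · refine Finset.sum_congr rfl fun i _ => ?_
    rw [Finset.card_image_of_injective _ (fun a b h => by simpa using h), Nat.card_Ico,
      Nat.add_sub_cancel_left]
  · intro i _ j _ hij
    rw [Function.onFun, Finset.disjoint_left]
    intro p h1 h2
    obtain ⟨a, -, rfl⟩ := Finset.mem_image.1 h1
    obtain ⟨b, -, h⟩ := Finset.mem_image.1 h2
    exact hij (congrArg Prod.fst h).symm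

theorem cells_le (c : γ.cells) : c.1.1 ≤ c.1.2 := (mem_cells.1 c.2).1

/-! ### Fillings and chains -/

/-- The absolute values of the entries of `S` are `e 1 < e 2 < ⋯`, each used once. -/
structure Labels (S : SignedFilling γ) (e : ℕ → ℕ) : Prop where
  mono : StrictMonoOn e (Set.Icc 1 γ.size)
  inj : Function.Injective fun c => (S c).1
  surj : ∀ k, 1 ≤ k → k ≤ γ.size → ∃ c, (S c).1 = e k
  range : ∀ c, ∃ k, 1 ≤ k ∧ k ≤ γ.size ∧ (S c).1 = e k

theorem diag_eq (hS : Function.Injective fun c => (S c).1) (c : γ.cells) :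
    S.diag (S c).1 =
      if (S c).2 = true then (c.1.2 : ℤ) - c.1.1 else (c.1.1 : ℤ) - c.1.2 := by
  unfold SignedFilling.diag
  rw [Finset.sum_eq_single_of_mem c (by simp)]
  intro d hd hne
  exact absurd (hS (Finset.mem_filter.1 hd).2) hne

theorem natAbs_diag (hS : Function.Injective fun c => (S c).1) (c : γ.cells) :
    c.1.1 + (S.diag (S c).1).natAbs = c.1.2 := by
  have := cells_le c
  rw [diag_eq hS]
  split_ifs <;> omega

/-- The cell of the `k`-th letter. -/
noncomputable def cellAt (S : SignedFilling γ) (e : ℕ → ℕ) (k : ℕ) : ℕ × ℕ :=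
  open Classical in if h : ∃ c, (S c).1 = e k then h.choose.1 else (0, 0)

theorem Labels.cellAt_eq (h : Labels S e) {c : γ.cells} (hc : (S c).1 = e k) :
    cellAt S e k = c.1 := by
  have h' : ∃ c, (S c).1 = e k := ⟨c, hc⟩
  unfold cellAt
  rw [dif_pos h']
  exact congrArg _ (h.inj (h'.choose_spec.trans hc.symm))

theorem Labels.lt_iff (h : Labels S e) (h1 : 1 ≤ k) (hk : k ≤ γ.size) (h2 : 1 ≤ l)
    (hl : l ≤ γ.size) : e k < e l ↔ k < l :=
  h.mono.lt_iff_lt ⟨h1, hk⟩ ⟨h2, hl⟩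

theorem Labels.le_iff (h : Labels S e) (h1 : 1 ≤ k) (hk : k ≤ γ.size) (h2 : 1 ≤ l)
    (hl : l ≤ γ.size) : e k ≤ e l ↔ k ≤ l :=
  h.mono.le_iff_le ⟨h1, hk⟩ ⟨h2, hl⟩

theorem Labels.cellAt_ne (h : Labels S e) (h1 : 1 ≤ k) (hkl : k < l) (hl : l ≤ γ.size) :
    cellAt S e k ≠ cellAt S e l := by
  obtain ⟨c, hc⟩ := h.surj k h1 (by omega)
  obtain ⟨d, hd⟩ := h.surj l (by omega) hl
  rw [h.cellAt_eq hc, h.cellAt_eq hd]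
  intro he
  have := (h.lt_iff h1 (by omega) (by omega) hl).2 hkl
  rw [← hc, ← hd, Subtype.ext he] at this
  exact lt_irrefl _ this

/-- The diagonals of the letters of a monotone filling form a chain. -/
theorem Labels.isChain (h : Labels S e) (hS : S.IsMonotone) :
    IsChain emp (fun k => S.diag (e k)) γ.size ∧
      shp emp (fun k => S.diag (e k)) γ.size = maya γ := by
  refine isShape_emp.isChain_of_cells (isShape_maya γ) (cell := cellAt S e) ?_ ?_ ?_
    (fun k l h1 h2 h3 => h.cellAt_ne h1 h2 h3) ?_ ?_ (fun d => by rw [hgt_emp]; exact Nat.zero_le _)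
  · intro k h1 h2
    obtain ⟨c, hc⟩ := h.surj k h1 h2
    rw [h.cellAt_eq hc]
    rw [← hc]; exact natAbs_diag h.inj c
  · intro k h1 h2
    obtain ⟨c, hc⟩ := h.surj k h1 h2
    rw [h.cellAt_eq hc]
    exact mem_cells_iff.1 c.2
  · intro p hp
    obtain ⟨k, h1, h2, h3⟩ := h.range ⟨p, mem_cells_iff.2 hp⟩
    exact ⟨k, h1, h2, h.cellAt_eq h3⟩
  · intro k l h1 h2 h3 h4
    obtain ⟨c, hc⟩ := h.surj k h1 h2
    obtain ⟨d, hd⟩ := h.surj l h3 h4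
    rw [h.cellAt_eq hc, h.cellAt_eq hd, ← h.le_iff h1 h2 h3 h4, ← hc, ← hd]
    exact hS.1 c d
  · intro k l h1 h2 h3 h4
    obtain ⟨c, hc⟩ := h.surj k h1 h2
    obtain ⟨d, hd⟩ := h.surj l h3 h4
    rw [h.cellAt_eq hc, h.cellAt_eq hd, ← h.le_iff h1 h2 h3 h4, ← hc, ← hd]
    exact hS.2.1 c d

/-- A filling which increases along the diagonals and gives a chain has its letters in the cells
determined by the chain. -/
theorem Labels.cellOf_eq (h : Labels S e)
    (hdiag : ∀ c d : γ.cells, c.1.1 + d.1.2 = d.1.1 + c.1.2 → c.1.1 < d.1.1 → (S c).1 < (S d).1)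
    (hch : IsChain emp (fun k => S.diag (e k)) γ.size) (h1 : 1 ≤ k) (hk : k ≤ γ.size) :
    cellAt S e k = cellOf emp (fun k => S.diag (e k)) k := by
  refine isShape_emp.cellOf_eq hch ?_ (fun k _ _ => by rw [hgt_emp]; exact Nat.zero_le _) ?_
    (fun k l h1 h2 h3 => h.cellAt_ne h1 h2 h3) k h1 hk
  · intro k h1 h2
    obtain ⟨c, hc⟩ := h.surj k h1 h2
    rw [h.cellAt_eq hc]
    rw [← hc]; exact natAbs_diag h.inj c
  · intro k h1 h2 r _ hr
    obtain ⟨c, hc⟩ := h.surj k h1 h2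
    rw [h.cellAt_eq hc] at hr
    have hn := natAbs_diag h.inj c
    rw [hc] at hn
    have hmem : (r, r + (S.diag (e k)).natAbs) ∈ γ.cells := by
      have := mem_cells_iff.1 c.2
      rw [mem_cells_iff]
      unfold InSkew at *
      simp only [hgt_emp, Nat.add_sub_cancel_left]
      rw [← hn, Nat.add_sub_cancel_left] at this
      omega
    obtain ⟨l, l1, l2, l3⟩ := h.range ⟨_, hmem⟩
    refine ⟨l, l1, ?_, h.cellAt_eq l3⟩
    have hlt := hdiag ⟨_, hmem⟩ c (by simp only; omega) hr
    rw [l3, hc] at hlt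
    exact (h.lt_iff l1 l2 h1 h2).1 hlt

theorem IsMonotone.diag_lt (h : Labels S e) (hS : S.IsMonotone) (c d : γ.cells)
    (h1 : c.1.1 + d.1.2 = d.1.1 + c.1.2) (h2 : c.1.1 < d.1.1) : (S c).1 < (S d).1 := by
  have hco := (mem_cells_iff.1 c.2).corner isShape_emp (isShape_maya γ) (mem_cells_iff.1 d.2)
    (by omega) (by omega)
  rw [← mem_cells_iff] at hco
  have g1 := hS.1 c ⟨_, hco⟩ rfl (by simp only; omega)
  have g2 := hS.2.1 ⟨_, hco⟩ d rfl (by simp only; omega)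
  refine lt_of_le_of_ne (g1.trans g2) fun he => ?_
  have := h.inj he
  rw [this] at h2
  exact lt_irrefl _ h2

theorem Labels.cellOf_eq' (h : Labels S e) (hS : S.IsMonotone) (h1 : 1 ≤ k) (hk : k ≤ γ.size) :
    cellAt S e k = cellOf emp (fun k => S.diag (e k)) k :=
  h.cellOf_eq (IsMonotone.diag_lt h hS) (h.isChain hS).1 h1 hk

/-- A filling which increases along the diagonals and gives a chain is monotone. -/
theorem Labels.isMonotone (h : Labels S e)
    (hdiag : ∀ c d : γ.cells, c.1.1 + d.1.2 = d.1.1 + c.1.2 → c.1.1 < d.1.1 → (S c).1 < (S d).1)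
    (hmark : ∀ c : γ.cells, c.1.1 = c.1.2 → (S c).2 = false)
    (hch : IsChain emp (fun k => S.diag (e k)) γ.size) : S.IsMonotone := by
  have key : ∀ c d : γ.cells, c.1.1 ≤ d.1.1 → c.1.2 ≤ d.1.2 → (S c).1 ≤ (S d).1 := by
    intro c d h1 h2
    obtain ⟨k, k1, k2, k3⟩ := h.range c
    obtain ⟨l, l1, l2, l3⟩ := h.range d
    rw [← h.cellAt_eq k3, ← h.cellAt_eq l3, h.cellOf_eq hdiag hch k1 k2,
      h.cellOf_eq hdiag hch l1 l2] at h1 h2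
    rw [k3, l3, h.le_iff k1 k2 l1 l2]
    exact isShape_emp.le_of_cellOf_le hch k1 k2 l1 l2 h1 h2
  exact ⟨fun c d h1 h2 => key c d h1.le h2, fun c d h1 h2 => key c d h2 h1.le, hmark⟩

/-- Since the main diagonal carries no marks, the sign of the diagonal determines the mark; this is
why diagonals determine a filling. -/
theorem IsMonotone.marked_iff (h : Labels S e) (hS : S.IsMonotone) (c : γ.cells) :
    (S c).2 = true ↔ 0 < S.diag (S c).1 := by
  have := cells_le c
  rw [diag_eq h.inj]
  split_ifs with h1
  · refine ⟨fun _ => ?_, fun _ => h1⟩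
    have : c.1.1 ≠ c.1.2 := fun h2 => by rw [hS.2.2 c h2] at h1; cases h1
    omega
  · refine ⟨fun h2 => absurd h2 h1, fun h2 => by omega⟩

/-- A monotone filling is determined by the diagonals of its letters. -/
theorem Labels.ext (h : Labels S e) (hS : S.IsMonotone) (h' : Labels S' e) (hS' : S'.IsMonotone)
    (hz : ∀ k, 1 ≤ k → k ≤ γ.size → S.diag (e k) = S'.diag (e k)) : S = S' := by
  funext c
  obtain ⟨k, k1, k2, k3⟩ := h.range c
  obtain ⟨d, hd⟩ := h'.surj k k1 k2
  have e1 := h.cellOf_eq' hS k1 k2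
  have e2 := h'.cellOf_eq' hS' k1 k2
  have e3 : cellOf emp (fun k => S.diag (e k)) k = cellOf emp (fun k => S'.diag (e k)) k := by
    unfold cellOf rowOf
    simp only
    rw [shp_congr fun l l1 l2 => hz l l1 (by omega), hz k k1 k2]
  rw [h.cellAt_eq k3, e3, ← e2, h'.cellAt_eq hd] at e1
  obtain rfl := Subtype.ext e1
  have m1 := IsMonotone.marked_iff h hS c
  have m2 := IsMonotone.marked_iff h' hS' c
  rw [k3, hz k k1 k2] at m1
  rw [hd] at m2
  exact Prod.ext (k3.trans hd.symm) (Bool.eq_iff_iff.2 (m1.trans m2.symm))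

/-- Every chain gives a filling. -/
theorem exists_labels (he : StrictMonoOn e (Set.Icc 1 γ.size)) (hz : IsChain emp z γ.size)
    (hs : shp emp z γ.size = maya γ) :
    ∃ S : SignedFilling γ, Labels S e ∧ S.IsMonotone ∧
      ∀ k, 1 ≤ k → k ≤ γ.size → S.diag (e k) = z k := by
  have hcell : ∀ c : γ.cells, ∃ k, 1 ≤ k ∧ k ≤ γ.size ∧ cellOf emp z k = c.1 := fun c =>
    isShape_emp.exists_cellOf hz (by rw [hs]; exact mem_cells_iff.1 c.2)
  choose κ hκ1 hκ2 hκ using hcell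
  let S : SignedFilling γ := fun c => (e (κ c), decide (0 < z (κ c)))
  have hinv : ∀ k, 1 ≤ k → k ≤ γ.size → ∃ c, κ c = k := by
    intro k h1 h2
    have := isShape_emp.inSkew_cellOf hz h1 h2
    rw [hs, ← mem_cells_iff] at this
    exact ⟨⟨_, this⟩, isShape_emp.cellOf_inj hz (hκ1 _) (hκ2 _) h1 h2 (hκ _)⟩
  have hκe : ∀ c d, e (κ c) = e (κ d) → κ c = κ d := fun c d h =>
    he.injOn ⟨hκ1 c, hκ2 c⟩ ⟨hκ1 d, hκ2 d⟩ h
  have hL : Labels S e := by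
    refine ⟨he, fun c d h => ?_, fun k h1 h2 => ?_, fun c => ⟨κ c, hκ1 c, hκ2 c, rfl⟩⟩
    · have := hκe c d h
      exact Subtype.ext (by rw [← hκ c, ← hκ d, this])
    · obtain ⟨c, hc⟩ := hinv k h1 h2
      exact ⟨c, by show e (κ c) = e k; rw [hc]⟩
  have hdist : ∀ c, c.1.1 + (z (κ c)).natAbs = c.1.2 := fun c => by rw [← hκ c]; rfl
  have hdg : ∀ k, 1 ≤ k → k ≤ γ.size → S.diag (e k) = z k := by
    intro k h1 h2
    obtain ⟨c, rfl⟩ := hinv k h1 h2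
    have := diag_eq hL.inj c
    change S.diag (e (κ c)) = if decide (0 < z (κ c)) = true then _ else _ at this
    rw [this]
    have := hdist c
    split_ifs with h
    · rw [decide_eq_true_eq] at h; omega
    · rw [decide_eq_true_eq] at h; omega
  have hmono : ∀ c d : γ.cells, c.1.1 ≤ d.1.1 → c.1.2 ≤ d.1.2 → (S c).1 ≤ (S d).1 := by
    intro c d h1 h2
    rw [← hκ c, ← hκ d] at h1 h2
    show e (κ c) ≤ e (κ d)
    rw [hL.le_iff (hκ1 c) (hκ2 c) (hκ1 d) (hκ2 d)]
    exact isShape_emp.le_of_cellOf_le hz (hκ1 c) (hκ2 c) (hκ1 d) (hκ2 d) h1 h2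
  refine ⟨S, hL, ⟨fun c d h1 h2 => hmono c d h1.le h2, fun c d h1 h2 => hmono c d h2 h1.le,
    fun c hc => ?_⟩, hdg⟩
  have := hdist c
  show decide (0 < z (κ c)) = false
  rw [decide_eq_false]; omega

theorem mem_signedStandardTableaux :
    S ∈ signedStandardTableaux γ ↔ Labels S id ∧ S.IsMonotone := by
  unfold signedStandardTableaux
  rw [Finset.mem_filter]
  constructor
  · rintro ⟨h1, ⟨h2, h3⟩, h4⟩
    refine ⟨⟨strictMonoOn_id, h2, fun k k1 k2 => ?_, fun c => ?_⟩, h4⟩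
    · have : k ∈ Finset.univ.image (fun c => (S c).1) := by
        rw [h3, Finset.mem_Icc]; exact ⟨k1, k2⟩
      obtain ⟨c, -, hc⟩ := Finset.mem_image.1 this
      exact ⟨c, hc⟩
    · have : (S c).1 ∈ Finset.univ.image (fun c => (S c).1) :=
        Finset.mem_image_of_mem _ (Finset.mem_univ c)
      rw [h3, Finset.mem_Icc] at this
      exact ⟨_, this.1, this.2, rfl⟩
  · rintro ⟨h1, h2⟩
    refine ⟨?_, ⟨h1.inj, ?_⟩, h2⟩
    · rw [Fintype.mem_piFinset]
      intro c
      obtain ⟨k, k1, k2, k3⟩ := h1.range c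
      rw [Finset.mem_product, Finset.mem_Icc, k3]
      exact ⟨⟨k1, k2⟩, Finset.mem_univ _⟩
    · ext k
      rw [Finset.mem_image, Finset.mem_Icc]
      constructor
      · rintro ⟨c, -, rfl⟩
        obtain ⟨k, k1, k2, k3⟩ := h1.range c
        rw [k3]; exact ⟨k1, k2⟩
      · rintro ⟨k1, k2⟩
        obtain ⟨c, hc⟩ := h1.surj k k1 k2
        exact ⟨c, Finset.mem_univ _, hc⟩

/-- Every shape belongs to a strict partition. -/
theorem IsShape.exists_maya {M : ℤ → Bool} (hM : IsShape M) : ∃ ε, maya ε = M := by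
  obtain ⟨B, hB⟩ := hM.bdd
  let F : Finset ℕ := (Finset.Icc 1 B.toNat).filter fun s => M s = true
  have hF : ∀ s : ℕ, s ∈ F ↔ 0 < s ∧ M s = true := by
    intro s
    simp only [F, Finset.mem_filter, Finset.mem_Icc]
    refine ⟨fun h => ⟨h.1.1, h.2⟩, fun h => ⟨⟨h.1, ?_⟩, h.2⟩⟩
    by_contra hc
    rw [hB s (by omega)] at h
    cases h.2
  refine ⟨⟨F.sort (· ≥ ·), F.sortedGT_sort.pairwise, fun p hp => ?_⟩, ?_⟩
  · rw [Finset.mem_sort] at hp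
    exact ((hF p).1 hp).1
  · have key : ∀ s : ℤ, 0 < s → (s.toNat ∈ F.sort (· ≥ ·) ↔ M s = true) := by
      intro s hs
      rw [Finset.mem_sort, hF, Int.toNat_of_nonneg hs.le]
      exact ⟨fun h => h.2, fun h => ⟨by omega, h⟩⟩
    funext s
    unfold maya
    simp only
    split_ifs with h
    · rw [Bool.eq_iff_iff, decide_eq_true_eq]; exact key s h
    · have h1 := key (1 - s) (by omega)
      rw [hM.sym] at h1
      cases hs : M s <;> simp [hs] at h1 ⊢ <;> exact h1

/-- The length of a chain is the size of its final shape. -/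
theorem size_eq_of_isChain (hz : IsChain emp z n) (hs : shp emp z n = maya γ) : γ.size = n := by
  rw [← card_cells]
  have : γ.cells = (Finset.Icc 1 n).image (cellOf emp z) := by
    ext p
    rw [mem_cells_iff, ← hs, Finset.mem_image]
    constructor
    · intro h
      obtain ⟨k, k1, k2, k3⟩ := isShape_emp.exists_cellOf hz h
      exact ⟨k, Finset.mem_Icc.2 ⟨k1, k2⟩, k3⟩
    · rintro ⟨k, hk, rfl⟩
      rw [Finset.mem_Icc] at hk
      exact isShape_emp.inSkew_cellOf hz hk.1 hk.2
  rw [this, Finset.card_image_of_injOn, Nat.card_Icc, Nat.add_sub_cancel]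
  intro k hk l hl h
  rw [Finset.coe_Icc, Set.mem_Icc] at hk hl
  exact isShape_emp.cellOf_inj hz hk.1 hk.2 hl.1 hl.2 h

end QueerDual

namespace QueerDual
variable {γ : StrictPartition} {S S' : SignedFilling γ} {e : ℕ → ℕ} {z : ℕ → ℤ} {n k l d r a b i : ℕ}

/-! ### The hook reading word -/

theorem rel_of_idxOf_lt {α : Type*} [DecidableEq α] {R : α → α → Prop} {l : List α}
    (hl : l.Pairwise R) {a b : α} (hb : b ∈ l) (h : l.idxOf a < l.idxOf b) : R a b := by
  have hb' := List.idxOf_lt_length_iff.2 hb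
  have := List.pairwise_iff_getElem.1 hl _ _ (h.trans hb') hb' h
  rwa [List.getElem_idxOf, List.getElem_idxOf] at this

/-- The entry in the cell `c` is read before the one in the cell `d`. -/
def Before (S : SignedFilling γ) (c d : γ.cells) : Prop :=
  (if (S d).2 = true then d.1.2 else d.1.1) < (if (S c).2 = true then c.1.2 else c.1.1) ∨
  (if (S d).2 = true then d.1.2 else d.1.1) = (if (S c).2 = true then c.1.2 else c.1.1) ∧
    ((S c).2 = true ∧ (S d).2 = false ∨ (S c).2 = true ∧ (S d).2 = true ∧ c.1.1 < d.1.1 ∨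
      (S c).2 = false ∧ (S d).2 = false ∧ c.1.2 < d.1.2)

theorem mem_marked {c : ℕ} (h : ((S.entry? r c).bind fun e => if e.2 = true then some e.1 else none)
    = some k) : ∃ p : γ.cells, p.1 = (r, c) ∧ (S p).1 = k ∧ (S p).2 = true := by
  unfold SignedFilling.entry? at h
  split_ifs at h with hm
  · refine ⟨⟨_, hm⟩, rfl, ?_⟩
    simp only [Option.bind_some] at h
    split_ifs at h with h2
    exact ⟨Option.some.inj h, h2⟩
  · cases h

theorem mem_unmarked {c : ℕ}
    (h : ((S.entry? r c).bind fun e => if e.2 = false then some e.1 else none) = some k) :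
    ∃ p : γ.cells, p.1 = (r, c) ∧ (S p).1 = k ∧ (S p).2 = false := by
  unfold SignedFilling.entry? at h
  split_ifs at h with hm
  · refine ⟨⟨_, hm⟩, rfl, ?_⟩
    simp only [Option.bind_some] at h
    split_ifs at h with h2
    exact ⟨Option.some.inj h, h2⟩
  · cases h

theorem pairwise_hook (S : SignedFilling γ) :
    S.hook.Pairwise fun a b => ∃ c d, (S c).1 = a ∧ (S d).1 = b ∧ Before S c d := by
  unfold SignedFilling.hook
  have hmem : ∀ i x, x ∈ ((List.range γ.size).filterMap fun r =>
      (S.entry? r i).bind fun e => if e.2 = true then some e.1 else none) ++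
      ((List.range γ.size).filterMap fun c =>
        (S.entry? i c).bind fun e => if e.2 = false then some e.1 else none) →
      ∃ p : γ.cells, (S p).1 = x ∧ (if (S p).2 = true then p.1.2 else p.1.1) = i := by
    intro i x hx
    rcases List.mem_append.1 hx with hx | hx
    · obtain ⟨r, -, hr⟩ := List.mem_filterMap.1 hx
      obtain ⟨p, h1, h2, h3⟩ := mem_marked hr
      exact ⟨p, h2, by rw [if_pos h3, h1]⟩
    · obtain ⟨r, -, hr⟩ := List.mem_filterMap.1 hx
      obtain ⟨p, h1, h2, h3⟩ := mem_unmarked hr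
      exact ⟨p, h2, by rw [h3, if_neg (by decide), h1]⟩
  rw [List.pairwise_flatMap]
  refine ⟨fun i _ => ?_, ?_⟩
  · rw [List.pairwise_append]
    refine ⟨?_, ?_, ?_⟩
    · rw [List.pairwise_filterMap]
      refine List.pairwise_lt_range.imp fun {r r'} hrr x hx y hy => ?_
      obtain ⟨p, h1, h2, h3⟩ := mem_marked hx
      obtain ⟨q, g1, g2, g3⟩ := mem_marked hy
      refine ⟨p, q, h2, g2, .inr ⟨?_, .inr (.inl ⟨h3, g3, ?_⟩)⟩⟩
      · rw [if_pos h3, if_pos g3, h1, g1]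
      · rw [h1, g1]; exact hrr
    · rw [List.pairwise_filterMap]
      refine List.pairwise_lt_range.imp fun {r r'} hrr x hx y hy => ?_
      obtain ⟨p, h1, h2, h3⟩ := mem_unmarked hx
      obtain ⟨q, g1, g2, g3⟩ := mem_unmarked hy
      refine ⟨p, q, h2, g2, .inr ⟨?_, .inr (.inr ⟨h3, g3, ?_⟩)⟩⟩
      · rw [h3, g3, if_neg (by decide), if_neg (by decide), h1, g1]
      · rw [h1, g1]; exact hrr
    · intro x hx y hy
      obtain ⟨r, -, hr⟩ := List.mem_filterMap.1 hx
      obtain ⟨r', -, hr'⟩ := List.mem_filterMap.1 hy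
      obtain ⟨p, h1, h2, h3⟩ := mem_marked hr
      obtain ⟨q, g1, g2, g3⟩ := mem_unmarked hr'
      refine ⟨p, q, h2, g2, .inr ⟨?_, .inl ⟨h3, g3⟩⟩⟩
      rw [h3, g3, if_neg (by decide), if_pos rfl, h1, g1]
  · rw [List.pairwise_reverse]
    refine List.pairwise_lt_range.imp fun {i i'} hii x hx y hy => ?_
    obtain ⟨p, h1, h2⟩ := hmem _ _ hx
    obtain ⟨q, g1, g2⟩ := hmem _ _ hy
    exact ⟨p, q, h1, g1, .inl (by rw [h2, g2]; exact hii)⟩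

/-- Every column that occurs already occurs in row `0`, so the ranges up to the size in the reading
word miss no cell. -/
theorem cells_lt (c : γ.cells) : c.1.2 < γ.size := by
  have h := mem_cells_iff.1 c.2
  have h1 := (isShape_maya γ).hgt_le_add (d := c.1.2 - c.1.1) (e := c.1.2) (by omega)
  have h2 : (Finset.range (c.1.2 + 1)).image (fun j => ((0 : ℕ), j)) ⊆ γ.cells := by
    intro p hp
    obtain ⟨j, hj, rfl⟩ := Finset.mem_image.1 hp
    rw [Finset.mem_range] at hj
    rw [mem_cells_iff]
    have h3 := (isShape_maya γ).hgt_anti (d := j) (e := c.1.2) (by omega)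
    unfold InSkew at *
    simp only [hgt_emp, Nat.sub_zero]
    omega
  have h3 := Finset.card_le_card h2
  rw [card_cells, Finset.card_image_of_injective _ (fun a b h => (Prod.mk.inj h).2),
    Finset.card_range] at h3
  omega

theorem mem_hook : k ∈ S.hook ↔ S.Occurs k := by
  unfold SignedFilling.hook SignedFilling.Occurs
  rw [List.mem_flatMap]
  constructor
  · rintro ⟨i, -, h⟩
    rcases List.mem_append.1 h with h | h
    · obtain ⟨r, -, hr⟩ := List.mem_filterMap.1 h
      obtain ⟨p, -, h2, -⟩ := mem_marked hr
      exact ⟨p, h2⟩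
    · obtain ⟨r, -, hr⟩ := List.mem_filterMap.1 h
      obtain ⟨p, -, h2, -⟩ := mem_unmarked hr
      exact ⟨p, h2⟩
  · rintro ⟨c, rfl⟩
    have h1 := cells_lt c
    have h2 := cells_le c
    have he : S.entry? c.1.1 c.1.2 = some (S c) := by
      unfold SignedFilling.entry?
      rw [dif_pos (show (c.1.1, c.1.2) ∈ γ.cells from c.2)]
    cases hm : (S c).2
    · refine ⟨c.1.1, by simp; omega, List.mem_append_right _ (List.mem_filterMap.2
        ⟨c.1.2, by simp; omega, ?_⟩)⟩
      rw [he, Option.bind_some, if_pos hm]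
    · refine ⟨c.1.2, by simp; omega, List.mem_append_left _ (List.mem_filterMap.2
        ⟨c.1.1, by simp; omega, ?_⟩)⟩
      rw [he, Option.bind_some, if_pos hm]

/-- If no letter lies between the two, their cells are not strictly north-east of one another, since
the corner cell would hold an intermediate letter. Comparing the hooks in the remaining weakly
north-west to south-east position yields the order of the signed diagonals. -/
theorem Before.diag_lt (hi : Function.Injective fun c => (S c).1) (hS : S.IsMonotone) {c d : γ.cells}
    (hno : ∀ c', ¬ ((S c).1 < (S c').1 ∧ (S c').1 < (S d).1) ∧
      ¬ ((S d).1 < (S c').1 ∧ (S c').1 < (S c).1)) (hcd : c ≠ d)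
    (h : Before S c d) : S.diag (S d).1 < S.diag (S c).1 := by
  have hstrict : ∀ p q : γ.cells, p.1.1 < q.1.1 → p.1.2 < q.1.2 →
      ∃ c', (S p).1 < (S c').1 ∧ (S c').1 < (S q).1 := by
    intro p q h1 h2
    have hco := (mem_cells_iff.1 p.2).corner isShape_emp (isShape_maya γ) (mem_cells_iff.1 q.2)
      h1.le h2.le
    rw [← mem_cells_iff] at hco
    refine ⟨⟨_, hco⟩, lt_of_le_of_ne (hS.1 p ⟨_, hco⟩ rfl h2.le) fun he => ?_,
      lt_of_le_of_ne (hS.2.1 ⟨_, hco⟩ q rfl h1.le) fun he => ?_⟩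
    · have := congrArg (fun c : γ.cells => c.1.2) (hi he)
      simp only at this; omega
    · have := congrArg (fun c : γ.cells => c.1.1) (hi he)
      simp only at this; omega
  have hne : c.1.1 ≠ d.1.1 ∨ c.1.2 ≠ d.1.2 := by
    by_contra hc
    push Not at hc
    exact hcd (Subtype.ext (Prod.ext hc.1 hc.2))
  have hcmp : (c.1.1 ≤ d.1.1 ∧ d.1.2 ≤ c.1.2) ∨ (d.1.1 ≤ c.1.1 ∧ c.1.2 ≤ d.1.2) := by
    by_contra hc
    rcases lt_or_ge c.1.1 d.1.1 with g | g
    · obtain ⟨c', h1⟩ := hstrict c d g (by omega)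
      exact (hno c').1 h1
    · obtain ⟨c', h1⟩ := hstrict d c (by omega) (by omega)
      exact (hno c').2 h1
  have k1 := cells_le c
  have k2 := cells_le d
  have m1 : (S c).2 = true → c.1.1 ≠ c.1.2 := fun h1 h2 => by
    rw [hS.2.2 c h2] at h1; cases h1
  have m2 : (S d).2 = true → d.1.1 ≠ d.1.2 := fun h1 h2 => by
    rw [hS.2.2 d h2] at h1; cases h1
  rw [diag_eq hi, diag_eq hi]
  unfold Before at h
  cases e1 : (S c).2 <;> cases e2 : (S d).2 <;> simp only [e1, e2] at h m1 m2 ⊢ <;>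
    simp at h m1 m2 ⊢ <;> omega

/-- Letters which are consecutive in a filling are read in the order of decreasing diagonals. -/
theorem idxOf_lt_iff (hi : Function.Injective fun c => (S c).1) (hS : S.IsMonotone)
    (ha : S.Occurs a) (hb : S.Occurs b) (hab : a ≠ b)
    (hno : ∀ k, S.Occurs k → ¬ (a < k ∧ k < b) ∧ ¬ (b < k ∧ k < a)) :
    S.hook.idxOf a < S.hook.idxOf b ↔ S.diag b < S.diag a := by
  have key : ∀ a b, S.Occurs b → a ≠ b →
      (∀ k, S.Occurs k → ¬ (a < k ∧ k < b) ∧ ¬ (b < k ∧ k < a)) →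
      S.hook.idxOf a < S.hook.idxOf b → S.diag b < S.diag a := by
    intro a b hb hab hno h
    obtain ⟨c, d, rfl, rfl, hB⟩ := rel_of_idxOf_lt (pairwise_hook S) (mem_hook.2 hb) h
    exact hB.diag_lt hi hS (fun c' => hno _ ⟨c', rfl⟩) fun he => hab (by rw [he])
  refine ⟨key a b hb hab hno, fun h => ?_⟩
  by_contra hc
  rcases (not_lt.1 hc).lt_or_eq with hc | hc
  · exact lt_asymm h (key b a ha hab.symm (fun k hk => (hno k hk).symm) hc)
  · exact hab ((List.idxOf_inj (mem_hook.2 hb)).1 hc).symm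

end QueerDual

namespace QueerDual
variable {γ δ : StrictPartition} {S S' : SignedFilling γ} {e e' f f' : ℕ → ℕ} {z w : ℕ → ℤ}
  {n k l d r a b i j p : ℕ}

/-! ### Toggling marks and swapping letters -/

theorem diag_toggle_self : (S.toggle l).diag l = -S.diag l := by
  unfold SignedFilling.diag SignedFilling.toggle
  rw [← Finset.sum_neg_distrib]
  refine Finset.sum_congr ?_ fun c hc => ?_
  · ext c
    simp only [Finset.mem_filter, Finset.mem_univ, true_and]
    split_ifs <;> simp
  · have h := (Finset.mem_filter.1 hc).2
    rw [if_pos h]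
    cases (S c).2 <;> simp

theorem diag_toggle_of_ne (h : k ≠ l) : (S.toggle l).diag k = S.diag k := by
  unfold SignedFilling.diag SignedFilling.toggle
  refine Finset.sum_congr ?_ fun c hc => ?_
  · ext c
    simp only [Finset.mem_filter, Finset.mem_univ, true_and]
    split_ifs <;> simp
  · have h' : (S c).1 ≠ l := by rw [(Finset.mem_filter.1 hc).2]; exact h
    simp only [if_neg h']

theorem toggle_fst (c : γ.cells) : ((S.toggle l) c).1 = (S c).1 := by
  unfold SignedFilling.toggle; split_ifs <;> rfl

theorem Labels.toggle (h : Labels S e) (l : ℕ) : Labels (S.toggle l) e := by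
  refine ⟨h.mono, ?_, ?_, ?_⟩ <;> simp only [toggle_fst]
  · exact h.inj
  · exact h.surj
  · exact h.range

theorem isMonotone_toggle (hi : Function.Injective fun c => (S c).1) (hS : S.IsMonotone)
    (hl : S.diag l ≠ 0) : (S.toggle l).IsMonotone := by
  refine ⟨fun c d => ?_, fun c d => ?_, fun c hc => ?_⟩
  · rw [toggle_fst, toggle_fst]; exact hS.1 c d
  · rw [toggle_fst, toggle_fst]; exact hS.2.1 c d
  · have h := hS.2.2 c hc
    unfold SignedFilling.toggle
    rw [if_neg, h]
    rintro rfl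
    rw [diag_eq hi, h, if_neg (by decide)] at hl
    omega

theorem diag_swap (k : ℕ) : (S.swap a b).diag (Equiv.swap a b k) = S.diag k := by
  unfold SignedFilling.diag SignedFilling.swap
  refine Finset.sum_congr ?_ fun c _ => rfl
  ext c
  simp

theorem diag_swap' (k : ℕ) : (S.swap a b).diag k = S.diag (Equiv.swap a b k) := by
  rw [← diag_swap (a := a) (b := b) (Equiv.swap a b k), Equiv.swap_apply_self]

theorem swap_comm (a b : ℕ) : S.swap a b = S.swap b a := by
  unfold SignedFilling.swap; rw [Equiv.swap_comm]

theorem toggle_comm (a b : ℕ) : (S.toggle a).toggle b = (S.toggle b).toggle a := by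
  funext c
  unfold SignedFilling.toggle
  split_ifs <;> rfl

/-- Swapping two letters which both occur. -/
theorem Labels.swap_of_occurs (h : Labels S e) (ha : S.Occurs a) (hb : S.Occurs b) :
    Labels (S.swap a b) e := by
  obtain ⟨ca, hca⟩ := ha
  obtain ⟨cb, hcb⟩ := hb
  refine ⟨h.mono, fun c d hcd => h.inj ((Equiv.swap a b).injective hcd), fun k h1 h2 => ?_,
    fun c => ?_⟩
  · obtain ⟨c, hc⟩ := h.surj k h1 h2
    by_cases e1 : (S c).1 = a
    · exact ⟨cb, by show Equiv.swap a b (S cb).1 = _; rw [hcb, Equiv.swap_apply_right, ← e1, hc]⟩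
    by_cases e2 : (S c).1 = b
    · exact ⟨ca, by show Equiv.swap a b (S ca).1 = _; rw [hca, Equiv.swap_apply_left, ← e2, hc]⟩
    exact ⟨c, by show Equiv.swap a b (S c).1 = _; rw [Equiv.swap_apply_of_ne_of_ne e1 e2, hc]⟩
  · show ∃ k, 1 ≤ k ∧ k ≤ γ.size ∧ Equiv.swap a b (S c).1 = e k
    by_cases e1 : (S c).1 = a
    · rw [e1, Equiv.swap_apply_left, ← hcb]; exact h.range cb
    by_cases e2 : (S c).1 = b
    · rw [e2, Equiv.swap_apply_right, ← hca]; exact h.range ca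
    rw [Equiv.swap_apply_of_ne_of_ne e1 e2]; exact h.range c

theorem swap_lt_swap (h : ¬ (a = p ∧ b = p + 1)) (hab : a < b) :
    Equiv.swap p (p + 1) a < Equiv.swap p (p + 1) b := by
  rw [Equiv.swap_apply_def, Equiv.swap_apply_def]
  split_ifs <;> omega

/-- Swapping `p` and `p + 1` if only one of them occurs. -/
theorem Labels.swap_of_not (h : Labels S e) (hp : ¬ (S.Occurs p ∧ S.Occurs (p + 1))) :
    Labels (S.swap p (p + 1)) (Equiv.swap p (p + 1) ∘ e) := by
  refine ⟨fun k hk l hl hkl => swap_lt_swap ?_ (h.mono hk hl hkl),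
    fun c d hcd => h.inj ((Equiv.swap p (p + 1)).injective hcd), fun k h1 h2 => ?_, fun c => ?_⟩
  · rintro ⟨h1, h2⟩
    obtain ⟨c, hc⟩ := h.surj k hk.1 hk.2
    obtain ⟨d, hd⟩ := h.surj l hl.1 hl.2
    exact hp ⟨⟨c, hc.trans h1⟩, ⟨d, hd.trans h2⟩⟩
  · obtain ⟨c, hc⟩ := h.surj k h1 h2
    exact ⟨c, congrArg (Equiv.swap p (p + 1)) hc⟩
  · obtain ⟨k, k1, k2, k3⟩ := h.range c
    exact ⟨k, k1, k2, congrArg (Equiv.swap p (p + 1)) k3⟩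

theorem isMonotone_swap_of_not (hS : S.IsMonotone) (hp : ¬ (S.Occurs p ∧ S.Occurs (p + 1))) :
    (S.swap p (p + 1)).IsMonotone := by
  have key : ∀ c d : γ.cells, (S c).1 ≤ (S d).1 →
      ((S.swap p (p + 1)) c).1 ≤ ((S.swap p (p + 1)) d).1 := by
    intro c d h
    show Equiv.swap p (p + 1) (S c).1 ≤ Equiv.swap p (p + 1) (S d).1
    rcases h.lt_or_eq with h | h
    · exact (swap_lt_swap (fun h' => hp ⟨⟨c, h'.1⟩, ⟨d, h'.2⟩⟩) h).le
    · rw [h]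
  exact ⟨fun c d h1 h2 => key c d (hS.1 c d h1 h2), fun c d h1 h2 => key c d (hS.2.1 c d h1 h2),
    hS.2.2⟩

/-- Swapping consecutive letters on different diagonals. -/
theorem isMonotone_swap (h : Labels S e) (hS : S.IsMonotone) (hp : S.Occurs p)
    (hp' : S.Occurs (p + 1)) (hne : |S.diag p| ≠ |S.diag (p + 1)|)
    (hch : IsChain emp (fun k => (S.swap p (p + 1)).diag (e k)) γ.size) :
    (S.swap p (p + 1)).IsMonotone := by
  refine (h.swap_of_occurs hp hp').isMonotone (fun c d h1 h2 => ?_) hS.2.2 hch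
  refine swap_lt_swap ?_ (IsMonotone.diag_lt h hS c d h1 h2)
  rintro ⟨e1, e2⟩
  have n1 := natAbs_diag h.inj c
  have n2 := natAbs_diag h.inj d
  rw [e1] at n1
  rw [e2] at n2
  rw [Int.abs_eq_natAbs, Int.abs_eq_natAbs] at hne
  apply hne
  congr 1
  omega

/-! ### The elementary dual equivalence on fillings -/

theorem Labels.succ_eq (h : Labels S e) (h1 : 1 ≤ j) (h2 : j ≤ γ.size)
    (ho : S.Occurs (e j + 1)) : j + 1 ≤ γ.size ∧ e (j + 1) = e j + 1 := by
  obtain ⟨c, hc⟩ := ho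
  obtain ⟨k, k1, k2, k3⟩ := h.range c
  have h3 : j < k := by rw [← h.lt_iff h1 h2 k1 k2]; omega
  have h4 := (h.le_iff (by omega) (by omega) k1 k2).2 (show j + 1 ≤ k by omega)
  have h5 := (h.lt_iff h1 h2 (by omega) (by omega)).2 (show j < j + 1 by omega)
  omega

theorem letterAt_left {α : Type*} [LinearOrder α] {f : ℕ → α} {x : α} (h : f (i - 1) = x) :
    letterAt f i x = i - 1 := if_pos h

theorem letterAt_mid {α : Type*} [LinearOrder α] {f : ℕ → α} {x : α} (h : f (i - 1) ≠ x)
    (h' : f i = x) : letterAt f i x = i := by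
  unfold letterAt; rw [if_neg h, if_pos h']

theorem letterAt_right {α : Type*} [LinearOrder α] {f : ℕ → α} {x : α} (h : f (i - 1) ≠ x)
    (h' : f i ≠ x) : letterAt f i x = i + 1 := by
  unfold letterAt; rw [if_neg h, if_neg h']

section
variable {α : Type*} [LinearOrder α] {f : ℕ → α}

theorem lo_mid_hi_of_lt (h1 : f (i - 1) < f i) (h2 : f i < f (i + 1)) :
    lo f i = f (i - 1) ∧ mid f i = f i ∧ hi f i = f (i + 1) := by
  unfold lo mid hi
  simp [h1.le, h2.le, (h1.trans h2).le]

theorem lo_mid_hi_of_gt (h1 : f (i + 1) < f i) (h2 : f i < f (i - 1)) :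
    lo f i = f (i + 1) ∧ mid f i = f i ∧ hi f i = f (i - 1) := by
  unfold lo mid hi
  simp [h1.le, h2.le, (h1.trans h2).le]

theorem lo_mid_hi_left (h1 : f i < f (i - 1)) (h2 : f (i - 1) ≤ f (i + 1)) :
    lo f i = f i ∧ mid f i = f (i - 1) ∧ hi f i = f (i + 1) := by
  unfold lo mid hi
  simp [h1.le, h2, h1.le.trans h2]

theorem lo_mid_hi_left' (h1 : f (i - 1) < f i) (h2 : f (i + 1) ≤ f (i - 1)) :
    lo f i = f (i + 1) ∧ mid f i = f (i - 1) ∧ hi f i = f i := by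
  unfold lo mid hi
  simp [h1.le, h2, h2.trans h1.le]

theorem lo_mid_hi_right (h1 : f i < f (i + 1)) (h2 : f (i + 1) ≤ f (i - 1)) :
    lo f i = f i ∧ mid f i = f (i + 1) ∧ hi f i = f (i - 1) := by
  unfold lo mid hi
  simp [h1.le, h2, h1.le.trans h2]

theorem lo_mid_hi_right' (h1 : f (i + 1) < f i) (h2 : f (i - 1) ≤ f (i + 1)) :
    lo f i = f (i - 1) ∧ mid f i = f (i + 1) ∧ hi f i = f i := by
  unfold lo mid hi
  simp [h1.le, h2, h2.trans h1.le]

end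

/-- The two extremes of three letters, one of which is the middle letter, are exchanged or both
toggled, where `p`, `p + 1` are the two letters. -/
theorem d_of_extremes (hne : S.diag i ≠ mid S.diag i) (h1 : lo S.diag i ≠ mid S.diag i)
    (h2 : mid S.diag i ≠ hi S.diag i)
    (h : (letterAt S.diag i (lo S.diag i) = p ∧ letterAt S.diag i (hi S.diag i) = p + 1 ∧
        lo S.diag i = S.diag p ∧ hi S.diag i = S.diag (p + 1)) ∨
      (letterAt S.diag i (lo S.diag i) = p + 1 ∧ letterAt S.diag i (hi S.diag i) = p ∧
        lo S.diag i = S.diag (p + 1) ∧ hi S.diag i = S.diag p)) :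
    S.d i = if |(|S.diag p| - |S.diag (p + 1)|)| = 1 then (S.toggle p).toggle (p + 1)
      else S.swap p (p + 1) := by
  unfold SignedFilling.d
  simp only
  rw [if_neg hne, if_neg h1, if_neg h2]
  rcases h with ⟨h3, h4, h5, h6⟩ | ⟨h3, h4, h5, h6⟩
  · rw [h3, h4, h5, h6]
  · rw [h3, h4, h5, h6, abs_sub_comm, toggle_comm, swap_comm]

/-- Translates the definition through minimum, median and maximum of diagonals into `tri`. If `i` is
not the median it is one of the extremes, so the letters acted on are two consecutive ones `p`, `p +
1`; when the outer diagonals coincide, only `i` is toggled. -/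
theorem Labels.d_spec (h : Labels S e) (hS : S.IsMonotone) (hj : 1 < j) (hjn : j < γ.size)
    (h1 : e (j - 1) = e j - 1) (h2 : e (j + 1) = e j + 1)
    (hm : ¬ (S.diag (e j - 1) < S.diag (e j) ↔ S.diag (e j) < S.diag (e j + 1))) :
    Labels (S.d (e j)) e ∧ (S.d (e j)).IsMonotone ∧
      ∀ k, 1 ≤ k → k ≤ γ.size → (S.d (e j)).diag (e k) = dE j (fun k => S.diag (e k)) k := by
  obtain ⟨hch, -⟩ := h.isChain hS
  obtain ⟨c0, hc0⟩ := h.surj (j - 1) (by omega) (by omega)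
  obtain ⟨c1, hc1⟩ := h.surj j (by omega) (by omega)
  obtain ⟨c2, hc2⟩ := h.surj (j + 1) (by omega) (by omega)
  have hlt := (h.lt_iff (k := j - 1) (l := j) (by omega) (by omega) (by omega) (by omega)).2
    (by omega)
  rw [h1] at hlt hc0
  rw [h2] at hc2
  have ht := hch.chain3 hj hjn
  have hchd := isShape_emp.isChain_dE hch hj hjn
  have hsh := isShape_emp.shp (fun k => S.diag (e k)) (j - 2)
  have htr : triple (fun k => S.diag (e k)) j =
      (S.diag (e j - 1), S.diag (e j), S.diag (e j + 1)) := by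
    show (S.diag (e (j - 1)), S.diag (e j), S.diag (e (j + 1))) = _
    rw [h1, h2]
  have hdE : ∀ k, 1 ≤ k → k ≤ γ.size → dE j (fun k => S.diag (e k)) k =
      if e k = e j - 1 then (tri (S.diag (e j - 1), S.diag (e j), S.diag (e j + 1))).1
      else if e k = e j then (tri (S.diag (e j - 1), S.diag (e j), S.diag (e j + 1))).2.1
      else if e k = e j + 1 then (tri (S.diag (e j - 1), S.diag (e j), S.diag (e j + 1))).2.2
      else S.diag (e k) := by
    intro k k1 k2
    unfold dE
    rw [htr, ← h1, ← h2]
    have i1 : e k = e (j - 1) ↔ k = j - 1 :=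
      ⟨fun g => h.mono.injOn ⟨k1, k2⟩ ⟨by omega, by omega⟩ g, fun g => by rw [g]⟩
    have i2 : e k = e j ↔ k = j :=
      ⟨fun g => h.mono.injOn ⟨k1, k2⟩ ⟨by omega, by omega⟩ g, fun g => by rw [g]⟩
    have i3 : e k = e (j + 1) ↔ k = j + 1 :=
      ⟨fun g => h.mono.injOn ⟨k1, k2⟩ ⟨by omega, by omega⟩ g, fun g => by rw [g]⟩
    simp only [i1, i2, i3]
  rw [htr] at ht
  obtain ⟨t1, t2, t3⟩ := ht
  simp only at t1 t2 t3
  have n1 := hsh.ne_of_chain t1 t2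
  have n2 := (hsh.shape_hop _).ne_of_chain t2 t3
  obtain ⟨i, hi⟩ : ∃ i, e j = i := ⟨_, rfl⟩
  rw [hi] at hm hlt hc0 hc1 hc2 t1 t2 t3 n1 n2 hdE ⊢
  have n1' : S.diag (i - 1) ≠ S.diag i := fun g => n1 (by rw [g])
  have n2' : S.diag i ≠ S.diag (i + 1) := fun g => n2 (by rw [g])
  by_cases hx : S.diag (i - 1) = S.diag (i + 1)
  · have hz := hsh.eq_zero_of_chain t1 t2 (hx ▸ t3)
    have hd : S.d i = S.toggle i := by
      unfold SignedFilling.d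
      simp only
      rcases lt_or_gt_of_ne n1' with g | g
      · obtain ⟨a1, a2, a3⟩ := lo_mid_hi_left' (f := S.diag) g hx.ge
        rw [a1, a2, a3, if_neg n1'.symm, if_pos hx.symm, letterAt_mid n1' rfl]
      · obtain ⟨a1, a2, a3⟩ := lo_mid_hi_left (f := S.diag) g hx.le
        rw [a1, a2, a3, if_neg n1'.symm, if_neg n1'.symm, if_pos hx, letterAt_mid n1' rfl]
    rw [hd]
    refine ⟨h.toggle i, isMonotone_toggle h.inj hS (by rw [← hz]; exact n1'.symm), ?_⟩
    intro k k1 k2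
    rw [hdE k k1 k2, ← hx, tri_eq, if_neg n1']
    by_cases e2 : e k = i
    · rw [e2, diag_toggle_self, if_neg (by omega), if_pos rfl]
    · rw [diag_toggle_of_ne e2, if_neg e2]
      split_ifs with g1 g2
      · rw [g1]
      · rw [g2, hx]
      · rfl
  -- the two extremes are the letters `p` and `p + 1`
  obtain ⟨p, hp, hgap, hd, htri⟩ : ∃ p, (p + 1 = i ∨ p = i) ∧
      (S.diag p + 1 < S.diag (p + 1) ∨ S.diag (p + 1) + 1 < S.diag p) ∧ (S.d i =
      if |(|S.diag p| - |S.diag (p + 1)|)| = 1 then (S.toggle p).toggle (p + 1)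
      else S.swap p (p + 1)) ∧
      tri (S.diag (i - 1), S.diag i, S.diag (i + 1)) =
        if p = i then (S.diag (i - 1), exch (S.diag i) (S.diag (i + 1)))
        else ((exch (S.diag (i - 1)) (S.diag i)).1, (exch (S.diag (i - 1)) (S.diag i)).2,
          S.diag (i + 1)) := by
    by_cases hb : (S.diag i < S.diag (i - 1) ∧ S.diag (i - 1) < S.diag (i + 1)) ∨
        (S.diag (i + 1) < S.diag (i - 1) ∧ S.diag (i - 1) < S.diag i)
    · refine ⟨i, .inr rfl, by omega, ?_, ?_⟩
      · rcases hb with ⟨g1, g2⟩ | ⟨g1, g2⟩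
        · obtain ⟨a1, a2, a3⟩ := lo_mid_hi_left (f := S.diag) g1 g2.le
          refine d_of_extremes (by rw [a2]; exact n1'.symm) (by rw [a1, a2]; exact n1'.symm)
            (by rw [a2, a3]; exact hx) (.inl ⟨?_, ?_, a1, a3⟩)
          · rw [a1]; exact letterAt_mid n1' rfl
          · rw [a3]; exact letterAt_right hx n2'
        · obtain ⟨a1, a2, a3⟩ := lo_mid_hi_left' (f := S.diag) g2 g1.le
          refine d_of_extremes (by rw [a2]; exact n1'.symm) (by rw [a1, a2]; exact Ne.symm hx)
            (by rw [a2, a3]; exact n1') (.inr ⟨?_, ?_, a1, a3⟩)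
          · rw [a1]; exact letterAt_right hx n2'
          · rw [a3]; exact letterAt_mid n1' rfl
      · rw [if_pos rfl]
        unfold tri
        simp only
        rw [if_neg (by omega), if_neg hx, if_pos hb]
    · have hii : i - 1 + 1 = i := by omega
      refine ⟨i - 1, .inl hii, by rw [hii]; omega, ?_, ?_⟩
      · have hb' : (S.diag i < S.diag (i + 1) ∧ S.diag (i + 1) < S.diag (i - 1)) ∨
            (S.diag (i - 1) < S.diag (i + 1) ∧ S.diag (i + 1) < S.diag i) := by omega
        rcases hb' with ⟨g1, g2⟩ | ⟨g1, g2⟩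
        · obtain ⟨a1, a2, a3⟩ := lo_mid_hi_right (f := S.diag) g1 g2.le
          refine d_of_extremes (by rw [a2]; exact n2') (by rw [a1, a2]; exact n2')
            (by rw [a2, a3]; exact Ne.symm hx) (.inr ⟨?_, ?_, by rw [hii, a1], a3⟩)
          · rw [a1, hii]; exact letterAt_mid n1' rfl
          · rw [a3]; exact letterAt_left rfl
        · obtain ⟨a1, a2, a3⟩ := lo_mid_hi_right' (f := S.diag) g2 g1.le
          refine d_of_extremes (by rw [a2]; exact n2') (by rw [a1, a2]; exact hx)
            (by rw [a2, a3]; exact n2'.symm) (.inl ⟨?_, ?_, a1, by rw [hii, a3]⟩)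
          · rw [a1]; exact letterAt_left rfl
          · rw [a3, hii]; exact letterAt_mid n1' rfl
      · rw [if_neg (by omega)]
        unfold tri
        simp only
        rw [if_neg (by omega), if_neg hx, if_neg hb]
  have hop : S.Occurs p ∧ S.Occurs (p + 1) := by
    rcases hp with rfl | rfl
    · exact ⟨⟨c0, by rw [hc0, Nat.add_sub_cancel]⟩, ⟨c1, hc1⟩⟩
    · exact ⟨⟨c1, hc1⟩, ⟨c2, hc2⟩⟩
  have hpne : |S.diag p| ≠ |S.diag (p + 1)| := by
    rcases hp with rfl | rfl
    · rw [Nat.add_sub_cancel] at n1; exact n1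
    · exact n2
  by_cases hadj : |(|S.diag p| - |S.diag (p + 1)|)| = 1
  · rw [if_pos hadj] at hd
    -- The median lies strictly between the two diagonals, so they differ by at least two. With
    -- adjacent absolute values, neither is `0`, and toggling puts no mark on the main diagonal.
    have hnz : S.diag p ≠ 0 ∧ S.diag (p + 1) ≠ 0 := by
      constructor <;> intro g <;> rw [g] at hadj hgap
      · rw [abs_zero, zero_sub, abs_neg, abs_abs] at hadj
        rcases abs_cases (S.diag (p + 1)) with g | g <;> omega
      · rw [abs_zero, sub_zero, abs_abs] at hadj
        rcases abs_cases (S.diag p) with g | g <;> omega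
    have hdg : ∀ k, (S.d i).diag k = if k = p ∨ k = p + 1 then -S.diag k else S.diag k := by
      intro k
      rw [hd]
      by_cases g2 : k = p + 1
      · rw [g2, diag_toggle_self, diag_toggle_of_ne (by omega), if_pos (.inr rfl)]
      · rw [diag_toggle_of_ne g2]
        by_cases g1 : k = p
        · rw [g1, diag_toggle_self, if_pos (.inl rfl)]
        · rw [diag_toggle_of_ne g1, if_neg (by omega)]
    refine ⟨by rw [hd]; exact (h.toggle _).toggle _, ?_, ?_⟩
    · rw [hd]
      refine isMonotone_toggle (h.toggle _).inj (isMonotone_toggle h.inj hS hnz.1) ?_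
      rw [diag_toggle_of_ne (by omega)]; exact hnz.2
    · intro k k1 k2
      rw [hdE k k1 k2, hdg, htri]
      rcases hp with rfl | rfl
      · rw [if_neg (show ¬ p = p + 1 by omega), Nat.add_sub_cancel,
          show exch (S.diag p) (S.diag (p + 1)) = _ from if_pos hadj]
        by_cases g1 : e k = p
        · rw [if_pos (.inl g1), if_pos g1, g1]
        by_cases g2 : e k = p + 1
        · rw [if_pos (.inr g2), if_neg g1, if_pos g2, g2]
        rw [if_neg (by omega), if_neg g1, if_neg g2]
        split_ifs with g3
        · rw [g3]
        · rfl
      · rw [if_pos rfl, show exch (S.diag p) (S.diag (p + 1)) = _ from if_pos hadj]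
        by_cases g1 : e k = p
        · rw [if_pos (.inl g1), if_neg (by omega), if_pos g1, g1]
        by_cases g2 : e k = p + 1
        · rw [if_pos (.inr g2), if_neg (by omega), if_neg g1, if_pos g2, g2]
        rw [if_neg (by omega), if_neg g1, if_neg g2]
        split_ifs with g3
        · rw [g3]
        · rfl
  · rw [if_neg hadj] at hd
    have hdg : ∀ k, 1 ≤ k → k ≤ γ.size →
        (S.d i).diag (e k) = dE j (fun k => S.diag (e k)) k := by
      intro k k1 k2
      rw [hdE k k1 k2, hd, diag_swap', htri]
      rcases hp with rfl | rfl
      · rw [if_neg (show ¬ p = p + 1 by omega), Nat.add_sub_cancel,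
          show exch (S.diag p) (S.diag (p + 1)) = _ from if_neg hadj]
        by_cases g1 : e k = p
        · rw [if_pos g1, g1, Equiv.swap_apply_left]
        by_cases g2 : e k = p + 1
        · rw [if_neg g1, if_pos g2, g2, Equiv.swap_apply_right]
        rw [if_neg g1, if_neg g2, Equiv.swap_apply_of_ne_of_ne g1 g2]
        split_ifs with g3
        · rw [g3]
        · rfl
      · rw [if_pos rfl, show exch (S.diag p) (S.diag (p + 1)) = _ from if_neg hadj]
        by_cases g1 : e k = p
        · rw [if_neg (by omega), if_pos g1, g1, Equiv.swap_apply_left]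
        by_cases g2 : e k = p + 1
        · rw [if_neg (by omega), if_neg g1, if_pos g2, g2, Equiv.swap_apply_right]
        rw [if_neg g1, if_neg g2, Equiv.swap_apply_of_ne_of_ne g1 g2]
        split_ifs with g3
        · rw [g3]
        · rfl
    refine ⟨by rw [hd]; exact h.swap_of_occurs hop.1 hop.2, ?_, hdg⟩
    rw [hd] at hdg ⊢
    exact isMonotone_swap h hS hop.1 hop.2 hpne (hchd.congr fun k k1 k2 => (hdg k k1 k2).symm)

/-- Letter `1` is on diagonal `0` and letter `2` on `±1`; `exch` negates both, which only toggles
the mark on `2`. -/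
theorem Labels.d0_spec (h : Labels S e) (hS : S.IsMonotone) (hn : 2 ≤ γ.size) (h1 : e 1 = 1)
    (h2 : e 2 = 2) : Labels S.d0 e ∧ S.d0.IsMonotone ∧
      ∀ k, 1 ≤ k → k ≤ γ.size → S.d0.diag (e k) = d0E (fun k => S.diag (e k)) k := by
  obtain ⟨hch, -⟩ := h.isChain hS
  have b1 := emp_chain_lt hch (k := 1) (by omega) (by omega)
  have b2 := emp_chain_lt hch (k := 2) (by omega) (by omega)
  have n1 := isShape_emp.ne_of_chain (hch 0 (by omega)) (hch 1 (by omega))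
  simp only [h1, h2, zero_add, show 1 + 1 = 2 from rfl] at b1 b2 n1
  have z1 : S.diag 1 = 0 := by rw [← abs_eq_zero]; have := abs_nonneg (S.diag 1); omega
  rw [z1, abs_zero] at n1
  have z2 : S.diag 2 ≠ 0 := fun g => n1 (by rw [g, abs_zero])
  have ha := abs_pos.2 z2
  refine ⟨h.toggle 2, isMonotone_toggle h.inj hS z2, fun k k1 k2 => ?_⟩
  show (S.toggle 2).diag (e k) = _
  have hex : exch (S.diag (e 1)) (S.diag (e 2)) = (-S.diag (e 1), -S.diag (e 2)) := by
    unfold exch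
    rw [if_pos]
    rw [h1, h2, z1, abs_zero, zero_sub, abs_neg, abs_abs]; omega
  by_cases g1 : k = 1
  · rw [g1, d0E_one, hex, h1, diag_toggle_of_ne (by omega), z1]; rfl
  by_cases g2 : k = 2
  · rw [g2, d0E_two, hex, h2, diag_toggle_self]
  rw [d0E_of_ne g1 g2, diag_toggle_of_ne]
  intro g
  exact g2 (h.mono.injOn ⟨k1, k2⟩ ⟨by omega, hn⟩ (g.trans h2.symm))

end QueerDual

namespace QueerDual
variable {γ δ : StrictPartition} {S S' : SignedFilling γ} {T : SignedFilling δ} {e e' : ℕ → ℕ}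
  {f g : ℕ → ℤ} {z w : ℕ → ℤ} {N n k l a b i j p : ℕ} {L : List ℤ} {q : List (ℤ → Bool)}

/-! ### Lists of far parts -/

/-- The far parts `V, V + 3, …, V + 3 (N - 1)`. -/
def farList (V N : ℕ) : List ℤ := (List.range N).map fun p : ℕ => (V + 3 * p : ℤ)

theorem mem_farList {V : ℕ} {Y : ℤ} : Y ∈ farList V N ↔ ∃ p < N, (V + 3 * p : ℤ) = Y := by
  simp [farList]

theorem length_farList (V N : ℕ) : (farList V N).length = N := by simp [farList]

theorem farList_sep (V N : ℕ) : (farList V N).Pairwise (· + 2 ≤ ·) := by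
  unfold farList
  rw [List.pairwise_map]
  exact (List.pairwise_lt_range (n := N)).imp fun h => by omega

/-! ### Labellings -/

theorem eqOn_of_image_eq (he : StrictMonoOn e (Set.Icc 1 N)) (he' : StrictMonoOn e' (Set.Icc 1 N))
    (h : ∀ k, 1 ≤ k → k ≤ N → ∃ l, 1 ≤ l ∧ l ≤ N ∧ e k = e' l)
    (h' : ∀ k, 1 ≤ k → k ≤ N → ∃ l, 1 ≤ l ∧ l ≤ N ∧ e' k = e l) :
    ∀ k, 1 ≤ k → k ≤ N → e k = e' k := by
  intro k
  induction k using Nat.strong_induction_on with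
  | _ k ih =>
    intro h1 h2
    obtain ⟨l, l1, l2, hl⟩ := h k h1 h2
    obtain ⟨l', l1', l2', hl'⟩ := h' k h1 h2
    refine le_antisymm ?_ ?_
    · rw [hl']
      refine (he.le_iff_le ⟨h1, h2⟩ ⟨l1', l2'⟩).2 ?_
      by_contra hlt
      have := he' ⟨l1', l2'⟩ ⟨h1, h2⟩ (not_le.1 hlt)
      rw [← ih l' (not_le.1 hlt) l1' l2'] at this
      omega
    · rw [hl]
      refine (he'.le_iff_le ⟨h1, h2⟩ ⟨l1, l2⟩).2 ?_
      by_contra hlt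
      have := he ⟨l1, l2⟩ ⟨h1, h2⟩ (not_le.1 hlt)
      rw [ih l (not_le.1 hlt) l1 l2] at this
      omega

theorem Labels.occurs_iff (h : Labels S e) : S.Occurs k ↔ ∃ j, 1 ≤ j ∧ j ≤ γ.size ∧ k = e j := by
  constructor
  · rintro ⟨c, rfl⟩; exact h.range c
  · rintro ⟨j, h1, h2, rfl⟩; exact h.surj j h1 h2

theorem Labels.eqOn (h : Labels S e) (h' : Labels S' e') (ho : ∀ k, S.Occurs k ↔ S'.Occurs k) :
    ∀ k, 1 ≤ k → k ≤ γ.size → e k = e' k :=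
  eqOn_of_image_eq h.mono h'.mono
    (fun k h1 h2 => h'.occurs_iff.1 ((ho _).1 (h.surj k h1 h2)))
    (fun k h1 h2 => h.occurs_iff.1 ((ho _).2 (h'.surj k h1 h2)))

theorem Labels.congr (h : Labels S e) (he : ∀ k, 1 ≤ k → k ≤ γ.size → e k = e' k) :
    Labels S e' := by
  refine ⟨fun k hk l hl hkl => ?_, h.inj, fun k h1 h2 => ?_, fun c => ?_⟩
  · rw [← he k hk.1 hk.2, ← he l hl.1 hl.2]; exact h.mono hk hl hkl
  · rw [← he k h1 h2]; exact h.surj k h1 h2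
  · obtain ⟨k, h1, h2, h3⟩ := h.range c
    exact ⟨k, h1, h2, h3.trans (he k h1 h2)⟩

theorem exists_strictMonoOn (A : Finset ℕ) (hA : A.card = N) :
    ∃ e : ℕ → ℕ, StrictMonoOn e (Set.Icc 1 N) ∧ (∀ k, 1 ≤ k → k ≤ N → e k ∈ A) ∧
      ∀ x ∈ A, ∃ k, 1 ≤ k ∧ k ≤ N ∧ x = e k := by
  refine ⟨fun k => if h : k - 1 < N then A.orderEmbOfFin hA ⟨k - 1, h⟩ else 0, ?_, ?_, ?_⟩
  · intro k hk l hl hkl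
    obtain ⟨k1, k2⟩ := hk
    obtain ⟨l1, l2⟩ := hl
    simp only
    rw [dif_pos (by omega), dif_pos (by omega)]
    refine (A.orderEmbOfFin hA).strictMono ?_
    rw [Fin.lt_def]; simp only; omega
  · intro k h1 h2
    simp only
    rw [dif_pos (by omega)]
    exact A.orderEmbOfFin_mem hA _
  · intro x hx
    have : x ∈ Set.range (A.orderEmbOfFin hA) := by rw [A.range_orderEmbOfFin hA]; exact hx
    obtain ⟨⟨k, hk⟩, rfl⟩ := this
    refine ⟨k + 1, by omega, by omega, ?_⟩
    simp only
    rw [dif_pos (by omega)]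
    rfl

theorem exists_labels_of_injective (hS : Function.Injective fun c => (S c).1) :
    ∃ e, Labels S e := by
  obtain ⟨e, h1, h2, h3⟩ := exists_strictMonoOn (N := γ.size)
    (Finset.univ.image fun c => (S c).1) (by
      rw [Finset.card_image_of_injective _ hS, Finset.card_univ, Fintype.card_coe, card_cells])
  refine ⟨e, h1, hS, fun k k1 k2 => ?_, fun c => ?_⟩
  · simpa using h2 k k1 k2
  · exact h3 _ (Finset.mem_image_of_mem _ (Finset.mem_univ c))

/-! ### Words of fillings -/

/-- The word `f` inserts to the filling `S` with letters `e 1 < e 2 < ⋯` and recording data `q`. -/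
structure Half (L : List ℤ) (S : SignedFilling γ) (e : ℕ → ℕ) (f : ℕ → ℤ)
    (q : List (ℤ → Bool)) : Prop where
  labels : Labels S e
  mono : S.IsMonotone
  word : Word emp 0 L γ.size fun k => f (e k)
  diag : ∀ k, 1 ≤ k → k ≤ γ.size → rsk emp L (fun k => f (e k)) k = S.diag (e k)
  recs_eq : recs emp γ.size L (fun k => f (e k)) = q

theorem Half.congr (h : Half L S e f q)
    (hf : ∀ k, 1 ≤ k → k ≤ γ.size → f (e k) = g (e k)) : Half L S e g q :=
  ⟨h.labels, h.mono, h.word.congr hf,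
    fun k h1 h2 => (rsk_congr hf h1 h2).symm.trans (h.diag k h1 h2),
    (recs_congr hf).symm.trans h.recs_eq⟩

theorem Half.congr_labels (h : Half L S e f q)
    (he : ∀ k, 1 ≤ k → k ≤ γ.size → e k = e' k) : Half L S e' f q := by
  have hf : ∀ k, 1 ≤ k → k ≤ γ.size → f (e k) = f (e' k) := fun k h1 h2 => by rw [he k h1 h2]
  exact ⟨h.labels.congr he, h.mono, h.word.congr hf,
    fun k h1 h2 => by rw [← he k h1 h2, ← h.diag k h1 h2]; exact (rsk_congr hf h1 h2).symm,
    (recs_congr hf).symm.trans h.recs_eq⟩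

theorem Half.mem (h : Half L S e f q) (hk : S.Occurs k) : -f k ∈ L := by
  obtain ⟨j, h1, h2, rfl⟩ := h.labels.occurs_iff.1 hk
  rcases h.word.letters j h1 h2 with h3 | ⟨Y, hY, h3⟩
  · have := abs_nonneg (f (e j)); omega
  · rw [h3, neg_neg]; exact hY

theorem Half.ne (h : Half L S e f q) (ha : S.Occurs a) (hb : S.Occurs b) (hab : a ≠ b) :
    f a ≠ f b := by
  wlog hlt : a < b generalizing a b
  · exact (this hb ha hab.symm (by omega)).symm
  obtain ⟨j, j1, j2, rfl⟩ := h.labels.occurs_iff.1 ha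
  obtain ⟨l, l1, l2, rfl⟩ := h.labels.occurs_iff.1 hb
  intro he
  have hm := h.mem hb
  exact h.word.far_inj hm j1 ((h.labels.lt_iff j1 j2 l1 l2).1 hlt) l2
    (by rw [he, neg_neg]) (by rw [neg_neg])

/-- Letters without another letter of `S` between them are consecutive after relabelling, and
insertion preserves the order of consecutive letters. -/
theorem Half.diag_lt_iff (h : Half L S e f q) (ha : S.Occurs a) (hb : S.Occurs b) (hab : a ≠ b)
    (hno : ∀ k, S.Occurs k → ¬ (a < k ∧ k < b) ∧ ¬ (b < k ∧ k < a)) :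
    S.diag b < S.diag a ↔ f b < f a := by
  have hne := h.ne ha hb hab
  obtain ⟨j, j1, j2, rfl⟩ := h.labels.occurs_iff.1 ha
  obtain ⟨l, l1, l2, rfl⟩ := h.labels.occurs_iff.1 hb
  have hsucc : ∀ j l, 1 ≤ j → j ≤ γ.size → 1 ≤ l → l ≤ γ.size → e j < e l →
      (∀ k, S.Occurs k → ¬ (e j < k ∧ k < e l)) → l = j + 1 := by
    intro j l j1 j2 l1 l2 hlt hno
    have h1 := (h.labels.lt_iff j1 j2 l1 l2).1 hlt
    by_contra hc
    refine hno (e (j + 1)) (h.labels.surj _ (by omega) (by omega)) ⟨?_, ?_⟩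
    · exact (h.labels.lt_iff j1 j2 (by omega) (by omega)).2 (by omega)
    · exact (h.labels.lt_iff (by omega) (by omega) l1 l2).2 (by omega)
  have hlt : ∀ j, 1 ≤ j → j + 1 ≤ γ.size →
      (S.diag (e j) < S.diag (e (j + 1)) ↔ f (e j) < f (e (j + 1))) ∧
      S.diag (e j) ≠ S.diag (e (j + 1)) := by
    intro j h1 h2
    have hr := h.word.rsk_lt_iff (i := j) h1 (by omega)
    rw [h.diag j h1 (by omega), h.diag (j + 1) (by omega) h2] at hr
    refine ⟨hr, fun he => ?_⟩
    obtain ⟨hch, -⟩ := h.labels.isChain h.mono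
    have c1 := hch (j - 1) (by omega)
    have c2 := hch j (by omega)
    obtain ⟨j', rfl⟩ : ∃ j', j = j' + 1 := ⟨j - 1, by omega⟩
    exact (isShape_emp.shp _ j').ne_of_chain c1 c2 (congrArg _ he)
  rcases lt_or_gt_of_ne hab with hlt' | hlt'
  · obtain rfl := hsucc j l j1 j2 l1 l2 hlt' fun k hk => (hno k hk).1
    have := hlt j j1 l2
    omega
  · obtain rfl := hsucc l j l1 l2 j1 j2 hlt' fun k hk => (hno k hk).2
    exact (hlt l l1 j2).1

theorem dE_comp (he : Labels S e) (h1 : e (j - 1) = e j - 1) (h2 : e (j + 1) = e j + 1)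
    (hj : 1 < j) (hjn : j < γ.size) (k1 : 1 ≤ k) (k2 : k ≤ γ.size) :
    dE (e j) f (e k) = dE j (fun k => f (e k)) k := by
  unfold dE triple
  rw [← h1, ← h2]
  have i1 : e k = e (j - 1) ↔ k = j - 1 :=
    ⟨fun g => he.mono.injOn ⟨k1, k2⟩ ⟨by omega, by omega⟩ g, fun g => by rw [g]⟩
  have i2 : e k = e j ↔ k = j :=
    ⟨fun g => he.mono.injOn ⟨k1, k2⟩ ⟨by omega, by omega⟩ g, fun g => by rw [g]⟩
  have i3 : e k = e (j + 1) ↔ k = j + 1 :=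
    ⟨fun g => he.mono.injOn ⟨k1, k2⟩ ⟨by omega, by omega⟩ g, fun g => by rw [g]⟩
  simp only [i1, i2, i3]

/-- Far diagonals are pairwise non-adjacent and distinct, so `tri` merely permutes them: this is the
classical dual equivalence of permutations. -/
theorem Word.dE (h : Word emp 0 L n z) (hj : 1 < j) (hjn : j < n) :
    Word emp 0 L n (QueerDual.dE j z) := by
  refine { h with chain := h.shape_base.isChain_dE h.chain hj hjn, letters := ?_ }
  have hneg : ∀ k, 1 ≤ k → k ≤ n → ∃ Y ∈ L, z k = -Y := fun k k1 k2 => by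
    rcases h.letters k k1 k2 with h3 | h3
    · have := abs_nonneg (z k); omega
    · exact h3
  obtain ⟨Y1, m1, e1⟩ := hneg (j - 1) (by omega) (by omega)
  obtain ⟨Y2, m2, e2⟩ := hneg j (by omega) (by omega)
  obtain ⟨Y3, m3, e3⟩ := hneg (j + 1) (by omega) (by omega)
  have p1 := h.lt_abs_far m1
  have p2 := h.lt_abs_far m2
  have p3 := h.lt_abs_far m3
  have f12 := h.far_eq_or m1 m2
  have f23 := h.far_eq_or m2 m3
  have x12 : exch (-Y1) (-Y2) = (-Y2, -Y1) := by
    unfold exch; rw [if_neg]; grind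
  have x23 : exch (-Y2) (-Y3) = (-Y3, -Y2) := by
    unfold exch; rw [if_neg]; grind
  have ht := h.chain.chain3 hj hjn
  intro k k1 k2
  right
  by_cases g : k = j - 1 ∨ k = j ∨ k = j + 1
  · have n1 : (z (j - 1) = z (j + 1)) → False := fun he => by
      rw [e1, e3] at he
      exact h.far_inj m3 (k := j - 1) (l := j + 1) (by omega) (by omega) (by omega)
        (by rw [e1]; exact he) e3
    have ht : ∃ A B C, A ∈ L ∧ B ∈ L ∧ C ∈ L ∧ tri (triple z j) = (-A, -B, -C) := by
      unfold tri triple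
      simp only
      rw [if_neg n1, e1, e2, e3, x12, x23]
      split_ifs
      · exact ⟨Y1, Y2, Y3, m1, m2, m3, rfl⟩
      · exact ⟨Y1, Y3, Y2, m1, m3, m2, rfl⟩
      · exact ⟨Y2, Y1, Y3, m2, m1, m3, rfl⟩
    obtain ⟨A, B, C, hA, hB, hC, ht⟩ := ht
    rcases g with rfl | rfl | rfl
    · exact ⟨A, hA, by rw [dE_left, ht]⟩
    · exact ⟨B, hB, by rw [dE_mid hj, ht]⟩
    · exact ⟨C, hC, by rw [dE_right hj, ht]⟩
  · rw [dE_of_ne (by omega) (by omega) (by omega)]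
    exact hneg k k1 k2
end QueerDual

/-! ### Action of the involutions on the word of one filling -/

namespace QueerDual
variable {γ δ : StrictPartition} {S S' : SignedFilling γ} {T : SignedFilling δ} {e e' : ℕ → ℕ}
  {f g : ℕ → ℤ} {z w : ℕ → ℤ} {N n k l a b i j p : ℕ} {L : List ℤ} {q q1 q2 : List (ℤ → Bool)}
  {X X' : SignedFilling γ × SignedFilling δ}

theorem Half.dE (h : Half L S e f q) (hj : 1 < j) (hjn : j < γ.size)
    (h1 : e (j - 1) = e j - 1) (h2 : e (j + 1) = e j + 1)
    (hm : ¬ (S.diag (e j - 1) < S.diag (e j) ↔ S.diag (e j) < S.diag (e j + 1))) :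
    Half L (S.d (e j)) e (QueerDual.dE (e j) f) q := by
  obtain ⟨a1, a2, a3⟩ := h.labels.d_spec h.mono hj hjn h1 h2 hm
  have hc : ∀ k, 1 ≤ k → k ≤ γ.size → QueerDual.dE j (fun k => f (e k)) k =
      QueerDual.dE (e j) f (e k) := fun k k1 k2 => (dE_comp h.labels h1 h2 hj hjn k1 k2).symm
  obtain ⟨r1, r2⟩ := h.word.rsk_dE hj hjn
  refine ⟨a1, a2, (h.word.dE hj hjn).congr hc, fun k k1 k2 => ?_, ?_⟩
  · rw [a3 k k1 k2, ← rsk_congr hc k1 k2, r1]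
    exact dE_congr hj hjn h.diag k1 k2
  · rw [← recs_congr hc, r2, h.recs_eq]

/-- If only one of `p`, `p + 1` occurs, the swap relabels the letters in an order-preserving way;
the sequence that is inserted does not change. -/
theorem Half.swap_of_not (h : Half L S e f q) (hp : ¬ (S.Occurs p ∧ S.Occurs (p + 1))) :
    Half L (S.swap p (p + 1)) (Equiv.swap p (p + 1) ∘ e) (fun k => f (Equiv.swap p (p + 1) k))
      q := by
  have hf : (fun k => f (Equiv.swap p (p + 1) ((Equiv.swap p (p + 1) ∘ e) k))) =
      fun k => f (e k) := by
    funext k; rw [Function.comp_apply, Equiv.swap_apply_self]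
  refine ⟨h.labels.swap_of_not hp, isMonotone_swap_of_not h.mono hp, ?_, ?_, ?_⟩
  · rw [hf]; exact h.word
  · intro k h1 h2
    rw [hf, h.diag k h1 h2, Function.comp_apply, diag_swap]
  · rw [hf]; exact h.recs_eq

theorem dE_comp_far (h12 : |(|f (i - 1)| - |f i|)| ≠ 1) (h23 : |(|f i| - |f (i + 1)|)| ≠ 1)
    (hne : f (i - 1) ≠ f (i + 1)) (hi : 1 < i) :
    ((f (i - 1) < f i ↔ f i < f (i + 1)) → f i ≠ f (i - 1) → f i ≠ f (i + 1) → dE i f = f) ∧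
    (((f i < f (i - 1) ∧ f (i - 1) < f (i + 1)) ∨ (f (i + 1) < f (i - 1) ∧ f (i - 1) < f i)) →
      dE i f = fun k => f (Equiv.swap i (i + 1) k)) ∧
    (((f i < f (i + 1) ∧ f (i + 1) < f (i - 1)) ∨ (f (i - 1) < f (i + 1) ∧ f (i + 1) < f i)) →
      dE i f = fun k => f (Equiv.swap (i - 1) i k)) := by
  refine ⟨fun h h1 h2 => ?_, fun h => ?_, fun h => ?_⟩
  · have ht : tri (triple f i) = (f (i - 1), f i, f (i + 1)) := tri_eq_self (by omega)
    funext k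
    unfold dE
    rw [ht]
    split_ifs with g1 g2 g3
    · rw [g1]
    · rw [g2]
    · rw [g3]
    · rfl
  · have ht : tri (triple f i) = (f (i - 1), f (i + 1), f i) := by
      unfold tri triple exch
      simp only
      rw [if_neg (by omega), if_neg hne, if_pos h, if_neg h23]
    funext k
    unfold dE
    rw [ht]
    by_cases g1 : k = i
    · rw [g1, if_neg (by omega), if_pos rfl, Equiv.swap_apply_left]
    by_cases g2 : k = i + 1
    · rw [g2, if_neg (by omega), if_neg (by omega), if_pos rfl, Equiv.swap_apply_right]
    rw [if_neg g1, if_neg g2, Equiv.swap_apply_of_ne_of_ne g1 g2]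
    split_ifs with g3
    · rw [g3]
    · rfl
  · have ht : tri (triple f i) = (f i, f (i - 1), f (i + 1)) := by
      unfold tri triple exch
      simp only
      rw [if_neg (by omega), if_neg hne, if_neg (by omega), if_neg h12]
    funext k
    unfold dE
    rw [ht]
    by_cases g1 : k = i - 1
    · rw [g1, if_pos rfl, Equiv.swap_apply_left]
    by_cases g2 : k = i
    · rw [g2, if_neg (by omega), if_pos rfl, Equiv.swap_apply_right]
    rw [if_neg g1, if_neg g2, Equiv.swap_apply_of_ne_of_ne g1 g2]
    split_ifs with g3
    · rw [g3]
    · rfl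

theorem mem_tensorTableaux : X ∈ tensorTableaux γ δ ↔
    X.1.IsMonotone ∧ X.2.IsMonotone ∧ (Function.Injective fun c => (X.1 c).1) ∧
      (Function.Injective fun c => (X.2 c).1) ∧ (∀ k, X.1.Occurs k → ¬ X.2.Occurs k) ∧
      ∀ k, X.1.Occurs k ∨ X.2.Occurs k ↔ 1 ≤ k ∧ k ≤ γ.size + δ.size := by
  unfold tensorTableaux
  simp only [Finset.mem_filter, Finset.mem_product, Fintype.mem_piFinset, Finset.mem_univ,
    and_true, Finset.mem_Icc]
  constructor
  · rintro ⟨-, ⟨h1, h2⟩, h3, h4⟩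
    refine ⟨h3, h4, fun c d h => ?_, fun c d h => ?_, ?_, fun k => ?_⟩
    · exact Sum.inl_injective (h1 (a₁ := .inl c) (a₂ := .inl d) h)
    · exact Sum.inr_injective (h1 (a₁ := .inr c) (a₂ := .inr d) h)
    · rintro k ⟨c, hc⟩ ⟨d, hd⟩
      have := h1 (a₁ := .inl c) (a₂ := .inr d) (hc.trans hd.symm)
      cases this
    · have h : k ∈ Finset.univ.image (fun c => (Sum.elim X.1 X.2 c).1) ↔
          k ∈ Finset.Icc 1 (γ.size + δ.size) := by rw [h2]
      simp only [Finset.mem_image, Finset.mem_univ, true_and, Sum.exists, Sum.elim_inl,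
        Sum.elim_inr, Finset.mem_Icc] at h
      exact h
  · rintro ⟨h3, h4, h1, h2, h5, h6⟩
    refine ⟨⟨fun c => (h6 _).1 (.inl ⟨c, rfl⟩), fun c => (h6 _).1 (.inr ⟨c, rfl⟩)⟩, ⟨?_, ?_⟩, h3, h4⟩
    · rintro (c | c) (d | d) h
      · rw [h1 h]
      · exact (h5 _ ⟨c, rfl⟩ ⟨d, h.symm⟩).elim
      · exact (h5 _ ⟨d, rfl⟩ ⟨c, h⟩).elim
      · rw [h2 h]
    · ext k
      simp only [Finset.mem_image, Finset.mem_univ, true_and, Sum.exists, Sum.elim_inl,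
        Sum.elim_inr, Finset.mem_Icc]
      exact h6 k

/-! ### Words of tableaux of concatenated shape -/

/-- The word `f` inserts to the two fillings of `X`, with recording data `q1` and `q2`. -/
structure Rep (q1 q2 : List (ℤ → Bool)) (X : SignedFilling γ × SignedFilling δ) (f : ℕ → ℤ) :
    Prop where
  mem : X ∈ tensorTableaux γ δ
  left : ∃ e, Half (farList (2 * (γ.size + δ.size) + 2) γ.size) X.1 e f q1
  right : ∃ e, Half (farList (2 * (γ.size + δ.size) + 2 + 3 * γ.size) δ.size) X.2 e f q2

theorem Rep.occurs_or (h : Rep q1 q2 X f) (h1 : 1 ≤ k) (h2 : k ≤ γ.size + δ.size) :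
    X.1.Occurs k ∧ ¬ X.2.Occurs k ∨ ¬ X.1.Occurs k ∧ X.2.Occurs k := by
  obtain ⟨-, -, -, -, h5, h6⟩ := mem_tensorTableaux.1 h.mem
  have := h5 k
  have := (h6 k).2 ⟨h1, h2⟩
  tauto

theorem Rep.left_val (h : Rep q1 q2 X f) (hk : X.1.Occurs k) :
    ∃ p < γ.size, f k = -(2 * (γ.size + δ.size) + 2 + 3 * p) := by
  obtain ⟨e, he⟩ := h.left
  obtain ⟨p, hp, h'⟩ := mem_farList.1 (he.mem hk)
  exact ⟨p, hp, by push_cast at h'; linarith⟩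

theorem Rep.right_val (h : Rep q1 q2 X f) (hk : X.2.Occurs k) :
    ∃ p < δ.size, f k = -(2 * (γ.size + δ.size) + 2 + 3 * γ.size + 3 * p) := by
  obtain ⟨e, he⟩ := h.right
  obtain ⟨p, hp, h'⟩ := mem_farList.1 (he.mem hk)
  exact ⟨p, hp, by push_cast at h'; linarith⟩

/-- The far parts reserved for `δ` lie beyond those for `γ`, just as the word of the second filling
is read after that of the first. -/
theorem Rep.lt_of_left_right (h : Rep q1 q2 X f) (ha : X.1.Occurs a) (hb : X.2.Occurs b) :
    f b < f a := by
  obtain ⟨p, hp, h1⟩ := h.left_val ha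
  obtain ⟨r, hr, h2⟩ := h.right_val hb
  rw [h1, h2]; omega

theorem Rep.far (h : Rep q1 q2 X f) (ha1 : 1 ≤ a) (ha : a ≤ γ.size + δ.size)
    (hb1 : 1 ≤ b) (hb : b ≤ γ.size + δ.size) (hab : a ≠ b) :
    f a < 0 ∧ f b < 0 ∧ (f a + 2 ≤ f b ∨ f b + 2 ≤ f a) ∧ |(|f a| - |f b|)| ≠ 1 := by
  have key : f a < 0 ∧ f b < 0 ∧ (f a + 2 ≤ f b ∨ f b + 2 ≤ f a) := by
    rcases h.occurs_or ha1 ha with ⟨oa, -⟩ | ⟨-, oa⟩ <;>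
      rcases h.occurs_or hb1 hb with ⟨ob, -⟩ | ⟨-, ob⟩
    · obtain ⟨p, hp, h1⟩ := h.left_val oa
      obtain ⟨r, hr, h2⟩ := h.left_val ob
      obtain ⟨e, he⟩ := h.left
      have := he.ne oa ob hab
      omega
    · obtain ⟨p, hp, h1⟩ := h.left_val oa
      obtain ⟨r, hr, h2⟩ := h.right_val ob
      omega
    · obtain ⟨p, hp, h1⟩ := h.right_val oa
      obtain ⟨r, hr, h2⟩ := h.left_val ob
      omega
    · obtain ⟨p, hp, h1⟩ := h.right_val oa
      obtain ⟨r, hr, h2⟩ := h.right_val ob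
      obtain ⟨e, he⟩ := h.right
      have := he.ne oa ob hab
      omega
  refine ⟨key.1, key.2.1, key.2.2, ?_⟩
  rw [abs_of_neg key.1, abs_of_neg key.2.1]
  rcases abs_cases (-f a - -f b) with g | g <;> omega

theorem Rep.ne (h : Rep q1 q2 X f) (ha1 : 1 ≤ a) (ha : a ≤ γ.size + δ.size)
    (hb1 : 1 ≤ b) (hb : b ≤ γ.size + δ.size) (hab : a ≠ b) : f a ≠ f b := by
  have := h.far ha1 ha hb1 hb hab; omega

/-- Reading order is the order of decreasing `f`. Within one filling this is known only for letters
consecutive there; letters in different fillings are compared by `Rep.lt_of_left_right`. -/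
theorem Rep.pos_lt_iff (h : Rep q1 q2 X f) (ha1 : 1 ≤ a) (ha : a ≤ γ.size + δ.size)
    (hb1 : 1 ≤ b) (hb : b ≤ γ.size + δ.size) (hab : a ≠ b)
    (hno : ∀ k, ((X.1.Occurs a ∧ X.1.Occurs b ∧ X.1.Occurs k) ∨
        (X.2.Occurs a ∧ X.2.Occurs b ∧ X.2.Occurs k)) →
      ¬ (a < k ∧ k < b) ∧ ¬ (b < k ∧ k < a)) :
    tensorPos X a < tensorPos X b ↔ f b < f a := by
  unfold tensorPos tensorHook
  obtain ⟨m1, m2, i1, i2, -, -⟩ := mem_tensorTableaux.1 h.mem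
  have hl : ∀ {k}, X.1.Occurs k → (X.1.hook ++ X.2.hook).idxOf k = X.1.hook.idxOf k ∧
      X.1.hook.idxOf k < X.1.hook.length := fun hk =>
    ⟨List.idxOf_append_of_mem (mem_hook.2 hk), List.idxOf_lt_length_of_mem (mem_hook.2 hk)⟩
  have hr : ∀ {k}, ¬ X.1.Occurs k → (X.1.hook ++ X.2.hook).idxOf k =
      X.1.hook.length + X.2.hook.idxOf k := fun hk => by
    rw [List.idxOf_append_of_notMem (fun g => hk (mem_hook.1 g))]
  rcases h.occurs_or ha1 ha with ⟨oa, oa'⟩ | ⟨oa', oa⟩ <;>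
    rcases h.occurs_or hb1 hb with ⟨ob, ob'⟩ | ⟨ob', ob⟩
  · obtain ⟨e, he⟩ := h.left
    have hno' := fun k (hk : X.1.Occurs k) => hno k (.inl ⟨oa, ob, hk⟩)
    rw [(hl oa).1, (hl ob).1, idxOf_lt_iff i1 m1 oa ob hab hno', he.diag_lt_iff oa ob hab hno']
  · have := h.lt_of_left_right oa ob
    have h1 := hl oa
    rw [h1.1, hr ob']
    omega
  · have := h.lt_of_left_right ob oa
    have h1 := hl ob
    rw [h1.1, hr oa']
    omega
  · obtain ⟨e, he⟩ := h.right
    have hno' := fun k (hk : X.2.Occurs k) => hno k (.inr ⟨oa, ob, hk⟩)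
    rw [hr oa', hr ob', ← he.diag_lt_iff oa ob hab hno', ← idxOf_lt_iff i2 m2 oa ob hab hno']
    omega

theorem Rep.mem_tensorDes (h : Rep q1 q2 X f) :
    i ∈ tensorDes X ↔ 1 ≤ i ∧ i < γ.size + δ.size ∧ f i < f (i + 1) := by
  unfold tensorDes wordDes
  rw [Finset.mem_filter, Finset.mem_Ico, and_assoc]
  refine and_congr_right fun h1 => and_congr_right fun h2 => ?_
  exact h.pos_lt_iff (by omega) (by omega) (by omega) (by omega) (by omega) fun k _ => by omega

theorem Rep.congr (h : Rep q1 q2 X f)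
    (hf : ∀ k, 1 ≤ k → k ≤ γ.size + δ.size → f k = g k) : Rep q1 q2 X g := by
  obtain ⟨-, -, -, -, -, h6⟩ := mem_tensorTableaux.1 h.mem
  obtain ⟨⟨e, he⟩, ⟨e', he'⟩⟩ := And.intro h.left h.right
  refine ⟨h.mem, ⟨e, he.congr fun k h1 h2 => ?_⟩, ⟨e', he'.congr fun k h1 h2 => ?_⟩⟩
  · have := (h6 _).1 (.inl (he.labels.surj k h1 h2)); exact hf _ this.1 this.2
  · have := (h6 _).1 (.inr (he'.labels.surj k h1 h2)); exact hf _ this.1 this.2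

/-- A tableau determines its word. -/
theorem Rep.word_unique (h : Rep q1 q2 X f) (h' : Rep q1 q2 X g) (h1 : 1 ≤ k)
    (h2 : k ≤ γ.size + δ.size) : f k = g k := by
  have key : ∀ {ε : StrictPartition} {S : SignedFilling ε} {L e e' q},
      Half L S e f q → Half L S e' g q → S.Occurs k → f k = g k := by
    intro ε S L e e' q he he' hk
    obtain ⟨j, j1, j2, rfl⟩ := he.labels.occurs_iff.1 hk
    have he' := he'.congr_labels (he'.labels.eqOn he.labels fun _ => Iff.rfl)
    exact he.word.rsk_inj he'.word (he.recs_eq.trans he'.recs_eq.symm)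
      (fun k k1 k2 => (he.diag k k1 k2).trans (he'.diag k k1 k2).symm) j j1 j2
  rcases h.occurs_or h1 h2 with ⟨o, -⟩ | ⟨-, o⟩
  · obtain ⟨⟨e, he⟩, ⟨e', he'⟩⟩ := And.intro h.left h'.left
    exact key he he' o
  · obtain ⟨⟨e, he⟩, ⟨e', he'⟩⟩ := And.intro h.right h'.right
    exact key he he' o

/-- A word determines its tableau. -/
theorem Rep.unique {q1' q2'} (h : Rep q1 q2 X f) (h' : Rep q1' q2' X' g)
    (hf : ∀ k, 1 ≤ k → k ≤ γ.size + δ.size → f k = g k) : X = X' := by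
  have h' := h'.congr fun k h1 h2 => (hf k h1 h2).symm
  have hl : ∀ k, X.1.Occurs k ↔ X'.1.Occurs k := by
    have key : ∀ {q1 q2 q1' q2'} {X X' : SignedFilling γ × SignedFilling δ}, Rep q1 q2 X f →
        Rep q1' q2' X' f → ∀ k, X.1.Occurs k → X'.1.Occurs k := by
      intro q1 q2 q1' q2' X X' h h' k hk
      obtain ⟨-, -, -, -, -, h6⟩ := mem_tensorTableaux.1 h.mem
      have := (h6 _).1 (.inl hk)
      rcases h'.occurs_or this.1 this.2 with ⟨o, -⟩ | ⟨-, o⟩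
      · exact o
      · obtain ⟨p, hp, h1⟩ := h.left_val hk
        obtain ⟨r, hr, h2⟩ := h'.right_val o
        omega
    exact fun k => ⟨key h h' k, key h' h k⟩
  have hr : ∀ k, X.2.Occurs k ↔ X'.2.Occurs k := by
    intro k
    obtain ⟨-, -, -, -, h5, h6⟩ := mem_tensorTableaux.1 h.mem
    obtain ⟨-, -, -, -, h5', h6'⟩ := mem_tensorTableaux.1 h'.mem
    have := h5 k
    have := h5' k
    have := h6 k
    have := h6' k
    have := hl k
    tauto
  have key : ∀ {ε : StrictPartition} {S S' : SignedFilling ε} {L e e' q q'},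
      Half L S e f q → Half L S' e' f q' → (∀ k, S.Occurs k ↔ S'.Occurs k) → S = S' := by
    intro ε S S' L e e' q q' he he' ho
    have he' := he'.congr_labels (he'.labels.eqOn he.labels fun k => (ho k).symm)
    exact he.labels.ext he.mono he'.labels he'.mono fun k h1 h2 =>
      (he.diag k h1 h2).symm.trans (he'.diag k h1 h2)
  obtain ⟨⟨e, he⟩, ⟨e', he'⟩⟩ := And.intro h.left h'.left
  obtain ⟨⟨d, hd⟩, ⟨d', hd'⟩⟩ := And.intro h.right h'.right
  exact Prod.ext (key he he' hl) (key hd hd' hr)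

/-- With as many far parts as letters, undoing the insertion leaves no bounded letter, so the word
consists of far letters only and satisfies the sharper bound `0`. -/
theorem Labels.exists_half {V : ℕ} (h : Labels S e) (hS : S.IsMonotone)
    (hV : 2 * γ.size + 1 < V) :
    ∃ z : ℕ → ℤ, ∀ f : ℕ → ℤ, (∀ k, 1 ≤ k → k ≤ γ.size → f (e k) = z k) →
      ∃ q, Half (farList V γ.size) S e f q := by
  have hfar : ∀ Y ∈ farList V γ.size, (γ.size : ℤ) + (farList V γ.size).length + 1 < Y := by
    intro Y hY
    obtain ⟨p, -, rfl⟩ := mem_farList.1 hY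
    rw [length_farList]; omega
  obtain ⟨z, hz, hr, hc⟩ := exists_rsk_eq (h.isChain hS).1 (L := farList V γ.size)
    (by rw [length_farList]) hfar (farList_sep _ _)
  have hz0 : Word emp 0 (farList V γ.size) γ.size z := by
    have hl : ∀ k, 1 ≤ k → k ≤ γ.size → ∃ Y ∈ farList V γ.size, z k = -Y := by
      intro k h1 h2
      refine (hz.letters k h1 h2).resolve_left fun h3 => ?_
      rw [length_farList, Nat.sub_self, Nat.le_zero, Finset.card_eq_zero,
        Finset.filter_eq_empty_iff] at hc
      exact hc (Finset.mem_Icc.2 ⟨h1, h2⟩) h3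
    refine word_of_injOn isShape_emp le_rfl (fun s hs => emp_pos hs) (fun Y hY => ?_)
      (farList_sep _ _) (fun k h1 h2 => ?_) fun k l h1 h2 h3 he => ?_
    · have := hfar Y hY; omega
    · obtain ⟨Y, hY, h3⟩ := hl k h1 h2
      rw [h3, neg_neg]; exact hY
    · obtain ⟨Y, hY, h4⟩ := hl l (by omega) h3
      exact hz.far_inj hY h1 h2 h3 (he.trans h4) h4
  refine ⟨z, fun f hf => ⟨_, h, hS, hz0.congr fun k h1 h2 => (hf k h1 h2).symm, fun k h1 h2 => ?_,
    rfl⟩⟩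
  rw [rsk_congr hf h1 h2, hr k h1 h2]

/-- Every tableau of concatenated shape has a word. -/
theorem exists_rep (hX : X ∈ tensorTableaux γ δ) : ∃ q1 q2 f, Rep q1 q2 X f := by
  obtain ⟨m1, m2, i1, i2, h5, h6⟩ := mem_tensorTableaux.1 hX
  obtain ⟨e, he⟩ := exists_labels_of_injective i1
  obtain ⟨d, hd⟩ := exists_labels_of_injective i2
  obtain ⟨z, hz⟩ := he.exists_half m1 (V := 2 * (γ.size + δ.size) + 2) (by omega)
  obtain ⟨w, hw⟩ := hd.exists_half m2 (V := 2 * (γ.size + δ.size) + 2 + 3 * γ.size) (by omega)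
  classical
  let f : ℕ → ℤ := fun x => if h : ∃ k, 1 ≤ k ∧ k ≤ γ.size ∧ e k = x then z h.choose
    else if h : ∃ k, 1 ≤ k ∧ k ≤ δ.size ∧ d k = x then w h.choose else 0
  have hf1 : ∀ k, 1 ≤ k → k ≤ γ.size → f (e k) = z k := by
    intro k h1 h2
    have hex : ∃ l, 1 ≤ l ∧ l ≤ γ.size ∧ e l = e k := ⟨k, h1, h2, rfl⟩
    simp only [f]
    rw [dif_pos hex]
    obtain ⟨a1, a2, a3⟩ := hex.choose_spec
    rw [he.mono.injOn ⟨a1, a2⟩ ⟨h1, h2⟩ a3]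
  have hf2 : ∀ k, 1 ≤ k → k ≤ δ.size → f (d k) = w k := by
    intro k h1 h2
    have hex : ∃ l, 1 ≤ l ∧ l ≤ δ.size ∧ d l = d k := ⟨k, h1, h2, rfl⟩
    simp only [f]
    rw [dif_neg, dif_pos hex]
    · obtain ⟨a1, a2, a3⟩ := hex.choose_spec
      rw [hd.mono.injOn ⟨a1, a2⟩ ⟨h1, h2⟩ a3]
    · rintro ⟨l, l1, l2, l3⟩
      exact h5 _ (he.surj l l1 l2) (l3 ▸ hd.surj k h1 h2)
  obtain ⟨q1, hq1⟩ := hz f hf1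
  obtain ⟨q2, hq2⟩ := hw f hf2
  exact ⟨q1, q2, f, hX, ⟨e, hq1⟩, ⟨d, hq2⟩⟩

end QueerDual

namespace QueerDual
variable {γ δ : StrictPartition} {S S' : SignedFilling γ} {T : SignedFilling δ} {e e' : ℕ → ℕ}
  {f g : ℕ → ℤ} {z w : ℕ → ℤ} {N n k l a b i j p : ℕ} {L : List ℤ} {q q1 q2 : List (ℤ → Bool)}
  {X X' : SignedFilling γ × SignedFilling δ}

/-! ### The involutions on words -/

theorem occurs_swap : (S.swap a b).Occurs k ↔ S.Occurs (Equiv.swap a b k) := by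
  constructor
  · rintro ⟨c, rfl⟩
    exact ⟨c, by show _ = Equiv.swap a b (Equiv.swap a b (S c).1); rw [Equiv.swap_apply_self]⟩
  · rintro ⟨c, hc⟩
    exact ⟨c, by show Equiv.swap a b (S c).1 = k; rw [hc, Equiv.swap_apply_self]⟩

theorem Rep.of_halves (h : Rep q1 q2 X f) {S' : SignedFilling γ} {T' : SignedFilling δ}
    {d d' : ℕ → ℕ}
    (h1 : Half (farList (2 * (γ.size + δ.size) + 2) γ.size) S' d g q1)
    (h2 : Half (farList (2 * (γ.size + δ.size) + 2 + 3 * γ.size) δ.size) T' d' g q2)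
    (σ : ℕ → ℕ) (hσ : ∀ k, 1 ≤ σ k ∧ σ k ≤ γ.size + δ.size ↔ 1 ≤ k ∧ k ≤ γ.size + δ.size)
    (ho1 : ∀ k, S'.Occurs k ↔ X.1.Occurs (σ k)) (ho2 : ∀ k, T'.Occurs k ↔ X.2.Occurs (σ k)) :
    Rep q1 q2 (S', T') g := by
  obtain ⟨-, -, -, -, h5, h6⟩ := mem_tensorTableaux.1 h.mem
  refine ⟨mem_tensorTableaux.2 ⟨h1.mono, h2.mono, h1.labels.inj, h2.labels.inj, fun k => ?_,
    fun k => ?_⟩, ⟨_, h1⟩, ⟨_, h2⟩⟩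
  · simp only; rw [ho1, ho2]; exact h5 _
  · simp only; rw [ho1, ho2, h6, hσ]

theorem Rep.swap (h : Rep q1 q2 X f) (hp : 1 ≤ p) (hpn : p + 1 ≤ γ.size + δ.size)
    (h1 : ¬ (X.1.Occurs p ∧ X.1.Occurs (p + 1))) (h2 : ¬ (X.2.Occurs p ∧ X.2.Occurs (p + 1))) :
    Rep q1 q2 (X.1.swap p (p + 1), X.2.swap p (p + 1))
      (fun k => f (Equiv.swap p (p + 1) k)) := by
  obtain ⟨⟨e, he⟩, ⟨e', he'⟩⟩ := And.intro h.left h.right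
  refine h.of_halves (he.swap_of_not h1) (he'.swap_of_not h2) (Equiv.swap p (p + 1)) (fun k => ?_)
    (fun k => occurs_swap) fun k => occurs_swap
  rw [Equiv.swap_apply_def]
  split_ifs <;> omega

theorem Half.exists_index (h : Half L S e f q) (hi : 1 < i) (h1 : S.Occurs (i - 1))
    (h2 : S.Occurs i) (h3 : S.Occurs (i + 1)) :
    ∃ j, 1 < j ∧ j < γ.size ∧ e j = i ∧ e (j - 1) = e j - 1 ∧ e (j + 1) = e j + 1 := by
  obtain ⟨j, j1, j2, hj⟩ := h.labels.occurs_iff.1 h1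
  have e1 : e j + 1 = i := by omega
  obtain ⟨j3, hj3⟩ := h.labels.succ_eq j1 j2 (by rw [e1]; exact h2)
  obtain ⟨j4, hj4⟩ := h.labels.succ_eq (j := j + 1) (by omega) j3 (by rw [hj3, e1]; exact h3)
  exact ⟨j + 1, by omega, by omega, by omega, by rw [Nat.add_sub_cancel]; omega, hj4⟩

theorem Half.dE_of_occurs (h : Half L S e f q) (hi : 1 < i) (h1 : S.Occurs (i - 1))
    (h2 : S.Occurs i) (h3 : S.Occurs (i + 1)) (hm : ¬ (f (i - 1) < f i ↔ f i < f (i + 1))) :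
    Half L (S.d i) e (QueerDual.dE i f) q := by
  obtain ⟨j, j1, j2, rfl, j3, j4⟩ := h.exists_index hi h1 h2 h3
  refine h.dE j1 j2 j3 j4 ?_
  have d1 := h.diag_lt_iff h2 h1 (by omega) fun k _ => by omega
  have d2 := h.diag_lt_iff h3 h2 (by omega) fun k _ => by omega
  rwa [d1, d2]

theorem d0E_comp (he : Labels S e) (h1 : e 1 = 1) (h2 : e 2 = 2) (hn : 2 ≤ γ.size) (k1 : 1 ≤ k)
    (k2 : k ≤ γ.size) : d0E f (e k) = d0E (fun k => f (e k)) k := by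
  have i1 : e k = 1 ↔ k = 1 :=
    ⟨fun g => he.mono.injOn ⟨k1, k2⟩ ⟨by omega, by omega⟩ (g.trans h1.symm), fun g => by rw [g, h1]⟩
  have i2 : e k = 2 ↔ k = 2 :=
    ⟨fun g => he.mono.injOn ⟨k1, k2⟩ ⟨by omega, by omega⟩ (g.trans h2.symm), fun g => by rw [g, h2]⟩
  unfold d0E
  simp only [i1, i2, h1, h2]

theorem d0E_eq_swap (h : |(|f 1| - |f 2|)| ≠ 1) : d0E f = fun k => f (Equiv.swap 1 2 k) := by
  have hx : exch (f 1) (f 2) = (f 2, f 1) := if_neg h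
  funext k
  unfold d0E
  rw [hx]
  by_cases g1 : k = 1
  · rw [g1, if_pos rfl, Equiv.swap_apply_left]
  by_cases g2 : k = 2
  · rw [g2, if_neg (by omega), if_pos rfl, Equiv.swap_apply_right]
  rw [if_neg g1, if_neg g2, Equiv.swap_apply_of_ne_of_ne g1 g2]

theorem Word.d0E (h : Word emp 0 L n z) (hn : 2 ≤ n) : Word emp 0 L n (QueerDual.d0E z) := by
  refine { h with chain := h.shape_base.isChain_d0E h.chain hn, letters := ?_ }
  have hneg : ∀ k, 1 ≤ k → k ≤ n → ∃ Y ∈ L, z k = -Y := fun k k1 k2 => by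
    rcases h.letters k k1 k2 with h3 | h3
    · have := abs_nonneg (z k); omega
    · exact h3
  obtain ⟨Y1, m1, e1⟩ := hneg 1 (by omega) (by omega)
  obtain ⟨Y2, m2, e2⟩ := hneg 2 (by omega) (by omega)
  have p1 := h.lt_abs_far m1
  have p2 := h.lt_abs_far m2
  have f12 := h.far_eq_or m1 m2
  have hx : |(|z 1| - |z 2|)| ≠ 1 := by rw [e1, e2]; grind
  intro k k1 k2
  right
  rw [d0E_eq_swap hx]
  simp only
  rw [Equiv.swap_apply_def]
  split_ifs
  · exact hneg 2 (by omega) hn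
  · exact hneg 1 (by omega) (by omega)
  · exact hneg k k1 k2

theorem Half.d0E_of_occurs (h : Half L S e f q) (hpos : ∀ k, S.Occurs k → 1 ≤ k)
    (h1 : S.Occurs 1) (h2 : S.Occurs 2) : Half L S.d0 e (QueerDual.d0E f) q := by
  obtain ⟨j, j1, j2, hj⟩ := h.labels.occurs_iff.1 h1
  have he1 : e 1 = 1 := by
    have h3 := hpos _ (h.labels.surj 1 le_rfl (by omega))
    have h4 := (h.labels.le_iff le_rfl (by omega) j1 j2).2 j1
    omega
  obtain ⟨hn, he2⟩ := h.labels.succ_eq le_rfl (by omega : 1 ≤ γ.size) (by rw [he1]; exact h2)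
  rw [he1] at he2
  have hn : 2 ≤ γ.size := hn
  obtain ⟨a1, a2, a3⟩ := h.labels.d0_spec h.mono hn he1 he2
  have hc : ∀ k, 1 ≤ k → k ≤ γ.size → QueerDual.d0E (fun k => f (e k)) k =
      QueerDual.d0E f (e k) := fun k k1 k2 => (d0E_comp h.labels he1 he2 hn k1 k2).symm
  obtain ⟨r1, r2⟩ := h.word.rsk_d0E hn
  refine ⟨a1, a2, (h.word.d0E hn).congr hc, fun k k1 k2 => ?_, ?_⟩
  · rw [a3 k k1 k2, ← rsk_congr hc k1 k2, r1]
    exact d0E_congr hn h.diag k1 k2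
  · rw [← recs_congr hc, r2, h.recs_eq]

theorem Labels.occurs_congr {S' : SignedFilling γ} (h : Labels S e) (h' : Labels S' e) :
    S.Occurs k ↔ S'.Occurs k := by
  rw [h.occurs_iff, h'.occurs_iff]

/-- If `1` and `2` are in one filling, the toggle is the image under insertion of swapping them in
the word; otherwise swapping them only relabels both fillings. On the word the rule is the same. -/
theorem Rep.queer (h : Rep q1 q2 X f) (hn : 2 ≤ γ.size + δ.size) :
    Rep q1 q2 (tensorQueer X) (d0E f) := by
  obtain ⟨-, -, -, -, h5, h6⟩ := mem_tensorTableaux.1 h.mem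
  obtain ⟨⟨e, he⟩, ⟨e', he'⟩⟩ := And.intro h.left h.right
  unfold tensorQueer
  rw [if_neg (by omega)]
  split_ifs with g1 g2
  · have hh := he.d0E_of_occurs (fun k hk => ((h6 k).1 (.inl hk)).1) g1.1 g1.2
    refine h.of_halves hh (he'.congr fun k k1 k2 => ?_) id (fun k => Iff.rfl)
      (fun k => hh.labels.occurs_congr he.labels) fun k => Iff.rfl
    refine (d0E_of_ne ?_ ?_).symm <;> intro g
    · exact h5 1 g1.1 (g ▸ he'.labels.surj k k1 k2)
    · exact h5 2 g1.2 (g ▸ he'.labels.surj k k1 k2)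
  · have hh := he'.d0E_of_occurs (fun k hk => ((h6 k).1 (.inr hk)).1) g2.1 g2.2
    refine h.of_halves (he.congr fun k k1 k2 => ?_) hh id (fun k => Iff.rfl)
      (fun k => Iff.rfl) fun k => hh.labels.occurs_congr he'.labels
    refine (d0E_of_ne ?_ ?_).symm <;> intro g
    · exact h5 1 (g ▸ he.labels.surj k k1 k2) g2.1
    · exact h5 2 (g ▸ he.labels.surj k k1 k2) g2.2
  · rw [d0E_eq_swap (h.far (by omega) (by omega) (by omega) (by omega) (by omega)).2.2.2]
    exact h.swap le_rfl hn g1 g2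

/-- All cases of `ψ_i` become one rule on the word: among `i - 1`, `i`, `i + 1`, swap the two that
are furthest apart unless `i` is in the middle. -/
theorem Rep.dual (h : Rep q1 q2 X f) (hi : 1 < i) (hin : i < γ.size + δ.size) :
    Rep q1 q2 (tensorDual i X) (dE i f) := by
  obtain ⟨-, -, -, -, h5, h6⟩ := mem_tensorTableaux.1 h.mem
  obtain ⟨⟨e, he⟩, ⟨e', he'⟩⟩ := And.intro h.left h.right
  have f1 := h.far (a := i - 1) (b := i) (by omega) (by omega) (by omega) (by omega) (by omega)
  have f2 := h.far (a := i) (b := i + 1) (by omega) (by omega) (by omega) (by omega) (by omega)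
  have f3 := h.far (a := i - 1) (b := i + 1) (by omega) (by omega) (by omega) (by omega) (by omega)
  have p1 := h.pos_lt_iff (a := i - 1) (b := i) (by omega) (by omega) (by omega) (by omega)
    (by omega) fun k _ => by omega
  have p1' := h.pos_lt_iff (a := i) (b := i - 1) (by omega) (by omega) (by omega) (by omega)
    (by omega) fun k _ => by omega
  have p2 := h.pos_lt_iff (a := i) (b := i + 1) (by omega) (by omega) (by omega) (by omega)
    (by omega) fun k _ => by omega
  have p2' := h.pos_lt_iff (a := i + 1) (b := i) (by omega) (by omega) (by omega) (by omega)
    (by omega) fun k _ => by omega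
  -- The letters `i - 1` and `i + 1` are comparable by position only if `i` is not in the same
  -- filling as both. This suffices, since positions of the extremes matter only in the swap case.
  have p3 : ¬ (X.1.Occurs (i - 1) ∧ X.1.Occurs i ∧ X.1.Occurs (i + 1)) →
      ¬ (X.2.Occurs (i - 1) ∧ X.2.Occurs i ∧ X.2.Occurs (i + 1)) →
      ((tensorPos X (i - 1) < tensorPos X (i + 1) ↔ f (i + 1) < f (i - 1)) ∧
        (tensorPos X (i + 1) < tensorPos X (i - 1) ↔ f (i - 1) < f (i + 1))) := by
    intro o1 o2
    have hno : ∀ k, ((X.1.Occurs (i - 1) ∧ X.1.Occurs (i + 1) ∧ X.1.Occurs k) ∨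
        (X.2.Occurs (i - 1) ∧ X.2.Occurs (i + 1) ∧ X.2.Occurs k)) → k ≠ i := by
      rintro k (hk | hk) rfl
      · exact o1 ⟨hk.1, hk.2.2, hk.2.1⟩
      · exact o2 ⟨hk.1, hk.2.2, hk.2.1⟩
    constructor
    · exact h.pos_lt_iff (by omega) (by omega) (by omega) (by omega) (by omega)
        fun k hk => by have := hno k hk; omega
    · exact h.pos_lt_iff (by omega) (by omega) (by omega) (by omega) (by omega) fun k hk => by
        have := hno k (hk.imp (fun g => ⟨g.2.1, g.1, g.2.2⟩) fun g => ⟨g.2.1, g.1, g.2.2⟩)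
        omega
  obtain ⟨c1, c2, c3⟩ := dE_comp_far f1.2.2.2 f2.2.2.2 (by omega) hi
  unfold tensorDual
  simp only
  generalize tensorPos X = P at *
  by_cases hm : f (i - 1) < f i ↔ f i < f (i + 1)
  · rw [if_pos, c1 hm (by omega) (by omega)]
    · exact h
    · by_cases g : f (i - 1) < f i
      · rw [(lo_mid_hi_of_gt (f := P) (i := i) (by omega) (by omega)).2.1]
      · rw [(lo_mid_hi_of_lt (f := P) (i := i) (by omega) (by omega)).2.1]
  have hmid : P i ≠ mid (P) i := by
    rcases le_total (P (i - 1)) (P (i + 1)) with g1 | g1 <;>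
      by_cases g2 : f (i - 1) < f i
    · rw [(lo_mid_hi_left (f := P) (i := i) (by omega) g1).2.1]; omega
    · rw [(lo_mid_hi_right' (f := P) (i := i) (by omega) g1).2.1]; omega
    · rw [(lo_mid_hi_right (f := P) (i := i) (by omega) g1).2.1]; omega
    · rw [(lo_mid_hi_left' (f := P) (i := i) (by omega) g1).2.1]; omega
  rw [if_neg hmid]
  split_ifs with o1 o2
  · have hh := he.dE_of_occurs hi o1.1 o1.2.1 o1.2.2 hm
    refine h.of_halves hh (he'.congr fun k k1 k2 => ?_) id (fun k => Iff.rfl)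
      (fun k => hh.labels.occurs_congr he.labels) fun k => Iff.rfl
    refine (dE_of_ne ?_ ?_ ?_).symm <;> intro g
    · exact h5 _ o1.1 (g ▸ he'.labels.surj k k1 k2)
    · exact h5 _ o1.2.1 (g ▸ he'.labels.surj k k1 k2)
    · exact h5 _ o1.2.2 (g ▸ he'.labels.surj k k1 k2)
  · have hh := he'.dE_of_occurs hi o2.1 o2.2.1 o2.2.2 hm
    refine h.of_halves (he.congr fun k k1 k2 => ?_) hh id (fun k => Iff.rfl)
      (fun k => Iff.rfl) fun k => hh.labels.occurs_congr he'.labels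
    refine (dE_of_ne ?_ ?_ ?_).symm <;> intro g
    · exact h5 _ (g ▸ he.labels.surj k k1 k2) o2.1
    · exact h5 _ (g ▸ he.labels.surj k k1 k2) o2.2.1
    · exact h5 _ (g ▸ he.labels.surj k k1 k2) o2.2.2
  obtain ⟨p3, p3'⟩ := p3 o1 o2
  -- Each filling owns an interval of values of `f`, so if both extremes are in one filling, so is
  -- the median. Hence in the swap case the extremes lie in different fillings.
  have hsep : ∀ {a b c}, X.1.Occurs a ∨ X.2.Occurs a → X.1.Occurs b ∨ X.2.Occurs b →
      X.1.Occurs c ∨ X.2.Occurs c → f a < f b → f b < f c →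
      (X.1.Occurs a ∧ X.1.Occurs c → X.1.Occurs b) ∧ (X.2.Occurs a ∧ X.2.Occurs c → X.2.Occurs b) := by
    intro a b c ha hb hc h1 h2
    refine ⟨fun hh => hb.resolve_right fun g => ?_, fun hh => hb.resolve_left fun g => ?_⟩
    · have := h.lt_of_left_right hh.1 g; omega
    · have := h.lt_of_left_right g hh.2; omega
  have r0 : X.1.Occurs (i - 1) ∨ X.2.Occurs (i - 1) := (h6 _).2 (by omega)
  have r1 : X.1.Occurs i ∨ X.2.Occurs i := (h6 _).2 (by omega)
  have r2 : X.1.Occurs (i + 1) ∨ X.2.Occurs (i + 1) := (h6 _).2 (by omega)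
  by_cases hb : (f i < f (i - 1) ∧ f (i - 1) < f (i + 1)) ∨
      (f (i + 1) < f (i - 1) ∧ f (i - 1) < f i)
  · rw [c2 hb]
    have hs : (X.1.Occurs i ∧ X.1.Occurs (i + 1) → X.1.Occurs (i - 1)) ∧
        (X.2.Occurs i ∧ X.2.Occurs (i + 1) → X.2.Occurs (i - 1)) := by
      rcases hb with hb | hb
      · exact hsep r1 r0 r2 hb.1 hb.2
      · have := hsep r2 r0 r1 hb.1 hb.2
        exact ⟨fun g => this.1 g.symm, fun g => this.2 g.symm⟩
    have hr := h.swap (p := i) (by omega) (by omega) (fun g => o1 ⟨hs.1 g, g⟩)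
      fun g => o2 ⟨hs.2 g, g⟩
    rcases hb with hb | hb
    · obtain ⟨a1, -, a3⟩ := lo_mid_hi_left' (f := P) (i := i) (by omega) (by omega)
      have l1 : letterAt P i (P (i + 1)) = i + 1 := letterAt_right (by omega) (by omega)
      have l2 : letterAt P i (P i) = i := letterAt_mid (by omega) rfl
      rw [a1, a3, l1, l2,
        swap_comm, swap_comm (S := X.2)]
      exact hr
    · obtain ⟨a1, -, a3⟩ := lo_mid_hi_left (f := P) (i := i) (by omega) (by omega)
      have l1 : letterAt P i (P (i + 1)) = i + 1 := letterAt_right (by omega) (by omega)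
      have l2 : letterAt P i (P i) = i := letterAt_mid (by omega) rfl
      rw [a1, a3, l1, l2]
      exact hr
  · have hb : (f i < f (i + 1) ∧ f (i + 1) < f (i - 1)) ∨
        (f (i - 1) < f (i + 1) ∧ f (i + 1) < f i) := by omega
    rw [c3 hb]
    have hs : (X.1.Occurs i ∧ X.1.Occurs (i - 1) → X.1.Occurs (i + 1)) ∧
        (X.2.Occurs i ∧ X.2.Occurs (i - 1) → X.2.Occurs (i + 1)) := by
      rcases hb with hb | hb
      · exact hsep r1 r2 r0 hb.1 hb.2
      · have := hsep r0 r2 r1 hb.1 hb.2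
        exact ⟨fun g => this.1 g.symm, fun g => this.2 g.symm⟩
    have hii : i - 1 + 1 = i := by omega
    have hr := h.swap (p := i - 1) (by omega) (by omega) 
      (by rw [hii]; exact fun g => o1 ⟨g.1, g.2, hs.1 g.symm⟩)
      (by rw [hii]; exact fun g => o2 ⟨g.1, g.2, hs.2 g.symm⟩)
    rw [hii] at hr
    rcases hb with hb | hb
    · obtain ⟨a1, -, a3⟩ := lo_mid_hi_right' (f := P) (i := i) (by omega) (by omega)
      have l1 : letterAt P i (P (i - 1)) = i - 1 := letterAt_left rfl
      have l2 : letterAt P i (P i) = i := letterAt_mid (by omega) rfl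
      rw [a1, a3, l1, l2]
      exact hr
    · obtain ⟨a1, -, a3⟩ := lo_mid_hi_right (f := P) (i := i) (by omega) (by omega)
      have l1 : letterAt P i (P (i - 1)) = i - 1 := letterAt_left rfl
      have l2 : letterAt P i (P i) = i := letterAt_mid (by omega) rfl
      rw [a1, a3, l1, l2, swap_comm,
        swap_comm (S := X.2)]
      exact hr

theorem Rep.psi (h : Rep q1 q2 X f)
    (hi : (2 ≤ i ∧ i < γ.size + δ.size) ∨ (i = 0 ∧ 2 ≤ γ.size + δ.size)) :
    Rep q1 q2 (tensorPsi i X) (opE i f) := by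
  unfold tensorPsi opE
  rcases hi with ⟨h1, h2⟩ | ⟨rfl, h1⟩
  · rw [if_neg (by omega), if_pos ⟨h1, h2⟩, if_neg (by omega)]
    exact h.dual h1 h2
  · rw [if_pos rfl, if_pos rfl]
    exact h.queer h1

theorem tensorPsi_eq_self (hi : ¬ ((2 ≤ i ∧ i < γ.size + δ.size) ∨ (i = 0 ∧ 2 ≤ γ.size + δ.size))) :
    tensorPsi i X = X := by
  unfold tensorPsi tensorQueer
  split_ifs with h1 h2 h3 h4 h5 <;> first | rfl | omega

theorem tensorPsi_mem (i : ℕ) (hX : X ∈ tensorTableaux γ δ) :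
    tensorPsi i X ∈ tensorTableaux γ δ := by
  by_cases hi : (2 ≤ i ∧ i < γ.size + δ.size) ∨ (i = 0 ∧ 2 ≤ γ.size + δ.size)
  · obtain ⟨q1, q2, f, hf⟩ := exists_rep hX
    exact (hf.psi hi).mem
  · rwa [tensorPsi_eq_self hi]

end QueerDual

namespace QueerDual
variable {γ δ : StrictPartition} {f g : ℕ → ℤ} {z w : ℕ → ℤ} {N n m s k l a b i j p : ℕ}
  {L : List ℤ} {q q1 q2 : List (ℤ → Bool)} {X X' : SignedFilling γ × SignedFilling δ}
  {β M : ℤ → Bool} {A : ℤ → Prop} {Q : Prop}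

/-! ### Involutions and commutation -/

theorem Rep.mem_far (h : Rep q1 q2 X f) (h1 : 1 ≤ k) (h2 : k ≤ γ.size + δ.size) :
    -f k ∈ farList (2 * (γ.size + δ.size) + 2) (γ.size + δ.size) := by
  rw [mem_farList]
  rcases h.occurs_or h1 h2 with ⟨o, -⟩ | ⟨-, o⟩
  · obtain ⟨p, hp, hf⟩ := h.left_val o
    exact ⟨p, by omega, by rw [hf]; push_cast; ring⟩
  · obtain ⟨p, hp, hf⟩ := h.right_val o
    exact ⟨γ.size + p, by omega, by rw [hf]; push_cast; ring⟩

/-- Any stretch of the word, inserted jointly for both fillings, is a word over any shape bounded by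
the number of letters. The choice of far parts starting at `2n + 2` leaves room for `n` insertions
over it. -/
theorem Rep.word_window (h : Rep q1 q2 X f) (hβ : IsShape β) {B : ℤ} (h0 : 0 ≤ B)
    (hB : ∀ x, B < x → β x = false) (hBn : B ≤ (γ.size + δ.size : ℕ))
    (hs : s + m ≤ γ.size + δ.size) :
    Word β B (farList (2 * (γ.size + δ.size) + 2) (γ.size + δ.size)) m fun j => f (s + j) := by
  refine word_of_injOn hβ h0 hB (fun Y hY => ?_) (farList_sep _ _)
    (fun k h1 h2 => h.mem_far (by omega) (by omega)) fun k l h1 h2 h3 =>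
    h.ne (by omega) (by omega) (by omega) (by omega) (by omega)
  obtain ⟨p, -, rfl⟩ := mem_farList.1 hY
  rw [length_farList]; push_cast at hBn ⊢; omega

theorem Rep.isChain (h : Rep q1 q2 X f) :
    IsChain (base emp (farList (2 * (γ.size + δ.size) + 2) (γ.size + δ.size))) f
      (γ.size + δ.size) := by
  have := (h.word_window (s := 0) (m := γ.size + δ.size) isShape_emp le_rfl (fun x hx => emp_pos hx)
    (by omega) (by omega)).chain
  simpa only [zero_add] using this

theorem opE_of_ne_zero (h : i ≠ 0) : opE i f = dE i f := if_neg h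

theorem tensorPsi_tensorPsi (hX : X ∈ tensorTableaux γ δ) :
    tensorPsi i (tensorPsi i X) = X := by
  by_cases hi : (2 ≤ i ∧ i < γ.size + δ.size) ∨ (i = 0 ∧ 2 ≤ γ.size + δ.size)
  · obtain ⟨q1, q2, f, hf⟩ := exists_rep hX
    refine ((hf.psi hi).psi hi).unique hf fun k _ _ => ?_
    rcases hi with ⟨h1, h2⟩ | ⟨rfl, h1⟩
    · rw [opE_of_ne_zero (by omega), opE_of_ne_zero (by omega), dE_dE (isShape_emp.shape_base _) hf.isChain h1 h2]
    · show d0E (d0E f) k = f k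
      rw [d0E_d0E]
  · rw [tensorPsi_eq_self hi, tensorPsi_eq_self hi]

theorem dE_dE_comm (hi : 1 < i) (hij : i + 3 ≤ j) : dE i (dE j f) = dE j (dE i f) := by
  have t1 : triple (dE j f) i = triple f i := by
    unfold triple
    rw [dE_of_ne, dE_of_ne, dE_of_ne] <;> omega
  have t2 : triple (dE i f) j = triple f j := by
    unfold triple
    rw [dE_of_ne, dE_of_ne, dE_of_ne] <;> omega
  funext k
  show (if k = i - 1 then (tri (triple (dE j f) i)).1 else
      if k = i then (tri (triple (dE j f) i)).2.1 else
      if k = i + 1 then (tri (triple (dE j f) i)).2.2 else dE j f k) =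
    if k = j - 1 then (tri (triple (dE i f) j)).1 else
      if k = j then (tri (triple (dE i f) j)).2.1 else
      if k = j + 1 then (tri (triple (dE i f) j)).2.2 else dE i f k
  rw [t1, t2]
  unfold dE
  split_ifs <;> first | rfl | omega

theorem d0E_dE_comm (hi : 3 < i) : d0E (dE i f) = dE i (d0E f) := by
  have t1 : triple (d0E f) i = triple f i := by
    unfold triple
    rw [d0E_of_ne, d0E_of_ne, d0E_of_ne] <;> omega
  have e1 : dE i f 1 = f 1 := dE_of_ne (by omega) (by omega) (by omega)
  have e2 : dE i f 2 = f 2 := dE_of_ne (by omega) (by omega) (by omega)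
  funext k
  show (if k = 1 then (exch (dE i f 1) (dE i f 2)).1 else
      if k = 2 then (exch (dE i f 1) (dE i f 2)).2 else dE i f k) =
    if k = i - 1 then (tri (triple (d0E f) i)).1 else
      if k = i then (tri (triple (d0E f) i)).2.1 else
      if k = i + 1 then (tri (triple (d0E f) i)).2.2 else d0E f k
  rw [t1, e1, e2]
  unfold dE d0E
  split_ifs <;> first | rfl | omega

theorem tensorPsi_comm (hX : X ∈ tensorTableaux γ δ) (hi : 1 < i) (hij : i + 3 ≤ j)
    (hj : j < γ.size + δ.size) : tensorPsi j (tensorPsi i X) = tensorPsi i (tensorPsi j X) := by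
  obtain ⟨q1, q2, f, hf⟩ := exists_rep hX
  have hi' : (2 ≤ i ∧ i < γ.size + δ.size) ∨ (i = 0 ∧ 2 ≤ γ.size + δ.size) := by omega
  have hj' : (2 ≤ j ∧ j < γ.size + δ.size) ∨ (j = 0 ∧ 2 ≤ γ.size + δ.size) := by omega
  refine ((hf.psi hi').psi hj').unique ((hf.psi hj').psi hi') fun k _ _ => ?_
  iterate 4 rw [opE_of_ne_zero (by omega)]
  rw [dE_dE_comm hi hij]

theorem tensorPsi_zero_comm (hX : X ∈ tensorTableaux γ δ) (hi : 3 < i)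
    (hin : i < γ.size + δ.size) : tensorPsi 0 (tensorPsi i X) = tensorPsi i (tensorPsi 0 X) := by
  obtain ⟨q1, q2, f, hf⟩ := exists_rep hX
  have hi' : (2 ≤ i ∧ i < γ.size + δ.size) ∨ (i = 0 ∧ 2 ≤ γ.size + δ.size) := by omega
  have hj' : (2 ≤ 0 ∧ 0 < γ.size + δ.size) ∨ (0 = 0 ∧ 2 ≤ γ.size + δ.size) := by omega
  refine ((hf.psi hi').psi hj').unique ((hf.psi hj').psi hi') fun k _ _ => ?_
  rw [opE_of_ne_zero (i := i) (by omega), opE_of_ne_zero (i := i) (by omega)]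
  exact congrFun (d0E_dE_comm hi) k

/-! ### Windows of words -/

/-- The letters `s + 1, …, s + m` of a word are inserted over the shape `β`; the results have their
entries in `A`, and all involutions inside the window are available, that at `0` if `Q` holds. -/
structure Window (n s m : ℕ) (β : ℤ → Bool) (A : ℤ → Prop) (Q : Prop) : Prop where
  shape : IsShape β
  bnd : ∀ x, (n : ℤ) < x → β x = false
  not_rem : ∀ b, A b → ¬ Rem β b
  conv : ∀ a b c, A a → A c → a < b → b < c → A b
  alt : (Q = True ∧ β = emp ∧ ∀ a, A a) ∨ (Q = False ∧ ∀ a b, A a → A b → |a| = |b| → a = b)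
  start : Q → s = 0
  le : s + m ≤ n
  entries : ∀ z, (∀ k, 1 ≤ k → k ≤ m → -z k ∈ farList (2 * n + 2) n) →
    Word β n (farList (2 * n + 2) n) m z →
    ∀ k, 1 ≤ k → k ≤ m → A (rsk β (farList (2 * n + 2) n) z k)

theorem opE_window (hj : (2 ≤ j ∧ j < m) ∨ (j = 0 ∧ s = 0)) (k : ℕ) :
    opE (s + j) f (s + k) = opE j (fun k => f (s + k)) k := by
  rcases hj with ⟨h1, h2⟩ | ⟨rfl, rfl⟩
  · have ht : triple f (s + j) = triple (fun k => f (s + k)) j := by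
      unfold triple
      rw [show s + j - 1 = s + (j - 1) by omega]
      rfl
    have i1 : s + k = s + j - 1 ↔ k = j - 1 := by omega
    have i2 : s + k = s + j ↔ k = j := by omega
    have i3 : s + k = s + j + 1 ↔ k = j + 1 := by omega
    rw [opE_of_ne_zero (by omega), opE_of_ne_zero (by omega)]
    unfold dE
    rw [ht]
    simp only [i1, i2, i3]
  · simp only [zero_add]

theorem opE_outside (hj : (2 ≤ j ∧ j < m) ∨ (j = 0 ∧ s = 0 ∧ 2 ≤ m))
    (hk : k ≤ s ∨ s + m < k) : opE (s + j) f k = f k := by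
  rcases hj with ⟨h1, h2⟩ | ⟨rfl, rfl, h2⟩
  · unfold opE
    rw [if_neg (by omega), dE_of_ne] <;> omega
  · exact d0E_of_ne (by omega) (by omega)

/-- The operators which are available in a window of length `m`. -/
abbrev Avail (Q : Prop) (m j : ℕ) : Prop := (2 ≤ j ∧ j < m) ∨ (Q ∧ j = 0 ∧ 2 ≤ m)

/-- The insertion tableau of a window. -/
noncomputable abbrev winP (β : ℤ → Bool) (n s : ℕ) (f : ℕ → ℤ) : ℕ → ℤ :=
  rsk β (farList (2 * n + 2) n) fun k => f (s + k)

/-- The recording data of a window. -/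
noncomputable abbrev winQ (β : ℤ → Bool) (n s m : ℕ) (f : ℕ → ℤ) : List (ℤ → Bool) :=
  recs β m (farList (2 * n + 2) n) fun k => f (s + k)

section
variable (hW : Window (γ.size + δ.size) s m β A Q)
include hW

theorem Window.word (h : Rep q1 q2 X f) :
    Word β (γ.size + δ.size : ℕ) (farList (2 * (γ.size + δ.size) + 2) (γ.size + δ.size)) m
      fun j => f (s + j) :=
  h.word_window hW.shape (by omega) hW.bnd le_rfl hW.le

theorem Window.chainIn (h : Rep q1 q2 X f) :
    ChainIn A β (winP β (γ.size + δ.size) s f) m := by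
  have hw := hW.word h
  refine ⟨hw.rsk.chain, hW.entries _ (fun k h1 h2 => h.mem_far (by omega) ?_) hw⟩
  have := hW.le; omega

theorem Window.step (h : Rep q1 q2 X f) (hj : Avail Q m j) :
    Rep q1 q2 (tensorPsi (s + j) X) (opE (s + j) f) ∧
      (∀ k, k ≤ s ∨ s + m < k → opE (s + j) f k = f k) ∧
      winP β (γ.size + δ.size) s (opE (s + j) f) = opE j (winP β (γ.size + δ.size) s f) ∧
      winQ β (γ.size + δ.size) s m (opE (s + j) f) = winQ β (γ.size + δ.size) s m f := by
  have hle := hW.le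
  have hw := hW.word h
  have h1 : (2 ≤ j ∧ j < m) ∨ (j = 0 ∧ s = 0 ∧ 2 ≤ m) := by
    rcases hj with hj | ⟨hQ, h1, h2⟩
    · exact .inl hj
    · exact .inr ⟨h1, hW.start hQ, h2⟩
  have hwin : (fun k => opE (s + j) f (s + k)) = opE j fun k => f (s + k) :=
    funext fun k => opE_window (m := m) (by omega) k
  refine ⟨h.psi (by omega), fun k hk => opE_outside h1 hk, ?_⟩
  unfold winP winQ
  rw [hwin]
  rcases hj with ⟨h1, h2⟩ | ⟨hQ, rfl, h2⟩
  · unfold opE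
    rw [if_neg (by omega)]
    have := hw.rsk_dE h1 h2
    rwa [if_neg (by omega)]
  · rcases hW.alt with ⟨-, rfl, -⟩ | ⟨hQ', -⟩
    · exact (h.word_window isShape_emp le_rfl (fun x hx => emp_pos hx) (by omega) hle).rsk_d0E h2
    · exact (hQ' ▸ hQ).elim

theorem Window.path {l : List ℕ} (hl : ∀ j ∈ l, Avail Q m j) (h : Rep q1 q2 X f) :
    ∃ g, Rep q1 q2 (l.foldl (fun U j => tensorPsi (s + j) U) X) g ∧
      (∀ k, k ≤ s ∨ s + m < k → g k = f k) ∧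
      winP β (γ.size + δ.size) s g = pathE l (winP β (γ.size + δ.size) s f) ∧
      winQ β (γ.size + δ.size) s m g = winQ β (γ.size + δ.size) s m f := by
  induction l generalizing X f with
  | nil => exact ⟨f, h, fun _ _ => rfl, rfl, rfl⟩
  | cons j l ih =>
    obtain ⟨h1, h2, h3, h4⟩ := hW.step h (hl j (List.mem_cons_self ..))
    obtain ⟨g, g1, g2, g3, g4⟩ := ih (fun i hi => hl i (List.mem_cons_of_mem _ hi)) h1
    refine ⟨g, g1, fun k hk => (g2 k hk).trans (h2 k hk), ?_, g4.trans h4⟩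
    rw [g3, h3]; rfl

theorem Window.word_eq {X X' : SignedFilling γ × SignedFilling δ} {q1' q2'} (h : Rep q1 q2 X f)
    (h' : Rep q1' q2' X' g) (ho : ∀ k, k ≤ s ∨ s + m < k → f k = g k)
    (hq : winQ β (γ.size + δ.size) s m f = winQ β (γ.size + δ.size) s m g)
    (hp : ∀ k, 1 ≤ k → k ≤ m →
      winP β (γ.size + δ.size) s f k = winP β (γ.size + δ.size) s g k) : X = X' := by
  refine h.unique h' fun k _ _ => ?_
  by_cases hk : k ≤ s ∨ s + m < k
  · exact ho k hk
  · have := (hW.word h).rsk_inj (hW.word h') hq hp (k - s) (by omega) (by omega)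
    rwa [show s + (k - s) = k by omega] at this

/-- Connectivity of chains is lifted to tableaux: a path of involutions on the inserted chain is
performed on the tableau, since insertion commutes with each step. -/
theorem Window.exists_path (h : Rep q1 q2 X f) (hw : ChainIn A β w m)
    (hs : shp β (winP β (γ.size + δ.size) s f) m = shp β w m) :
    ∃ l : List ℕ, (∀ j ∈ l, Avail Q m j) ∧ l.count (m - 1) ≤ 2 ∧
      ∃ g, Rep q1 q2 (l.foldl (fun U j => tensorPsi (s + j) U) X) g ∧
      (∀ k, k ≤ s ∨ s + m < k → g k = f k) ∧
      (∀ k, 1 ≤ k → k ≤ m → winP β (γ.size + δ.size) s g k = w k) ∧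
      winQ β (γ.size + δ.size) s m g = winQ β (γ.size + δ.size) s m f := by
  obtain ⟨l, h1, h2, h3⟩ := ChainIn.reach hW.shape hW.not_rem hW.conv
    (Q := Q) (hW.alt.imp_right fun h => h.2) (hW.chainIn h) hw hs
  obtain ⟨g, g1, g2, g3, g4⟩ := hW.path h1 h
  exact ⟨l, h1, h2, g, g1, g2, fun k k1 k2 => by rw [g3]; exact h3 k k1 k2, g4⟩

end

/-- The involution with index `i` on the set of tableaux of concatenated shape. -/
def psiT (i : ℕ) (X : {X // X ∈ tensorTableaux γ δ}) : {X // X ∈ tensorTableaux γ δ} :=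
  ⟨tensorPsi i X.1, tensorPsi_mem i X.2⟩

theorem psiT_psiT (i : ℕ) (X : {X // X ∈ tensorTableaux γ δ}) : psiT i (psiT i X) = X :=
  Subtype.ext (tensorPsi_tensorPsi X.2)

theorem val_foldl_psiT (l : List ℕ) (X : {X // X ∈ tensorTableaux γ δ}) :
    (l.foldl (fun U j => psiT (s + j) U) X).1 = l.foldl (fun U j => tensorPsi (s + j) U) X.1 := by
  induction l generalizing X with
  | nil => rfl
  | cons j l ih => exact ih _

theorem mem_eqvClass {α : Type*} [Fintype α] {φ : ℕ → α → α} {I : Set ℕ} {T U : α} :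
    U ∈ eqvClass φ I T ↔ Relation.EqvGen (fun x y => ∃ i ∈ I, φ i x = y) T U := by
  classical
  unfold eqvClass
  simp only [Finset.mem_filter, Finset.mem_univ, true_and]

theorem eqvGen_foldl {α : Type*} {φ : ℕ → α → α} {I : Set ℕ} {l : List ℕ} (T : α)
    (hl : ∀ j ∈ l, s + j ∈ I) : Relation.EqvGen (fun x y => ∃ i ∈ I, φ i x = y) T
      (l.foldl (fun U j => φ (s + j) U) T) := by
  induction l generalizing T with
  | nil => exact .refl _
  | cons j l ih =>
    exact .trans _ _ _ (.rel _ _ ⟨s + j, hl j (List.mem_cons_self ..), rfl⟩)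
      (ih _ fun i hi => hl i (List.mem_cons_of_mem _ hi))

section
variable (hW : Window (γ.size + δ.size) s m β A Q) {I : Set ℕ}
  (hI : ∀ i, i ∈ I ↔ ∃ j, i = s + j ∧ Avail Q m j)
  {X U : {X // X ∈ tensorTableaux γ δ}}
include hW hI

/-- The letters outside the window and the recording data are invariants of the class. -/
theorem Window.of_mem_class (h : Rep q1 q2 X.1 f) (hU : U ∈ eqvClass psiT I X) :
    ∃ g, Rep q1 q2 U.1 g ∧ (∀ k, k ≤ s ∨ s + m < k → g k = f k) ∧
      winQ β (γ.size + δ.size) s m g = winQ β (γ.size + δ.size) s m f := by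
  have key : ∀ i ∈ I, ∀ V : {X // X ∈ tensorTableaux γ δ},
      (∃ g, Rep q1 q2 V.1 g ∧ (∀ k, k ≤ s ∨ s + m < k → g k = f k) ∧
        winQ β (γ.size + δ.size) s m g = winQ β (γ.size + δ.size) s m f) →
      ∃ g, Rep q1 q2 (psiT i V).1 g ∧ (∀ k, k ≤ s ∨ s + m < k → g k = f k) ∧
        winQ β (γ.size + δ.size) s m g = winQ β (γ.size + δ.size) s m f := by
    rintro i hi V ⟨g, g1, g2, g3⟩
    obtain ⟨j, rfl, hj⟩ := (hI i).1 hi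
    obtain ⟨h1, h2, -, h4⟩ := hW.step g1 hj
    exact ⟨_, h1, fun k hk => (h2 k hk).trans (g2 k hk), h4.trans g3⟩
  have main : ∀ {V V'}, Relation.EqvGen (fun x y => ∃ i ∈ I, psiT (γ := γ) (δ := δ) i x = y) V V' →
      ((∃ g, Rep q1 q2 V.1 g ∧ (∀ k, k ≤ s ∨ s + m < k → g k = f k) ∧
        winQ β (γ.size + δ.size) s m g = winQ β (γ.size + δ.size) s m f) ↔
      ∃ g, Rep q1 q2 V'.1 g ∧ (∀ k, k ≤ s ∨ s + m < k → g k = f k) ∧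
        winQ β (γ.size + δ.size) s m g = winQ β (γ.size + δ.size) s m f) := by
    intro V V' hVV
    induction hVV with
    | rel x y hxy =>
      obtain ⟨i, hi, rfl⟩ := hxy
      refine ⟨key i hi x, fun hy => ?_⟩
      have := key i hi _ hy
      rwa [psiT_psiT] at this
    | refl x => exact Iff.rfl
    | symm x y _ ih => exact ih.symm
    | trans x y z _ _ ih1 ih2 => exact ih1.trans ih2
  exact (main (mem_eqvClass.1 hU)).1 ⟨f, h, fun _ _ => rfl, rfl⟩

/-- Equal recording data force equal final shapes, so the chains are connected with at most two uses
of the last involution; injectivity of the insertion identifies the endpoint with `U`. -/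
theorem Window.exists_path_of_mem (h : Rep q1 q2 X.1 f) (hU : U ∈ eqvClass psiT I X) :
    ∃ l : List ℕ, (∀ j ∈ l, Avail Q m j) ∧ l.count (m - 1) ≤ 2 ∧
      U = l.foldl (fun U j => psiT (s + j) U) X := by
  obtain ⟨g, g1, g2, g3⟩ := hW.of_mem_class hI h hU
  obtain ⟨l, h1, h2, g', r1, r2, r3, r4⟩ := hW.exists_path h (hW.chainIn g1)
    (Word.shp_rsk_eq g3).symm
  refine ⟨l, h1, h2, Subtype.ext ?_⟩
  rw [val_foldl_psiT]
  exact hW.word_eq g1 r1 (fun k hk => (g2 k hk).trans (r2 k hk).symm) (g3.trans r4.symm)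
    fun k k1 k2 => (r3 k k1 k2).symm

/-- The sum over a class is a sum over all chains with the same end. -/
theorem Window.sum_class {τ G : Type*} [AddCommMonoid G] (h : Rep q1 q2 X.1 f) (C : Finset τ)
    (ζ : τ → ℕ → ℤ)
    (h1 : ∀ c ∈ C, ChainIn A β (ζ c) m ∧
      shp β (ζ c) m = shp β (winP β (γ.size + δ.size) s f) m)
    (h2 : ∀ c ∈ C, ∀ c' ∈ C, (∀ k, 1 ≤ k → k ≤ m → ζ c k = ζ c' k) → c = c')
    (h3 : ∀ w, ChainIn A β w m → shp β w m = shp β (winP β (γ.size + δ.size) s f) m →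
      ∃ c ∈ C, ∀ k, 1 ≤ k → k ≤ m → ζ c k = w k)
    (F : {X // X ∈ tensorTableaux γ δ} → G) (F' : τ → G)
    (hF : ∀ U g, ∀ c ∈ C, Rep q1 q2 U.1 g →
      (∀ k, 1 ≤ k → k ≤ m → winP β (γ.size + δ.size) s g k = ζ c k) → F U = F' c) :
    ∑ U ∈ eqvClass psiT I X, F U = ∑ c ∈ C, F' c := by
  obtain ⟨E, hE⟩ : ∃ E, E = eqvClass psiT I X := ⟨_, rfl⟩
  rw [← hE]
  have hex : ∀ U ∈ E, ∃ c ∈ C, ∃ g, Rep q1 q2 U.1 g ∧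
      (∀ k, k ≤ s ∨ s + m < k → g k = f k) ∧
      winQ β (γ.size + δ.size) s m g = winQ β (γ.size + δ.size) s m f ∧
      ∀ k, 1 ≤ k → k ≤ m → winP β (γ.size + δ.size) s g k = ζ c k := by
    intro U hU
    rw [hE] at hU
    obtain ⟨g, g1, g2, g3⟩ := hW.of_mem_class hI h hU
    obtain ⟨c, hc, hz⟩ := h3 _ (hW.chainIn g1) (Word.shp_rsk_eq g3)
    exact ⟨c, hc, g, g1, g2, g3, fun k k1 k2 => (hz k k1 k2).symm⟩
  choose c hc g g1 g2 g3 g4 using hex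
  refine Finset.sum_bij (fun U hU => c U hU) hc ?_ ?_ fun U hU => hF U _ _ (hc U hU) (g1 U hU) (g4 U hU)
  · intro U hU V hV hUV
    refine Subtype.ext (hW.word_eq (g1 U hU) (g1 V hV)
      (fun k hk => (g2 U hU k hk).trans (g2 V hV k hk).symm) ((g3 U hU).trans (g3 V hV).symm)
      fun k k1 k2 => ?_)
    rw [g4 U hU k k1 k2, hUV, g4 V hV k k1 k2]
  -- Surjectivity: walk to the given chain inside the class. The walk produces some word of its
  -- endpoint `U`, which agrees with the chosen one because a tableau determines its word.
  · intro d hd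
    obtain ⟨r1, r2⟩ := h1 d hd
    obtain ⟨l, l1, -, g', s1, s2, s3, s4⟩ := hW.exists_path h r1 r2.symm
    have hU : l.foldl (fun U j => psiT (s + j) U) X ∈ E := by
      rw [hE]
      exact mem_eqvClass.2 (eqvGen_foldl X fun j hj => (hI _).2 ⟨j, rfl, l1 j hj⟩)
    rw [← val_foldl_psiT] at s1
    generalize l.foldl (fun U j => psiT (s + j) U) X = U at hU s1
    have hle := hW.le
    have hb : ∀ k, 1 ≤ k → k ≤ m → 1 ≤ s + k ∧ s + k ≤ γ.size + δ.size := fun k k1 k2 => by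
      clear * - hle k1 k2; omega
    have he : ∀ k, 1 ≤ k → k ≤ m → g U hU (s + k) = g' (s + k) := fun k k1 k2 =>
      (g1 U hU).word_unique (k := s + k) s1 (hb k k1 k2).1 (hb k k1 k2).2
    have hcU := hc U hU
    have hz : ∀ k, 1 ≤ k → k ≤ m → ζ (c U hU) k = ζ d k := by
      intro k k1 k2
      rw [← g4 U hU k k1 k2, ← s3 k k1 k2]
      exact rsk_congr he k1 k2
    have hcd : c U hU = d := h2 (c U hU) hcU d hd hz
    exact ⟨U, hU, hcd⟩

end
end QueerDual

namespace QueerDual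
variable {γ δ ε : StrictPartition} {f g : ℕ → ℤ} {z w : ℕ → ℤ} {N n m s k l a b i j p : ℕ}
  {L : List ℤ} {q q1 q2 : List (ℤ → Bool)} {X X' : SignedFilling γ × SignedFilling δ}
  {β M : ℤ → Bool} {A : ℤ → Prop} {Q : Prop}

/-! ### The two kinds of windows -/

theorem window_emp (h : m ≤ n) : Window n 0 m emp (fun _ => True) True where
  shape := isShape_emp
  bnd := fun x hx => emp_pos (by omega)
  not_rem := fun b _ hb => by
    by_cases h0 : b ≤ 0
    · have := hb.1; rw [emp_nonpos h0] at this; cases this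
    · have := hb.2; rw [emp_pos (by omega)] at this; cases this
  conv := fun _ _ _ _ _ _ _ => trivial
  alt := .inl ⟨rfl, rfl, fun _ => trivial⟩
  start := fun _ => rfl
  le := by omega
  entries := fun _ _ _ _ _ _ => trivial

/-- The staircase with parts `1, …, K`. -/
def stair (K : ℕ) : ℤ → Bool := fun s => decide (s ≤ -K ∨ (0 < s ∧ s ≤ K))

theorem stair_eq_true {K : ℕ} {x : ℤ} : stair K x = true ↔ x ≤ -K ∨ (0 < x ∧ x ≤ K) := by
  unfold stair; rw [decide_eq_true_eq]

theorem stair_eq_false {K : ℕ} {x : ℤ} : stair K x = false ↔ ¬ (x ≤ -K ∨ (0 < x ∧ x ≤ K)) := by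
  unfold stair; rw [decide_eq_false_iff_not]

theorem isShape_stair (K : ℕ) : IsShape (stair K) where
  sym := fun x => by
    rw [Bool.eq_iff_iff, stair_eq_true, Bool.not_eq_true', stair_eq_false]; omega
  bdd := ⟨K + 1, fun x hx => by rw [stair_eq_false]; omega⟩

/-- Letters which are smaller than all free sites stay negative. -/
theorem Word.rsk_le {B : ℤ} (h : Word β B L n z) {u : ℤ} (hz : ∀ k, 1 ≤ k → k ≤ n → z k ≤ u)
    (hβ : ∀ x, u + 2 ≤ x → x ≤ 0 → β x = false) (hB : -u - 1 ≤ B) (hu : u + L.length < 0) :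
    ∀ k, 1 ≤ k → k ≤ n → QueerDual.rsk β L z k ≤ u + L.length := by
  induction L generalizing B z u with
  | nil => intro k h1 h2; simpa [QueerDual.rsk] using hz k h1 h2
  | cons Y L ih =>
    rw [List.length_cons] at hu ⊢
    push_cast at hu ⊢
    -- The free site `u + 2` stops every bump at `u + 1`, so a pass raises the upper bound of the
    -- letters by at most one.
    have hfree : ∀ k ≤ n, shp (base β (Y :: L)) z k (u + 2) = false := by
      intro k
      induction k with
      | zero =>
        intro _
        show base β (Y :: L) (u + 2) = false
        rw [base_of_not_mem, hβ _ le_rfl (by omega)]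
        · intro hm; have := h.lt_abs_far hm; omega
        · intro hm; have := h.lt_abs_far hm; omega
      | succ k ihk =>
        intro hk
        have := hz (k + 1) (by omega) hk
        show hop (z (k + 1)) (shp (base β (Y :: L)) z k) (u + 2) = false
        rw [hop_eq (by omega) (by omega) (by omega) (by omega)]
        exact ihk (by omega)
    have hpass : ∀ k, 1 ≤ k → k ≤ n → passF (base β (Y :: L)) Y z k ≤ u + 1 := by
      intro k h1 h2
      obtain ⟨k, rfl⟩ : ∃ t, k = t + 1 := ⟨k - 1, by omega⟩
      have h3 := hz (k + 1) h1 h2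
      rw [passF_succ]
      unfold stepOut
      split_ifs
      · by_contra hc
        have := ((h.shape_base.shp z k).bmp_spec (h.chain k h2)).2.1 (u + 2) (by omega) (by omega)
        have h4 := hfree (k + 1) h2
        change hop (z (k + 1)) _ _ = false at h4
        rw [this] at h4; cases h4
      · omega
    intro k h1 h2
    have := ih h.stage (u := u + 1) hpass (fun x hx hx' => hβ x (by omega) hx') (by omega)
      (by omega) k h1 h2
    show QueerDual.rsk β L (passF (base β (Y :: L)) Y z) k ≤ _
    omega

/-- The free sites of the staircase `n, …, 1` between `-n + 1` and `0` hold back each pass by one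
site. Starting at or below `-n - 1`, the letters are still negative after `n` passes, so no marks
occur and the index `0` is not needed. -/
theorem window_stair (h : s + m ≤ n) : Window n s m (stair n) (· < 0) False where
  shape := isShape_stair n
  bnd := fun x hx => by rw [stair_eq_false]; omega
  not_rem := fun b hb hr => by
    have h1 := stair_eq_false.1 hr.1
    have h2 := stair_eq_true.1 hr.2
    omega
  conv := fun a b c _ hc _ _ => by omega
  alt := .inr ⟨rfl, fun a b ha hb hab => by rw [abs_of_neg ha, abs_of_neg hb] at hab; omega⟩
  start := fun h => h.elim
  le := h
  entries := fun z hz hw k h1 h2 => by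
    have hl := length_farList (2 * n + 2) n
    have := hw.rsk_le (u := -n - 1) (fun k h1 h2 => by
      obtain ⟨p, -, hp⟩ := mem_farList.1 (hz k h1 h2)
      push_cast at hp; omega) (fun x hx hx' => by rw [stair_eq_false]; omega)
      (by omega) (by rw [hl]; omega) k h1 h2
    rw [hl] at this
    omega

/-! ### Classes and Schur `P`-functions -/

theorem mem_wordDes_hook {S : SignedFilling ε} (hS : S ∈ signedStandardTableaux ε) :
    j ∈ wordDes ε.size S.hook ↔ 1 ≤ j ∧ j < ε.size ∧ S.diag j < S.diag (j + 1) := by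
  obtain ⟨h1, h2⟩ := mem_signedStandardTableaux.1 hS
  unfold wordDes
  rw [Finset.mem_filter, Finset.mem_Ico, and_assoc]
  refine and_congr_right fun h3 => and_congr_right fun h4 => ?_
  exact idxOf_lt_iff h1.inj h2 (h1.surj (j + 1) (by omega) (by omega))
    (h1.surj j h3 (by omega)) (by omega) fun k _ => by omega

/-- The chains over the empty shape with a fixed end are the signed standard tableaux of one strict
partition, and insertion preserves descents. -/
theorem sum_class_schurP (hm : m ≤ γ.size + δ.size) {I : Set ℕ}
    (hI : ∀ i, i ∈ I ↔ Avail True m i) (X : {X // X ∈ tensorTableaux γ δ}) :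
    ∃ ε : StrictPartition, ε.size = m ∧
      ∑ U ∈ eqvClass psiT I X, fundamental m (tensorDes U.1 ∩ Finset.Icc 1 (m - 1)) =
        schurP ε := by
  obtain ⟨q1, q2, f, hf⟩ := exists_rep X.2
  have hW := window_emp hm
  have hI' : ∀ i, i ∈ I ↔ ∃ j, i = 0 + j ∧ Avail True m j := fun i => by
    rw [hI]; simp only [zero_add]
    exact ⟨fun h => ⟨i, rfl, h⟩, fun ⟨j, hj, h⟩ => hj ▸ h⟩
  obtain ⟨ε, hε⟩ := (isShape_emp.shp (winP emp (γ.size + δ.size) 0 f) m).exists_maya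
  have hsize := size_eq_of_isChain (hW.chainIn hf).1 hε.symm
  refine ⟨ε, hsize, ?_⟩
  unfold schurP
  rw [hsize]
  refine hW.sum_class hI' hf (signedStandardTableaux ε) (fun S => S.diag) ?_ ?_ ?_ _ _ ?_
  · intro S hS
    obtain ⟨h1, h2⟩ := mem_signedStandardTableaux.1 hS
    obtain ⟨h3, h4⟩ := h1.isChain h2
    rw [hsize] at h3 h4
    exact ⟨⟨h3, fun _ _ _ => trivial⟩, h4.trans hε⟩
  · intro S hS S' hS' h
    obtain ⟨h1, h2⟩ := mem_signedStandardTableaux.1 hS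
    obtain ⟨h1', h2'⟩ := mem_signedStandardTableaux.1 hS'
    exact h1.ext h2 h1' h2' fun k k1 k2 => h k k1 (by omega)
  · intro w hw hs
    obtain ⟨S, h1, h2, h3⟩ := exists_labels (e := id) (γ := ε) (fun _ _ _ _ h => h)
      (by rw [hsize]; exact hw.1) (by rw [hsize, hs, hε])
    exact ⟨S, mem_signedStandardTableaux.2 ⟨h1, h2⟩, fun k k1 k2 => h3 k k1 (by omega)⟩
  · intro U g S hS hg hz
    congr 1
    ext j
    have h1 := mem_wordDes_hook hS (j := j)
    rw [hsize] at h1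
    rw [h1, Finset.mem_inter, hg.mem_tensorDes, Finset.mem_Icc]
    by_cases hj : 1 ≤ j ∧ j < m
    · have h2 := (hW.word hg).rsk_lt_iff hj.1 hj.2
      have h3 := hz j hj.1 hj.2.le
      have h4 := hz (j + 1) (by omega) hj.2
      unfold winP at h3 h4
      rw [← h3, ← h4, h2]
      simp only [zero_add]
      omega
    · omega

end QueerDual

namespace QueerDual
variable {γ δ ε : StrictPartition} {f g : ℕ → ℤ} {z w : ℕ → ℤ} {K N n m s k l a b i j p r : ℕ}
  {μ : YoungDiagram} {T T' : μ.cells → ℕ}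
  {M : ℤ → Bool} {X X' : SignedFilling γ × SignedFilling δ}

/-! ### Standard Young tableaux as chains over a staircase -/

theorem hgt_stair (K d : ℕ) : hgt (stair K) d = K - d := by
  have h : ∀ t d, d + t = K → hgt (stair K) d = t := by
    intro t
    induction t with
    | zero =>
      intro d hd
      unfold hgt
      rw [Set.ncard_eq_zero ((isShape_stair K).finite_parts _)]
      ext x
      simp only [Set.mem_ofPred_eq, Set.mem_empty_iff_false, iff_false, stair_eq_true]
      omega
    | succ t ih =>
      intro d hd
      rw [(isShape_stair K).hgt_succ, ih (d + 1) (by omega), if_pos]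
      rw [stair_eq_true]; omega
  rcases le_total d K with hd | hd
  · exact h _ _ (by omega)
  · have h1 := (isShape_stair K).hgt_anti hd
    rw [h 0 K rfl] at h1
    omega

theorem inSkew_stair {p : ℕ × ℕ} :
    InSkew (stair K) M p ↔ p.1 ≤ p.2 ∧ K ≤ p.2 ∧ p.1 < hgt M (p.2 - p.1) := by
  unfold InSkew; rw [hgt_stair]; omega

theorem ChainIn.hgt_zero (h : ChainIn (· < 0) (stair K) z n) (hk : k ≤ n) :
    hgt (shp (stair K) z k) 0 = K := by
  induction k with
  | zero => exact hgt_stair K 0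
  | succ k ih =>
    have := h.2 (k + 1) (by omega) hk
    rw [(isShape_stair K).hgt_shp_succ h.1 hk, ih (by omega), if_neg (by omega), add_zero]

/-- The diagram `μ`, moved `K` columns to the right, consists of the cells of `M` which are not in
the staircase. -/
structure Fits (K : ℕ) (M : ℤ → Bool) (μ : YoungDiagram) : Prop where
  shape : IsShape M
  hgt_zero : hgt M 0 = K
  le : ∀ d, hgt (stair K) d ≤ hgt M d
  mem : ∀ r j, (r, j) ∈ μ.cells ↔ InSkew (stair K) M (r, K + j)

/-- Negative letters never touch the main diagonal, so the cells added to the staircase start in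
column `K` of each row and form an ordinary Young diagram. -/
theorem ChainIn.exists_fits (h : ChainIn (· < 0) (stair K) z n) :
    ∃ μ : YoungDiagram, μ.card = n ∧ Fits K (shp (stair K) z n) μ := by
  have hs := (isShape_stair K).shp z n
  have hM := h.hgt_zero le_rfl
  have hcol : ∀ k, 1 ≤ k → k ≤ n → K ≤ (cellOf (stair K) z k).2 := fun k h1 h2 =>
    (inSkew_stair.1 ((isShape_stair K).inSkew_cellOf h.1 h1 h2)).2.1
  have hmem : ∀ r j, (r, j) ∈ (Finset.Icc 1 n).image (fun k =>
      ((cellOf (stair K) z k).1, (cellOf (stair K) z k).2 - K)) ↔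
      InSkew (stair K) (shp (stair K) z n) (r, K + j) := by
    intro r j
    rw [Finset.mem_image]
    constructor
    · rintro ⟨k, hk, he⟩
      rw [Finset.mem_Icc] at hk
      have h1 := (isShape_stair K).inSkew_cellOf h.1 hk.1 hk.2
      have h2 := hcol k hk.1 hk.2
      obtain ⟨rfl, rfl⟩ := Prod.mk.inj he
      rwa [show K + ((cellOf (stair K) z k).2 - K) = (cellOf (stair K) z k).2 by omega]
    · intro hp
      obtain ⟨k, k1, k2, k3⟩ := (isShape_stair K).exists_cellOf h.1 hp
      refine ⟨k, Finset.mem_Icc.2 ⟨k1, k2⟩, ?_⟩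
      rw [k3, Nat.add_sub_cancel_left]
  have hcard : ((Finset.Icc 1 n).image fun k =>
      ((cellOf (stair K) z k).1, (cellOf (stair K) z k).2 - K)).card = n := by
    rw [Finset.card_image_of_injOn, Nat.card_Icc, Nat.add_sub_cancel]
    intro k hk l hl he
    rw [Finset.coe_Icc, Set.mem_Icc] at hk hl
    obtain ⟨e1, e2⟩ := Prod.mk.inj he
    have h1 := hcol k hk.1 hk.2
    have h2 := hcol l hl.1 hl.2
    exact (isShape_stair K).cellOf_inj h.1 hk.1 hk.2 hl.1 hl.2 (Prod.ext e1 (by omega))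
  generalize (Finset.Icc 1 n).image (fun k =>
    ((cellOf (stair K) z k).1, (cellOf (stair K) z k).2 - K)) = F at hmem hcard
  refine ⟨⟨F, ?_⟩, hcard, hs, hM, fun d => (isShape_stair K).hgt_shp_mono h.1 (Nat.zero_le n) le_rfl d,
    hmem⟩
  · rintro ⟨r, j⟩ ⟨r', j'⟩ ⟨hr, hj⟩ hp
    simp only at hr hj
    refine (hmem r' j').2 ?_
    have hp := (hmem r j).1 hp
    rw [inSkew_stair] at hp ⊢
    obtain ⟨h1, h2, h3⟩ := hp
    simp only at h1 h2 h3 ⊢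
    have h4 := hs.hgt_anti (Nat.zero_le (K + j - r))
    refine ⟨by omega, by omega, ?_⟩
    rcases le_total (K + j' - r') (K + j - r) with h5 | h5
    · have := hs.hgt_anti h5; omega
    · have := hs.hgt_le_add h5; omega

/-- The main diagonal still has length `K`, so only `K` rows are used and the shifted diagram stays
strictly off the main diagonal. -/
theorem Fits.row_lt (h : Fits K M μ) (c : μ.cells) : c.1.1 < K := by
  have h1 := inSkew_stair.1 ((h.mem c.1.1 c.1.2).1 c.2)
  have h2 := h.shape.hgt_anti (Nat.zero_le (K + c.1.2 - c.1.1))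
  rw [h.hgt_zero] at h2
  exact h1.2.2.trans_le h2

/-- The negative diagonals of the letters of a tableau whose shape is moved `K` columns. -/
def youngDiag (K : ℕ) (T : μ.cells → ℕ) (k : ℕ) : ℤ :=
  ∑ c : μ.cells with T c = k, ((c.1.1 : ℤ) - (K + c.1.2))

theorem youngDiag_eq (hT : Function.Injective T) (c : μ.cells) :
    youngDiag K T (T c) = (c.1.1 : ℤ) - (K + c.1.2) := by
  unfold youngDiag
  rw [Finset.sum_eq_single_of_mem c (by simp)]
  intro d hd hne
  exact absurd (hT (Finset.mem_filter.1 hd).2) hne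

theorem mem_standardYoungTableaux : T ∈ standardYoungTableaux μ ↔
    Function.Injective T ∧ (∀ c, 1 ≤ T c ∧ T c ≤ μ.card) ∧
    (∀ k, 1 ≤ k → k ≤ μ.card → ∃ c, T c = k) ∧
    (∀ c d : μ.cells, c.1.1 = d.1.1 → c.1.2 < d.1.2 → T c < T d) ∧
    (∀ c d : μ.cells, c.1.2 = d.1.2 → c.1.1 < d.1.1 → T c < T d) := by
  unfold standardYoungTableaux
  simp only [Finset.mem_filter, Fintype.mem_piFinset, Finset.mem_Icc]
  constructor
  · rintro ⟨h1, ⟨h2, h3⟩, h4, h5⟩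
    refine ⟨h2, h1, fun k k1 k2 => ?_, h4, h5⟩
    have : k ∈ Finset.univ.image T := by rw [h3, Finset.mem_Icc]; exact ⟨k1, k2⟩
    simpa using this
  · rintro ⟨h1, h2, h3, h4, h5⟩
    refine ⟨h2, ⟨h1, ?_⟩, h4, h5⟩
    ext k
    rw [Finset.mem_image, Finset.mem_Icc]
    constructor
    · rintro ⟨c, -, rfl⟩; exact h2 c
    · rintro ⟨k1, k2⟩
      obtain ⟨c, hc⟩ := h3 k k1 k2
      exact ⟨c, Finset.mem_univ _, hc⟩

/-- The cell of a letter, moved `K` columns. -/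
noncomputable def youngCell (K : ℕ) (T : μ.cells → ℕ) (k : ℕ) : ℕ × ℕ :=
  open Classical in if h : ∃ c, T c = k then (h.choose.1.1, K + h.choose.1.2) else (0, 0)

theorem youngCell_eq (hT : Function.Injective T) (c : μ.cells) :
    youngCell K T (T c) = (c.1.1, K + c.1.2) := by
  have h : ∃ d, T d = T c := ⟨c, rfl⟩
  unfold youngCell
  rw [dif_pos h, hT h.choose_spec]

theorem le_of_cells (hT : T ∈ standardYoungTableaux μ) {c d : μ.cells} (h1 : c.1.1 ≤ d.1.1)
    (h2 : c.1.2 ≤ d.1.2) : T c ≤ T d := by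
  obtain ⟨-, -, -, h4, h5⟩ := mem_standardYoungTableaux.1 hT
  have hx : (c.1.1, d.1.2) ∈ μ.cells := μ.isLowerSet (a := d.1) ⟨h1, le_rfl⟩ d.2
  have e1 : T c ≤ T ⟨_, hx⟩ := by
    rcases h2.lt_or_eq with h | h
    · exact (h4 c ⟨_, hx⟩ rfl h).le
    · exact le_of_eq (congrArg T (Subtype.ext (Prod.ext rfl h)))
  have e2 : T ⟨_, hx⟩ ≤ T d := by
    rcases h1.lt_or_eq with h | h
    · exact (h5 ⟨_, hx⟩ d rfl h).le
    · exact le_of_eq (congrArg T (Subtype.ext (Prod.ext h rfl)))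
  exact e1.trans e2

theorem Fits.chainIn (h : Fits K M μ) (hT : T ∈ standardYoungTableaux μ) :
    ChainIn (· < 0) (stair K) (youngDiag K T) μ.card ∧
      shp (stair K) (youngDiag K T) μ.card = M := by
  obtain ⟨h1, h2, h3, h4, h5⟩ := mem_standardYoungTableaux.1 hT
  have hneg : ∀ k, 1 ≤ k → k ≤ μ.card → youngDiag K T k < 0 := by
    intro k k1 k2
    obtain ⟨c, rfl⟩ := h3 k k1 k2
    rw [youngDiag_eq h1]
    have := h.row_lt c
    omega
  have hch : IsChain (stair K) (youngDiag K T) μ.card ∧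
      shp (stair K) (youngDiag K T) μ.card = M := by
    refine (isShape_stair K).isChain_of_cells h.shape (cell := youngCell K T) ?_ ?_ ?_ ?_ ?_ ?_ h.le
    · intro k k1 k2
      obtain ⟨c, rfl⟩ := h3 k k1 k2
      rw [youngDiag_eq h1, youngCell_eq h1]
      have := h.row_lt c
      simp only; omega
    · intro k k1 k2
      obtain ⟨c, rfl⟩ := h3 k k1 k2
      rw [youngCell_eq h1]
      exact (h.mem _ _).1 c.2
    · rintro ⟨r, j⟩ hp
      have h6 := (inSkew_stair.1 hp).2.1
      simp only at h6
      obtain ⟨j, rfl⟩ := Nat.exists_eq_add_of_le h6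
      have hc := (h.mem r j).2 hp
      exact ⟨T ⟨_, hc⟩, (h2 _).1, (h2 _).2, youngCell_eq h1 _⟩
    · intro k l k1 kl l2 he
      obtain ⟨c, rfl⟩ := h3 k k1 (by omega)
      obtain ⟨d, rfl⟩ := h3 l (by omega) l2
      rw [youngCell_eq h1, youngCell_eq h1] at he
      obtain ⟨e1, e2⟩ := Prod.mk.inj he
      have : c = d := Subtype.ext (Prod.ext e1 (by omega))
      rw [this] at kl
      exact lt_irrefl _ kl
    · intro k l k1 k2 l1 l2 e1 e2
      obtain ⟨c, rfl⟩ := h3 k k1 k2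
      obtain ⟨d, rfl⟩ := h3 l l1 l2
      rw [youngCell_eq h1, youngCell_eq h1] at e1 e2
      simp only at e1 e2
      exact le_of_cells hT e1.le (by omega)
    · intro k l k1 k2 l1 l2 e1 e2
      obtain ⟨c, rfl⟩ := h3 k k1 k2
      obtain ⟨d, rfl⟩ := h3 l l1 l2
      rw [youngCell_eq h1, youngCell_eq h1] at e1 e2
      simp only at e1 e2
      exact le_of_cells hT e2 (by omega)
  exact ⟨⟨hch.1, hneg⟩, hch.2⟩

theorem Fits.youngCell_eq_cellOf (h : Fits K M μ) (hT : T ∈ standardYoungTableaux μ) (k1 : 1 ≤ k)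
    (k2 : k ≤ μ.card) : youngCell K T k = cellOf (stair K) (youngDiag K T) k := by
  obtain ⟨h1, h2, h3, h4, h5⟩ := mem_standardYoungTableaux.1 hT
  have habs : ∀ c : μ.cells, (youngDiag K T (T c)).natAbs = K + c.1.2 - c.1.1 := by
    intro c
    rw [youngDiag_eq h1]
    have := h.row_lt c
    omega
  refine (isShape_stair K).cellOf_eq (cell := youngCell K T) (h.chainIn hT).1.1 ?_ ?_ ?_ ?_ k k1 k2
  · intro k k1 k2
    obtain ⟨c, rfl⟩ := h3 k k1 k2
    rw [habs, youngCell_eq h1]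
    have := h.row_lt c
    simp only; omega
  · intro k k1 k2
    obtain ⟨c, rfl⟩ := h3 k k1 k2
    rw [habs, youngCell_eq h1]
    exact ((h.mem _ _).1 c.2).2.1
  · intro k k1 k2 r r1 r2
    obtain ⟨c, rfl⟩ := h3 k k1 k2
    rw [habs, hgt_stair] at r1
    rw [habs]
    rw [youngCell_eq h1] at r2
    simp only at r2
    have hrow := h.row_lt c
    have hc := (h.mem c.1.1 c.1.2).1 c.2
    have hp : InSkew (stair K) M (r, K + (r + (K + c.1.2 - c.1.1) - K)) := by
      rw [inSkew_stair] at hc ⊢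
      simp only at hc ⊢
      refine ⟨by omega, by omega, ?_⟩
      rw [show K + (r + (K + c.1.2 - c.1.1) - K) - r = K + c.1.2 - c.1.1 by omega]
      omega
    have hd := (h.mem _ _).2 hp
    refine ⟨T ⟨_, hd⟩, (h2 _).1, ?_, ?_⟩
    · refine lt_of_le_of_ne (le_of_cells hT (by simp only; omega) (by simp only; omega)) ?_
      intro he
      have := congrArg (fun c => c.1.1) (h1 he)
      simp only at this
      omega
    · rw [youngCell_eq h1]
      exact Prod.ext rfl (by simp only; omega)
  · intro k l k1 kl l2 he
    obtain ⟨c, rfl⟩ := h3 k k1 (by omega)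
    obtain ⟨d, rfl⟩ := h3 l (by omega) l2
    rw [youngCell_eq h1, youngCell_eq h1] at he
    obtain ⟨e1, e2⟩ := Prod.mk.inj he
    have : c = d := Subtype.ext (Prod.ext e1 (by omega))
    rw [this] at kl
    exact lt_irrefl _ kl

theorem cellOf_congr {β : ℤ → Bool} (h : ∀ k, 1 ≤ k → k ≤ n → z k = w k) (h1 : 1 ≤ k)
    (h2 : k ≤ n) : cellOf β z k = cellOf β w k := by
  unfold cellOf rowOf
  rw [h k h1 h2, shp_congr (k := k - 1) fun l l1 l2 => h l l1 (by omega)]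

theorem Fits.ext (h : Fits K M μ) (hT : T ∈ standardYoungTableaux μ)
    (hT' : T' ∈ standardYoungTableaux μ)
    (he : ∀ k, 1 ≤ k → k ≤ μ.card → youngDiag K T k = youngDiag K T' k) : T = T' := by
  obtain ⟨h1, h2, -⟩ := mem_standardYoungTableaux.1 hT
  obtain ⟨h1', h2', h3', -⟩ := mem_standardYoungTableaux.1 hT'
  funext c
  obtain ⟨k1, k2⟩ := h2 c
  have hc := h.youngCell_eq_cellOf hT k1 k2
  rw [cellOf_congr he k1 k2, ← h.youngCell_eq_cellOf hT' k1 k2, youngCell_eq h1] at hc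
  obtain ⟨d, hd⟩ := h3' _ k1 k2
  rw [← hd, youngCell_eq h1'] at hc
  obtain ⟨e1, e2⟩ := Prod.mk.inj hc
  have : c = d := Subtype.ext (Prod.ext e1 (by omega))
  rw [← hd, this]

theorem Fits.exists_tableau (h : Fits K M μ) (hw : ChainIn (· < 0) (stair K) w μ.card)
    (hs : shp (stair K) w μ.card = M) :
    ∃ T ∈ standardYoungTableaux μ, ∀ k, 1 ≤ k → k ≤ μ.card → youngDiag K T k = w k := by
  have hst := isShape_stair K
  have hcell : ∀ c : μ.cells, ∃ k, 1 ≤ k ∧ k ≤ μ.card ∧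
      cellOf (stair K) w k = (c.1.1, K + c.1.2) := fun c =>
    hst.exists_cellOf hw.1 (by rw [hs]; exact (h.mem _ _).1 c.2)
  choose T hT1 hT2 hT3 using hcell
  have hinj : Function.Injective T := by
    intro c d hcd
    have := hT3 c
    rw [hcd, hT3 d] at this
    obtain ⟨e1, e2⟩ := Prod.mk.inj this
    exact Subtype.ext (Prod.ext e1.symm (by omega))
  have hsurj : ∀ k, 1 ≤ k → k ≤ μ.card → ∃ c, T c = k := by
    intro k k1 k2
    have hp := hst.inSkew_cellOf hw.1 k1 k2
    rw [hs] at hp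
    obtain ⟨j, hj⟩ := Nat.exists_eq_add_of_le (inSkew_stair.1 hp).2.1
    have hp' : InSkew (stair K) M ((cellOf (stair K) w k).1, K + j) := by rwa [← hj]
    refine ⟨⟨_, (h.mem _ _).2 hp'⟩, hst.cellOf_inj hw.1 (hT1 _) (hT2 _) k1 k2 ?_⟩
    rw [hT3]
    exact Prod.ext rfl hj.symm
  have hmono : ∀ c d : μ.cells, c.1.1 ≤ d.1.1 → c.1.2 ≤ d.1.2 → T c ≤ T d := fun c d e1 e2 =>
    hst.le_of_cellOf_le hw.1 (hT1 c) (hT2 c) (hT1 d) (hT2 d) (by rw [hT3, hT3]; exact e1)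
      (by rw [hT3, hT3]; simp only; omega)
  refine ⟨T, mem_standardYoungTableaux.2 ⟨hinj, fun c => ⟨hT1 c, hT2 c⟩, hsurj, fun c d e1 e2 => ?_,
    fun c d e1 e2 => ?_⟩, fun k k1 k2 => ?_⟩
  · refine lt_of_le_of_ne (hmono c d e1.le e2.le) fun he => ?_
    rw [hinj he] at e2; exact lt_irrefl _ e2
  · refine lt_of_le_of_ne (hmono c d e2.le e1.le) fun he => ?_
    rw [hinj he] at e2; exact lt_irrefl _ e2
  · obtain ⟨c, rfl⟩ := hsurj k k1 k2
    have h1 := hT3 c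
    unfold cellOf at h1
    obtain ⟨e1, e2⟩ := Prod.mk.inj h1
    have := hw.2 _ k1 k2
    rw [youngDiag_eq hinj]
    omega

/-! ### The row reading word -/

theorem pairwise_rowWord (T : μ.cells → ℕ) : (rowWord T).Pairwise fun a b => ∃ c d, T c = a ∧
    T d = b ∧ (d.1.1 < c.1.1 ∨ d.1.1 = c.1.1 ∧ c.1.2 < d.1.2) := by
  have hmem : ∀ {i j x : ℕ}, x ∈ (if h : (i, j) ∈ μ.cells then some (T ⟨(i, j), h⟩) else none) →
      ∃ c : μ.cells, c.1 = (i, j) ∧ T c = x := by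
    intro i j x hx
    split_ifs at hx with h
    · exact ⟨⟨_, h⟩, rfl, by simpa using hx⟩
    · simp at hx
  unfold rowWord
  rw [List.pairwise_flatMap]
  refine ⟨fun i _ => ?_, ?_⟩
  · rw [List.pairwise_filterMap]
    refine List.pairwise_lt_range.imp fun {j j'} hjj x hx y hy => ?_
    obtain ⟨c, c1, c2⟩ := hmem hx
    obtain ⟨d, d1, d2⟩ := hmem hy
    exact ⟨c, d, c2, d2, .inr (by rw [c1, d1]; exact ⟨rfl, hjj⟩)⟩
  · rw [List.pairwise_reverse]
    refine List.pairwise_lt_range.imp fun {i i'} hii x hx y hy => ?_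
    obtain ⟨j, -, hj⟩ := List.mem_filterMap.1 hx
    obtain ⟨j', -, hj'⟩ := List.mem_filterMap.1 hy
    obtain ⟨c, c1, c2⟩ := hmem hj
    obtain ⟨d, d1, d2⟩ := hmem hj'
    exact ⟨c, d, c2, d2, .inl (by rw [c1, d1]; exact hii)⟩

theorem lt_card_of_mem {r j : ℕ} (h : (r, j) ∈ μ.cells) : r < μ.card ∧ j < μ.card := by
  constructor
  · have h1 : (Finset.range (r + 1)).image (fun i => (i, j)) ⊆ μ.cells := by
      intro p hp
      obtain ⟨i, hi, rfl⟩ := Finset.mem_image.1 hp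
      rw [Finset.mem_range] at hi
      exact μ.isLowerSet (a := (r, j)) ⟨by simp only; omega, le_rfl⟩ h
    have h2 := Finset.card_le_card h1
    rw [Finset.card_image_of_injective _ (fun a b h => (Prod.mk.inj h).1), Finset.card_range] at h2
    exact h2
  · have h1 : (Finset.range (j + 1)).image (fun i => (r, i)) ⊆ μ.cells := by
      intro p hp
      obtain ⟨i, hi, rfl⟩ := Finset.mem_image.1 hp
      rw [Finset.mem_range] at hi
      exact μ.isLowerSet (a := (r, j)) ⟨le_rfl, by simp only; omega⟩ h
    have h2 := Finset.card_le_card h1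
    rw [Finset.card_image_of_injective _ (fun a b h => (Prod.mk.inj h).2), Finset.card_range] at h2
    exact h2

theorem mem_rowWord (c : μ.cells) : T c ∈ rowWord T := by
  obtain ⟨h1, h2⟩ := lt_card_of_mem (r := c.1.1) (j := c.1.2) c.2
  unfold rowWord
  rw [List.mem_flatMap]
  refine ⟨c.1.1, by simpa using h1, List.mem_filterMap.2 ⟨c.1.2, by simpa using h2, ?_⟩⟩
  rw [dif_pos c.2]

/-- Consecutive letters of a standard Young tableau are read by rows in the order of decreasing
diagonals, since neither cell is strictly north-east of the other. -/
theorem Fits.mem_wordDes (hT : T ∈ standardYoungTableaux μ) :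
    j ∈ wordDes μ.card (rowWord T) ↔
      1 ≤ j ∧ j < μ.card ∧ youngDiag K T j < youngDiag K T (j + 1) := by
  unfold wordDes
  rw [Finset.mem_filter, Finset.mem_Ico, and_assoc]
  refine and_congr_right fun j1 => and_congr_right fun j2 => ?_
  obtain ⟨h1, h2, h3, h4, h5⟩ := mem_standardYoungTableaux.1 hT
  obtain ⟨c, hc⟩ := h3 j j1 j2.le
  obtain ⟨d, hd⟩ := h3 (j + 1) (by omega) j2
  rw [← hd, ← hc, youngDiag_eq h1, youngDiag_eq h1]
  have hdc : ¬ (d.1.1 ≤ c.1.1 ∧ d.1.2 ≤ c.1.2) := fun g => by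
    have := le_of_cells hT g.1 g.2; omega
  have hcor : ¬ (c.1.1 < d.1.1 ∧ c.1.2 < d.1.2) := fun g => by
    have hx : (c.1.1, d.1.2) ∈ μ.cells := μ.isLowerSet (a := d.1) ⟨g.1.le, le_rfl⟩ d.2
    have e1 := h4 c ⟨_, hx⟩ rfl g.2
    have e2 := h5 ⟨_, hx⟩ d rfl g.1
    omega
  constructor
  · intro h
    obtain ⟨a, b, ha, hb, hab⟩ := rel_of_idxOf_lt (pairwise_rowWord T) (mem_rowWord c) h
    rw [h1 ha, h1 hb] at hab
    omega
  · intro h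
    by_contra hn
    rcases (not_lt.1 hn).lt_or_eq with h' | h'
    · obtain ⟨a, b, ha, hb, hab⟩ := rel_of_idxOf_lt (pairwise_rowWord T) (mem_rowWord d) h'
      rw [h1 ha, h1 hb] at hab
      omega
    · have := (List.idxOf_inj (mem_rowWord c)).1 h'
      omega

/-! ### Classes and Schur functions -/

theorem mem_desRestrict {D : Finset ℕ} {c : ℕ} :
    j ∈ desRestrict (s + 1) c D ↔ 1 ≤ j ∧ s + j < c ∧ s + j ∈ D := by
  unfold desRestrict
  rw [Finset.mem_image]
  constructor
  · rintro ⟨x, hx, rfl⟩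
    obtain ⟨h1, h2, h3⟩ := Finset.mem_filter.1 hx
    rw [show s + (x + 1 - (s + 1)) = x by omega]
    exact ⟨by omega, h3, h1⟩
  · rintro ⟨h1, h2, h3⟩
    exact ⟨s + j, Finset.mem_filter.2 ⟨h3, by omega, h2⟩, by omega⟩

theorem sum_class_schur (hm : s + m ≤ γ.size + δ.size) {I : Set ℕ}
    (hI : ∀ i, i ∈ I ↔ ∃ j, i = s + j ∧ Avail False m j) (X : {X // X ∈ tensorTableaux γ δ}) :
    ∃ μ : YoungDiagram, μ.card = m ∧
      ∑ U ∈ eqvClass psiT I X, fundamental m (desRestrict (s + 1) (s + m) (tensorDes U.1)) =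
        schur μ := by
  obtain ⟨q1, q2, f, hf⟩ := exists_rep X.2
  have hW := window_stair hm
  obtain ⟨μ, hμ, hfit⟩ := (hW.chainIn hf).exists_fits
  refine ⟨μ, hμ, ?_⟩
  unfold schur
  rw [hμ]
  refine hW.sum_class hI hf (standardYoungTableaux μ) (fun T => youngDiag (γ.size + δ.size) T)
    ?_ ?_ ?_ _ _ ?_
  · intro T hT
    have := hfit.chainIn hT
    rwa [hμ] at this
  · intro T hT T' hT' h
    exact hfit.ext hT hT' fun k k1 k2 => h k k1 (by omega)
  · intro w hw hs
    obtain ⟨T, hT, h⟩ := hfit.exists_tableau (w := w) (by rw [hμ]; exact hw) (by rw [hμ]; exact hs)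
    exact ⟨T, hT, fun k k1 k2 => h k k1 (by omega)⟩
  · intro U g T hT hg hz
    congr 1
    ext j
    have h1 := Fits.mem_wordDes (K := γ.size + δ.size) hT (j := j)
    rw [hμ] at h1
    rw [h1, mem_desRestrict, hg.mem_tensorDes]
    by_cases hj : 1 ≤ j ∧ j < m
    · have h2 := (hW.word hg).rsk_lt_iff hj.1 hj.2
      have h3 := hz j hj.1 hj.2.le
      have h4 := hz (j + 1) (by omega) hj.2
      unfold winP at h3 h4
      rw [← h3, ← h4, h2, show s + (j + 1) = s + j + 1 by omega]
      omega
    · omega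

end QueerDual

namespace QueerDual
variable {γ δ ε : StrictPartition} {G G' G1 G2 : ℕ → ℕ} {e d e1 e2 : ℕ → ℕ}
  {f : ℕ → ℤ} {n k l a b i j x y : ℕ} {q1 q2 : List (ℤ → Bool)}
  {D B : Finset ℕ} {X X' : SignedFilling γ × SignedFilling δ}

/-! ### Coefficients -/

/-- `G 1 ≤ ⋯ ≤ G n`, with strict inequality at the elements of `D`. -/
def Compat (n : ℕ) (D : Finset ℕ) (G : ℕ → ℕ) : Prop :=
  (∀ k l, 1 ≤ k → k ≤ l → l ≤ n → G k ≤ G l) ∧ ∀ k, 1 ≤ k → k < n → k ∈ D → G k < G (k + 1)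

/-- The exponent of the monomial with factors `x_{G 1}, …, x_{G n}`. -/
noncomputable def content (n : ℕ) (G : ℕ → ℕ) : ℕ →₀ ℕ :=
  ∑ k ∈ Finset.Icc 1 n, Finsupp.single (G k) 1

/-- A function on `Fin n` as a function of the letters `1, …, n`. -/
def letters (g : Fin n → ℕ) (k : ℕ) : ℕ := if h : k - 1 < n then g ⟨k - 1, h⟩ else 0

theorem letters_succ (g : Fin n → ℕ) (j : Fin n) : letters g (j + 1) = g j := by
  unfold letters
  rw [dif_pos (by simp)]
  congr 1

theorem letters_of (G : ℕ → ℕ) (h1 : 1 ≤ k) (hk : k ≤ n) :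
    letters (fun j : Fin n => G (j + 1)) k = G k := by
  unfold letters
  rw [dif_pos (by omega)]
  simp only
  rw [Nat.sub_add_cancel h1]

theorem letters_ext {g g' : Fin n → ℕ} (h : ∀ k, 1 ≤ k → k ≤ n → letters g k = letters g' k) :
    g = g' := by
  funext j
  rw [← letters_succ g, ← letters_succ g', h _ (by omega) (by omega)]

theorem content_congr (h : ∀ k, 1 ≤ k → k ≤ n → G k = G' k) : content n G = content n G' :=
  Finset.sum_congr rfl fun k hk => by
    rw [Finset.mem_Icc] at hk
    rw [h k hk.1 hk.2]

theorem Compat.congr (hc : Compat n D G) (h : ∀ k, 1 ≤ k → k ≤ n → G k = G' k) :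
    Compat n D G' := by
  refine ⟨fun k l h1 h2 h3 => ?_, fun k h1 h2 h3 => ?_⟩
  · rw [← h k h1 (by omega), ← h l (by omega) h3]; exact hc.1 k l h1 h2 h3
  · rw [← h k h1 (by omega), ← h (k + 1) (by omega) h2]; exact hc.2 k h1 h2 h3

theorem mem_support_content (h1 : 1 ≤ k) (hk : k ≤ n) : G k ∈ (content n G).support := by
  unfold content
  rw [Finsupp.mem_support_iff, Finsupp.finsetSum_apply]
  have : Finsupp.single (G k) 1 (G k) ≤
      ∑ l ∈ Finset.Icc 1 n, (Finsupp.single (G l) 1 : ℕ →₀ ℕ) (G k) :=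
    Finset.single_le_sum (f := fun l => (Finsupp.single (G l) 1 : ℕ →₀ ℕ) (G k))
      (fun _ _ => Nat.zero_le _) (Finset.mem_Icc.2 ⟨h1, hk⟩)
  rw [Finsupp.single_eq_same] at this
  omega

open Classical in
/-- The sequences which contribute to the coefficient of `F_{n,D}` at `c`. -/
noncomputable def seqs (n : ℕ) (D B : Finset ℕ) (c : ℕ →₀ ℕ) : Finset (Fin n → ℕ) :=
  (Fintype.piFinset fun _ : Fin n => B).filter fun g =>
    Compat n D (letters g) ∧ content n (letters g) = c

theorem mem_seqs {c : ℕ →₀ ℕ} (hB : c.support ⊆ B) {g : Fin n → ℕ} :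
    g ∈ seqs n D B c ↔ Compat n D (letters g) ∧ content n (letters g) = c := by
  classical
  unfold seqs
  simp only [Finset.mem_filter, Fintype.mem_piFinset]
  refine ⟨fun h => h.2, fun h => ⟨fun j => hB ?_, h⟩⟩
  rw [← h.2, ← letters_succ g j]
  exact mem_support_content (by omega) (by omega)

/-- A finite set `B` containing the support turns the coefficient into the size of a finite set, so
the product formula below becomes a bijection. -/
theorem coeff_fundamental {c : ℕ →₀ ℕ} (hB : c.support ⊆ B) :
    MvPowerSeries.coeff c (fundamental n D) = ((seqs n D B c).card : ℤ) := by
  show ((Nat.card _ : ℕ) : ℤ) = _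
  congr 1
  refine Nat.subtype_card _ fun g => ?_
  rw [mem_seqs hB]
  have hm : Monotone g ↔ ∀ k l, 1 ≤ k → k ≤ l → l ≤ n → letters g k ≤ letters g l := by
    constructor
    · intro h k l h1 h2 h3
      obtain ⟨k, rfl⟩ : ∃ t, k = t + 1 := ⟨k - 1, by omega⟩
      obtain ⟨l, rfl⟩ : ∃ t, l = t + 1 := ⟨l - 1, by omega⟩
      have e1 := letters_succ g ⟨k, by omega⟩
      have e2 := letters_succ g ⟨l, by omega⟩
      simp only at e1 e2
      rw [e1, e2]
      exact h (Fin.mk_le_mk.2 (by omega))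
    · intro h i j hij
      rw [← letters_succ g i, ← letters_succ g j]
      exact h _ _ (by omega) (by have := Fin.le_def.1 hij; omega) (by omega)
  have hd : (∀ (k : ℕ) (hk : k + 1 < n), k + 1 ∈ D → g ⟨k, by omega⟩ < g ⟨k + 1, hk⟩) ↔
      ∀ k, 1 ≤ k → k < n → k ∈ D → letters g k < letters g (k + 1) := by
    constructor
    · intro h k h1 h2 h3
      obtain ⟨k, rfl⟩ : ∃ t, k = t + 1 := ⟨k - 1, by omega⟩
      have e1 := letters_succ g ⟨k, by omega⟩
      have e2 := letters_succ g ⟨k + 1, h2⟩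
      simp only at e1 e2
      rw [e1, e2]
      exact h k h2 h3
    · intro h k h1 h2
      have e1 := letters_succ g ⟨k, by omega⟩
      have e2 := letters_succ g ⟨k + 1, h1⟩
      simp only at e1 e2
      rw [← e1, ← e2]
      exact h (k + 1) (by omega) h1 h2
  have hc : content n (letters g) = ∑ j, Finsupp.single (g j) 1 := by
    unfold content
    have : Finset.Icc 1 n = (Finset.range n).image (· + 1) := by
      ext x
      simp only [Finset.mem_Icc, Finset.mem_image, Finset.mem_range]
      exact ⟨fun h => ⟨x - 1, by omega, by omega⟩, fun ⟨y, h1, h2⟩ => by omega⟩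
    rw [this, Finset.sum_image (fun _ _ _ _ h => Nat.succ_injective h), Finset.sum_range]
    exact Finset.sum_congr rfl fun j _ => by rw [letters_succ]
  rw [hm, hd, hc, ← and_assoc]
  rfl

theorem card_eq_of_rel {α β : Type*} {s : Finset α} {t : Finset β} (R : α → β → Prop)
    (h1 : ∀ a ∈ s, ∃ b ∈ t, R a b) (h2 : ∀ b ∈ t, ∃ a ∈ s, R a b)
    (u1 : ∀ a ∈ s, ∀ b ∈ t, ∀ b' ∈ t, R a b → R a b' → b = b')
    (u2 : ∀ b ∈ t, ∀ a ∈ s, ∀ a' ∈ s, R a b → R a' b → a = a') : s.card = t.card := by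
  classical
  choose f hf hfR using h1
  refine Finset.card_bij f hf (fun a ha a' ha' h => ?_) fun b hb => ?_
  · exact u2 _ (hf a ha) a ha a' ha' (hfR a ha) (h ▸ hfR a' ha')
  · obtain ⟨a, ha, hab⟩ := h2 b hb
    exact ⟨a, ha, u1 a ha _ (hf a ha) b hb (hfR a ha) hab⟩

/-! ### Shuffles -/

/-- The letters `1, …, a + b` are distributed to two increasing sequences. -/
structure IsShuffle (a b : ℕ) (e d : ℕ → ℕ) : Prop where
  mono_left : StrictMonoOn e (Set.Icc 1 a)
  mono_right : StrictMonoOn d (Set.Icc 1 b)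
  left : ∀ k, 1 ≤ k → k ≤ a → 1 ≤ e k ∧ e k ≤ a + b
  right : ∀ l, 1 ≤ l → l ≤ b → 1 ≤ d l ∧ d l ≤ a + b
  ne : ∀ k l, 1 ≤ k → k ≤ a → 1 ≤ l → l ≤ b → e k ≠ d l

theorem IsShuffle.symm (h : IsShuffle a b e d) : IsShuffle b a d e :=
  ⟨h.mono_right, h.mono_left, fun l h1 h2 => by have := h.right l h1 h2; omega,
    fun k h1 h2 => by have := h.left k h1 h2; omega,
    fun l k h1 h2 h3 h4 => (h.ne k l h3 h4 h1 h2).symm⟩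

theorem IsShuffle.union (h : IsShuffle a b e d) : Disjoint ((Finset.Icc 1 a).image e)
    ((Finset.Icc 1 b).image d) ∧
    (Finset.Icc 1 a).image e ∪ (Finset.Icc 1 b).image d = Finset.Icc 1 (a + b) := by
  have hd : Disjoint ((Finset.Icc 1 a).image e) ((Finset.Icc 1 b).image d) := by
    rw [Finset.disjoint_left]
    intro x hx hx'
    obtain ⟨k, hk, rfl⟩ := Finset.mem_image.1 hx
    obtain ⟨l, hl, he⟩ := Finset.mem_image.1 hx'
    rw [Finset.mem_Icc] at hk hl
    exact h.ne k l hk.1 hk.2 hl.1 hl.2 he.symm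
  refine ⟨hd, Finset.eq_of_subset_of_card_le ?_ ?_⟩
  · intro x hx
    rw [Finset.mem_Icc]
    rcases Finset.mem_union.1 hx with hx | hx
    · obtain ⟨k, hk, rfl⟩ := Finset.mem_image.1 hx
      rw [Finset.mem_Icc] at hk
      exact h.left k hk.1 hk.2
    · obtain ⟨k, hk, rfl⟩ := Finset.mem_image.1 hx
      rw [Finset.mem_Icc] at hk
      exact h.right k hk.1 hk.2
  · rw [Finset.card_union_of_disjoint hd, Finset.card_image_of_injOn, Finset.card_image_of_injOn]
    · simp
    · rw [Finset.coe_Icc]; exact h.mono_right.injOn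
    · rw [Finset.coe_Icc]; exact h.mono_left.injOn

theorem IsShuffle.cover (h : IsShuffle a b e d) (h1 : 1 ≤ x) (h2 : x ≤ a + b) :
    (∃ k, 1 ≤ k ∧ k ≤ a ∧ x = e k) ∨ ∃ l, 1 ≤ l ∧ l ≤ b ∧ x = d l := by
  have : x ∈ Finset.Icc 1 (a + b) := Finset.mem_Icc.2 ⟨h1, h2⟩
  rw [← h.union.2, Finset.mem_union, Finset.mem_image, Finset.mem_image] at this
  rcases this with ⟨k, hk, rfl⟩ | ⟨l, hl, rfl⟩
  · rw [Finset.mem_Icc] at hk; exact .inl ⟨k, hk.1, hk.2, rfl⟩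
  · rw [Finset.mem_Icc] at hl; exact .inr ⟨l, hl.1, hl.2, rfl⟩

theorem IsShuffle.content_eq (h : IsShuffle a b e d) (G : ℕ → ℕ) :
    content (a + b) G = content a (fun k => G (e k)) + content b fun l => G (d l) := by
  unfold content
  rw [← h.union.2, Finset.sum_union h.union.1, Finset.sum_image, Finset.sum_image]
  · rw [Finset.coe_Icc]; exact h.mono_right.injOn
  · rw [Finset.coe_Icc]; exact h.mono_left.injOn

/-- A shuffle is determined by the comparisons between its two sequences alone; this gives
uniqueness of the merged tableau. -/
theorem IsShuffle.left_eq (h : IsShuffle a b e d) (h1 : 1 ≤ k) (h2 : k ≤ a) :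
    e k = k + ((Finset.Icc 1 b).filter fun l => d l < e k).card := by
  have hk := h.left k h1 h2
  have hu : Finset.Icc 1 (e k) = (Finset.Icc 1 k).image e ∪
      ((Finset.Icc 1 b).filter fun l => d l < e k).image d := by
    ext x
    simp only [Finset.mem_union, Finset.mem_image, Finset.mem_filter, Finset.mem_Icc]
    constructor
    · rintro ⟨x1, x2⟩
      rcases h.cover x1 (by omega) with ⟨j, j1, j2, rfl⟩ | ⟨l, l1, l2, rfl⟩
      · exact .inl ⟨j, ⟨j1, (h.mono_left.le_iff_le ⟨j1, j2⟩ ⟨h1, h2⟩).1 x2⟩, rfl⟩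
      · have := h.ne k l h1 h2 l1 l2
        exact .inr ⟨l, ⟨⟨l1, l2⟩, by omega⟩, rfl⟩
    · rintro (⟨j, ⟨j1, j2⟩, rfl⟩ | ⟨l, ⟨⟨l1, l2⟩, l3⟩, rfl⟩)
      · exact ⟨(h.left j j1 (by omega)).1,
          (h.mono_left.le_iff_le ⟨j1, by omega⟩ ⟨h1, h2⟩).2 j2⟩
      · exact ⟨(h.right l l1 l2).1, l3.le⟩
  have hc := congrArg Finset.card hu
  rw [Finset.card_union_of_disjoint, Finset.card_image_of_injOn, Finset.card_image_of_injOn] at hc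
  · simpa using hc
  · intro x hx y hy
    rw [Finset.coe_filter, Set.mem_ofPred_eq, Finset.mem_Icc] at hx hy
    exact h.mono_right.injOn hx.1 hy.1
  · intro x hx y hy
    rw [Finset.coe_Icc, Set.mem_Icc] at hx hy
    exact h.mono_left.injOn ⟨hx.1, by omega⟩ ⟨hy.1, by omega⟩
  · refine h.union.1.mono (Finset.image_subset_image (Finset.Icc_subset_Icc_right h2))
      (Finset.image_subset_image (Finset.filter_subset _ _))

/-- The shuffle which sorts two weakly increasing sequences, with the letters of the first one
before equal letters of the second one. -/
theorem exists_shuffle (h1 : ∀ k l, 1 ≤ k → k ≤ l → l ≤ a → G1 k ≤ G1 l)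
    (h2 : ∀ k l, 1 ≤ k → k ≤ l → l ≤ b → G2 k ≤ G2 l) :
    ∃ e d, IsShuffle a b e d ∧ ∀ k l, 1 ≤ k → k ≤ a → 1 ≤ l → l ≤ b →
      (d l < e k ↔ G2 l < G1 k) := by
  -- The rank in the merged sequence: predecessors in the own sequence plus those in the other one,
  -- ties being decided for the first sequence by `<` here and `≤` below.
  let E : ℕ → ℕ := fun k => k + ((Finset.Icc 1 b).filter fun l => G2 l < G1 k).card
  let F : ℕ → ℕ := fun l => l + ((Finset.Icc 1 a).filter fun k => G1 k ≤ G2 l).card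
  have key : ∀ k l, 1 ≤ k → k ≤ a → 1 ≤ l → l ≤ b →
      (G2 l < G1 k → F l < E k) ∧ (G1 k ≤ G2 l → E k < F l) := by
    intro k l k1 k2 l1 l2
    refine ⟨fun h => ?_, fun h => ?_⟩
    · have c1 : (Finset.Icc 1 l).card ≤ ((Finset.Icc 1 b).filter fun l => G2 l < G1 k).card := by
        refine Finset.card_le_card fun x hx => ?_
        rw [Finset.mem_Icc] at hx
        rw [Finset.mem_filter, Finset.mem_Icc]
        exact ⟨⟨hx.1, by omega⟩, (h2 x l hx.1 hx.2 l2).trans_lt h⟩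
      have c2 : ((Finset.Icc 1 a).filter fun k => G1 k ≤ G2 l).card ≤ (Finset.Icc 1 (k - 1)).card := by
        refine Finset.card_le_card fun x hx => ?_
        rw [Finset.mem_filter, Finset.mem_Icc] at hx
        rw [Finset.mem_Icc]
        refine ⟨hx.1.1, ?_⟩
        by_contra hc
        have := h1 k x k1 (by omega) hx.1.2
        omega
      rw [Nat.card_Icc] at c1 c2
      simp only [E, F]; omega
    · have c1 : ((Finset.Icc 1 b).filter fun l => G2 l < G1 k).card ≤ (Finset.Icc 1 (l - 1)).card := by
        refine Finset.card_le_card fun x hx => ?_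
        rw [Finset.mem_filter, Finset.mem_Icc] at hx
        rw [Finset.mem_Icc]
        refine ⟨hx.1.1, ?_⟩
        by_contra hc
        have := h2 l x l1 (by omega) hx.1.2
        omega
      have c2 : (Finset.Icc 1 k).card ≤ ((Finset.Icc 1 a).filter fun k => G1 k ≤ G2 l).card := by
        refine Finset.card_le_card fun x hx => ?_
        rw [Finset.mem_Icc] at hx
        rw [Finset.mem_filter, Finset.mem_Icc]
        exact ⟨⟨hx.1, by omega⟩, (h1 x k hx.1 hx.2 k2).trans h⟩
      rw [Nat.card_Icc] at c1 c2
      simp only [E, F]; omega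
  have cle : ∀ (c : ℕ) (p : ℕ → Prop) [DecidablePred p], ((Finset.Icc 1 c).filter p).card ≤ c :=
    fun c p _ => (Finset.card_filter_le _ _).trans (by rw [Nat.card_Icc]; omega)
  refine ⟨E, F, ⟨fun k hk k' hk' hkk => ?_, fun l hl l' hl' hll => ?_, fun k k1 k2 => ?_,
    fun l l1 l2 => ?_, fun k l k1 k2 l1 l2 he => ?_⟩, fun k l k1 k2 l1 l2 => ?_⟩
  · have := h1 k k' hk.1 hkk.le hk'.2
    have : ((Finset.Icc 1 b).filter fun l => G2 l < G1 k).card ≤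
        ((Finset.Icc 1 b).filter fun l => G2 l < G1 k').card :=
      Finset.card_le_card (Finset.monotone_filter_right _ fun x _ (hx : _ < _) => by
        show _ < _; omega)
    simp only [E]; omega
  · have := h2 l l' hl.1 hll.le hl'.2
    have : ((Finset.Icc 1 a).filter fun k => G1 k ≤ G2 l).card ≤
        ((Finset.Icc 1 a).filter fun k => G1 k ≤ G2 l').card :=
      Finset.card_le_card (Finset.monotone_filter_right _ fun x _ (hx : _ ≤ _) => by
        show _ ≤ _; omega)
    simp only [F]; omega
  · have := cle b fun l => G2 l < G1 k
    simp only [E]; omega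
  · have := cle a fun k => G1 k ≤ G2 l
    simp only [F]; omega
  · have := key k l k1 k2 l1 l2
    by_cases h : G2 l < G1 k
    · have := this.1 h; omega
    · have := this.2 (by omega); omega
  · have := key k l k1 k2 l1 l2
    by_cases h : G2 l < G1 k
    · have := this.1 h; omega
    · have := this.2 (by omega); omega

end QueerDual

namespace QueerDual
variable {γ δ ε : StrictPartition} {S S0 S0' : SignedFilling γ} {T T0 T0' : SignedFilling δ}
  {G G' G1 G1' G2 G2' : ℕ → ℕ} {e d : ℕ → ℕ} {L : List ℤ}
  {f : ℕ → ℤ} {n k l a b i j x y : ℕ} {q q1 q2 : List (ℤ → Bool)}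
  {D B : Finset ℕ} {X X' : SignedFilling γ × SignedFilling δ}

/-! ### Merging sequences -/

theorem IsShuffle.exists_glue (h : IsShuffle a b e d) (G1 G2 : ℕ → ℕ) :
    ∃ G : ℕ → ℕ, (∀ k, 1 ≤ k → k ≤ a → G (e k) = G1 k) ∧
      ∀ l, 1 ≤ l → l ≤ b → G (d l) = G2 l := by
  classical
  refine ⟨fun x => if h : ∃ k, 1 ≤ k ∧ k ≤ a ∧ e k = x then G1 h.choose
    else if h : ∃ l, 1 ≤ l ∧ l ≤ b ∧ d l = x then G2 h.choose else 0, fun k k1 k2 => ?_,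
    fun l l1 l2 => ?_⟩
  · have hex : ∃ j, 1 ≤ j ∧ j ≤ a ∧ e j = e k := ⟨k, k1, k2, rfl⟩
    simp only
    rw [dif_pos hex]
    obtain ⟨a1, a2, a3⟩ := hex.choose_spec
    rw [h.mono_left.injOn ⟨a1, a2⟩ ⟨k1, k2⟩ a3]
  · have hex : ∃ j, 1 ≤ j ∧ j ≤ b ∧ d j = d l := ⟨l, l1, l2, rfl⟩
    simp only
    rw [dif_neg, dif_pos hex]
    · obtain ⟨a1, a2, a3⟩ := hex.choose_spec
      rw [h.mono_right.injOn ⟨a1, a2⟩ ⟨l1, l2⟩ a3]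
    · rintro ⟨k, k1, k2, k3⟩
      exact h.ne k l k1 k2 l1 l2 k3

/-- The tableau `X` with the sequence `G` standardizes to `S0` and `T0`, with sequences `G1` and
`G2`. -/
def Merge (S0 : SignedFilling γ) (G1 : ℕ → ℕ) (T0 : SignedFilling δ) (G2 : ℕ → ℕ)
    (X : SignedFilling γ × SignedFilling δ) (G : ℕ → ℕ) : Prop :=
  ∃ e d, IsShuffle γ.size δ.size e d ∧ Labels X.1 e ∧ Labels X.2 d ∧
    (∀ k, 1 ≤ k → k ≤ γ.size → X.1.diag (e k) = S0.diag k ∧ G (e k) = G1 k) ∧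
    (∀ l, 1 ≤ l → l ≤ δ.size → X.2.diag (d l) = T0.diag l ∧ G (d l) = G2 l) ∧
    ∀ k l, 1 ≤ k → k ≤ γ.size → 1 ≤ l → l ≤ δ.size → (d l < e k ↔ G2 l < G1 k)

theorem Merge.content_eq (h : Merge S0 G1 T0 G2 X G) :
    content (γ.size + δ.size) G = content γ.size G1 + content δ.size G2 := by
  obtain ⟨e, d, hs, -, -, h1, h2, -⟩ := h
  rw [hs.content_eq, content_congr fun k k1 k2 => (h1 k k1 k2).2,
    content_congr fun l l1 l2 => (h2 l l1 l2).2]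

theorem Merge.congr (h : Merge S0 G1 T0 G2 X G)
    (h1 : ∀ k, 1 ≤ k → k ≤ γ.size → G1 k = G1' k) (h2 : ∀ k, 1 ≤ k → k ≤ δ.size → G2 k = G2' k)
    (hG : ∀ k, 1 ≤ k → k ≤ γ.size + δ.size → G k = G' k) : Merge S0 G1' T0 G2' X G' := by
  obtain ⟨e, d, hs, he, hd, a1, a2, a3⟩ := h
  refine ⟨e, d, hs, he, hd, fun k k1 k2 => ?_, fun l l1 l2 => ?_, fun k l k1 k2 l1 l2 => ?_⟩
  · obtain ⟨r1, r2⟩ := hs.left k k1 k2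
    rw [← h1 k k1 k2, ← hG _ r1 r2]; exact a1 k k1 k2
  · obtain ⟨r1, r2⟩ := hs.right l l1 l2
    rw [← h2 l l1 l2, ← hG _ r1 r2]; exact a2 l l1 l2
  · rw [← h1 k k1 k2, ← h2 l l1 l2]; exact a3 k l k1 k2 l1 l2

theorem Merge.parts_unique (h : Merge S0 G1 T0 G2 X G) (h' : Merge S0' G1' T0' G2' X G)
    (hS : S0 ∈ signedStandardTableaux γ) (hS' : S0' ∈ signedStandardTableaux γ)
    (hT : T0 ∈ signedStandardTableaux δ) (hT' : T0' ∈ signedStandardTableaux δ) :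
    S0 = S0' ∧ T0 = T0' ∧ (∀ k, 1 ≤ k → k ≤ γ.size → G1 k = G1' k) ∧
      ∀ k, 1 ≤ k → k ≤ δ.size → G2 k = G2' k := by
  obtain ⟨e, d, hs, he, hd, a1, a2, a3⟩ := h
  obtain ⟨e', d', hs', he', hd', a1', a2', a3'⟩ := h'
  have hee := he.eqOn he' fun _ => Iff.rfl
  have hdd := hd.eqOn hd' fun _ => Iff.rfl
  obtain ⟨l1, m1⟩ := mem_signedStandardTableaux.1 hS
  obtain ⟨l1', m1'⟩ := mem_signedStandardTableaux.1 hS'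
  obtain ⟨l2, m2⟩ := mem_signedStandardTableaux.1 hT
  obtain ⟨l2', m2'⟩ := mem_signedStandardTableaux.1 hT'
  refine ⟨l1.ext m1 l1' m1' fun k k1 k2 => ?_, l2.ext m2 l2' m2' fun k k1 k2 => ?_,
    fun k k1 k2 => ?_, fun k k1 k2 => ?_⟩
  · show S0.diag k = S0'.diag k
    rw [← (a1 k k1 k2).1, ← (a1' k k1 k2).1, hee k k1 k2]
  · show T0.diag k = T0'.diag k
    rw [← (a2 k k1 k2).1, ← (a2' k k1 k2).1, hdd k k1 k2]
  · rw [← (a1 k k1 k2).2, ← (a1' k k1 k2).2, hee k k1 k2]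
  · rw [← (a2 k k1 k2).2, ← (a2' k k1 k2).2, hdd k k1 k2]

theorem Merge.unique (h : Merge S0 G1 T0 G2 X G) (h' : Merge S0 G1 T0 G2 X' G')
    (hX : X ∈ tensorTableaux γ δ) (hX' : X' ∈ tensorTableaux γ δ) :
    X = X' ∧ ∀ k, 1 ≤ k → k ≤ γ.size + δ.size → G k = G' k := by
  obtain ⟨e, d, hs, he, hd, a1, a2, a3⟩ := h
  obtain ⟨e', d', hs', he', hd', a1', a2', a3'⟩ := h'
  obtain ⟨m1, m2, -⟩ := mem_tensorTableaux.1 hX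
  obtain ⟨m1', m2', -⟩ := mem_tensorTableaux.1 hX'
  have hee : ∀ k, 1 ≤ k → k ≤ γ.size → e' k = e k := by
    intro k k1 k2
    rw [hs.left_eq k1 k2, hs'.left_eq k1 k2]
    congr 2
    refine Finset.filter_congr fun l hl => ?_
    rw [Finset.mem_Icc] at hl
    rw [a3 k l k1 k2 hl.1 hl.2, a3' k l k1 k2 hl.1 hl.2]
  have hdd : ∀ l, 1 ≤ l → l ≤ δ.size → d' l = d l := by
    intro l l1 l2
    rw [hs.symm.left_eq l1 l2, hs'.symm.left_eq l1 l2]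
    congr 2
    refine Finset.filter_congr fun k hk => ?_
    rw [Finset.mem_Icc] at hk
    have n1 := hs.ne k l hk.1 hk.2 l1 l2
    have n2 := hs'.ne k l hk.1 hk.2 l1 l2
    have c1 := a3 k l hk.1 hk.2 l1 l2
    have c2 := a3' k l hk.1 hk.2 l1 l2
    omega
  refine ⟨Prod.ext (he.ext m1 (he'.congr hee) m1' fun k k1 k2 => ?_)
    (hd.ext m2 (hd'.congr hdd) m2' fun k k1 k2 => ?_), fun x x1 x2 => ?_⟩
  · rw [(a1 k k1 k2).1, ← hee k k1 k2, (a1' k k1 k2).1]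
  · rw [(a2 k k1 k2).1, ← hdd k k1 k2, (a2' k k1 k2).1]
  · rcases hs.cover x1 x2 with ⟨k, k1, k2, rfl⟩ | ⟨l, l1, l2, rfl⟩
    · rw [(a1 k k1 k2).2, ← hee k k1 k2, (a1' k k1 k2).2]
    · rw [(a2 l l1 l2).2, ← hdd l l1 l2, (a2' l l1 l2).2]

theorem Half.diag_lt_succ (h : Half L S e f q) (k1 : 1 ≤ k) (k2 : k < γ.size) :
    S.diag (e k) < S.diag (e (k + 1)) ↔ f (e k) < f (e (k + 1)) := by
  have hr := h.word.rsk_lt_iff k1 k2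
  rwa [h.diag k k1 (by omega), h.diag (k + 1) (by omega) k2] at hr

theorem Half.compat (h : Half L S e f q) (hS : S0 ∈ signedStandardTableaux γ)
    (hz : ∀ k, 1 ≤ k → k ≤ γ.size → S0.diag k = S.diag (e k))
    (hG : ∀ k l, 1 ≤ k → k ≤ l → l ≤ γ.size → G (e k) ≤ G (e l))
    (hD : ∀ k, 1 ≤ k → k < γ.size → G (e k) = G (e (k + 1)) → f (e (k + 1)) < f (e k)) :
    Compat γ.size (wordDes γ.size S0.hook) fun k => G (e k) := by
  refine ⟨hG, fun k k1 k2 hk => lt_of_le_of_ne (hG k (k + 1) k1 (by omega) k2) fun he => ?_⟩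
  have h1 := ((mem_wordDes_hook hS).1 hk).2.2
  rw [hz k k1 (by omega), hz (k + 1) (by omega) k2, h.diag_lt_succ k1 k2] at h1
  have := hD k k1 k2 he
  omega

theorem Labels.exists_standard (h : Labels S e) (hS : S.IsMonotone) :
    ∃ S0 ∈ signedStandardTableaux γ, ∀ k, 1 ≤ k → k ≤ γ.size → S0.diag k = S.diag (e k) := by
  obtain ⟨h1, h2⟩ := h.isChain hS
  obtain ⟨S0, a1, a2, a3⟩ := exists_labels (e := id) (fun _ _ _ _ h => h) h1 h2
  exact ⟨S0, mem_signedStandardTableaux.2 ⟨a1, a2⟩, a3⟩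

/-- Letters with equal entries increase from left to right. -/
theorem Rep.lt_of_compat (h : Rep q1 q2 X f) (hc : Compat (γ.size + δ.size) (tensorDes X) G)
    (x1 : 1 ≤ x) (hxy : x < y) (hy : y ≤ γ.size + δ.size) (hG : G x = G y) : f y < f x := by
  have hstep : ∀ z, 1 ≤ z → z < γ.size + δ.size → G z = G (z + 1) → f (z + 1) < f z := by
    intro z z1 z2 hz
    have h1 := h.mem_tensorDes (i := z)
    have h2 := h.ne z1 z2.le (b := z + 1) (by omega) z2 (by omega)
    have h3 : z ∉ tensorDes X := fun g => by have := hc.2 z z1 z2 g; omega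
    rw [h1] at h3
    by_contra h4
    exact h3 ⟨z1, z2, by omega⟩
  induction y, hxy using Nat.le_induction with
  | base => exact hstep x x1 (by omega) hG
  | succ y hxy ih =>
    have h1 := hc.1 x y x1 (by omega) (by omega)
    have h2 := hc.1 y (y + 1) (by omega) (by omega) hy
    exact (hstep y (by omega) (by omega) (by omega)).trans (ih (by omega) (by omega))

/-- Restriction of `G` to the two fillings. At equal values of `G` there is no descent, so `f`
decreases; as `f` is larger on the first filling, its letters come first. This is the tie rule of
`exists_shuffle`. -/
theorem exists_parts (hX : X ∈ tensorTableaux γ δ)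
    (hc : Compat (γ.size + δ.size) (tensorDes X) G) :
    ∃ S0 ∈ signedStandardTableaux γ, ∃ T0 ∈ signedStandardTableaux δ, ∃ G1 G2,
      Compat γ.size (wordDes γ.size S0.hook) G1 ∧ Compat δ.size (wordDes δ.size T0.hook) G2 ∧
      Merge S0 G1 T0 G2 X G := by
  obtain ⟨q1, q2, f, hf⟩ := exists_rep hX
  obtain ⟨m1, m2, -, -, h5, h6⟩ := mem_tensorTableaux.1 hX
  obtain ⟨⟨e, he⟩, ⟨d, hd⟩⟩ := And.intro hf.left hf.right
  obtain ⟨S0, hS0, hzS⟩ := he.labels.exists_standard m1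
  obtain ⟨T0, hT0, hzT⟩ := hd.labels.exists_standard m2
  have hs : IsShuffle γ.size δ.size e d := by
    refine ⟨he.labels.mono, hd.labels.mono, fun k k1 k2 => (h6 _).1 (.inl (he.labels.surj k k1 k2)),
      fun k k1 k2 => (h6 _).1 (.inr (hd.labels.surj k k1 k2)), fun k l k1 k2 l1 l2 g => ?_⟩
    exact h5 _ (he.labels.surj k k1 k2) (g ▸ hd.labels.surj l l1 l2)
  have he1 : ∀ k l, 1 ≤ k → k ≤ l → l ≤ γ.size → e k ≤ e l := fun k l k1 kl l2 =>
    (he.labels.le_iff k1 (by omega) (by omega) l2).2 kl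
  have hd1 : ∀ k l, 1 ≤ k → k ≤ l → l ≤ δ.size → d k ≤ d l := fun k l k1 kl l2 =>
    (hd.labels.le_iff k1 (by omega) (by omega) l2).2 kl
  refine ⟨S0, hS0, T0, hT0, fun k => G (e k), fun l => G (d l),
    he.compat hS0 hzS (fun k l k1 kl l2 => ?_) (fun k k1 k2 hG => ?_),
    hd.compat hT0 hzT (fun k l k1 kl l2 => ?_) (fun k k1 k2 hG => ?_),
    e, d, hs, he.labels, hd.labels, fun k k1 k2 => ⟨(hzS k k1 k2).symm, rfl⟩,
    fun l l1 l2 => ⟨(hzT l l1 l2).symm, rfl⟩, fun k l k1 k2 l1 l2 => ?_⟩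
  · exact hc.1 _ _ (hs.left k k1 (by omega)).1 (he1 k l k1 kl l2) (hs.left l (by omega) l2).2
  · exact hf.lt_of_compat hc (hs.left k k1 (by omega)).1
      ((he.labels.lt_iff k1 (by omega) (by omega) k2).2 (by omega))
      (hs.left (k + 1) (by omega) k2).2 hG
  · exact hc.1 _ _ (hs.right k k1 (by omega)).1 (hd1 k l k1 kl l2) (hs.right l (by omega) l2).2
  · exact hf.lt_of_compat hc (hs.right k k1 (by omega)).1
      ((hd.labels.lt_iff k1 (by omega) (by omega) k2).2 (by omega))
      (hs.right (k + 1) (by omega) k2).2 hG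
  · obtain ⟨r1, r2⟩ := hs.left k k1 k2
    obtain ⟨t1, t2⟩ := hs.right l l1 l2
    have hlr := hf.lt_of_left_right (he.labels.surj k k1 k2) (hd.labels.surj l l1 l2)
    constructor
    · intro h
      refine lt_of_le_of_ne (hc.1 _ _ t1 h.le r2) fun hG => ?_
      have := hf.lt_of_compat hc t1 h r2 hG
      omega
    · intro h
      by_contra hn
      have := hc.1 _ _ r1 (not_lt.1 hn) t2
      simp only at h
      omega

/-- The converse of `exists_parts`: relabel the two standard tableaux along the sorting shuffle. A
descent from a letter of the first filling to the next letter in the second is impossible, and in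
the opposite direction the tie rule makes `G` strictly increase. -/
theorem exists_merge (hS : S0 ∈ signedStandardTableaux γ) (hT : T0 ∈ signedStandardTableaux δ)
    (h1 : Compat γ.size (wordDes γ.size S0.hook) G1)
    (h2 : Compat δ.size (wordDes δ.size T0.hook) G2) :
    ∃ X ∈ tensorTableaux γ δ, ∃ G, Compat (γ.size + δ.size) (tensorDes X) G ∧
      Merge S0 G1 T0 G2 X G := by
  obtain ⟨e, d, hs, hcmp⟩ := exists_shuffle h1.1 h2.1
  obtain ⟨l1, m1⟩ := mem_signedStandardTableaux.1 hS
  obtain ⟨l2, m2⟩ := mem_signedStandardTableaux.1 hT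
  obtain ⟨c1, c1'⟩ := l1.isChain m1
  obtain ⟨c2, c2'⟩ := l2.isChain m2
  obtain ⟨S, a1, a2, a3⟩ := exists_labels hs.mono_left c1 c1'
  obtain ⟨T, b1, b2, b3⟩ := exists_labels hs.mono_right c2 c2'
  obtain ⟨G, g1, g2⟩ := hs.exists_glue G1 G2
  have hX : (S, T) ∈ tensorTableaux γ δ := by
    refine mem_tensorTableaux.2 ⟨a2, b2, a1.inj, b1.inj, fun x hx hx' => ?_, fun x => ?_⟩
    · obtain ⟨k, k1, k2, rfl⟩ := a1.occurs_iff.1 hx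
      obtain ⟨l, l1, l2, h⟩ := b1.occurs_iff.1 hx'
      exact hs.ne k l k1 k2 l1 l2 h
    · rw [a1.occurs_iff, b1.occurs_iff]
      constructor
      · rintro (⟨k, k1, k2, rfl⟩ | ⟨k, k1, k2, rfl⟩)
        · exact hs.left k k1 k2
        · exact hs.right k k1 k2
      · rintro ⟨x1, x2⟩; exact hs.cover x1 x2
  refine ⟨_, hX, G, ?_, e, d, hs, a1, b1, fun k k1 k2 => ⟨a3 k k1 k2, g1 k k1 k2⟩,
    fun l l1 l2 => ⟨b3 l l1 l2, g2 l l1 l2⟩, hcmp⟩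
  obtain ⟨q1, q2, f, hf⟩ := exists_rep hX
  obtain ⟨⟨e', he⟩, ⟨d', hd⟩⟩ := And.intro hf.left hf.right
  have he := he.congr_labels (he.labels.eqOn a1 fun _ => Iff.rfl)
  have hd := hd.congr_labels (hd.labels.eqOn b1 fun _ => Iff.rfl)
  simp only at he hd
  refine ⟨fun x y x1 hxy y2 => ?_, fun i i1 i2 hi => ?_⟩
  · rcases hs.cover x1 (by omega) with ⟨k, k1, k2, rfl⟩ | ⟨k, k1, k2, rfl⟩ <;>
      rcases hs.cover (by omega) y2 with ⟨l, l1, l2, rfl⟩ | ⟨l, l1, l2, rfl⟩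
    · rw [g1 k k1 k2, g1 l l1 l2]
      exact h1.1 k l k1 ((a1.le_iff k1 k2 l1 l2).1 hxy) l2
    · rw [g1 k k1 k2, g2 l l1 l2]
      have := hcmp k l k1 k2 l1 l2
      omega
    · rw [g2 k k1 k2, g1 l l1 l2]
      have := hcmp l k l1 l2 k1 k2
      have := hs.ne l k l1 l2 k1 k2
      omega
    · rw [g2 k k1 k2, g2 l l1 l2]
      exact h2.1 k l k1 ((b1.le_iff k1 k2 l1 l2).1 hxy) l2
  · have hfi := (hf.mem_tensorDes.1 hi).2.2
    rcases hs.cover i1 i2.le with ⟨k, k1, k2, rfl⟩ | ⟨k, k1, k2, rfl⟩ <;>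
      rcases hs.cover (x := _ + 1) (by omega) i2 with ⟨l, l1, l2, hl⟩ | ⟨l, l1, l2, hl⟩
    · obtain ⟨r1, r2⟩ := a1.succ_eq k1 k2 (hl ▸ a1.surj l l1 l2)
      rw [← r2] at hfi ⊢
      rw [g1 k k1 k2, g1 (k + 1) (by omega) r1]
      rw [← he.diag_lt_succ k1 r1, a3 k k1 k2, a3 (k + 1) (by omega) r1] at hfi
      exact h1.2 k k1 r1 ((mem_wordDes_hook hS).2 ⟨k1, r1, hfi⟩)
    · rw [hl] at hfi
      have := hf.lt_of_left_right (a1.surj k k1 k2) (b1.surj l l1 l2)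
      omega
    · rw [hl, g2 k k1 k2, g1 l l1 l2]
      have := hcmp l k l1 l2 k1 k2
      omega
    · obtain ⟨r1, r2⟩ := b1.succ_eq k1 k2 (hl ▸ b1.surj l l1 l2)
      rw [← r2] at hfi ⊢
      rw [g2 k k1 k2, g2 (k + 1) (by omega) r1]
      rw [← hd.diag_lt_succ k1 r1, b3 k k1 k2, b3 (k + 1) (by omega) r1] at hfi
      exact h2.2 k k1 r1 ((mem_wordDes_hook hT).2 ⟨k1, r1, hfi⟩)

/-! ### The product of two Schur `P`-functions -/

theorem coeff_schurP {c : ℕ →₀ ℕ} (hB : c.support ⊆ B) :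
    MvPowerSeries.coeff c (schurP γ) = (((signedStandardTableaux γ).sigma fun S =>
      seqs γ.size (wordDes γ.size S.hook) B c).card : ℤ) := by
  unfold schurP
  rw [map_sum, Finset.card_sigma, Nat.cast_sum]
  exact Finset.sum_congr rfl fun S _ => coeff_fundamental hB

theorem schurP_mul_schurP : schurP γ * schurP δ =
    ∑ X ∈ tensorTableaux γ δ, fundamental (γ.size + δ.size) (tensorDes X) := by
  ext c
  rw [MvPowerSeries.coeff_mul, map_sum]
  have hl : ∑ p ∈ Finset.HasAntidiagonal.antidiagonal c, MvPowerSeries.coeff p.1 (schurP γ) *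
      MvPowerSeries.coeff p.2 (schurP δ) = (((Finset.HasAntidiagonal.antidiagonal c).sigma fun p =>
        ((signedStandardTableaux γ).sigma fun S =>
          seqs γ.size (wordDes γ.size S.hook) c.support p.1) ×ˢ
        ((signedStandardTableaux δ).sigma fun T =>
          seqs δ.size (wordDes δ.size T.hook) c.support p.2)).card : ℤ) := by
    rw [Finset.card_sigma, Nat.cast_sum]
    refine Finset.sum_congr rfl fun p hp => ?_
    have hp' := Finset.HasAntidiagonal.mem_antidiagonal.1 hp
    rw [Finset.card_product, Nat.cast_mul, coeff_schurP (B := c.support), coeff_schurP]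
    · exact Finsupp.support_mono (hp' ▸ le_add_self)
    · exact Finsupp.support_mono (hp' ▸ le_self_add)
  have hr : ∑ X ∈ tensorTableaux γ δ,
      MvPowerSeries.coeff c (fundamental (γ.size + δ.size) (tensorDes X)) =
      (((tensorTableaux γ δ).sigma fun X =>
        seqs (γ.size + δ.size) (tensorDes X) c.support c).card : ℤ) := by
    rw [Finset.card_sigma, Nat.cast_sum]
    exact Finset.sum_congr rfl fun X _ => coeff_fundamental subset_rfl
  rw [hl, hr]
  congr 1
  have hsup : ∀ {p : (ℕ →₀ ℕ) × (ℕ →₀ ℕ)}, p.1 + p.2 = c →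
      p.1.support ⊆ c.support ∧ p.2.support ⊆ c.support := fun hp =>
    ⟨Finsupp.support_mono (hp ▸ le_self_add), Finsupp.support_mono (hp ▸ le_add_self)⟩
  -- The bijection is given as a relation that is total and functional in both directions, which
  -- avoids constructing an inverse.
  refine card_eq_of_rel (fun p Y => Merge p.2.1.1 (letters p.2.1.2) p.2.2.1 (letters p.2.2.2)
    Y.1 (letters Y.2)) ?_ ?_ ?_ ?_
  · rintro ⟨p, ⟨S, g1⟩, ⟨T, g2⟩⟩ hp
    simp only [Finset.mem_sigma, Finset.mem_product, Finset.HasAntidiagonal.mem_antidiagonal] at hp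
    obtain ⟨hpc, ⟨hS, hg1⟩, hT, hg2⟩ := hp
    rw [mem_seqs (hsup hpc).1] at hg1
    rw [mem_seqs (hsup hpc).2] at hg2
    obtain ⟨X, hX, G, hG, hm⟩ := exists_merge hS hT hg1.1 hg2.1
    have hlet : ∀ k, 1 ≤ k → k ≤ γ.size + δ.size →
        G k = letters (fun j : Fin (γ.size + δ.size) => G (j + 1)) k := fun k k1 k2 =>
      (letters_of G k1 k2).symm
    refine ⟨⟨X, fun j => G (j + 1)⟩, ?_, hm.congr (fun _ _ _ => rfl) (fun _ _ _ => rfl) hlet⟩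
    rw [Finset.mem_sigma, mem_seqs subset_rfl]
    refine ⟨hX, hG.congr hlet, ?_⟩
    rw [← content_congr hlet, hm.content_eq, hg1.2, hg2.2, hpc]
  · rintro ⟨X, g⟩ hY
    rw [Finset.mem_sigma, mem_seqs subset_rfl] at hY
    obtain ⟨hX, hg, hcg⟩ := hY
    obtain ⟨S, hS, T, hT, G1, G2, h1, h2, hm⟩ := exists_parts hX hg
    have hl1 : ∀ k, 1 ≤ k → k ≤ γ.size → G1 k = letters (fun j : Fin γ.size => G1 (j + 1)) k :=
      fun k k1 k2 => (letters_of G1 k1 k2).symm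
    have hl2 : ∀ k, 1 ≤ k → k ≤ δ.size → G2 k = letters (fun j : Fin δ.size => G2 (j + 1)) k :=
      fun k k1 k2 => (letters_of G2 k1 k2).symm
    have hpc : content γ.size G1 + content δ.size G2 = c := hm.content_eq.symm.trans hcg
    have hpc' := hsup (p := (content γ.size G1, content δ.size G2)) hpc
    refine ⟨⟨(content γ.size G1, content δ.size G2), ⟨S, fun j => G1 (j + 1)⟩,
      ⟨T, fun j => G2 (j + 1)⟩⟩, ?_, hm.congr hl1 hl2 fun _ _ _ => rfl⟩
    simp only [Finset.mem_sigma, Finset.mem_product, Finset.HasAntidiagonal.mem_antidiagonal]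
    rw [mem_seqs hpc'.1, mem_seqs hpc'.2]
    exact ⟨hpc, ⟨hS, h1.congr hl1, (content_congr hl1).symm⟩, hT, h2.congr hl2,
      (content_congr hl2).symm⟩
  · rintro ⟨p, ⟨S, g1⟩, ⟨T, g2⟩⟩ - ⟨X, g⟩ hY ⟨X', g'⟩ hY' hR hR'
    obtain ⟨rfl, hg⟩ := hR.unique hR' (Finset.mem_sigma.1 hY).1 (Finset.mem_sigma.1 hY').1
    exact Sigma.ext rfl (heq_of_eq (letters_ext hg))
  · rintro ⟨X, g⟩ - ⟨p, ⟨S, g1⟩, ⟨T, g2⟩⟩ hp ⟨p', ⟨S', g1'⟩, ⟨T', g2'⟩⟩ hp' hR hR'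
    simp only [Finset.mem_sigma, Finset.mem_product, Finset.HasAntidiagonal.mem_antidiagonal] at hp hp'
    obtain ⟨hpc, ⟨hS, hg1⟩, hT, hg2⟩ := hp
    obtain ⟨hpc', ⟨hS', hg1'⟩, hT', hg2'⟩ := hp'
    rw [mem_seqs (hsup hpc).1] at hg1
    rw [mem_seqs (hsup hpc).2] at hg2
    rw [mem_seqs (hsup hpc').1] at hg1'
    rw [mem_seqs (hsup hpc').2] at hg2'
    obtain ⟨rfl, rfl, e1, e2⟩ := hR.parts_unique hR' hS hS' hT hT'
    obtain rfl := letters_ext e1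
    obtain rfl := letters_ext e2
    obtain rfl : p = p' := Prod.ext (hg1.2.symm.trans hg1'.2) (hg2.2.symm.trans hg2'.2)
    rfl

/-- The class sums give a nonnegative combination of Schur `P`-functions. -/
theorem exists_schurP_expansion (γ δ : StrictPartition) : ∃ f : StrictPartition →₀ ℕ,
    schurP γ * schurP δ = f.sum fun ε m => m • schurP ε := by
  classical
  let I : Set ℕ := {i | Avail True (γ.size + δ.size) i}
  let r : Setoid {X // X ∈ tensorTableaux γ δ} :=
    Relation.EqvGen.setoid fun x y => ∃ i ∈ I, psiT i x = y
  have hcl := fun X => sum_class_schurP (γ := γ) (δ := δ) le_rfl (I := I) (fun i => Iff.rfl) X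
  choose ε hsize hε using hcl
  have hdes : ∀ U : {X // X ∈ tensorTableaux γ δ},
      tensorDes U.1 ∩ Finset.Icc 1 (γ.size + δ.size - 1) = tensorDes U.1 := by
    intro U
    refine Finset.inter_eq_left.2 fun i hi => ?_
    have := Finset.mem_Ico.1 (Finset.mem_filter.1 hi).1
    rw [Finset.mem_Icc]; omega
  simp only [hdes] at hε
  -- The coefficient of `P_ε` counts the classes, under all the involutions, whose sum is `P_ε`.
  refine ⟨∑ c : Quotient r, Finsupp.single (ε c.out) 1, ?_⟩
  have hs := Finsupp.sum_finsetSum_index (s := Finset.univ)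
    (g := fun c : Quotient r => Finsupp.single (ε c.out) (1 : ℕ))
    (h := fun ε m => m • schurP ε) (fun _ => zero_smul ℕ _) (fun _ _ _ => add_smul _ _ _)
  rw [schurP_mul_schurP, ← Finset.sum_coe_sort, ← hs, ← Finset.sum_fiberwise Finset.univ (fun X => (⟦X⟧ : Quotient r))]
  refine Finset.sum_congr rfl fun c _ => ?_
  refine Eq.trans ?_ (Finsupp.sum_single_index (h := fun ε m => m • schurP ε)
    (zero_smul ℕ _)).symm
  rw [one_smul, ← hε]
  refine Finset.sum_congr ?_ fun _ _ => rfl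
  ext U
  rw [Finset.mem_filter, mem_eqvClass]
  simp only [Finset.mem_univ, true_and]
  conv_lhs => rw [← Quotient.out_eq c]
  rw [Quotient.eq]
  exact ⟨fun h => .symm _ _ h, fun h => .symm _ _ h⟩

/-! ### The queer dual equivalence -/

/-- The case `k = 0` of the path condition is separate: index `k` is the last involution of a window
of length `k + 1` only for `k ≥ 1`. Here a class has at most two elements. -/
theorem eqvGen_zero {X U : {X // X ∈ tensorTableaux γ δ}}
    (h : Relation.EqvGen (fun x y => ∃ i ∈ {h : ℕ | h ≤ 0 ∧ h ≠ 1}, psiT i x = y) X U) :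
    U = X ∨ U = psiT 0 X := by
  induction h with
  | rel x y hxy =>
    obtain ⟨i, hi, rfl⟩ := hxy
    obtain rfl : i = 0 := Nat.le_zero.1 hi.1
    exact .inr rfl
  | refl x => exact .inl rfl
  | symm x y _ ih =>
    rcases ih with rfl | rfl
    · exact .inl rfl
    · exact .inr (psiT_psiT 0 x).symm
  | trans x y z _ _ ih1 ih2 =>
    rcases ih1 with rfl | rfl <;> rcases ih2 with rfl | rfl
    · exact .inl rfl
    · exact .inr rfl
    · exact .inr rfl
    · exact .inl (psiT_psiT 0 x)

theorem avail_iff (hk : 1 ≤ k) : i ∈ {h : ℕ | h ≤ k ∧ h ≠ 1} ↔ Avail True (k + 1) i := by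
  rw [Set.mem_ofPred_eq]
  unfold Avail
  simp only [true_and]
  omega

theorem isQueerDualEquivalence (γ δ : StrictPartition) :
    IsQueerDualEquivalence (A := {X // X ∈ tensorTableaux γ δ}) (γ.size + δ.size)
      (fun X => tensorDes X.1) psiT where
  dual := {
    des_subset := fun T => Finset.filter_subset _ _
    involutive := fun i _ _ X => psiT_psiT i X
    schur_local := fun h i h1 hi hi3 hin X => by
      -- The involutions with indices `h, …, i` move the letters `h - 1, …, i + 1`, a window of
      -- length `i - h + 3` that begins after the letter `h - 2`.
      obtain ⟨μ, h2, h3⟩ := sum_class_schur (γ := γ) (δ := δ) (s := h - 2) (m := i - h + 3)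
        (by omega) (I := Set.Icc h i) (fun x => by
          rw [Set.mem_Icc]
          unfold Avail
          simp only [false_and, or_false]
          exact ⟨fun g => ⟨x - (h - 2), by omega, by omega⟩, fun ⟨j, j1, j2⟩ => by omega⟩) X
      refine ⟨μ, h2, ?_⟩
      rw [← h3, show h - 2 + 1 = h - 1 by omega, show h - 2 + (i - h + 3) = i + 1 by omega]
    comm := fun i j hi hin hj hjn hij X => Subtype.ext (by
      rcases hij with h | h
      · exact tensorPsi_comm X.2 hi h hjn
      · exact (tensorPsi_comm X.2 hj h hin).symm) }
  involutive_zero := fun X => psiT_psiT 0 X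
  schurP_local := fun i h1 h3 hin X =>
    sum_class_schurP (m := i + 1) (by omega) (fun j => avail_iff h1) X
  comm_zero := fun i hi hin X => Subtype.ext (tensorPsi_zero_comm X.2 hi hin)
  two_edge := fun k hk X U hU => by
    rcases Nat.eq_zero_or_pos k with rfl | hk0
    · rcases eqvGen_zero (mem_eqvClass.1 hU) with rfl | rfl
      · exact ⟨[], by simp, by simp, rfl⟩
      · exact ⟨[0], by simp, by simp, rfl⟩
    · obtain ⟨q1, q2, f, hf⟩ := exists_rep X.2
      obtain ⟨l, l1, l2, l3⟩ := (window_emp (n := γ.size + δ.size) (m := k + 1)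
        (by omega)).exists_path_of_mem (I := {h | h ≤ k ∧ h ≠ 1}) (fun i => by
          rw [avail_iff hk0]
          simp only [zero_add]
          exact ⟨fun h => ⟨i, rfl, h⟩, fun ⟨j, hj, h⟩ => hj ▸ h⟩) hf hU
      refine ⟨l, fun j hj => (avail_iff hk0).2 (l1 j hj), l2, ?_⟩
      rw [l3]
      simp only [zero_add]

end QueerDual

theorem mainTheorem3 (γ δ : QueerDual.StrictPartition) :
    (∃ h : ∀ i, ∀ X ∈ QueerDual.tensorTableaux γ δ,
        QueerDual.tensorPsi i X ∈ QueerDual.tensorTableaux γ δ,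
      QueerDual.IsQueerDualEquivalence (A := {X // X ∈ QueerDual.tensorTableaux γ δ})
        (γ.size + δ.size)
        (fun X => QueerDual.tensorDes X.1)
        (fun i X => ⟨QueerDual.tensorPsi i X.1, h i X.1 X.2⟩)) ∧
    (∃ f : QueerDual.StrictPartition →₀ ℕ,
      QueerDual.schurP γ * QueerDual.schurP δ =
        f.sum fun ε m => m • QueerDual.schurP ε) := by
  refine ⟨⟨fun i X hX => QueerDual.tensorPsi_mem i hX, ?_⟩, QueerDual.exists_schurP_expansion γ δ⟩
  exact QueerDual.isQueerDualEquivalence γ δ
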